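/- **Setting.** Let $\Omega\subset\mathbb{R}^N$ ($N\ge 1$) be a bounded domain (nonempty, open, connected) with smooth boundary and outer unit normal $\nu$. For $1<p,q<\infty$ and $\alpha,\beta>0$ with $\frac{\alpha}{p}+\frac{\beta}{q}=1$ put $$\lambda_{p,q}^{\alpha,\beta}:=\inf\left\{\frac{\int_\Omega\frac{|\nabla u|^p}{p}\,dx+\int_\Omega\frac{|\nabla v|^q}{q}\,dx}{\int_\Omega|u|^\alpha|v|^\beta\,dx}\;:\;(u,v)\in W^{1,p}_0(\Omega)\times W^{1,q}(\Omega),\ uv\not\equiv0,\ \int_\Omega|u|^\alpha|v|^{\beta-2}v\,dx=0\right\}.$$ A normalized eigenfunction for $\lambda=\lambda_{p,q}^{\alpha,\beta}$ is a nontrivial pair $(u,v)\in W^{1,p}_0(\Omega)\times W^{1,q}(\Omega)$ with $\int_\Omega|u|^\alpha|v|^\beta\,dx=1$ such that, for all $(w,z)\in W^{1,p}_0(\Omega)\times W^{1,q}(\Omega)$, $$\int_\Omega|\nabla u|^{p-2}\nabla u\cdot\nabla w\,dx=\lambda\alpha\int_\Omega|u|^{\alpha-2}u|v|^\beta w\,dx,\qquad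 \int_\Omega|\nabla v|^{q-2}\nabla v\cdot\nabla z\,dx=\lambda\beta\int_\Omega|u|^\alpha|v|^{\beta-2}vz\,dx.$$ For $\Gamma\in(0,1)$ and $Q\in(0,\infty)$ let $\mathcal{A}_\infty$ be the set of pairs $(w,z)\in W^{1,\infty}_0(\Omega)\times W^{1,\infty}(\Omega)$ (functions in $W^{1,\infty}(\Omega)$ being identified with their continuous representatives on $\overline\Omega$, and $W^{1,\infty}_0(\Omega)$ being the set of those that vanish on $\partial\Omega$) such that $wz\not\equiv0$ and $$\max_{\Omega}|w|^\Gamma z_+^{(1-\Gamma)Q}=\max_{\Omega}|w|^\Gamma z_-^{(1-\Gamma)Q},$$ where $z_\pm$ are the positive and negative parts of $z$, and let $$\Lambda_\infty(\Gamma,Q):=\inf\left\{\frac{\max\{\|\nabla w\|_{L^\infty(\Omega)},\ \|\nabla z\|_{L^\infty(\Omega)}^Q\}}{\||w|^\Gamma|z|^{(1-\Gamma)Q}\|_{L^\infty(\Omega)}}\;:\;(w,z)\in\mathcal{A}_\infty\right\}.$$ Viscosity solutions are continuous functions on $\overline\Omega$ tested by $C^2$ functions $\phi$ that touch strictly from above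 (subsolution inequality $\le0$) or from below (supersolution inequality $\ge0$) at a point $x_0$. The Dirichlet condition holds pointwise, and test points lie in $\Omega$. For the Neumann condition, $\phi\in C^2(\overline\Omega)$ and $x_0\in\overline\Omega$; if $x_0\in\partial\Omega$ the requirement for an equation $F=0$ is $\min\{F(x_0,\phi,\nabla\phi,D^2\phi),\frac{\partial\phi}{\partial\nu}(x_0)\}\le0$ for touching from above and $\max\{F(x_0,\phi,\nabla\phi,D^2\phi),\frac{\partial\phi}{\partial\nu}(x_0)\}\ge0$ for touching from below. **Theorem 1.2.** Let $p_n,q_n>1$ and $\alpha_n,\beta_n>0$ satisfy $\frac{\alpha_n}{p_n}+\frac{\beta_n}{q_n}=1$, $p_n,q_n\to\infty$, $\frac{\alpha_n}{p_n}\to\Gamma\in(0,1)$ and $\frac{q_n}{p_n}\to Q\in(0,\infty)$. Then: 1. $\left(\lambda_{p_n,q_n}^{\alpha_n,\beta_n}\right)^{1/p_n}\to\Lambda_\infty(\Gamma,Q)$. 2. For all large $n$ there is a normalized eigenfunction $(u_n,v_n)$ for $\lambda_{p_n,q_n}^{\alpha_n,\beta_n}$ with $u_n\ge0$. 3. For any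 choice of normalized eigenfunctions $(u_n,v_n)$ for $\lambda_{p_n,q_n}^{\alpha_n,\beta_n}$ ($n$ large) there are a subsequence and functions $u_\infty,v_\infty$ such that along the subsequence (the continuous representatives of) $u_n\to u_\infty$ and $v_n\to v_\infty$ uniformly in $\overline\Omega$; the pair $(u_\infty,v_\infty)$ belongs to $\mathcal{A}_\infty$ and attains the infimum $\Lambda_\infty(\Gamma,Q)$; and, with $\Lambda=\Lambda_\infty(\Gamma,Q)$, the function $v_\infty$ is a viscosity solution of $$\begin{cases}\min\{-\langle D^2v\,Dv,Dv\rangle,\ |Dv|-\Lambda^{1/Q}|u_\infty|^{\Gamma/Q}|v|^{1-\Gamma}\}=0&\text{in }\{v>0\},\\ \max\{-\langle D^2v\,Dv,Dv\rangle,\ -|Dv|+\Lambda^{1/Q}|u_\infty|^{\Gamma/Q}|v|^{1-\Gamma}\}=0&\text{in }\{v<0\},\\ -\langle D^2v\,Dv,Dv\rangle=0&\text{in }\{v=0\},\\ \dfrac{\partial v}{\partial\nu}=0&\text{on }\partial\Omega.\end{cases}$$ If in addition $u_n\ge0$ for all large $n$, then $u_\infty\ge0$ and $u_\infty$ is a viscosity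 solution of $$\begin{cases}\min\{-\langle D^2u\,Du,Du\rangle,\ |Du|-\Lambda\,|u|^\Gamma|v_\infty|^{(1-\Gamma)Q}\}=0&\text{in }\Omega,\\ u=0&\text{on }\partial\Omega.\end{cases}$$ -/

import Mathlib

open Set Filter Topology MeasureTheory
open scoped ENNReal ContDiff Gradient

namespace PQSystem

noncomputable section

/-- `ℝ^N` with the Euclidean norm. -/
abbrev Euc (N : ℕ) : Type := EuclideanSpace ℝ (Fin N)

/-! ### Smooth bounded domains -/

/-- `ρ` is a smooth local defining function of `Ω` at `x`: near `x` the set `Ω` is `{ρ < 0}`, and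
`∇ρ(x) ≠ 0`. -/
def IsDefiningFunctionAt {N : ℕ} (Ω : Set (Euc N)) (x : Euc N) (ρ : Euc N → ℝ) : Prop :=
  ∇ ρ x ≠ 0 ∧ ∃ U : Set (Euc N), IsOpen U ∧ x ∈ U ∧ ContDiffOn ℝ ∞ ρ U ∧
    ∀ y ∈ U, (y ∈ Ω ↔ ρ y < 0)

/-- A bounded domain (nonempty connected open set) with smooth boundary. -/
structure IsSmoothBoundedDomain {N : ℕ} (Ω : Set (Euc N)) : Prop where
  isOpen : IsOpen Ω
  isConnected : IsConnected Ω
  isBounded : Bornology.IsBounded Ω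
  smooth_boundary : ∀ x ∈ frontier Ω, ∃ ρ, IsDefiningFunctionAt Ω x ρ

/-- `ν` is the outer unit normal to `∂Ω` at `x`. -/
def IsOuterUnitNormal {N : ℕ} (Ω : Set (Euc N)) (x ν : Euc N) : Prop :=
  ∃ ρ, IsDefiningFunctionAt Ω x ρ ∧ ν = ‖∇ ρ x‖⁻¹ • ∇ ρ x

/-! ### Sobolev spaces -/

/-- `φ ∈ C_c^∞(Ω)`. -/
def IsTestFunction {N : ℕ} (Ω : Set (Euc N)) (φ : Euc N → ℝ) : Prop :=
  ContDiff ℝ ∞ φ ∧ HasCompactSupport φ ∧ tsupport φ ⊆ Ω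

/-- `G` is the weak (distributional) gradient of `u` in `Ω`. -/
def HasWeakGrad {N : ℕ} (Ω : Set (Euc N)) (u : Euc N → ℝ) (G : Euc N → Euc N) : Prop :=
  LocallyIntegrableOn u Ω ∧ LocallyIntegrableOn G Ω ∧
    ∀ φ, IsTestFunction Ω φ → ∫ x in Ω, u x • ∇ φ x = - ∫ x in Ω, φ x • G x

open Classical in
/-- The weak gradient of `u` in `Ω` (the zero field if there is none). -/
def weakGrad {N : ℕ} (Ω : Set (Euc N)) (u : Euc N → ℝ) : Euc N → Euc N :=
  if h : ∃ G, HasWeakGrad Ω u G then h.choose else 0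

/-- Weak gradients are unique up to null sets, so `weakGrad` is well defined almost everywhere. -/
theorem HasWeakGrad.ae_eq_weakGrad {N : ℕ} {Ω : Set (Euc N)} (hΩ : IsOpen Ω) {u : Euc N → ℝ}
    {G : Euc N → Euc N} (hG : HasWeakGrad Ω u G) :
    weakGrad Ω u =ᵐ[volume.restrict Ω] G := by
  have hex : ∃ G, HasWeakGrad Ω u G := ⟨G, hG⟩
  have hW : HasWeakGrad Ω u (weakGrad Ω u) := by
    rw [weakGrad, dif_pos hex]
    exact hex.choose_spec
  have hint : ∀ {H : Euc N → Euc N}, LocallyIntegrableOn H Ω → ∀ g, IsTestFunction Ω g →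
      IntegrableOn (fun x => g x • H x) Ω := by
    intro H hH g hg
    have h1 : IntegrableOn (fun x => g x • H x) (tsupport g) :=
      (hH.integrableOn_compact_subset hg.2.2 hg.2.1).continuousOn_smul
        hg.1.continuous.continuousOn hg.2.1
    have h2 : Integrable (fun x => g x • H x) :=
      (integrableOn_iff_integrable_of_support_subset
        (fun x hx => subset_tsupport g fun h0 => hx (by simp [h0]))).1 h1
    exact h2.integrableOn
  have hloc : LocallyIntegrableOn (weakGrad Ω u - G) Ω := LocallyIntegrableOn.sub hW.2.1 hG.2.1
  have hzero : ∀ g : Euc N → ℝ, ContDiff ℝ ∞ g → HasCompactSupport g → tsupport g ⊆ Ω →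
      ∫ x, g x • (weakGrad Ω u - G) x = 0 := by
    intro g hg1 hg2 hg3
    have hg : IsTestFunction Ω g := ⟨hg1, hg2, hg3⟩
    have e1 := hW.2.2 g hg
    have e2 := hG.2.2 g hg
    have e3 : ∫ x in Ω, g x • (weakGrad Ω u - G) x = 0 := by
      simp only [Pi.sub_apply, smul_sub]
      rw [integral_sub (hint hW.2.1 g hg) (hint hG.2.1 g hg), sub_eq_zero]
      exact neg_injective (e1.symm.trans e2)
    rw [← e3, setIntegral_eq_integral_of_forall_compl_eq_zero]
    intro x hx
    rw [image_eq_zero_of_notMem_tsupport (fun h => hx (hg3 h)), zero_smul]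
  have h0 := hΩ.ae_eq_zero_of_integral_contDiff_smul_eq_zero hloc hzero
  rw [EventuallyEq, ae_restrict_iff' hΩ.measurableSet]
  filter_upwards [h0] with x hx hxΩ using sub_eq_zero.mp (hx hxΩ)

/-- `u ∈ W^{1,r}(Ω)`, `1 ≤ r ≤ ∞`. -/
def MemW1 {N : ℕ} (Ω : Set (Euc N)) (r : ℝ≥0∞) (u : Euc N → ℝ) : Prop :=
  (∃ G, HasWeakGrad Ω u G) ∧ MemLp u r (volume.restrict Ω) ∧
    MemLp (weakGrad Ω u) r (volume.restrict Ω)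

/-- `u ∈ W^{1,r}_0(Ω)` for finite `r`: the closure of `C_c^∞(Ω)` in `W^{1,r}(Ω)`. -/
def MemW10 {N : ℕ} (Ω : Set (Euc N)) (r : ℝ≥0∞) (u : Euc N → ℝ) : Prop :=
  MemW1 Ω r u ∧ ∃ φ : ℕ → Euc N → ℝ, (∀ k, IsTestFunction Ω (φ k)) ∧
    Tendsto (fun k => eLpNorm (u - φ k) r (volume.restrict Ω)) atTop (𝓝 0) ∧
    Tendsto (fun k => eLpNorm (weakGrad Ω u - ∇ (φ k)) r (volume.restrict Ω)) atTop (𝓝 0)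

/-- `z` is (the continuous representative on `closure Ω` of) an element of `W^{1,∞}(Ω)`. -/
def MemW1Top {N : ℕ} (Ω : Set (Euc N)) (z : Euc N → ℝ) : Prop :=
  MemW1 Ω ∞ z ∧ ContinuousOn z (closure Ω)

/-- `w` is an element of `W^{1,∞}_0(Ω)`: a function in `W^{1,∞}(Ω)`, continuous on `closure Ω`,
that vanishes on `∂Ω`. -/
def MemW1Top0 {N : ℕ} (Ω : Set (Euc N)) (w : Euc N → ℝ) : Prop :=
  MemW1Top Ω w ∧ ∀ x ∈ frontier Ω, w x = 0

/-! ### The eigenvalue problem for finite exponents -/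

/-- The admissible class `𝒜_{p,q}^{α,β}`. -/
def Admissible {N : ℕ} (Ω : Set (Euc N)) (p q α β : ℝ) (u v : Euc N → ℝ) : Prop :=
  MemW10 Ω (ENNReal.ofReal p) u ∧ MemW1 Ω (ENNReal.ofReal q) v ∧
    ¬ (∀ᵐ x ∂volume.restrict Ω, u x * v x = 0) ∧
    ∫ x in Ω, |u x| ^ α * (|v x| ^ (β - 2) * v x) = 0

/-- The quotient that is minimized over `𝒜_{p,q}^{α,β}`. -/
def rayleigh {N : ℕ} (Ω : Set (Euc N)) (p q α β : ℝ) (u v : Euc N → ℝ) : ℝ :=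
  ((∫ x in Ω, ‖weakGrad Ω u x‖ ^ p / p) + ∫ x in Ω, ‖weakGrad Ω v x‖ ^ q / q) /
    ∫ x in Ω, |u x| ^ α * |v x| ^ β

/-- The first nontrivial eigenvalue `λ_{p,q}^{α,β}`. -/
def firstEigenvalue {N : ℕ} (Ω : Set (Euc N)) (p q α β : ℝ) : ℝ :=
  sInf {r | ∃ u v, Admissible Ω p q α β u v ∧ r = rayleigh Ω p q α β u v}

/-- `(u, v)` is an eigenfunction with eigenvalue `lam`: a nontrivial weak solution of
`-Δ_p u = lam α |u|^{α-2} u |v|^β`, `-Δ_q v = lam β |u|^α |v|^{β-2} v` in `Ω`, with `u = 0` and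
`|∇v|^{q-2} ∂v/∂ν = 0` on `∂Ω`. -/
structure IsEigenfunction {N : ℕ} (Ω : Set (Euc N)) (p q α β lam : ℝ) (u v : Euc N → ℝ) :
    Prop where
  mem_u : MemW10 Ω (ENNReal.ofReal p) u
  mem_v : MemW1 Ω (ENNReal.ofReal q) v
  nontrivial : ¬ (∀ᵐ x ∂volume.restrict Ω, u x = 0 ∧ v x = 0)
  eq_u : ∀ w, MemW10 Ω (ENNReal.ofReal p) w →
    ∫ x in Ω, ‖weakGrad Ω u x‖ ^ (p - 2) * inner ℝ (weakGrad Ω u x) (weakGrad Ω w x) =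
      lam * α * ∫ x in Ω, |u x| ^ (α - 2) * u x * |v x| ^ β * w x
  eq_v : ∀ z, MemW1 Ω (ENNReal.ofReal q) z →
    ∫ x in Ω, ‖weakGrad Ω v x‖ ^ (q - 2) * inner ℝ (weakGrad Ω v x) (weakGrad Ω z x) =
      lam * β * ∫ x in Ω, |u x| ^ α * (|v x| ^ (β - 2) * v x) * z x

/-- `(u, v)` is an eigenfunction corresponding to `λ_{p,q}^{α,β}`, normalized by
`∫_Ω |u|^α |v|^β = 1`. -/
def IsNormalizedFirstEigenfunction {N : ℕ} (Ω : Set (Euc N)) (p q α β : ℝ) (u v : Euc N → ℝ) :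
    Prop :=
  IsEigenfunction Ω p q α β (firstEigenvalue Ω p q α β) u v ∧
    ∫ x in Ω, |u x| ^ α * |v x| ^ β = 1

/-! ### The limit minimization problem -/

/-- The admissible class `𝒜_∞`. -/
def AdmissibleTop {N : ℕ} (Ω : Set (Euc N)) (Γ Q : ℝ) (w z : Euc N → ℝ) : Prop :=
  MemW1Top0 Ω w ∧ MemW1Top Ω z ∧ (∃ x ∈ Ω, w x * z x ≠ 0) ∧
    sSup ((fun x => |w x| ^ Γ * ((z x)⁺) ^ ((1 - Γ) * Q)) '' Ω) =
      sSup ((fun x => |w x| ^ Γ * ((z x)⁻) ^ ((1 - Γ) * Q)) '' Ω)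

/-- `‖f‖_{L^∞(Ω)}`. -/
def supNorm {N : ℕ} {F : Type*} [NormedAddCommGroup F] (Ω : Set (Euc N)) (f : Euc N → F) : ℝ :=
  (eLpNorm f ∞ (volume.restrict Ω)).toReal

/-- The quotient that is minimized over `𝒜_∞`. -/
def rayleighTop {N : ℕ} (Ω : Set (Euc N)) (Γ Q : ℝ) (w z : Euc N → ℝ) : ℝ :=
  max (supNorm Ω (weakGrad Ω w)) (supNorm Ω (weakGrad Ω z) ^ Q) /
    supNorm Ω (fun x => |w x| ^ Γ * |z x| ^ ((1 - Γ) * Q))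

/-- `Λ_∞(Γ, Q)`. -/
def lambdaTop {N : ℕ} (Ω : Set (Euc N)) (Γ Q : ℝ) : ℝ :=
  sInf {r | ∃ w z, AdmissibleTop Ω Γ Q w z ∧ r = rayleighTop Ω Γ Q w z}

/-- `(w, z)` solves the minimization problem for `Λ_∞(Γ, Q)`. -/
def IsMinimizerTop {N : ℕ} (Ω : Set (Euc N)) (Γ Q : ℝ) (w z : Euc N → ℝ) : Prop :=
  AdmissibleTop Ω Γ Q w z ∧ rayleighTop Ω Γ Q w z = lambdaTop Ω Γ Q

/-! ### Viscosity solutions -/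

/-- A second order operator `F(x, y, z, S)`; `S` is a bilinear form. -/
abbrev Operator (N : ℕ) : Type := Euc N → ℝ → Euc N → (Euc N →L[ℝ] Euc N →L[ℝ] ℝ) → ℝ

/-- `F(x, φ(x), ∇φ(x), D²φ(x))`. -/
def Operator.at {N : ℕ} (F : Operator N) (φ : Euc N → ℝ) (x : Euc N) : ℝ :=
  F x (φ x) (∇ φ x) (fderiv ℝ (fderiv ℝ φ) x)

/-- `φ` touches `u` strictly from above at `x₀`, relative to the set `K`: `u(x₀) = φ(x₀)` and
`u - φ` has a strict local maximum (on `K`) at `x₀`. -/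
def TouchesAbove {N : ℕ} (K : Set (Euc N)) (u φ : Euc N → ℝ) (x₀ : Euc N) : Prop :=
  u x₀ = φ x₀ ∧ ∀ᶠ x in 𝓝[K \ {x₀}] x₀, u x < φ x

/-- `φ` touches `u` strictly from below at `x₀`, relative to the set `K`: `u(x₀) = φ(x₀)` and
`u - φ` has a strict local minimum (on `K`) at `x₀`. -/
def TouchesBelow {N : ℕ} (K : Set (Euc N)) (u φ : Euc N → ℝ) (x₀ : Euc N) : Prop :=
  u x₀ = φ x₀ ∧ ∀ᶠ x in 𝓝[K \ {x₀}] x₀, φ x < u x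

/-- Viscosity subsolution of `F = 0` in `Ω`, `u = 0` on `∂Ω`. -/
def IsDirichletSubsolution {N : ℕ} (Ω : Set (Euc N)) (F : Operator N) (u : Euc N → ℝ) : Prop :=
  UpperSemicontinuousOn u (closure Ω) ∧ (∀ x ∈ frontier Ω, u x ≤ 0) ∧
    ∀ x₀ ∈ Ω, ∀ φ : Euc N → ℝ, ContDiffOn ℝ 2 φ Ω → TouchesAbove Ω u φ x₀ → F.at φ x₀ ≤ 0

/-- Viscosity supersolution of `F = 0` in `Ω`, `u = 0` on `∂Ω`. -/
def IsDirichletSupersolution {N : ℕ} (Ω : Set (Euc N)) (F : Operator N) (u : Euc N → ℝ) : Prop :=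
  LowerSemicontinuousOn u (closure Ω) ∧ (∀ x ∈ frontier Ω, 0 ≤ u x) ∧
    ∀ x₀ ∈ Ω, ∀ φ : Euc N → ℝ, ContDiffOn ℝ 2 φ Ω → TouchesBelow Ω u φ x₀ → 0 ≤ F.at φ x₀

/-- Viscosity solution of `F = 0` in `Ω`, `u = 0` on `∂Ω`. -/
def IsDirichletViscositySolution {N : ℕ} (Ω : Set (Euc N)) (F : Operator N) (u : Euc N → ℝ) :
    Prop :=
  IsDirichletSubsolution Ω F u ∧ IsDirichletSupersolution Ω F u

/-- Viscosity subsolution of `F = 0` in `Ω`, `∂v/∂ν = 0` on `∂Ω`. Test functions in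
`C²(closure Ω)` are taken as restrictions of `C²` functions on the whole space. -/
def IsNeumannSubsolution {N : ℕ} (Ω : Set (Euc N)) (F : Operator N) (v : Euc N → ℝ) : Prop :=
  UpperSemicontinuousOn v (closure Ω) ∧
    ∀ x₀ ∈ closure Ω, ∀ φ : Euc N → ℝ, ContDiff ℝ 2 φ → TouchesAbove (closure Ω) v φ x₀ →
      (x₀ ∈ Ω → F.at φ x₀ ≤ 0) ∧
      (x₀ ∈ frontier Ω → ∀ ν, IsOuterUnitNormal Ω x₀ ν →
        min (F.at φ x₀) (inner ℝ (∇ φ x₀) ν) ≤ 0)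

/-- Viscosity supersolution of `F = 0` in `Ω`, `∂v/∂ν = 0` on `∂Ω`. -/
def IsNeumannSupersolution {N : ℕ} (Ω : Set (Euc N)) (F : Operator N) (v : Euc N → ℝ) : Prop :=
  LowerSemicontinuousOn v (closure Ω) ∧
    ∀ x₀ ∈ closure Ω, ∀ φ : Euc N → ℝ, ContDiff ℝ 2 φ → TouchesBelow (closure Ω) v φ x₀ →
      (x₀ ∈ Ω → 0 ≤ F.at φ x₀) ∧
      (x₀ ∈ frontier Ω → ∀ ν, IsOuterUnitNormal Ω x₀ ν →
        0 ≤ max (F.at φ x₀) (inner ℝ (∇ φ x₀) ν))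

/-- Viscosity solution of `F = 0` in `Ω`, `∂v/∂ν = 0` on `∂Ω`. -/
def IsNeumannViscositySolution {N : ℕ} (Ω : Set (Euc N)) (F : Operator N) (v : Euc N → ℝ) :
    Prop :=
  IsNeumannSubsolution Ω F v ∧ IsNeumannSupersolution Ω F v

/-- The limit operator for `u`, given `v = v_∞` and `Λ = Λ_∞(Γ, Q)`:
`min {-⟨S z, z⟩, |z| - Λ |y|^Γ |v(x)|^{(1-Γ)Q}}`. -/
def limitOperatorU {N : ℕ} (Γ Q Λ : ℝ) (v : Euc N → ℝ) : Operator N := fun x y z S =>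
  min (-(S z z)) (‖z‖ - Λ * |y| ^ Γ * |v x| ^ ((1 - Γ) * Q))

/-- The sign-dependent limit operator for `v`, given `u = u_∞` and `Λ = Λ_∞(Γ, Q)`. -/
def limitOperatorV {N : ℕ} (Γ Q Λ : ℝ) (u : Euc N → ℝ) : Operator N := fun x y z S =>
  if 0 < y then
    min (-(S z z)) (‖z‖ - Λ ^ (1 / Q) * |u x| ^ (Γ / Q) * |y| ^ (1 - Γ))
  else if y < 0 then
    max (-(S z z)) (-‖z‖ + Λ ^ (1 / Q) * |u x| ^ (Γ / Q) * |y| ^ (1 - Γ))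
  else -(S z z)

end

end PQSystem

namespace PQSystem

section

open scoped Convolution

variable {N : ℕ} {Ω : Set (Euc N)}

/-! ### Gradients -/

/-! Only large `n` matter. Then `p, q ≥ 2N` and `α, β ≥ 2`, so Morrey's inequality, carried up to
the boundary by the interior cones of a smooth domain (`exists_coneAt`), gives continuous
representatives, an oscillation bound and compactness in the uniform topology.

Existence. Minimizing sequences converge uniformly, and the energies are lower semicontinuous by
Clarkson's inequality (`exists_strong_limit`), without weak compactness. A minimizer solves the
equations with no extra multiplier for the constraint: adding a constant to `v` restores the zero
moment at no cost in energy, and by convexity of `|·|^β` a constant shift starting from zero moment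
cannot lower the coupling. The resulting one-sided estimates suffice for a convex energy
(`first_variation`).

Eigenvalues. For an upper bound, take a pair `(w, z)` of the limit class and shift `z` by the
constant `c` that makes it admissible. Nothing is known about `c`, but `|z + c|` dominates `z⁺` or
`z⁻` according to the sign of `c`, and the balance condition of the limit class says precisely that
the `p`-th roots of both one-sided integrals have the same limit (`AdmissibleTop.exists_bound`). For
the lower bound, testing the equations with `u` and `v` gives energies `lam * α` and `lam * β`. If
`lam ^ (1 / p)` tends to `l` along a subsequence, the uniform limits have gradients bounded by `l`
and `l ^ (1 / Q)`; the normalization becomes supremum one and the zero moment becomes the balance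
condition. So the limit pair has quotient at most `l`, while `l` is at most every quotient: the pair
is a minimizer and `l` is the limit eigenvalue (`exists_subseq_minimizer`).

Limit equations. Let `φ` touch the limit from below at `x₀`, and suppose `f n + div (|∇φ|^(r-2) ∇φ)`
is positive near `x₀` for all large `n`, where `f n` is the source of the `r n`-Laplace equation.
Testing that equation with a cut-off of a smooth step function of `φ - v n + δ`, and using
monotonicity of `a ↦ |a|^(r-2) a`, gives a contradiction (`WeakLimit.not_eventually_pos`); at
boundary points the flux of `∇φ` has the favourable sign when the normal derivative is negative.
Expanding the divergence and comparing the gradient norm with the limit of `|f n| ^ (1 / r n)`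
yields the supersolution inequalities. Subsolution inequalities follow by passing to `-v` or `-u`.
-/

lemma continuous_gradient {φ : Euc N → ℝ} (h : ContDiff ℝ 1 φ) : Continuous (∇ φ) := by
  have : ∇ φ = fun x => (InnerProductSpace.toDual ℝ (Euc N)).symm (fderiv ℝ φ x) := rfl
  rw [this]
  exact (LinearIsometryEquiv.continuous _).comp (h.continuous_fderiv one_ne_zero)

lemma norm_gradient (φ : Euc N → ℝ) (x : Euc N) : ‖∇ φ x‖ = ‖fderiv ℝ φ x‖ := by
  rw [← toDual_gradient, LinearIsometryEquiv.norm_map]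

lemma hasCompactSupport_gradient {φ : Euc N → ℝ} (h : HasCompactSupport φ) :
    HasCompactSupport (∇ φ) := by
  have : ∇ φ = fun x => (InnerProductSpace.toDual ℝ (Euc N)).symm (fderiv ℝ φ x) := rfl
  rw [this]
  exact (h.fderiv (𝕜 := ℝ)).comp_left (g := (InnerProductSpace.toDual ℝ (Euc N)).symm) (map_zero _)

lemma eq_of_forall_inner {a b : Euc N} (h : ∀ e : Euc N, inner ℝ a e = inner ℝ b e) : a = b :=
  ext_inner_right ℝ h

/-! ### Sobolev functions with a given gradient -/

/-- `u ∈ W^{1,r}(Ω)` with weak gradient `G`. -/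
structure SobolevPair (Ω : Set (Euc N)) (r : ℝ≥0∞) (u : Euc N → ℝ) (G : Euc N → Euc N) : Prop where
  memLp : MemLp u r (volume.restrict Ω)
  memLp_grad : MemLp G r (volume.restrict Ω)
  ibp : ∀ φ, IsTestFunction Ω φ → ∫ x in Ω, u x • ∇ φ x = - ∫ x in Ω, φ x • G x

lemma isFiniteMeasure_restrict (hb : Bornology.IsBounded Ω) :
    IsFiniteMeasure (volume.restrict Ω) :=
  ⟨by rw [Measure.restrict_apply_univ]; exact hb.measure_lt_top⟩

lemma SobolevPair.integrable {r : ℝ≥0∞} {u G} (h : SobolevPair Ω r u G)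
    (hb : Bornology.IsBounded Ω) (hr : 1 ≤ r) : IntegrableOn u Ω :=
  have := isFiniteMeasure_restrict hb
  h.memLp.integrable hr

lemma SobolevPair.integrable_grad {r : ℝ≥0∞} {u G} (h : SobolevPair Ω r u G)
    (hb : Bornology.IsBounded Ω) (hr : 1 ≤ r) : IntegrableOn G Ω :=
  have := isFiniteMeasure_restrict hb
  h.memLp_grad.integrable hr

lemma SobolevPair.hasWeakGrad {r : ℝ≥0∞} {u G} (h : SobolevPair Ω r u G)
    (hb : Bornology.IsBounded Ω) (hr : 1 ≤ r) : HasWeakGrad Ω u G :=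
  ⟨(h.integrable hb hr).locallyIntegrableOn, (h.integrable_grad hb hr).locallyIntegrableOn, h.ibp⟩

/-- The bridge to `weakGrad`: gradients are carried as explicit data, so sums, products and limits
need no choice of representative until the end. -/
lemma SobolevPair.weakGrad_ae_eq {r : ℝ≥0∞} {u G} (h : SobolevPair Ω r u G) (ho : IsOpen Ω)
    (hb : Bornology.IsBounded Ω) (hr : 1 ≤ r) : weakGrad Ω u =ᵐ[volume.restrict Ω] G :=
  (h.hasWeakGrad hb hr).ae_eq_weakGrad ho

lemma SobolevPair.memW1 {r : ℝ≥0∞} {u G} (h : SobolevPair Ω r u G) (ho : IsOpen Ω)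
    (hb : Bornology.IsBounded Ω) (hr : 1 ≤ r) : MemW1 Ω r u :=
  ⟨⟨G, h.hasWeakGrad hb hr⟩, h.memLp, (memLp_congr_ae (h.weakGrad_ae_eq ho hb hr)).2 h.memLp_grad⟩

lemma MemW1.sobolevPair {r : ℝ≥0∞} {u} (h : MemW1 Ω r u) : SobolevPair Ω r u (weakGrad Ω u) := by
  refine ⟨h.2.1, h.2.2, ?_⟩
  have : HasWeakGrad Ω u (weakGrad Ω u) := by
    rw [weakGrad, dif_pos h.1]
    exact h.1.choose_spec
  exact this.2.2

lemma SobolevPair.congr {r : ℝ≥0∞} {u G u' G'} (h : SobolevPair Ω r u G)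
    (hu : u =ᵐ[volume.restrict Ω] u') (hG : G =ᵐ[volume.restrict Ω] G') :
    SobolevPair Ω r u' G' := by
  refine ⟨(memLp_congr_ae hu).1 h.memLp, (memLp_congr_ae hG).1 h.memLp_grad, fun φ hφ => ?_⟩
  have e := h.ibp φ hφ
  have e1 : ∫ x in Ω, u x • ∇ φ x = ∫ x in Ω, u' x • ∇ φ x :=
    integral_congr_ae (by filter_upwards [hu] with x hx; simp [hx])
  have e2 : ∫ x in Ω, φ x • G x = ∫ x in Ω, φ x • G' x :=
    integral_congr_ae (by filter_upwards [hG] with x hx; simp [hx])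
  rw [← e1, ← e2, e]

lemma SobolevPair.mono_exponent {r s : ℝ≥0∞} {u G} (h : SobolevPair Ω r u G)
    (hb : Bornology.IsBounded Ω) (hs : s ≤ r) : SobolevPair Ω s u G :=
  have := isFiniteMeasure_restrict hb
  ⟨h.memLp.mono_exponent hs, h.memLp_grad.mono_exponent hs, h.ibp⟩

lemma IsTestFunction.continuous {φ : Euc N → ℝ} (h : IsTestFunction Ω φ) : Continuous φ :=
  h.1.continuous

lemma bounded_of_compactSupport {F : Type*} [NormedAddCommGroup F] {f : Euc N → F}
    (hf : Continuous f) (hs : HasCompactSupport f) : ∃ C, ∀ x, ‖f x‖ ≤ C :=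
  hs.exists_bound_of_continuous hf

lemma integrableOn_mul_of_bounded {u f : Euc N → ℝ} (hu : IntegrableOn u Ω) (hf : Continuous f)
    (hb : ∃ C, ∀ x, ‖f x‖ ≤ C) : IntegrableOn (fun x => u x * f x) Ω := by
  obtain ⟨C, hC⟩ := hb
  exact hu.mul_bdd (c := C) hf.aestronglyMeasurable (Eventually.of_forall hC)

lemma integrableOn_smul_of_bounded {F : Type*} [NormedAddCommGroup F] [NormedSpace ℝ F]
    {G : Euc N → F} {f : Euc N → ℝ} (hu : IntegrableOn G Ω) (hf : Continuous f)
    (hb : ∃ C, ∀ x, ‖f x‖ ≤ C) : IntegrableOn (fun x => f x • G x) Ω := by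
  obtain ⟨C, hC⟩ := hb
  exact hu.bdd_smul C hf.aestronglyMeasurable (Eventually.of_forall hC)

lemma integrableOn_smul_of_bounded' {u : Euc N → ℝ} {f : Euc N → Euc N} (hu : IntegrableOn u Ω)
    (hf : Continuous f) (hb : ∃ C, ∀ x, ‖f x‖ ≤ C) : IntegrableOn (fun x => u x • f x) Ω := by
  obtain ⟨C, hC⟩ := hb
  exact hu.smul_bdd C hf.aestronglyMeasurable (Eventually.of_forall hC)

/-- The vector identity defining the weak gradient, tested in every direction. -/
lemma ibp_iff_forall_direction {u : Euc N → ℝ} {G : Euc N → Euc N} (hu : IntegrableOn u Ω)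
    (hG : IntegrableOn G Ω) {φ : Euc N → ℝ} (hφ : ContDiff ℝ 1 φ) (hc : HasCompactSupport φ) :
    (∫ x in Ω, u x • ∇ φ x = - ∫ x in Ω, φ x • G x) ↔
      ∀ e, ∫ x in Ω, u x * fderiv ℝ φ x e = - ∫ x in Ω, φ x * inner ℝ (G x) e := by
  have h1 : ∀ e, inner ℝ (∫ x in Ω, u x • ∇ φ x) e = ∫ x in Ω, u x * fderiv ℝ φ x e := by
    intro e
    rw [real_inner_comm, ← integral_inner (integrableOn_smul_of_bounded' hu
      (continuous_gradient hφ) (bounded_of_compactSupport (continuous_gradient hφ)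
      (hasCompactSupport_gradient hc)))]
    refine integral_congr_ae (Eventually.of_forall fun x => ?_)
    simp only [inner_smul_right]
    rw [real_inner_comm, inner_gradient_left]
  have h2 : ∀ e, inner ℝ (- ∫ x in Ω, φ x • G x) e = - ∫ x in Ω, φ x * inner ℝ (G x) e := by
    intro e
    rw [inner_neg_left, real_inner_comm, ← integral_inner (integrableOn_smul_of_bounded hG
      hφ.continuous (bounded_of_compactSupport hφ.continuous hc))]
    congr 1
    refine integral_congr_ae (Eventually.of_forall fun x => ?_)
    simp only [inner_smul_right]
    rw [real_inner_comm]
  constructor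
  · intro h e
    rw [← h1, ← h2, h]
  · intro h
    refine eq_of_forall_inner fun e => ?_
    rw [h1, h2, h]

/-! ### Mollification -/

/-- A sequence of bump functions with support shrinking to the origin. -/
noncomputable def mollBump (N k : ℕ) : ContDiffBump (0 : Euc N) where
  rIn := 1 / (2 * (k + 1))
  rOut := 1 / (k + 1)
  rIn_pos := by positivity
  rIn_lt_rOut := by
    rw [one_div, one_div, mul_inv]
    have : (0 : ℝ) < ((k : ℝ) + 1)⁻¹ := by positivity
    linarith

/-- Mollification of `g`. -/
noncomputable def moll {F : Type*} [NormedAddCommGroup F] [NormedSpace ℝ F] (k : ℕ)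
    (g : Euc N → F) : Euc N → F :=
  (mollBump N k).normed volume ⋆[ContinuousLinearMap.lsmul ℝ ℝ, volume] g

lemma mollBump_rOut (k : ℕ) : (mollBump N k).rOut = 1 / ((k : ℝ) + 1) := rfl

lemma tendsto_mollBump_rOut : Tendsto (fun k => (mollBump N k).rOut) atTop (𝓝 0) :=
  tendsto_one_div_add_atTop_nhds_zero_nat

lemma moll_apply {F : Type*} [NormedAddCommGroup F] [NormedSpace ℝ F] (k : ℕ)
    (g : Euc N → F) (x : Euc N) :
    moll k g x = ∫ y, (mollBump N k).normed volume (x - y) • g y := by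
  rw [moll, convolution_eq_swap]
  rfl

lemma contDiff_moll {F : Type*} [NormedAddCommGroup F] [NormedSpace ℝ F] (k : ℕ)
    {g : Euc N → F} (hg : LocallyIntegrable g) : ContDiff ℝ ∞ (moll k g) :=
  (mollBump N k).hasCompactSupport_normed.contDiff_convolution_left _
    (mollBump N k).contDiff_normed hg

lemma moll_eq_zero {F : Type*} [NormedAddCommGroup F] [NormedSpace ℝ F] (k : ℕ)
    {g : Euc N → F} {x : Euc N} (h : ∀ y, dist y x < 1 / ((k : ℝ) + 1) → g y = 0) :
    moll k g x = 0 := by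
  rw [moll_apply]
  refine integral_eq_zero_of_ae (Eventually.of_forall fun y => ?_)
  by_cases hy : dist y x < 1 / ((k : ℝ) + 1)
  · simp [h y hy]
  · have : x - y ∉ Function.support ((mollBump N k).normed volume) := by
      rw [ContDiffBump.support_normed_eq, Metric.mem_ball, dist_zero_right, mollBump_rOut,
        ← dist_eq_norm, dist_comm]
      exact hy
    rw [Function.notMem_support] at this
    simp [this]

lemma dist_moll_le {F : Type*} [NormedAddCommGroup F] [NormedSpace ℝ F] [CompleteSpace F] (k : ℕ)
    {g : Euc N → F} (hg : AEStronglyMeasurable g) {x : Euc N} {ε : ℝ}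
    (h : ∀ y, dist y x < 1 / ((k : ℝ) + 1) → dist (g y) (g x) ≤ ε) :
    dist (moll k g x) (g x) ≤ ε :=
  ContDiffBump.dist_normed_convolution_le hg h

lemma ae_tendsto_moll {F : Type*} [NormedAddCommGroup F] [NormedSpace ℝ F] [CompleteSpace F]
    {g : Euc N → F} (hg : LocallyIntegrable g) :
    ∀ᵐ x, Tendsto (fun k => moll k g x) atTop (𝓝 (g x)) := by
  -- The bumps satisfy `rOut = 2 * rIn`; a bounded ratio is what Lebesgue differentiation needs.
  refine ContDiffBump.ae_convolution_tendsto_right_of_locallyIntegrable (K := 2)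
    tendsto_mollBump_rOut (Eventually.of_forall fun k => ?_) hg
  change 1 / ((k : ℝ) + 1) ≤ 2 * (1 / (2 * (k + 1)))
  field_simp
  exact le_rfl

/-- Mollifications of a continuous function with compact support converge uniformly. -/
lemma moll_uniform {F : Type*} [NormedAddCommGroup F] [NormedSpace ℝ F] [CompleteSpace F]
    {g : Euc N → F} (hg : UniformContinuous g) {ε : ℝ} (hε : 0 < ε) :
    ∀ᶠ k in atTop, ∀ x, dist (moll k g x) (g x) ≤ ε := by
  obtain ⟨δ, hδ, h⟩ := Metric.uniformContinuous_iff.1 hg ε hε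
  filter_upwards [(tendsto_mollBump_rOut (N := N)).eventually (gt_mem_nhds hδ)] with k hk x
  refine dist_moll_le k hg.continuous.aestronglyMeasurable fun y hy => ?_
  exact (h (hy.trans hk)).le

lemma fderiv_moll_of_contDiff (k : ℕ) {φ : Euc N → ℝ} (hφ : ContDiff ℝ 1 φ)
    (hc : HasCompactSupport φ) (x e : Euc N) :
    fderiv ℝ (moll k φ) x e = moll k (fun y => fderiv ℝ φ y e) x := by
  have hη : LocallyIntegrable ((mollBump N k).normed (volume : Measure (Euc N))) :=
    (mollBump N k).contDiff_normed (n := 0) |>.continuous.locallyIntegrable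
  have h := hc.hasFDerivAt_convolution_right (ContinuousLinearMap.lsmul ℝ ℝ) hη hφ x
  rw [moll, h.fderiv, convolution_precompR_apply _ hη (hc.fderiv (𝕜 := ℝ))
    (hφ.continuous_fderiv one_ne_zero)]
  rfl

lemma tsupport_moll_subset (k : ℕ) {φ : Euc N → ℝ} :
    tsupport (moll k φ) ⊆ Metric.cthickening (1 / ((k : ℝ) + 1)) (tsupport φ) := by
  refine closure_minimal ?_ Metric.isClosed_cthickening
  intro x hx
  by_contra hcon
  refine hx (moll_eq_zero k fun y hy => ?_)
  by_contra hy0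
  exact hcon (Metric.mem_cthickening_of_dist_le x y _ _ (subset_tsupport _ hy0)
    (by rw [dist_comm]; exact hy.le))

lemma eventually_isTestFunction_moll (ho : IsOpen Ω) {φ : Euc N → ℝ} (hφ : LocallyIntegrable φ)
    (hc : HasCompactSupport φ) (hs : tsupport φ ⊆ Ω) :
    ∀ᶠ k in atTop, IsTestFunction Ω (moll k φ) := by
  obtain ⟨δ, hδ, hsub⟩ := IsCompact.exists_cthickening_subset_open hc ho hs
  filter_upwards [(tendsto_mollBump_rOut (N := N)).eventually (gt_mem_nhds hδ)] with k hk
  have h1 := tsupport_moll_subset k (φ := φ)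
  refine ⟨contDiff_moll k hφ, ?_, ?_⟩
  · exact (IsCompact.cthickening hc (r := 1 / ((k : ℝ) + 1))).of_isClosed_subset
      (isClosed_tsupport _) h1
  · exact (h1.trans (Metric.cthickening_mono hk.le _)).trans hsub

/-- The weak gradient may be tested with `C¹` functions of compact support. -/
lemma SobolevPair.ibp_contDiff {r : ℝ≥0∞} {u G} (h : SobolevPair Ω r u G) (ho : IsOpen Ω)
    (hb : Bornology.IsBounded Ω) (hr : 1 ≤ r) {φ : Euc N → ℝ} (hφ : ContDiff ℝ 1 φ)
    (hc : HasCompactSupport φ) (hs : tsupport φ ⊆ Ω) (e : Euc N) :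
    ∫ x in Ω, u x * fderiv ℝ φ x e = - ∫ x in Ω, φ x * inner ℝ (G x) e := by
  have hu := h.integrable hb hr
  have hG := h.integrable_grad hb hr
  have hGe : IntegrableOn (fun x => inner ℝ (G x) e) Ω := hG.inner_const e
  -- Mollifying `φ` produces genuine test functions, still supported in `Ω` for large `k`; both
  -- sides then pass to the limit.
  have key : ∀ᶠ k in atTop, ∫ x in Ω, u x * fderiv ℝ (moll k φ) x e =
      - ∫ x in Ω, moll k φ x * inner ℝ (G x) e := by
    filter_upwards [eventually_isTestFunction_moll ho hφ.continuous.locallyIntegrable hc hs]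
      with k hk
    exact (ibp_iff_forall_direction hu hG (hk.1.of_le (by simp)) hk.2.1).1 (h.ibp _ hk) e
  have lim : ∀ (w g : Euc N → ℝ), IntegrableOn w Ω → Continuous g → HasCompactSupport g →
      Tendsto (fun k => ∫ x in Ω, w x * moll k g x) atTop (𝓝 (∫ x in Ω, w x * g x)) := by
    intro w g hw hg hgc
    have hguc := hgc.uniformContinuous_of_continuous hg
    obtain ⟨C, hC⟩ := bounded_of_compactSupport hg hgc
    refine tendsto_integral_filter_of_dominated_convergence (fun x => ‖w x‖ * (C + 1)) ?_ ?_
      (hw.norm.mul_const _) ?_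
    · exact Eventually.of_forall fun k => hw.aestronglyMeasurable.mul
        (contDiff_moll k hg.locallyIntegrable).continuous.aestronglyMeasurable
    · filter_upwards [moll_uniform hguc one_pos] with k hk
      refine Eventually.of_forall fun x => ?_
      rw [norm_mul]
      refine mul_le_mul_of_nonneg_left ?_ (norm_nonneg _)
      have := hk x
      rw [dist_eq_norm] at this
      calc ‖moll k g x‖ = ‖g x + (moll k g x - g x)‖ := by congr 1; ring
        _ ≤ ‖g x‖ + ‖moll k g x - g x‖ := norm_add_le _ _
        _ ≤ C + 1 := add_le_add (hC x) this
    · refine Eventually.of_forall fun x => Tendsto.const_mul _ ?_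
      rw [Metric.tendsto_atTop']
      intro ε hε
      obtain ⟨K, hK⟩ := eventually_atTop.1 (moll_uniform hguc (half_pos hε))
      exact ⟨K, fun k hk => lt_of_le_of_lt (hK k hk.le x) (half_lt_self hε)⟩
  have l1 := lim u (fun x => fderiv ℝ φ x e) hu
    ((hφ.continuous_fderiv one_ne_zero).clm_apply continuous_const)
    ((hc.fderiv (𝕜 := ℝ)).comp_left (g := fun L : Euc N →L[ℝ] ℝ => L e) rfl)
  have l2 := lim (fun x => inner ℝ (G x) e) φ hGe hφ.continuous hc
  have l2' : Tendsto (fun k => - ∫ x in Ω, moll k φ x * inner ℝ (G x) e) atTop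
      (𝓝 (- ∫ x in Ω, φ x * inner ℝ (G x) e)) := by
    simp_rw [mul_comm (inner ℝ (G _) e)] at l2
    exact l2.neg
  refine tendsto_nhds_unique (l1.congr' ?_) l2'
  filter_upwards [key] with k hk
  rw [← hk]
  simp_rw [fderiv_moll_of_contDiff k hφ hc]

end

/-! ### Algebra of Sobolev pairs, product rule, and gradients of mollifications. -/

section

open scoped Convolution

variable {N : ℕ} {Ω : Set (Euc N)}

lemma SobolevPair.add {r : ℝ≥0∞} {u G u' G'} (h : SobolevPair Ω r u G) (h' : SobolevPair Ω r u' G')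
    (hb : Bornology.IsBounded Ω) (hr : 1 ≤ r) : SobolevPair Ω r (u + u') (G + G') := by
  refine ⟨h.memLp.add h'.memLp, h.memLp_grad.add h'.memLp_grad, fun φ hφ => ?_⟩
  have hd := continuous_gradient (hφ.1.of_le (by simp))
  have hd' := bounded_of_compactSupport hd (hasCompactSupport_gradient hφ.2.1)
  have hc := bounded_of_compactSupport hφ.continuous hφ.2.1
  simp only [Pi.add_apply, add_smul, smul_add]
  rw [integral_add (integrableOn_smul_of_bounded' (h.integrable hb hr) hd hd')
    (integrableOn_smul_of_bounded' (h'.integrable hb hr) hd hd'),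
    integral_add (integrableOn_smul_of_bounded (h.integrable_grad hb hr) hφ.continuous hc)
    (integrableOn_smul_of_bounded (h'.integrable_grad hb hr) hφ.continuous hc), h.ibp φ hφ,
    h'.ibp φ hφ]
  abel

lemma SobolevPair.const_smul {r : ℝ≥0∞} {u G} (h : SobolevPair Ω r u G) (c : ℝ) :
    SobolevPair Ω r (c • u) (c • G) := by
  refine ⟨h.memLp.const_smul c, h.memLp_grad.const_smul c, fun φ hφ => ?_⟩
  have e1 : ∀ x, (c • u) x • ∇ φ x = c • (u x • ∇ φ x) := fun x => by simp [mul_smul]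
  have e2 : ∀ x, φ x • (c • G) x = c • (φ x • G x) := fun x => by simp [smul_comm c (φ x)]
  simp only [e1, e2]
  rw [integral_smul, integral_smul, h.ibp φ hφ, smul_neg]

lemma SobolevPair.neg {r : ℝ≥0∞} {u G} (h : SobolevPair Ω r u G) : SobolevPair Ω r (-u) (-G) := by
  simpa using h.const_smul (-1)

lemma SobolevPair.sub {r : ℝ≥0∞} {u G u' G'} (h : SobolevPair Ω r u G) (h' : SobolevPair Ω r u' G')
    (hb : Bornology.IsBounded Ω) (hr : 1 ≤ r) : SobolevPair Ω r (u - u') (G - G') := by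
  simpa [sub_eq_add_neg] using h.add h'.neg hb hr

/-- A continuous function on the closure of a bounded set is in every `L^r`. -/
lemma memLp_of_continuousOn {F : Type*} [NormedAddCommGroup F] (ho : IsOpen Ω)
    (hb : Bornology.IsBounded Ω) {f : Euc N → F} (hf : ContinuousOn f (closure Ω))
    (r : ℝ≥0∞) : MemLp f r (volume.restrict Ω) := by
  have := isFiniteMeasure_restrict hb
  obtain ⟨C, hC⟩ := hb.isCompact_closure.exists_bound_of_continuousOn hf
  refine MemLp.of_bound ((hf.mono subset_closure).aestronglyMeasurable ho.measurableSet) C ?_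
  filter_upwards [ae_restrict_mem ho.measurableSet] with x hx
  exact hC x (subset_closure hx)

lemma integrableOn_of_continuousOn {F : Type*} [NormedAddCommGroup F] (ho : IsOpen Ω)
    (hb : Bornology.IsBounded Ω) {f : Euc N → F} (hf : ContinuousOn f (closure Ω)) :
    IntegrableOn f Ω :=
  memLp_one_iff_integrable.1 (memLp_of_continuousOn ho hb hf 1)

lemma sobolevPair_of_contDiff (ho : IsOpen Ω) (hb : Bornology.IsBounded Ω) {g : Euc N → ℝ}
    (hg : ContDiff ℝ 1 g) (r : ℝ≥0∞) : SobolevPair Ω r g (∇ g) := by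
  have hgc : Continuous (∇ g) := continuous_gradient hg
  refine ⟨memLp_of_continuousOn ho hb hg.continuous.continuousOn r,
    memLp_of_continuousOn ho hb hgc.continuousOn r, fun φ hφ => ?_⟩
  have hφ1 : ContDiff ℝ 1 φ := hφ.1.of_le (by simp)
  rw [ibp_iff_forall_direction (integrableOn_of_continuousOn ho hb hg.continuous.continuousOn)
    (integrableOn_of_continuousOn ho hb hgc.continuousOn) hφ1 hφ.2.1]
  intro e
  have z1 : ∀ x ∉ Ω, φ x = 0 := fun x hx =>
    image_eq_zero_of_notMem_tsupport fun h => hx (hφ.2.2 h)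
  have z2 : ∀ x ∉ Ω, fderiv ℝ φ x = 0 := fun x hx =>
    image_eq_zero_of_notMem_tsupport fun h => hx (hφ.2.2 (tsupport_fderiv_subset ℝ h))
  -- Both integrands vanish off `Ω`, so the integrals may be taken over the whole space, where
  -- integration by parts has no boundary term.
  rw [setIntegral_eq_integral_of_forall_compl_eq_zero (fun x hx => by simp [z2 x hx]),
    setIntegral_eq_integral_of_forall_compl_eq_zero (fun x hx => by simp [z1 x hx])]
  have c1 : Continuous fun x => fderiv ℝ φ x e :=
    (hφ1.continuous_fderiv one_ne_zero).clm_apply continuous_const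
  have c2 : Continuous fun x => fderiv ℝ g x e :=
    (hg.continuous_fderiv one_ne_zero).clm_apply continuous_const
  rw [integral_mul_fderiv_eq_neg_fderiv_mul_of_integrable]
  · simp_rw [inner_gradient_left, mul_comm]
  · exact (c2.mul hφ.continuous).integrable_of_hasCompactSupport hφ.2.1.mul_left
  · exact (hg.continuous.mul c1).integrable_of_hasCompactSupport
      (((hφ.2.1.fderiv (𝕜 := ℝ)).comp_left (g := fun L : Euc N →L[ℝ] ℝ => L e) rfl).mul_left)
  · exact (hg.continuous.mul hφ.continuous).integrable_of_hasCompactSupport hφ.2.1.mul_left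
  · exact fun x _ => hg.differentiable one_ne_zero x
  · exact fun x _ => hφ1.differentiable one_ne_zero x

lemma sobolevPair_const (ho : IsOpen Ω) (hb : Bornology.IsBounded Ω) (c : ℝ) (r : ℝ≥0∞) :
    SobolevPair Ω r (fun _ => c) 0 := by
  have := sobolevPair_of_contDiff ho hb (contDiff_const (c := c)) r
  rwa [gradient_fun_const'] at this

lemma SobolevPair.add_const {r : ℝ≥0∞} {u G} (h : SobolevPair Ω r u G) (ho : IsOpen Ω)
    (hb : Bornology.IsBounded Ω) (hr : 1 ≤ r) (c : ℝ) :
    SobolevPair Ω r (fun x => u x + c) G := by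
  have := h.add (sobolevPair_const ho hb c r) hb hr
  rw [add_zero] at this
  exact this

/-- Product with a `C¹` function. -/
lemma SobolevPair.mul_contDiff {r : ℝ≥0∞} {u G} (h : SobolevPair Ω r u G) (ho : IsOpen Ω)
    (hb : Bornology.IsBounded Ω) (hr : 1 ≤ r) {χ : Euc N → ℝ} (hχ : ContDiff ℝ 1 χ) :
    SobolevPair Ω r (fun x => χ x * u x) (fun x => χ x • G x + u x • ∇ χ x) := by
  have hgc : Continuous (∇ χ) := continuous_gradient hχ
  have m1 : MemLp χ ∞ (volume.restrict Ω) :=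
    memLp_of_continuousOn ho hb hχ.continuous.continuousOn _
  have m2 : MemLp (∇ χ) ∞ (volume.restrict Ω) := memLp_of_continuousOn ho hb hgc.continuousOn _
  have hm1 : MemLp (fun x => χ x * u x) r (volume.restrict Ω) := h.memLp.mul m1
  have hm2 : MemLp (fun x => χ x • G x + u x • ∇ χ x) r (volume.restrict Ω) :=
    (h.memLp_grad.smul m1).add (m2.smul h.memLp)
  have := isFiniteMeasure_restrict hb
  refine ⟨hm1, hm2, fun φ hφ => ?_⟩
  have hφ1 : ContDiff ℝ 1 φ := hφ.1.of_le (by simp)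
  rw [ibp_iff_forall_direction (hm1.integrable hr) (hm2.integrable hr) hφ1 hφ.2.1]
  intro e
  -- The product rule results from testing with `χ * φ`, which is only `C¹`.
  have key := h.ibp_contDiff ho hb hr (hχ.mul hφ1) hφ.2.1.mul_left
    ((tsupport_mul_subset_right).trans hφ.2.2) e
  have e1 : ∀ x, fderiv ℝ (fun y => χ y * φ y) x e = χ x * fderiv ℝ φ x e + φ x * fderiv ℝ χ x e := by
    intro x
    rw [fderiv_fun_mul (hχ.differentiable one_ne_zero x) (hφ1.differentiable one_ne_zero x)]
    simp
  have c1 : Continuous fun x => fderiv ℝ φ x e :=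
    (hφ1.continuous_fderiv one_ne_zero).clm_apply continuous_const
  have s1 : HasCompactSupport fun x => fderiv ℝ φ x e :=
    (hφ.2.1.fderiv (𝕜 := ℝ)).comp_left (g := fun L : Euc N →L[ℝ] ℝ => L e) rfl
  have c2 : Continuous fun x => fderiv ℝ χ x e :=
    (hχ.continuous_fderiv one_ne_zero).clm_apply continuous_const
  have hu := h.integrable hb hr
  have hGe : IntegrableOn (fun x => inner ℝ (G x) e) Ω := (h.integrable_grad hb hr).inner_const e
  have i1 : IntegrableOn (fun x => u x * (χ x * fderiv ℝ φ x e)) Ω :=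
    integrableOn_mul_of_bounded hu (hχ.continuous.mul c1)
      (bounded_of_compactSupport (hχ.continuous.mul c1) s1.mul_left)
  have i2 : IntegrableOn (fun x => u x * (φ x * fderiv ℝ χ x e)) Ω :=
    integrableOn_mul_of_bounded hu (hφ.continuous.mul c2)
      (bounded_of_compactSupport (hφ.continuous.mul c2) hφ.2.1.mul_right)
  have i3 : IntegrableOn (fun x => inner ℝ (G x) e * (χ x * φ x)) Ω :=
    integrableOn_mul_of_bounded hGe (hχ.continuous.mul hφ.continuous)
      (bounded_of_compactSupport (hχ.continuous.mul hφ.continuous) hφ.2.1.mul_left)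
  simp only [e1, mul_add] at key
  rw [integral_add i1 i2] at key
  have t1 : ∫ x in Ω, χ x * u x * fderiv ℝ φ x e = ∫ x in Ω, u x * (χ x * fderiv ℝ φ x e) := by
    congr 1; ext x; ring
  have t2 : ∫ x in Ω, φ x * inner ℝ (χ x • G x + u x • ∇ χ x) e =
      (∫ x in Ω, (χ x * φ x) * inner ℝ (G x) e) + ∫ x in Ω, u x * (φ x * fderiv ℝ χ x e) := by
    rw [← integral_add (i3.congr (Eventually.of_forall fun x => by simp only []; ring)) i2]
    congr 1; ext x
    simp only [inner_add_left, inner_smul_left, inner_gradient_left, conj_trivial]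
    ring
  rw [t1, t2]
  linarith

lemma integrable_indicator_of_integrableOn {F : Type*} [NormedAddCommGroup F] (ho : IsOpen Ω)
    {f : Euc N → F} (hf : IntegrableOn f Ω) : Integrable (Ω.indicator f) :=
  (integrable_indicator_iff ho.measurableSet).2 hf

/-- The gradient of a mollified Sobolev function is the mollified gradient. -/
lemma SobolevPair.gradient_moll {r : ℝ≥0∞} {u G} (h : SobolevPair Ω r u G) (ho : IsOpen Ω)
    (hb : Bornology.IsBounded Ω) (hr : 1 ≤ r) (k : ℕ) {x : Euc N}
    (hx : Metric.closedBall x (1 / ((k : ℝ) + 1)) ⊆ Ω) :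
    ∇ (moll k (Ω.indicator u)) x = moll k (Ω.indicator G) x := by
  have hu := h.integrable hb hr
  have hG := h.integrable_grad hb hr
  have hU := integrable_indicator_of_integrableOn ho hu
  have hV := integrable_indicator_of_integrableOn ho hG
  set η : Euc N → ℝ := (mollBump N k).normed volume with hη
  have hη1 : ContDiff ℝ ∞ η := (mollBump N k).contDiff_normed
  have hηc : HasCompactSupport η := (mollBump N k).hasCompactSupport_normed
  -- For fixed `x` the kernel itself is a test function: the hypothesis on the ball keeps its
  -- support in `Ω`.
  have hψ : IsTestFunction Ω (fun y => η (x - y)) := by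
    have hsub : tsupport (fun y => η (x - y)) ⊆ Metric.closedBall x (1 / ((k : ℝ) + 1)) := by
      refine closure_minimal ?_ Metric.isClosed_closedBall
      intro y hy
      have : x - y ∈ Function.support η := hy
      rw [hη, ContDiffBump.support_normed_eq, Metric.mem_ball, dist_zero_right, mollBump_rOut,
        ← dist_eq_norm, dist_comm] at this
      exact this.le
    exact ⟨hη1.comp (contDiff_const.sub contDiff_id),
      (isCompact_closedBall _ _).of_isClosed_subset (isClosed_tsupport _) hsub, hsub.trans hx⟩
  refine eq_of_forall_inner fun e => ?_
  have key := (ibp_iff_forall_direction hu hG (hψ.1.of_le (by simp)) hψ.2.1).1 (h.ibp _ hψ) e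
  have d1 : ∀ y, fderiv ℝ (fun y => η (x - y)) y e = - fderiv ℝ η (x - y) e := by
    intro y
    have : HasFDerivAt (fun y => η (x - y))
        ((fderiv ℝ η (x - y)).comp (-ContinuousLinearMap.id ℝ (Euc N))) y :=
      ((hη1.differentiable (by simp)) (x - y)).hasFDerivAt.comp y
        ((hasFDerivAt_id y).const_sub x)
    rw [this.fderiv]
    simp
  have hder := hηc.hasFDerivAt_convolution_left (ContinuousLinearMap.lsmul ℝ ℝ)
    (hη1.of_le (by simp)) hU.locallyIntegrable x
  have hex := (hηc.fderiv (𝕜 := ℝ)).convolutionExists_left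
    (ContinuousLinearMap.precompL (Euc N) (ContinuousLinearMap.lsmul ℝ ℝ))
    (hη1.continuous_fderiv (by simp)) hU.locallyIntegrable x
  have hex' := hex.integrable_swap
  have l1 : inner ℝ (∇ (moll k (Ω.indicator u)) x) e =
      ∫ y in Ω, u y * fderiv ℝ η (x - y) e := by
    rw [inner_gradient_left, moll, hder.fderiv, convolution_eq_swap,
      ContinuousLinearMap.integral_apply hex', ← integral_indicator ho.measurableSet]
    congr 1; ext y
    by_cases hy : y ∈ Ω
    · simp [hy, ContinuousLinearMap.precompL_apply, mul_comm]
    · simp [hy]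
  have hexV := hηc.convolutionExists_left (ContinuousLinearMap.lsmul ℝ ℝ)
    hη1.continuous hV.locallyIntegrable x
  have hexV' : Integrable fun y => η (x - y) • Ω.indicator G y := hexV.integrable_swap
  have l2 : inner ℝ (moll k (Ω.indicator G) x) e = ∫ y in Ω, η (x - y) * inner ℝ (G y) e := by
    rw [moll_apply, real_inner_comm, ← integral_inner hexV', ← integral_indicator ho.measurableSet]
    congr 1; ext y
    by_cases hy : y ∈ Ω
    · simp [hy, inner_smul_right, real_inner_comm, hη]
    · simp [hy]
  rw [l1, l2]
  simp only [d1, mul_neg, integral_neg, neg_inj] at key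
  exact key

/-- Mollification does not increase `L^r` norms. -/
lemma lintegral_enorm_moll_rpow_le {F : Type*} [NormedAddCommGroup F] [NormedSpace ℝ F]
    [MeasurableSpace F] [BorelSpace F] [SecondCountableTopology F] [CompleteSpace F]
    (k : ℕ) {g : Euc N → F} (hg : AEStronglyMeasurable g) {r : ℝ} (hr : 1 ≤ r) :
    ∫⁻ x, ‖moll k g x‖ₑ ^ r ≤ ∫⁻ x, ‖g x‖ₑ ^ r := by
  wlog hm : StronglyMeasurable g generalizing g
  · have e1 : moll k g = moll k (hg.mk g) := by
      ext x
      rw [moll_apply, moll_apply]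
      refine integral_congr_ae ?_
      filter_upwards [hg.ae_eq_mk] with y hy
      rw [hy]
    have e2 : ∫⁻ x, ‖g x‖ₑ ^ r = ∫⁻ x, ‖hg.mk g x‖ₑ ^ r :=
      lintegral_congr_ae (by filter_upwards [hg.ae_eq_mk] with y hy; rw [← hy])
    rw [e1, e2]
    exact this hg.stronglyMeasurable_mk.aestronglyMeasurable hg.stronglyMeasurable_mk
  set η : Euc N → ℝ := (mollBump N k).normed volume with hη
  have hη0 : ∀ y, 0 ≤ η y := (mollBump N k).nonneg_normed
  have hηc : Continuous η := ((mollBump N k).contDiff_normed (n := 0)).continuous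
  have hηm : Measurable fun y => ENNReal.ofReal (η y) := hηc.measurable.ennreal_ofReal
  -- The mollifier is a probability density, so monotonicity of `L^r` norms in the exponent (Jensen)
  -- bounds the power pointwise; Tonelli and translation invariance then conclude.
  set ν : Measure (Euc N) := volume.withDensity fun y => ENNReal.ofReal (η y) with hν
  have : IsProbabilityMeasure ν := ⟨by
    rw [hν, withDensity_apply _ MeasurableSet.univ, Measure.restrict_univ,
      ← ofReal_integral_eq_lintegral_ofReal (mollBump N k).integrable_normed
        (Eventually.of_forall hη0), (mollBump N k).integral_normed, ENNReal.ofReal_one]⟩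
  have hgm : Measurable g := hm.measurable
  have hpt : ∀ x, ‖moll k g x‖ₑ ^ r ≤ ∫⁻ y, ‖g (x - y)‖ₑ ^ r ∂ν := by
    intro x
    have hmx : Measurable fun y => g (x - y) := hgm.comp (measurable_const.sub measurable_id)
    have h1 : ‖moll k g x‖ₑ ≤ ∫⁻ y, ‖g (x - y)‖ₑ ∂ν := by
      rw [moll, convolution_def]
      refine (enorm_integral_le_lintegral_enorm _).trans ?_
      rw [hν, lintegral_withDensity_eq_lintegral_mul _ hηm hmx.enorm]
      refine lintegral_mono fun y => ?_
      simp only [ContinuousLinearMap.lsmul_apply, enorm_smul, Pi.mul_apply]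
      rw [Real.enorm_eq_ofReal (hη0 y)]
    have h2 := eLpNorm'_le_eLpNorm'_of_exponent_le one_pos hr ν
      (hmx.stronglyMeasurable.aestronglyMeasurable (μ := ν))
    simp only [eLpNorm', ENNReal.rpow_one, div_one] at h2
    calc ‖moll k g x‖ₑ ^ r ≤ ((∫⁻ y, ‖g (x - y)‖ₑ ^ r ∂ν) ^ (1 / r)) ^ r :=
          ENNReal.rpow_le_rpow (h1.trans h2) (by linarith)
      _ = ∫⁻ y, ‖g (x - y)‖ₑ ^ r ∂ν := by
          rw [← ENNReal.rpow_mul, one_div_mul_cancel (by linarith), ENNReal.rpow_one]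
  refine (lintegral_mono hpt).trans ?_
  rw [lintegral_lintegral_swap]
  · have : ∀ y, ∫⁻ x, ‖g (x - y)‖ₑ ^ r = ∫⁻ x, ‖g x‖ₑ ^ r := fun y =>
      lintegral_sub_right_eq_self (fun x => ‖g x‖ₑ ^ r) y
    simp [this]
  · refine Measurable.aemeasurable ?_
    exact ((hgm.comp (measurable_fst.sub measurable_snd)).enorm.pow_const r)

end

section

variable {N : ℕ} {Ω : Set (Euc N)}

/-! ### Morrey's inequality -/

/-- The Jacobian `t ^ (-N)` decides which exponent works below: its root of order `2N` is `t ^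
(-1/2)`, which is integrable at the origin. -/
lemma lintegral_comp_homothety {H : Euc N → ℝ≥0∞} (hH : Measurable H) (x : Euc N) {t : ℝ}
    (ht : 0 < t) :
    ∫⁻ z, H (x + t • (z - x)) = ENNReal.ofReal ((t ^ N)⁻¹) * ∫⁻ y, H y := by
  rw [lintegral_sub_right_eq_self (fun z => H (x + t • z)) x]
  have hm : Measurable fun y => H (x + y) := hH.comp (measurable_const.add measurable_id)
  have h1 : ∫⁻ z, H (x + t • z) = ∫⁻ y, H (x + y) ∂(Measure.map (fun z : Euc N => t • z) volume) :=
    (lintegral_map hm (measurable_const_smul t)).symm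
  rw [h1, Measure.map_addHaar_smul _ ht.ne', lintegral_smul_measure,
    lintegral_add_left_eq_self (fun y => H y) x, finrank_euclideanSpace, Fintype.card_fin,
    abs_of_pos (by positivity), smul_eq_mul]

lemma lintegral_rpow_neg_half :
    ∫⁻ t in Ioc (0 : ℝ) 1, ENNReal.ofReal (t ^ (-(1 / 2) : ℝ)) = 2 := by
  have hi : IntervalIntegrable (fun t : ℝ => t ^ (-(1 / 2) : ℝ)) volume 0 1 :=
    intervalIntegral.intervalIntegrable_rpow' (by norm_num)
  rw [← ofReal_integral_eq_lintegral_ofReal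
    ((intervalIntegrable_iff_integrableOn_Ioc_of_le zero_le_one).1 hi),
    ← intervalIntegral.integral_of_le zero_le_one, integral_rpow (Or.inl (by norm_num))]
  · norm_num
  · filter_upwards [ae_restrict_mem measurableSet_Ioc] with t ht
    exact Real.rpow_nonneg ht.1.le _

lemma enorm_sub_le_lintegral_segment {w : Euc N → ℝ} (hw : ContDiff ℝ 1 w) (x z : Euc N) {d : ℝ}
    (hd : ‖z - x‖ ≤ d) :
    ‖w z - w x‖ₑ ≤ ENNReal.ofReal d * ∫⁻ t in Ioc (0 : ℝ) 1, ‖∇ w (x + t • (z - x))‖ₑ := by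
  have hder : ∀ t : ℝ, HasDerivAt (fun t : ℝ => w (x + t • (z - x)))
      (fderiv ℝ w (x + t • (z - x)) (z - x)) t := by
    intro t
    have h1 : HasDerivAt (fun t : ℝ => x + t • (z - x)) (z - x) t := by
      simpa using ((hasDerivAt_id t).smul_const (z - x)).const_add x
    exact ((hw.differentiable one_ne_zero _).hasFDerivAt).comp_hasDerivAt t h1
  have hcont : Continuous fun t : ℝ => fderiv ℝ w (x + t • (z - x)) (z - x) :=
    ((hw.continuous_fderiv one_ne_zero).comp (by fun_prop)).clm_apply continuous_const
  have hftc := intervalIntegral.integral_eq_sub_of_hasDerivAt (a := 0) (b := 1)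
    (fun t _ => hder t) (hcont.intervalIntegrable _ _)
  simp only [one_smul, zero_smul, add_zero, add_sub_cancel] at hftc
  rw [← hftc, intervalIntegral.integral_of_le zero_le_one]
  refine (enorm_integral_le_lintegral_enorm _).trans ?_
  rw [← lintegral_const_mul' _ _ ENNReal.ofReal_ne_top]
  refine lintegral_mono fun t => ?_
  have e1 : ‖∇ w (x + t • (z - x))‖ₑ = ‖fderiv ℝ w (x + t • (z - x))‖ₑ := by
    rw [← ofReal_norm, norm_gradient, ofReal_norm]
  rw [e1, mul_comm]
  refine ((fderiv ℝ w (x + t • (z - x))).le_opENorm (z - x)).trans ?_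
  gcongr
  rw [← ofReal_norm]
  exact ENNReal.ofReal_le_ofReal hd

/-- Integrate the segment estimate over `z ∈ D` and exchange the order. For fixed `t`, Hölder with
exponent `2N` and the homothety of ratio `t` cost a factor `t ^ (-1/2)`, whose integral over `(0,
1]` is `2`. -/
lemma lintegral_enorm_sub_le (hN : 1 ≤ N) {w : Euc N → ℝ} (hw : ContDiff ℝ 1 w)
    {D A : Set (Euc N)} (hD : MeasurableSet D) (hA : MeasurableSet A) {x : Euc N} {d : ℝ}
    (hd : ∀ z ∈ D, ‖z - x‖ ≤ d) (hDA : ∀ z ∈ D, ∀ t ∈ Ioc (0 : ℝ) 1, x + t • (z - x) ∈ A) :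
    ∫⁻ z in D, ‖w z - w x‖ₑ ≤ ENNReal.ofReal d * 2 *
      ((volume D) ^ (1 - 1 / (2 * N : ℝ)) *
        (∫⁻ y in A, ‖∇ w y‖ₑ ^ (2 * N : ℝ)) ^ (1 / (2 * N : ℝ))) := by
  have hN' : (1 : ℝ) ≤ N := by exact_mod_cast hN
  have hgc : Continuous (∇ w) := continuous_gradient hw
  set R : ℝ := 2 * N with hR
  have hR1 : 1 < R := by rw [hR]; linarith
  have hF : Measurable fun y => ‖∇ w y‖ₑ := hgc.measurable.enorm
  set I := ∫⁻ y in A, ‖∇ w y‖ₑ ^ R with hI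
  have step : ∀ t ∈ Ioc (0 : ℝ) 1, ∫⁻ z in D, ‖∇ w (x + t • (z - x))‖ₑ ≤
      ENNReal.ofReal (t ^ (-(1 / 2) : ℝ)) * ((volume D) ^ (1 - 1 / R) * I ^ (1 / R)) := by
    intro t ht
    have hmt : Measurable fun z => ‖∇ w (x + t • (z - x))‖ₑ :=
      hF.comp (by fun_prop)
    have hconj : R.HolderConjugate (R / (R - 1)) := Real.HolderConjugate.conjExponent hR1
    have h1 := ENNReal.lintegral_mul_le_Lp_mul_Lq (volume.restrict D) hconj
      hmt.aemeasurable (aemeasurable_const (b := (1 : ℝ≥0∞)))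
    simp only [Pi.mul_apply, mul_one, ENNReal.one_rpow, lintegral_const,
      Measure.restrict_apply_univ, one_mul] at h1
    have h2 : ∫⁻ z in D, ‖∇ w (x + t • (z - x))‖ₑ ^ R ≤ ENNReal.ofReal ((t ^ N)⁻¹) * I := by
      have hm : Measurable (A.indicator fun y => ‖∇ w y‖ₑ ^ R) :=
        (hF.pow_const R).indicator hA
      have h3 := lintegral_comp_homothety hm x ht.1
      rw [lintegral_indicator hA] at h3
      rw [hI, ← h3, ← lintegral_indicator hD]
      refine lintegral_mono fun z => ?_
      by_cases hz : z ∈ D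
      · simp [hz, hDA z hz t ht]
      · simp [hz]
    have h4 : ENNReal.ofReal ((t ^ N)⁻¹) ^ (1 / R) = ENNReal.ofReal (t ^ (-(1 / 2) : ℝ)) := by
      rw [ENNReal.ofReal_rpow_of_nonneg (by have := ht.1; positivity) (by positivity),
        ← Real.rpow_natCast, ← Real.rpow_neg ht.1.le, ← Real.rpow_mul ht.1.le]
      congr 2
      rw [hR]
      field_simp
    calc ∫⁻ z in D, ‖∇ w (x + t • (z - x))‖ₑ
        ≤ (∫⁻ z in D, ‖∇ w (x + t • (z - x))‖ₑ ^ R) ^ (1 / R) *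
            (volume D) ^ (1 / (R / (R - 1))) := h1
      _ ≤ (ENNReal.ofReal ((t ^ N)⁻¹) * I) ^ (1 / R) * (volume D) ^ (1 / (R / (R - 1))) := by
          gcongr
      _ = _ := by
          rw [ENNReal.mul_rpow_of_nonneg _ _ (by positivity), h4]
          have : 1 / (R / (R - 1)) = 1 - 1 / R := by
            have : R - 1 ≠ 0 := by linarith
            field_simp
          rw [this]
          ring
  calc ∫⁻ z in D, ‖w z - w x‖ₑ
      ≤ ∫⁻ z in D, ENNReal.ofReal d * ∫⁻ t in Ioc (0 : ℝ) 1, ‖∇ w (x + t • (z - x))‖ₑ :=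
        setLIntegral_mono' hD fun z hz => enorm_sub_le_lintegral_segment hw x z (hd z hz)
    _ = ENNReal.ofReal d * ∫⁻ z in D, ∫⁻ t in Ioc (0 : ℝ) 1, ‖∇ w (x + t • (z - x))‖ₑ :=
        lintegral_const_mul' _ _ ENNReal.ofReal_ne_top
    _ = ENNReal.ofReal d * ∫⁻ t in Ioc (0 : ℝ) 1, ∫⁻ z in D, ‖∇ w (x + t • (z - x))‖ₑ := by
        rw [lintegral_lintegral_swap]
        refine Measurable.aemeasurable (hF.comp ?_)
        fun_prop
    _ ≤ ENNReal.ofReal d * ∫⁻ t in Ioc (0 : ℝ) 1,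
          ENNReal.ofReal (t ^ (-(1 / 2) : ℝ)) * ((volume D) ^ (1 - 1 / R) * I ^ (1 / R)) := by
        gcongr 1
        exact setLIntegral_mono' measurableSet_Ioc step
    _ = _ := by
        rw [lintegral_mul_const _ (by fun_prop), lintegral_rpow_neg_half]
        ring

/-- The constant in Morrey's inequality. -/
noncomputable def morreyConst (N : ℕ) : ℝ :=
  24 * (volume (Metric.closedBall (0 : Euc N) 1)).toReal ^ (-(1 / (2 * N : ℝ)))

lemma morreyConst_pos (N : ℕ) : 0 < morreyConst N := by
  have : 0 < (volume (Metric.closedBall (0 : Euc N) 1)).toReal :=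
    ENNReal.toReal_pos (Metric.measure_closedBall_pos _ _ one_pos).ne'
      measure_closedBall_lt_top.ne
  unfold morreyConst
  positivity

/-- The values at `x` and `y` are compared through the average over one ball. Only segments from the
two points to that ball are used, so it may be placed inside the domain when `x` and `y` lie near
the boundary. The constant `24` is two points times the length factor `6` times the integral `2`;
the volume power `-1/(2N)` turns `s` into `√s`. -/
lemma abs_sub_le_of_ball (hN : 1 ≤ N) {w : Euc N → ℝ} (hw : ContDiff ℝ 1 w)
    {A : Set (Euc N)} (hA : MeasurableSet A) {x y c : Euc N} {s B : ℝ} (hs : 0 < s) (hB : 0 ≤ B)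
    (hdx : ∀ z ∈ Metric.closedBall c s, ‖z - x‖ ≤ 6 * s)
    (hdy : ∀ z ∈ Metric.closedBall c s, ‖z - y‖ ≤ 6 * s)
    (hx : ∀ z ∈ Metric.closedBall c s, ∀ t ∈ Ioc (0 : ℝ) 1, x + t • (z - x) ∈ A)
    (hy : ∀ z ∈ Metric.closedBall c s, ∀ t ∈ Ioc (0 : ℝ) 1, y + t • (z - y) ∈ A)
    (hI : (∫⁻ y in A, ‖∇ w y‖ₑ ^ (2 * N : ℝ)) ^ (1 / (2 * N : ℝ)) ≤ ENNReal.ofReal B) :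
    |w x - w y| ≤ morreyConst N * √s * B := by
  have hN' : (1 : ℝ) ≤ N := by exact_mod_cast hN
  set D := Metric.closedBall c s with hDdef
  have hD : MeasurableSet D := Metric.isClosed_closedBall.measurableSet
  have h1 := lintegral_enorm_sub_le hN hw hD hA hdx hx
  have h2 := lintegral_enorm_sub_le hN hw hD hA hdy hy
  set R : ℝ := 2 * N with hR
  have hR1 : 1 < R := by rw [hR]; linarith
  set κ := (volume (Metric.closedBall (0 : Euc N) 1)).toReal with hκ
  have hκ0 : 0 < κ := ENNReal.toReal_pos (Metric.measure_closedBall_pos _ _ one_pos).ne'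
      measure_closedBall_lt_top.ne
  have hvol : volume D = ENNReal.ofReal (s ^ N * κ) := by
    rw [hDdef, Measure.addHaar_closedBall' _ _ hs.le, finrank_euclideanSpace, Fintype.card_fin,
      ENNReal.ofReal_mul (by positivity), hκ, ENNReal.ofReal_toReal measure_closedBall_lt_top.ne]
  set V := s ^ N * κ with hV
  have hV0 : 0 < V := by positivity
  have key : ENNReal.ofReal (|w x - w y| * V) ≤
      ENNReal.ofReal (24 * s * (V ^ (1 - 1 / R) * B)) := by
    calc ENNReal.ofReal (|w x - w y| * V) = ∫⁻ _ in D, ‖w x - w y‖ₑ := by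
          rw [lintegral_const, Measure.restrict_apply_univ, hvol, ENNReal.ofReal_mul (abs_nonneg _),
            ← Real.norm_eq_abs, ofReal_norm]
      _ ≤ ∫⁻ z in D, (‖w z - w x‖ₑ + ‖w z - w y‖ₑ) := by
          refine lintegral_mono fun z => ?_
          have e1 : w x - w y = -(w z - w x) + (w z - w y) := by ring
          rw [e1]
          refine (enorm_add_le _ _).trans ?_
          rw [enorm_neg]
      _ = (∫⁻ z in D, ‖w z - w x‖ₑ) + ∫⁻ z in D, ‖w z - w y‖ₑ := by
          refine lintegral_add_left (Continuous.measurable ?_) _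
          have := hw.continuous
          fun_prop
      _ ≤ _ := add_le_add h1 h2
      _ ≤ ENNReal.ofReal (6 * s) * 2 * (volume D ^ (1 - 1 / R) * ENNReal.ofReal B) +
            ENNReal.ofReal (6 * s) * 2 * (volume D ^ (1 - 1 / R) * ENNReal.ofReal B) := by
          gcongr
      _ = ENNReal.ofReal (24 * s * (V ^ (1 - 1 / R) * B)) := by
          rw [hvol, ENNReal.ofReal_rpow_of_pos hV0, ← ENNReal.ofReal_mul (by positivity)]
          have : (2 : ℝ≥0∞) = ENNReal.ofReal 2 := by simp
          rw [this, ← ENNReal.ofReal_mul (by positivity), ← ENNReal.ofReal_mul (by positivity),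
            ← ENNReal.ofReal_add (by positivity) (by positivity)]
          congr 1
          ring
  rw [ENNReal.ofReal_le_ofReal_iff (by positivity)] at key
  have e2 : V ^ (1 - 1 / R) = V * V ^ (-(1 / R)) := by
    rw [sub_eq_add_neg, Real.rpow_add hV0, Real.rpow_one]
  have e3 : V ^ (-(1 / R)) = (√s)⁻¹ * κ ^ (-(1 / R)) := by
    rw [hV, Real.mul_rpow (by positivity) hκ0.le, ← Real.rpow_natCast, ← Real.rpow_mul hs.le,
      Real.sqrt_eq_rpow, ← Real.rpow_neg hs.le]
    congr 2
    rw [hR]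
    field_simp
  have e4 : s * (√s)⁻¹ = √s := by
    rw [← div_eq_mul_inv, Real.div_sqrt]
  have e5 : 24 * s * (V ^ (1 - 1 / R) * B) = (morreyConst N * √s * B) * V := by
    calc 24 * s * (V ^ (1 - 1 / R) * B) = 24 * κ ^ (-(1 / R)) * (s * (√s)⁻¹) * B * V := by
          rw [e2, e3]; ring
      _ = _ := by rw [e4, morreyConst]
  rw [e5] at key
  exact le_of_mul_le_mul_right key hV0

/-- Locally uniform interior cone condition at `x₀`. -/
def ConeAt (Ω : Set (Euc N)) (x₀ : Euc N) (ρ : ℝ) (e : Euc N) : Prop :=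
  0 < ρ ∧ ‖e‖ ≤ 1 ∧ ∀ x ∈ closure Ω, dist x x₀ < ρ → ∀ s, 0 < s → s < ρ →
    ∀ ξ : Euc N, ‖ξ - (4 * s) • e‖ ≤ 2 * s → ∀ t ∈ Ioc (0 : ℝ) 1, x + t • ξ ∈ Ω

lemma nonpos_of_mem_closure {U : Set (Euc N)} (hU : IsOpen U) {ρ : Euc N → ℝ}
    (hρ : ContinuousOn ρ U) (h : ∀ y ∈ U, (y ∈ Ω ↔ ρ y < 0)) {x : Euc N} (hx : x ∈ closure Ω)
    (hxU : x ∈ U) : ρ x ≤ 0 := by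
  by_contra hcon
  push Not at hcon
  have hc := (hρ.continuousAt (hU.mem_nhds hxU)).eventually (lt_mem_nhds hcon)
  obtain ⟨y, hy, hyΩ⟩ := mem_closure_iff_nhds.1 hx _ (hc.and (hU.mem_nhds hxU))
  exact absurd ((h y hy.2).1 hyΩ) (not_lt.2 (le_of_lt hy.1))

/-- At an interior point `e = 0` and a small ball suffice. At a boundary point `e` is the inner
normal: the defining function decreases along `ξ` at first order, and strict differentiability makes
this uniform in the starting point `x` of the closure. The radius `2 * s` in the cone, twice that of
the averaging ball, leaves room to use the same ball for any `y` within `s` of `x`. -/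
lemma exists_coneAt (hΩ : IsSmoothBoundedDomain Ω) {x₀ : Euc N} (hx₀ : x₀ ∈ closure Ω) :
    ∃ ρ e, ConeAt Ω x₀ ρ e := by
  by_cases hmem : x₀ ∈ Ω
  · obtain ⟨δ, hδ, hsub⟩ := Metric.isOpen_iff.1 hΩ.isOpen x₀ hmem
    refine ⟨δ / 4, 0, by positivity, by simp, fun x _ hx s hs hsρ ξ hξ t ht => hsub ?_⟩
    rw [smul_zero, sub_zero] at hξ
    rw [Metric.mem_ball]
    calc dist (x + t • ξ) x₀ ≤ dist (x + t • ξ) x + dist x x₀ := dist_triangle _ _ _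
      _ ≤ ‖ξ‖ + dist x x₀ := by
          gcongr
          rw [dist_eq_norm, add_sub_cancel_left, norm_smul, Real.norm_of_nonneg ht.1.le]
          exact mul_le_of_le_one_left (norm_nonneg _) ht.2
      _ < δ := by linarith
  · have hfr : x₀ ∈ frontier Ω := ⟨hx₀, by rwa [hΩ.isOpen.interior_eq]⟩
    obtain ⟨ρ, hρ⟩ := hΩ.smooth_boundary x₀ hfr
    obtain ⟨hg, U, hU, hxU, hC, hiff⟩ := hρ
    set g := ∇ ρ x₀ with hgdef
    have hg0 : 0 < ‖g‖ := norm_pos_iff.2 hg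
    have hstrict : HasStrictFDerivAt ρ (fderiv ℝ ρ x₀) x₀ :=
      ((hC.contDiffAt (hU.mem_nhds hxU)).hasStrictFDerivAt (by simp))
    -- Since `‖ξ‖ ≤ 6 * s`, the factor `‖g‖ / 6` bounds the error by `t * s * ‖g‖`, half of the
    -- first-order decrease `2 * t * s * ‖g‖`.
    have hev := hstrict.isLittleO.def (c := ‖g‖ / 6) (by positivity)
    rw [nhds_prod_eq] at hev
    obtain ⟨W, hW, hWp⟩ := (Filter.eventually_prod_self_iff (r := fun a b =>
      ‖ρ a - ρ b - fderiv ℝ ρ x₀ (a - b)‖ ≤ ‖g‖ / 6 * ‖a - b‖)).1 hev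
    obtain ⟨δ, hδ, hsub⟩ := Metric.mem_nhds_iff.1 (inter_mem hW (hU.mem_nhds hxU))
    have he : ‖(-(‖g‖⁻¹ • g) : Euc N)‖ = 1 := by
      rw [norm_neg, norm_smul, norm_inv, norm_norm, inv_mul_cancel₀ hg0.ne']
    -- One seventh of `δ` for the distance to `x₀` and six for the length of `ξ`.
    refine ⟨δ / 7, -(‖g‖⁻¹ • g), by positivity, he.le, fun x hx hxd s hs hsρ ξ hξ t ht => ?_⟩
    set e : Euc N := -(‖g‖⁻¹ • g) with hedef
    have hξn : ‖ξ‖ ≤ 6 * s := by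
      calc ‖ξ‖ = ‖(ξ - (4 * s) • e) + (4 * s) • e‖ := by rw [sub_add_cancel]
        _ ≤ 2 * s + 4 * s := by
            refine (norm_add_le _ _).trans (add_le_add hξ ?_)
            rw [norm_smul, he, mul_one, Real.norm_of_nonneg (by positivity)]
        _ = 6 * s := by ring
    have htξ : ‖t • ξ‖ ≤ t * (6 * s) := by
      rw [norm_smul, Real.norm_of_nonneg ht.1.le]
      exact mul_le_mul_of_nonneg_left hξn ht.1.le
    have hxb : x ∈ W ∩ U := hsub (by rw [Metric.mem_ball]; linarith)
    have hyb : x + t • ξ ∈ W ∩ U := hsub (by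
      rw [Metric.mem_ball]
      calc dist (x + t • ξ) x₀ ≤ dist (x + t • ξ) x + dist x x₀ := dist_triangle _ _ _
        _ ≤ 6 * s + dist x x₀ := by
            gcongr
            rw [dist_eq_norm, add_sub_cancel_left]
            refine htξ.trans (mul_le_of_le_one_left (by positivity) ht.2)
        _ < δ := by linarith)
    rw [hiff _ hyb.2]
    have hx0 : ρ x ≤ 0 := nonpos_of_mem_closure hU hC.continuousOn hiff hx hxb.2
    have h1 := hWp _ hyb.1 _ hxb.1
    simp only [add_sub_cancel_left] at h1
    have h2 : fderiv ℝ ρ x₀ (t • ξ) = t * inner ℝ g ξ := by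
      rw [← inner_gradient_left, inner_smul_right]
    have h3 : inner ℝ g ξ ≤ -(2 * s * ‖g‖) := by
      have e1 : inner ℝ g ξ = -(‖g‖ * inner ℝ e ξ) := by
        rw [hedef, inner_neg_left, inner_smul_left]
        simp
        field_simp
      have e2 : inner ℝ e ξ = 4 * s + inner ℝ e (ξ - (4 * s) • e) := by
        rw [inner_sub_right, inner_smul_right, real_inner_self_eq_norm_sq, he]
        ring
      have e3 : -(2 * s) ≤ inner ℝ e (ξ - (4 * s) • e) := by
        have := abs_real_inner_le_norm e (ξ - (4 * s) • e)
        rw [he, one_mul] at this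
        linarith [(abs_le.1 (this.trans hξ)).1]
      rw [e1]
      have : 2 * s ≤ inner ℝ e ξ := by linarith
      nlinarith
    have h4 := (abs_le.1 h1).2
    rw [h2] at h4
    have h5 : t * inner ℝ g ξ ≤ t * -(2 * s * ‖g‖) := mul_le_mul_of_nonneg_left h3 ht.1.le
    have h6 : ‖g‖ / 6 * ‖t • ξ‖ ≤ ‖g‖ / 6 * (t * (6 * s)) := by gcongr
    have h7 : 0 < t * s * ‖g‖ := by have := ht.1; positivity
    nlinarith

/-- The exponent `2N` used in Morrey's inequality. -/
noncomputable def morreyExp (N : ℕ) : ℝ≥0∞ := ENNReal.ofReal (2 * N)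

/-- The `L^{2N}` norm of a vector field. -/
noncomputable def gradNorm (Ω : Set (Euc N)) (G : Euc N → Euc N) : ℝ :=
  (eLpNorm G (morreyExp N) (volume.restrict Ω)).toReal

lemma gradNorm_nonneg (G : Euc N → Euc N) : 0 ≤ gradNorm Ω G := ENNReal.toReal_nonneg

lemma one_le_morreyExp (hN : 1 ≤ N) : 1 ≤ morreyExp N := by
  have hN' : (1 : ℝ) ≤ N := by exact_mod_cast hN
  rw [morreyExp, ENNReal.one_le_ofReal]
  linarith

lemma morreyExp_ne_top : morreyExp N ≠ ⊤ := ENNReal.ofReal_ne_top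

lemma toReal_morreyExp : (morreyExp N).toReal = 2 * N := by
  rw [morreyExp, ENNReal.toReal_ofReal (by positivity)]

/-- The smooth estimate is applied to mollifications on a compact subset of `Ω`, where their
gradients are mollified gradients with no larger `L^{2N}` norm. Convergence is assumed only at the
two points, so the lemma serves both before a continuous representative exists, at almost every
point, and afterwards. -/
lemma SobolevPair.abs_sub_le_of_tendsto (hN : 1 ≤ N) (ho : IsOpen Ω) (hb : Bornology.IsBounded Ω)
    {u G} (h : SobolevPair Ω (morreyExp N) u G) {x₀ : Euc N} {ρ : ℝ} {e : Euc N}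
    (hc : ConeAt Ω x₀ ρ e) {x y : Euc N} (hx : x ∈ Ω) (hy : y ∈ Ω)
    (hx' : Tendsto (fun k => moll k (Ω.indicator u) x) atTop (𝓝 (u x)))
    (hy' : Tendsto (fun k => moll k (Ω.indicator u) y) atTop (𝓝 (u y)))
    (hxd : dist x x₀ < ρ) (hyd : dist y x₀ < ρ) {s : ℝ} (hs : 0 < s) (hsρ : s < ρ)
    (hxy : dist x y ≤ s) : |u x - u y| ≤ morreyConst N * √s * gradNorm Ω G := by
  have hN' : (1 : ℝ) ≤ N := by exact_mod_cast hN
  set c := x + (4 * s) • e with hcdef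
  have hzx : ∀ z ∈ Metric.closedBall c s, ‖(z - x) - (4 * s) • e‖ ≤ 2 * s := by
    intro z hz
    rw [Metric.mem_closedBall, dist_eq_norm] at hz
    have : z - x - (4 * s) • e = z - c := by rw [hcdef]; abel
    rw [this]
    linarith
  have hzy : ∀ z ∈ Metric.closedBall c s, ‖(z - y) - (4 * s) • e‖ ≤ 2 * s := by
    intro z hz
    rw [Metric.mem_closedBall, dist_eq_norm] at hz
    have : z - y - (4 * s) • e = (z - c) + (x - y) := by rw [hcdef]; abel
    rw [this]
    rw [dist_eq_norm] at hxy
    linarith [norm_add_le (z - c) (x - y)]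
  have hnorm : ∀ ξ : Euc N, ‖ξ - (4 * s) • e‖ ≤ 2 * s → ‖ξ‖ ≤ 6 * s := by
    intro ξ hξ
    calc ‖ξ‖ = ‖(ξ - (4 * s) • e) + (4 * s) • e‖ := by rw [sub_add_cancel]
      _ ≤ 2 * s + 4 * s := by
          refine (norm_add_le _ _).trans (add_le_add hξ ?_)
          rw [norm_smul, Real.norm_of_nonneg (by positivity)]
          exact mul_le_of_le_one_right (by positivity) hc.2.1
      _ = 6 * s := by ring
  -- the union of the segments is a compact subset of `Ω`
  set f : Euc N → ℝ × Euc N → Euc N := fun a p => a + p.1 • (p.2 - a) with hf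
  set A := f x '' (Icc (0 : ℝ) 1 ×ˢ Metric.closedBall c s) ∪
    f y '' (Icc (0 : ℝ) 1 ×ˢ Metric.closedBall c s) with hAdef
  have hAc : IsCompact A := by
    have hK : IsCompact (Icc (0 : ℝ) 1 ×ˢ Metric.closedBall c s) :=
      isCompact_Icc.prod (isCompact_closedBall c s)
    exact (hK.image (by fun_prop)).union (hK.image (by fun_prop))
  have hAΩ : A ⊆ Ω := by
    rintro _ (⟨⟨t, z⟩, ⟨ht, hz⟩, rfl⟩ | ⟨⟨t, z⟩, ⟨ht, hz⟩, rfl⟩)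
    · rcases eq_or_lt_of_le ht.1 with h0 | h0
      · have h0' : t = 0 := h0.symm
        simp [hf, h0', hx]
      · exact hc.2.2 x (subset_closure hx) hxd s hs hsρ (z - x) (hzx z hz) t ⟨h0, ht.2⟩
    · rcases eq_or_lt_of_le ht.1 with h0 | h0
      · have h0' : t = 0 := h0.symm
        simp [hf, h0', hy]
      · exact hc.2.2 y (subset_closure hy) hyd s hs hsρ (z - y) (hzy z hz) t ⟨h0, ht.2⟩
  have hAx : ∀ z ∈ Metric.closedBall c s, ∀ t ∈ Ioc (0 : ℝ) 1, x + t • (z - x) ∈ A :=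
    fun z hz t ht => Or.inl ⟨(t, z), ⟨⟨ht.1.le, ht.2⟩, hz⟩, rfl⟩
  have hAy : ∀ z ∈ Metric.closedBall c s, ∀ t ∈ Ioc (0 : ℝ) 1, y + t • (z - y) ∈ A :=
    fun z hz t ht => Or.inr ⟨(t, z), ⟨⟨ht.1.le, ht.2⟩, hz⟩, rfl⟩
  obtain ⟨δ, hδ, hsub⟩ := hAc.exists_cthickening_subset_open ho hAΩ
  have hr := one_le_morreyExp hN
  have hU := integrable_indicator_of_integrableOn ho (h.integrable hb hr)
  have hV := integrable_indicator_of_integrableOn ho (h.integrable_grad hb hr)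
  have hev : ∀ᶠ k in atTop, |moll k (Ω.indicator u) x - moll k (Ω.indicator u) y| ≤
      morreyConst N * √s * gradNorm Ω G := by
    filter_upwards [(tendsto_mollBump_rOut (N := N)).eventually (gt_mem_nhds hδ)] with k hk
    refine abs_sub_le_of_ball hN ((contDiff_moll k hU.locallyIntegrable).of_le (by simp))
      hAc.measurableSet hs (gradNorm_nonneg G) (fun z hz => hnorm _ (hzx z hz))
      (fun z hz => hnorm _ (hzy z hz)) hAx hAy ?_
    have e1 : ∀ z ∈ A, ∇ (moll k (Ω.indicator u)) z = moll k (Ω.indicator G) z := by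
      intro z hz
      refine h.gradient_moll ho hb hr k (Subset.trans ?_ hsub)
      exact (Metric.closedBall_subset_closedBall hk.le).trans
        (Metric.closedBall_subset_cthickening hz δ)
    have e2 : ∫⁻ z in A, ‖∇ (moll k (Ω.indicator u)) z‖ₑ ^ (2 * N : ℝ) ≤
        ∫⁻ z in Ω, ‖G z‖ₑ ^ (2 * N : ℝ) := by
      calc ∫⁻ z in A, ‖∇ (moll k (Ω.indicator u)) z‖ₑ ^ (2 * N : ℝ)
          = ∫⁻ z in A, ‖moll k (Ω.indicator G) z‖ₑ ^ (2 * N : ℝ) :=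
            setLIntegral_congr_fun hAc.measurableSet fun z hz => by simp only [e1 z hz]
        _ ≤ ∫⁻ z, ‖moll k (Ω.indicator G) z‖ₑ ^ (2 * N : ℝ) := setLIntegral_le_lintegral _ _
        _ ≤ ∫⁻ z, ‖Ω.indicator G z‖ₑ ^ (2 * N : ℝ) :=
            lintegral_enorm_moll_rpow_le k hV.aestronglyMeasurable (by linarith)
        _ = ∫⁻ z in Ω, ‖G z‖ₑ ^ (2 * N : ℝ) := by
            rw [← lintegral_indicator ho.measurableSet]
            congr 1; ext z
            by_cases hz : z ∈ Ω
            · simp [hz]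
            · have : (0 : ℝ) < 2 * N := by linarith
              simp [hz, this]
    rw [gradNorm, ENNReal.ofReal_toReal h.memLp_grad.eLpNorm_ne_top,
      eLpNorm_eq_lintegral_rpow_enorm_toReal (by
        have := one_le_morreyExp hN; exact (zero_lt_one.trans_le this).ne')
        morreyExp_ne_top, toReal_morreyExp]
    exact ENNReal.rpow_le_rpow e2 (by positivity)
  exact le_of_tendsto (hx'.sub hy').abs hev

end

/-! ### Continuity up to the boundary, oscillation bounds and equicontinuity. -/

section

variable {N : ℕ} {Ω : Set (Euc N)}

lemma tendsto_moll_of_continuousOn (ho : IsOpen Ω) {u : Euc N → ℝ} (hu : ContinuousOn u Ω)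
    {x : Euc N} (hx : x ∈ Ω) :
    Tendsto (fun k => moll k (Ω.indicator u) x) atTop (𝓝 (u x)) := by
  rw [Metric.tendsto_atTop']
  intro ε hε
  have hcont : ∀ᶠ y in 𝓝 x, y ∈ Ω ∧ dist (u y) (u x) < ε / 2 :=
    Filter.Eventually.and (ho.mem_nhds hx) ((hu.continuousAt (ho.mem_nhds hx)).eventually
      (Metric.ball_mem_nhds _ (half_pos hε)))
  obtain ⟨δ, hδ, hball⟩ := Metric.eventually_nhds_iff.1 hcont
  obtain ⟨K, hK⟩ := eventually_atTop.1
    ((tendsto_mollBump_rOut (N := N)).eventually (gt_mem_nhds hδ))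
  have hmeas : AEStronglyMeasurable (Ω.indicator u) :=
    (aestronglyMeasurable_indicator_iff ho.measurableSet).2
      (hu.aestronglyMeasurable ho.measurableSet)
  refine ⟨K, fun k hk => ?_⟩
  have := dist_moll_le k hmeas (x := x) (ε := ε / 2) fun y hy => by
    have hy' := hball (hy.trans (hK k hk.le))
    rw [indicator_of_mem hy'.1, indicator_of_mem hx]
    exact hy'.2.le
  rw [indicator_of_mem hx] at this
  linarith

lemma exists_seq_tendsto_of_mem_closure {x : Euc N} (hx : x ∈ closure Ω) :
    ∃ s : ℕ → Euc N, (∀ n, s n ∈ Ω) ∧ Tendsto s atTop (𝓝 x) :=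
  mem_closure_iff_seq_limit.1 hx

lemma tendsto_comp_of_continuousOn {u : Euc N → ℝ} (hu : ContinuousOn u (closure Ω))
    {x : Euc N} (hx : x ∈ closure Ω) {s : ℕ → Euc N} (hs : ∀ n, s n ∈ Ω)
    (hlim : Tendsto s atTop (𝓝 x)) : Tendsto (fun n => u (s n)) atTop (𝓝 (u x)) :=
  (hu x hx).tendsto.comp (tendsto_nhdsWithin_iff.2
    ⟨hlim, Eventually.of_forall fun n => subset_closure (hs n)⟩)

/-- Local Morrey estimate, up to the boundary. -/
lemma SobolevPair.abs_sub_le (hN : 1 ≤ N) (ho : IsOpen Ω) (hb : Bornology.IsBounded Ω)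
    {u G} (h : SobolevPair Ω (morreyExp N) u G) (hu : ContinuousOn u (closure Ω))
    {x₀ : Euc N} {ρ : ℝ} {e : Euc N} (hc : ConeAt Ω x₀ ρ e) {x y : Euc N} (hx : x ∈ closure Ω)
    (hy : y ∈ closure Ω) (hxd : dist x x₀ < ρ) (hyd : dist y x₀ < ρ) {s : ℝ}
    (hsρ : s < ρ) (hxy : dist x y < s) : |u x - u y| ≤ morreyConst N * √s * gradNorm Ω G := by
  have hs : 0 < s := dist_nonneg.trans_lt hxy
  obtain ⟨a, ha, hax⟩ := exists_seq_tendsto_of_mem_closure hx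
  obtain ⟨b, hb', hby⟩ := exists_seq_tendsto_of_mem_closure hy
  have l1 := tendsto_comp_of_continuousOn hu hx ha hax
  have l2 := tendsto_comp_of_continuousOn hu hy hb' hby
  refine le_of_tendsto (l1.sub l2).abs ?_
  have e1 := (hax.dist (tendsto_const_nhds (x := x₀))).eventually (gt_mem_nhds hxd)
  have e2 := (hby.dist (tendsto_const_nhds (x := x₀))).eventually (gt_mem_nhds hyd)
  have e3 := (hax.dist hby).eventually (gt_mem_nhds hxy)
  filter_upwards [e1, e2, e3] with n h1 h2 h3
  exact h.abs_sub_le_of_tendsto hN ho hb hc (ha n) (hb' n)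
    (tendsto_moll_of_continuousOn ho (hu.mono subset_closure) (ha n))
    (tendsto_moll_of_continuousOn ho (hu.mono subset_closure) (hb' n)) h1 h2 hs hsρ h3.le

/-- Every function in `W^{1,2N}` has a representative that is continuous up to the boundary. -/
lemma SobolevPair.exists_continuousOn (hN : 1 ≤ N) (hΩ : IsSmoothBoundedDomain Ω)
    {u G} (h : SobolevPair Ω (morreyExp N) u G) :
    ∃ u', ContinuousOn u' (closure Ω) ∧ u' =ᵐ[volume.restrict Ω] u := by
  have ho := hΩ.isOpen
  have hb := hΩ.isBounded
  have hU := integrable_indicator_of_integrableOn ho (h.integrable hb (one_le_morreyExp hN))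
  -- The points where mollifications recover `u` have full measure, hence are dense; there `u`
  -- satisfies the Morrey estimate near every point of the closure and so extends continuously.
  set T : Set (Euc N) := {x | x ∈ Ω ∧ Tendsto (fun k => moll k (Ω.indicator u) x) atTop (𝓝 (u x))}
    with hT
  have hae : ∀ᵐ x ∂(volume.restrict Ω), x ∈ T := by
    filter_upwards [ae_restrict_mem ho.measurableSet,
      ae_restrict_of_ae (ae_tendsto_moll hU.locallyIntegrable)] with x hx hx'
    rw [indicator_of_mem hx] at hx'
    exact ⟨hx, hx'⟩
  have hdense : closure Ω ⊆ closure T := by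
    refine closure_minimal (fun x hx => ?_) isClosed_closure
    rw [mem_closure_iff_nhds]
    intro V hV
    by_contra hne
    rw [not_nonempty_iff_eq_empty] at hne
    obtain ⟨W, hWV, hWo, hxW⟩ := mem_nhds_iff.1 hV
    have hpos : 0 < volume (W ∩ Ω) := (hWo.inter ho).measure_pos _ ⟨x, hxW, hx⟩
    rw [ae_restrict_iff' ho.measurableSet, ae_iff] at hae
    refine hpos.ne' (measure_mono_null (fun y hy => ?_) hae)
    simp only [Classical.not_imp, mem_ofPred_eq]
    exact ⟨hy.2, fun hyT => (hne ▸ (⟨hWV hy.1, hyT⟩ : y ∈ V ∩ T) : y ∈ (∅ : Set (Euc N)))⟩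
  have hC := morreyConst_pos N
  have hG0 := gradNorm_nonneg (Ω := Ω) G
  -- oscillation near a point of the closure
  have hosc : ∀ x₀ ∈ closure Ω, ∀ ε > 0, ∃ δ > 0, ∀ x ∈ T, ∀ y ∈ T, dist x x₀ < δ → dist y x₀ < δ →
      |u x - u y| < ε := by
    intro x₀ hx₀ ε hε
    obtain ⟨ρ, e, hc⟩ := exists_coneAt hΩ hx₀
    have hlim : Tendsto (fun s : ℝ => morreyConst N * √s * gradNorm Ω G) (𝓝[>] 0) (𝓝 0) := by
      have : Continuous fun s : ℝ => morreyConst N * √s * gradNorm Ω G := by fun_prop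
      have h0 := this.tendsto 0
      simp only [Real.sqrt_zero, mul_zero, zero_mul] at h0
      exact h0.mono_left nhdsWithin_le_nhds
    obtain ⟨s, ⟨hs1, hs2⟩, hs3⟩ := ((hlim.eventually (gt_mem_nhds hε)).and
      ((nhdsWithin_le_nhds (gt_mem_nhds hc.1)))).and self_mem_nhdsWithin |>.exists
    have hs0 : 0 < s := hs3
    refine ⟨s / 2, half_pos hs0, fun x hx y hy hxd hyd => lt_of_le_of_lt ?_ hs1⟩
    refine h.abs_sub_le_of_tendsto hN ho hb hc hx.1 hy.1 hx.2 hy.2 (hxd.trans ?_) (hyd.trans ?_)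
      hs0 hs2 ?_
    · have : s < ρ := hs2
      linarith
    · have : s < ρ := hs2
      linarith
    · linarith [dist_triangle_right x y x₀]
  have hlim : ∀ x ∈ closure Ω, ∃ y, Tendsto u (𝓝[T] x) (𝓝 y) := by
    intro x hx
    have hne : (𝓝[T] x).NeBot := mem_closure_iff_nhdsWithin_neBot.1 (hdense hx)
    refine cauchy_map_iff_exists_tendsto.1 ?_
    rw [Metric.cauchy_iff]
    refine ⟨inferInstance, fun ε hε => ?_⟩
    obtain ⟨δ, hδ, hd⟩ := hosc x hx ε hε
    refine ⟨u '' (T ∩ Metric.ball x δ), image_mem_map ?_, ?_⟩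
    · exact inter_mem self_mem_nhdsWithin (mem_nhdsWithin_of_mem_nhds (Metric.ball_mem_nhds x hδ))
    · rintro _ ⟨a, ha, rfl⟩ _ ⟨b, hb, rfl⟩
      exact hd a ha.1 b hb.1 ha.2 hb.2
  refine ⟨extendFrom T u, continuousOn_extendFrom hdense hlim, ?_⟩
  filter_upwards [hae] with x hx
  refine extendFrom_eq (subset_closure hx) ?_
  rw [Metric.tendsto_nhdsWithin_nhds]
  intro ε hε
  obtain ⟨δ, hδ, hd⟩ := hosc x (subset_closure hx.1) ε hε
  exact ⟨δ, hδ, fun y hy hyd => hd y hy x hx hyd (by simpa using hδ)⟩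

/-- Oscillation bound on the whole domain. -/
lemma exists_oscillation_bound (hN : 1 ≤ N) (hΩ : IsSmoothBoundedDomain Ω) :
    ∃ C, 0 ≤ C ∧ ∀ u G, SobolevPair Ω (morreyExp N) u G → ContinuousOn u (closure Ω) →
      ∀ x ∈ closure Ω, ∀ y ∈ closure Ω, |u x - u y| ≤ C * gradNorm Ω G := by
  have ho := hΩ.isOpen
  have hb := hΩ.isBounded
  have hloc : ∀ x₀ ∈ closure Ω, ∃ δ > 0, ∃ C, 0 ≤ C ∧ ∀ x ∈ closure Ω, ∀ y ∈ closure Ω,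
      dist x x₀ < δ → dist y x₀ < δ → ∀ u G, SobolevPair Ω (morreyExp N) u G →
      ContinuousOn u (closure Ω) → |u x - u y| ≤ C * gradNorm Ω G := by
    intro x₀ hx₀
    obtain ⟨ρ, e, hc⟩ := exists_coneAt hΩ hx₀
    have hρ := hc.1
    refine ⟨ρ / 4, by positivity, morreyConst N * √(ρ / 2),
      by have := morreyConst_pos N; positivity, fun x hx y hy hxd hyd u G h hu => ?_⟩
    exact h.abs_sub_le hN ho hb hu hc hx hy (by linarith) (by linarith) (by linarith)
      (by linarith [dist_triangle_right x y x₀])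
  -- Comparability with some constant holds locally and is symmetric and transitive, so it holds for
  -- all pairs of the connected closure. The constant depends on the pair until compactness makes it
  -- uniform.
  set P : Euc N → Euc N → Prop := fun x y => ∃ C, 0 ≤ C ∧ ∀ u G,
    SobolevPair Ω (morreyExp N) u G → ContinuousOn u (closure Ω) →
    |u x - u y| ≤ C * gradNorm Ω G with hP
  have hconn : IsPreconnected (closure Ω) := hΩ.isConnected.isPreconnected.closure
  have hall : ∀ x ∈ closure Ω, ∀ y ∈ closure Ω, P x y := by
    intro x hx y hy
    refine hconn.induction₂ P ?_ ?_ ?_ hx hy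
    · intro x hx
      obtain ⟨δ, hδ, C, hC0, hC⟩ := hloc x hx
      filter_upwards [self_mem_nhdsWithin,
        mem_nhdsWithin_of_mem_nhds (Metric.ball_mem_nhds x hδ)] with y hy hyd
      exact ⟨C, hC0, fun u G h hu => hC x hx y hy (by simpa using hδ) hyd u G h hu⟩
    · rintro x y z - - - ⟨C, hC0, hC⟩ ⟨C', hC0', hC'⟩
      refine ⟨C + C', by positivity, fun u G h hu => ?_⟩
      have e1 := hC u G h hu
      have e2 := hC' u G h hu
      rw [add_mul]
      exact (abs_sub_le (u x) (u y) (u z)).trans (add_le_add e1 e2)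
    · rintro x y - - ⟨C, hC0, hC⟩
      exact ⟨C, hC0, fun u G h hu => by rw [abs_sub_comm]; exact hC u G h hu⟩
  obtain ⟨b, hbΩ⟩ := hΩ.isConnected.nonempty
  have hbc := subset_closure hbΩ
  have hcomp : IsCompact (closure Ω) := hb.isCompact_closure
  have key : ∃ C, 0 ≤ C ∧ ∀ x ∈ closure Ω, ∀ u G, SobolevPair Ω (morreyExp N) u G →
      ContinuousOn u (closure Ω) → |u x - u b| ≤ C * gradNorm Ω G := by
    refine hcomp.induction_on (p := fun S => ∃ C, 0 ≤ C ∧ ∀ x ∈ S, ∀ u G,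
      SobolevPair Ω (morreyExp N) u G → ContinuousOn u (closure Ω) →
      |u x - u b| ≤ C * gradNorm Ω G) ⟨0, le_rfl, by simp⟩ ?_ ?_ ?_
    · rintro s t hst ⟨C, hC0, hC⟩
      exact ⟨C, hC0, fun x hx => hC x (hst hx)⟩
    · rintro s t ⟨C, hC0, hC⟩ ⟨C', hC0', hC'⟩
      refine ⟨max C C', le_max_of_le_left hC0, fun x hx u G h hu => ?_⟩
      rcases hx with hx | hx
      · exact (hC x hx u G h hu).trans
          (mul_le_mul_of_nonneg_right (le_max_left _ _) (gradNorm_nonneg G))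
      · exact (hC' x hx u G h hu).trans
          (mul_le_mul_of_nonneg_right (le_max_right _ _) (gradNorm_nonneg G))
    · intro x hx
      obtain ⟨δ, hδ, C, hC0, hC⟩ := hloc x hx
      obtain ⟨C', hC0', hC'⟩ := hall x hx b hbc
      refine ⟨closure Ω ∩ Metric.ball x δ, inter_mem self_mem_nhdsWithin
        (mem_nhdsWithin_of_mem_nhds (Metric.ball_mem_nhds x hδ)), C + C', by positivity,
        fun y hy u G h hu => ?_⟩
      have e1 := hC y hy.1 x hx hy.2 (by simpa using hδ) u G h hu
      have e2 := hC' u G h hu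
      rw [add_mul]
      exact (abs_sub_le (u y) (u x) (u b)).trans (add_le_add e1 e2)
  obtain ⟨C, hC0, hC⟩ := key
  refine ⟨C + C, by positivity, fun u G h hu x hx y hy => ?_⟩
  have e1 := hC x hx u G h hu
  have e2 := hC y hy u G h hu
  rw [abs_sub_comm] at e2
  rw [add_mul]
  exact (abs_sub_le (u x) (u b) (u y)).trans (add_le_add e1 e2)

/-- Functions with bounded gradient norm are equicontinuous. -/
lemma exists_equicontinuity (hN : 1 ≤ N) (hΩ : IsSmoothBoundedDomain Ω) {x₀ : Euc N}
    (hx₀ : x₀ ∈ closure Ω) (M : ℝ) {ε : ℝ} (hε : 0 < ε) :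
    ∃ δ > 0, ∀ u G, SobolevPair Ω (morreyExp N) u G → ContinuousOn u (closure Ω) →
      gradNorm Ω G ≤ M → ∀ x ∈ closure Ω, dist x x₀ < δ → |u x - u x₀| < ε := by
  obtain ⟨ρ, e, hc⟩ := exists_coneAt hΩ hx₀
  have hlim : Tendsto (fun s : ℝ => morreyConst N * √s * M) (𝓝[>] 0) (𝓝 0) := by
    have : Continuous fun s : ℝ => morreyConst N * √s * M := by fun_prop
    have h0 := this.tendsto 0
    simp only [Real.sqrt_zero, mul_zero, zero_mul] at h0
    exact h0.mono_left nhdsWithin_le_nhds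
  obtain ⟨s, ⟨hs1, hs2⟩, hs3⟩ := ((hlim.eventually (gt_mem_nhds hε)).and
    ((nhdsWithin_le_nhds (gt_mem_nhds hc.1)))).and self_mem_nhdsWithin |>.exists
  have hs0 : 0 < s := hs3
  have hsρ : s < ρ := hs2
  refine ⟨s, hs0, fun u G h hu hM x hx hxd => lt_of_le_of_lt ?_ hs1⟩
  refine (h.abs_sub_le hN hΩ.isOpen hΩ.isBounded hu hc hx hx₀ (hxd.trans hsρ)
    (by simpa using hc.1) hsρ hxd).trans ?_
  have := morreyConst_pos N
  gcongr

end

section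

variable {N : ℕ} {Ω : Set (Euc N)}

/-! ### Clarkson's inequality and lower semicontinuity -/

/-- The parallelogram law settles squares; superadditivity and then convexity of `t ↦ t ^ (r / 2)`
settle the powers. -/
lemma clarkson {E : Type*} [NormedAddCommGroup E] [InnerProductSpace ℝ E] {r : ℝ} (hr : 2 ≤ r)
    (a b : E) : ‖(1 / 2 : ℝ) • (a + b)‖ ^ r + ‖(1 / 2 : ℝ) • (a - b)‖ ^ r ≤
      (‖a‖ ^ r + ‖b‖ ^ r) / 2 := by
  have hs : 1 ≤ r / 2 := by linarith
  have hpow : ∀ c : E, ‖c‖ ^ r = (‖c‖ ^ 2) ^ (r / 2) := fun c => by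
    rw [← Real.rpow_natCast, ← Real.rpow_mul (norm_nonneg _)]
    congr 1
    push_cast
    ring
  have hpar : ‖(1 / 2 : ℝ) • (a + b)‖ ^ 2 + ‖(1 / 2 : ℝ) • (a - b)‖ ^ 2 =
      (1 / 2) * ‖a‖ ^ 2 + (1 / 2) * ‖b‖ ^ 2 := by
    have := parallelogram_law_with_norm ℝ a b
    rw [norm_smul, norm_smul, Real.norm_of_nonneg (by norm_num)]
    nlinarith
  rw [hpow, hpow, hpow a, hpow b]
  calc _ ≤ (‖(1 / 2 : ℝ) • (a + b)‖ ^ 2 + ‖(1 / 2 : ℝ) • (a - b)‖ ^ 2) ^ (r / 2) :=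
        Real.add_rpow_le_rpow_add (by positivity) (by positivity) hs
    _ = ((1 / 2) * ‖a‖ ^ 2 + (1 / 2) * ‖b‖ ^ 2) ^ (r / 2) := by rw [hpar]
    _ ≤ (1 / 2) * (‖a‖ ^ 2) ^ (r / 2) + (1 / 2) * (‖b‖ ^ 2) ^ (r / 2) := by
        have h := (convexOn_rpow hs).2 (mem_Ici.2 (sq_nonneg ‖a‖)) (mem_Ici.2 (sq_nonneg ‖b‖))
          (show (0 : ℝ) ≤ 1 / 2 by norm_num) (show (0 : ℝ) ≤ 1 / 2 by norm_num) (by norm_num)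
        simpa only [smul_eq_mul] using h
    _ = _ := by ring

section Closure

variable {X F : Type*} [MeasurableSpace X] {μ : Measure X}
  [NormedAddCommGroup F] [InnerProductSpace ℝ F]

lemma integrable_norm_rpow_of_memLp {F : Type*} [NormedAddCommGroup F] {f : X → F} {r : ℝ}
    (hr : 0 < r) (hf : MemLp f (ENNReal.ofReal r) μ) : Integrable (fun x => ‖f x‖ ^ r) μ := by
  have := hf.integrable_norm_rpow (by simpa using hr) ENNReal.ofReal_ne_top
  rwa [ENNReal.toReal_ofReal hr.le] at this

lemma eLpNorm_eq_ofReal_integral {F : Type*} [NormedAddCommGroup F] {f : X → F} {r : ℝ}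
    (hr : 0 < r) (hf : MemLp f (ENNReal.ofReal r) μ) :
    eLpNorm f (ENNReal.ofReal r) μ = ENNReal.ofReal ((∫ x, ‖f x‖ ^ r ∂μ) ^ (1 / r)) := by
  rw [hf.eLpNorm_eq_integral_rpow_norm (by simpa using hr) ENNReal.ofReal_ne_top,
    ENNReal.toReal_ofReal hr.le, one_div]

lemma integral_norm_rpow_eq {F : Type*} [NormedAddCommGroup F] {f : X → F} {r : ℝ}
    (hr : 0 < r) (hf : MemLp f (ENNReal.ofReal r) μ) :
    ∫ x, ‖f x‖ ^ r ∂μ = (eLpNorm f (ENNReal.ofReal r) μ).toReal ^ r := by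
  have h0 : 0 ≤ ∫ x, ‖f x‖ ^ r ∂μ := integral_nonneg fun x => by positivity
  rw [eLpNorm_eq_ofReal_integral hr hf, ENNReal.toReal_ofReal (by positivity), ← Real.rpow_mul h0,
    one_div_mul_cancel hr.ne', Real.rpow_one]

/-- Let `P` be a class of pairs that is closed under midpoints. If `(w_k, G_k) ∈ P`, `w_k → u` in
`L^r` and the energies of `G_k` are bounded by `M`, then `u` is the strong limit of pairs in `P`
whose second components converge, too, with energy of the limit at most `M`. -/
lemma exists_strong_limit {r : ℝ} (hr : 2 ≤ r) (P : (X → ℝ) → (X → F) → Prop) [CompleteSpace F]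
    (hmem : ∀ w G, P w G → MemLp w (ENNReal.ofReal r) μ ∧ MemLp G (ENNReal.ofReal r) μ)
    (hmid : ∀ w G w' G', P w G → P w' G' →
      P ((1 / 2 : ℝ) • (w + w')) ((1 / 2 : ℝ) • (G + G')))
    {u : X → ℝ} (hu : MemLp u (ENNReal.ofReal r) μ) {w : ℕ → X → ℝ} {G : ℕ → X → F}
    (hP : ∀ k, P (w k) (G k))
    (hlim : Tendsto (fun k => eLpNorm (u - w k) (ENNReal.ofReal r) μ) atTop (𝓝 0))
    {M : ℝ} (hM : ∀ k, ∫ x, ‖G k x‖ ^ r ∂μ ≤ M) :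
    ∃ H : X → F, MemLp H (ENNReal.ofReal r) μ ∧ ∫ x, ‖H x‖ ^ r ∂μ ≤ M ∧
      ∃ (w' : ℕ → X → ℝ) (G' : ℕ → X → F), (∀ k, P (w' k) (G' k)) ∧
        Tendsto (fun k => eLpNorm (u - w' k) (ENNReal.ofReal r) μ) atTop (𝓝 0) ∧
        Tendsto (fun k => eLpNorm (H - G' k) (ENNReal.ofReal r) μ) atTop (𝓝 0) := by
  have hr0 : 0 < r := by linarith
  have hr1 : 1 ≤ ENNReal.ofReal r := by rw [ENNReal.one_le_ofReal]; linarith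
  have hfact : Fact (1 ≤ ENNReal.ofReal r) := ⟨hr1⟩
  set En : (X → F) → ℝ := fun G => ∫ x, ‖G x‖ ^ r ∂μ with hEn
  have hEn0 : ∀ G, 0 ≤ En G := fun G => integral_nonneg fun x => by positivity
  set c : ℕ → ℝ≥0∞ := fun j => ENNReal.ofReal (1 / ((j : ℝ) + 1)) with hc
  set S : ℕ → Set ℝ := fun j => {e | ∃ w G, P w G ∧ eLpNorm (u - w) (ENNReal.ofReal r) μ ≤ c j ∧
    e = En G} with hS
  have hc0 : ∀ j, 0 < c j := fun j => by simp only [hc, ENNReal.ofReal_pos]; positivity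
  have hSne : ∀ j, ∃ e ∈ S j, e ≤ M := by
    intro j
    obtain ⟨k, hk⟩ := (hlim.eventually (gt_mem_nhds (hc0 j))).exists
    exact ⟨En (G k), ⟨w k, G k, hP k, hk.le, rfl⟩, hM k⟩
  have hSb : ∀ j, BddBelow (S j) := fun j => ⟨0, by rintro _ ⟨w, G, -, -, rfl⟩; exact hEn0 G⟩
  -- `m j` is the least energy in the class at `L^r` distance at most `1 / (j + 1)` from `u`; it
  -- increases with `j` and stays below `M`. The midpoint of almost minimizers at levels `i ≤ j`
  -- competes at level `i`, so Clarkson's inequality bounds their difference by the increment of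
  -- `m`: almost minimizers form a Cauchy sequence.
  set m : ℕ → ℝ := fun j => sInf (S j) with hm
  have hmM : ∀ j, m j ≤ M := fun j => by
    obtain ⟨e, he, heM⟩ := hSne j
    exact (csInf_le (hSb j) he).trans heM
  have hcanti : Antitone c := fun i j hij => by
    refine ENNReal.ofReal_le_ofReal ?_
    have : (i : ℝ) ≤ j := by exact_mod_cast hij
    gcongr
  have hmono : Monotone m := by
    intro i j hij
    obtain ⟨e, he, -⟩ := hSne j
    refine csInf_le_csInf (hSb i) ⟨e, he⟩ ?_
    rintro _ ⟨w, G, hP, hw, rfl⟩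
    exact ⟨w, G, hP, hw.trans (hcanti hij), rfl⟩
  have hex : ∀ j : ℕ, ∃ w G, P w G ∧ eLpNorm (u - w) (ENNReal.ofReal r) μ ≤ c j ∧
      En G < m j + 1 / ((j : ℝ) + 1) := by
    intro j
    obtain ⟨e, he, -⟩ := hSne j
    obtain ⟨_, ⟨w, G, hP, hw, rfl⟩, hlt⟩ := Real.lt_sInf_add_pos (s := S j) ⟨e, he⟩
      (ε := 1 / ((j : ℝ) + 1)) (by positivity)
    exact ⟨w, G, hP, hw, hlt⟩
  choose w' G' hP' hw' hG' using hex
  have hGm : ∀ j, MemLp (G' j) (ENNReal.ofReal r) μ := fun j => (hmem _ _ (hP' j)).2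
  have hwm : ∀ j, MemLp (w' j) (ENNReal.ofReal r) μ := fun j => (hmem _ _ (hP' j)).1
  have hmlim : Tendsto m atTop (𝓝 (⨆ j, m j)) :=
    tendsto_atTop_ciSup hmono ⟨M, by rintro _ ⟨j, rfl⟩; exact hmM j⟩
  -- differences are small
  have hdiff : ∀ i j, i ≤ j → ∫ x, ‖((1 / 2 : ℝ) • (G' i - G' j)) x‖ ^ r ∂μ ≤
      (m j - m i) / 2 + 1 / ((i : ℝ) + 1) := by
    intro i j hij
    have hmidP := hmid _ _ _ _ (hP' i) (hP' j)
    have hle : m i ≤ En ((1 / 2 : ℝ) • (G' i + G' j)) := by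
      refine csInf_le (hSb i) ⟨_, _, hmidP, ?_, rfl⟩
      have e1 : u - (1 / 2 : ℝ) • (w' i + w' j) =
          (1 / 2 : ℝ) • (u - w' i) + (1 / 2 : ℝ) • (u - w' j) := by
        ext x
        simp only [Pi.sub_apply, Pi.smul_apply, Pi.add_apply, smul_eq_mul]
        ring
      rw [e1]
      have h2 : (‖(1 / 2 : ℝ)‖ₑ) = ENNReal.ofReal (1 / 2) := by
        rw [Real.enorm_eq_ofReal (by norm_num)]
      calc _ ≤ eLpNorm ((1 / 2 : ℝ) • (u - w' i)) (ENNReal.ofReal r) μ +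
            eLpNorm ((1 / 2 : ℝ) • (u - w' j)) (ENNReal.ofReal r) μ :=
            eLpNorm_add_le ((hu.sub (hwm i)).const_smul _).1 ((hu.sub (hwm j)).const_smul _).1 hr1
        _ = ENNReal.ofReal (1 / 2) * eLpNorm (u - w' i) (ENNReal.ofReal r) μ +
            ENNReal.ofReal (1 / 2) * eLpNorm (u - w' j) (ENNReal.ofReal r) μ := by
            rw [eLpNorm_const_smul, eLpNorm_const_smul, h2]
        _ ≤ ENNReal.ofReal (1 / 2) * c i + ENNReal.ofReal (1 / 2) * c i := by
            gcongr
            · exact hw' i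
            · exact (hw' j).trans (hcanti hij)
        _ = c i := by
            rw [← add_mul, ← ENNReal.ofReal_add (by norm_num) (by norm_num)]
            norm_num
    have hI1 : MemLp ((1 / 2 : ℝ) • (G' i + G' j)) (ENNReal.ofReal r) μ :=
      ((hGm i).add (hGm j)).const_smul _
    have hI2 : MemLp ((1 / 2 : ℝ) • (G' i - G' j)) (ENNReal.ofReal r) μ :=
      ((hGm i).sub (hGm j)).const_smul _
    have hcl : En ((1 / 2 : ℝ) • (G' i + G' j)) +
        (∫ x, ‖((1 / 2 : ℝ) • (G' i - G' j)) x‖ ^ r ∂μ) ≤ (En (G' i) + En (G' j)) / 2 := by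
      simp only [hEn]
      rw [← integral_add (integrable_norm_rpow_of_memLp hr0 hI1)
        (integrable_norm_rpow_of_memLp hr0 hI2),
        ← integral_add (integrable_norm_rpow_of_memLp hr0 (hGm i))
        (integrable_norm_rpow_of_memLp hr0 (hGm j)), ← integral_div]
      refine integral_mono ((integrable_norm_rpow_of_memLp hr0 hI1).add
        (integrable_norm_rpow_of_memLp hr0 hI2)) (((integrable_norm_rpow_of_memLp hr0 (hGm i)).add
        (integrable_norm_rpow_of_memLp hr0 (hGm j))).div_const _) fun x => ?_
      exact clarkson hr (G' i x) (G' j x)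
    have g1 := hG' i
    have g2 := hG' j
    have g3 : 1 / ((j : ℝ) + 1) ≤ 1 / ((i : ℝ) + 1) := by
      have : (i : ℝ) ≤ j := by exact_mod_cast hij
      gcongr
    linarith
  -- the sequence is Cauchy in `L^r`
  set g : ℕ → Lp F (ENNReal.ofReal r) μ := fun j => (hGm j).toLp (G' j) with hg
  have hnorm : ∀ i j, ‖g i - g j‖ =
      2 * (∫ x, ‖((1 / 2 : ℝ) • (G' i - G' j)) x‖ ^ r ∂μ) ^ (1 / r) := by
    intro i j
    have hI2 : MemLp ((1 / 2 : ℝ) • (G' i - G' j)) (ENNReal.ofReal r) μ :=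
      ((hGm i).sub (hGm j)).const_smul _
    have e1 : g i - g j = (((hGm i).sub (hGm j)).toLp (G' i - G' j)) := (MemLp.toLp_sub _ _).symm
    have e2 := eLpNorm_eq_ofReal_integral hr0 hI2
    rw [eLpNorm_const_smul, Real.enorm_eq_ofReal (by norm_num)] at e2
    have e3 := congrArg ENNReal.toReal e2
    rw [ENNReal.toReal_mul, ENNReal.toReal_ofReal (by norm_num), ENNReal.toReal_ofReal
      (Real.rpow_nonneg (integral_nonneg fun x => by positivity) _)] at e3
    rw [e1, Lp.norm_toLp, ← e3]
    ring
  have hcauchy : CauchySeq g := by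
    refine Metric.cauchySeq_iff'.2 fun ε hε => ?_
    have hpos : 0 < (ε / 2) ^ r := Real.rpow_pos_of_pos (half_pos hε) r
    have hl : Tendsto (fun i : ℕ => ((⨆ j, m j) - m i) / 2 + 1 / ((i : ℝ) + 1)) atTop (𝓝 0) := by
      have := ((tendsto_const_nhds (x := ⨆ j, m j)).sub hmlim).div_const 2 |>.add
        tendsto_one_div_add_atTop_nhds_zero_nat
      simpa using this
    obtain ⟨i, hi⟩ := (hl.eventually (gt_mem_nhds hpos)).exists
    refine ⟨i, fun j hj => ?_⟩
    rw [dist_comm, dist_eq_norm, hnorm]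
    have h1 := hdiff i j hj
    have h2 : m j ≤ ⨆ j, m j := le_ciSup ⟨M, by rintro _ ⟨j, rfl⟩; exact hmM j⟩ j
    have h0 : 0 ≤ ∫ x, ‖((1 / 2 : ℝ) • (G' i - G' j)) x‖ ^ r ∂μ :=
      integral_nonneg fun x => by positivity
    have h3 : (∫ x, ‖((1 / 2 : ℝ) • (G' i - G' j)) x‖ ^ r ∂μ) ^ (1 / r) < ε / 2 := by
      calc _ < ((ε / 2) ^ r) ^ (1 / r) :=
            Real.rpow_lt_rpow h0 (by linarith) (by positivity)
        _ = ε / 2 := by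
            rw [← Real.rpow_mul (by positivity), mul_one_div_cancel hr0.ne', Real.rpow_one]
    linarith
  obtain ⟨H, hH⟩ := cauchySeq_tendsto_of_complete hcauchy
  have hHm : MemLp (H : X → F) (ENNReal.ofReal r) μ := Lp.memLp H
  refine ⟨H, hHm, ?_, w', G', hP', ?_, ?_⟩
  · have e1 : ∫ x, ‖H x‖ ^ r ∂μ = ‖H‖ ^ r := by
      rw [integral_norm_rpow_eq hr0 hHm, Lp.norm_def]
    have e2 : ∀ j, En (G' j) = ‖g j‖ ^ r := fun j => by
      simp only [hEn, hg]
      rw [integral_norm_rpow_eq hr0 (hGm j), Lp.norm_toLp]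
    rw [e1]
    have l1 : Tendsto (fun j => ‖g j‖ ^ r) atTop (𝓝 (‖H‖ ^ r)) :=
      hH.norm.rpow_const (Or.inr hr0.le)
    have l2 : Tendsto (fun j : ℕ => M + 1 / ((j : ℝ) + 1)) atTop (𝓝 M) := by
      simpa using (tendsto_const_nhds (x := M)).add tendsto_one_div_add_atTop_nhds_zero_nat
    refine le_of_tendsto_of_tendsto' l1 l2 fun j => ?_
    rw [← e2]
    linarith [hG' j, hmM j]
  · refine tendsto_of_tendsto_of_tendsto_of_le_of_le tendsto_const_nhds ?_ (fun _ => zero_le) hw'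
    have := ENNReal.tendsto_ofReal (tendsto_one_div_add_atTop_nhds_zero_nat (𝕜 := ℝ))
    simpa [hc] using this
  · have l1 := (Lp.tendsto_Lp_iff_tendsto_eLpNorm' g H).1 hH
    refine l1.congr fun j => ?_
    have : ⇑(g j) - ⇑H =ᵐ[μ] G' j - ⇑H := by
      filter_upwards [(hGm j).coeFn_toLp] with x hx
      simp only [Pi.sub_apply]
      rw [hx]
    rw [eLpNorm_congr_ae this, eLpNorm_sub_comm]

end Closure

/-- Weak gradients are closed under strong limits. -/
lemma sobolevPair_of_tendsto {r : ℝ≥0∞} (hb : Bornology.IsBounded Ω)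
    (hr : 1 ≤ r) {u : Euc N → ℝ} {G : Euc N → Euc N} (hu : MemLp u r (volume.restrict Ω))
    (hG : MemLp G r (volume.restrict Ω)) {w : ℕ → Euc N → ℝ} {H : ℕ → Euc N → Euc N}
    (h : ∀ k, SobolevPair Ω r (w k) (H k))
    (h1 : Tendsto (fun k => eLpNorm (u - w k) r (volume.restrict Ω)) atTop (𝓝 0))
    (h2 : Tendsto (fun k => eLpNorm (G - H k) r (volume.restrict Ω)) atTop (𝓝 0)) :
    SobolevPair Ω r u G := by
  have := isFiniteMeasure_restrict hb
  refine ⟨hu, hG, fun φ hφ => ?_⟩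
  have toL1 : ∀ {F : Type} [NormedAddCommGroup F] {f : Euc N → F} {g : ℕ → Euc N → F},
      MemLp f r (volume.restrict Ω) → (∀ k, MemLp (g k) r (volume.restrict Ω)) →
      Tendsto (fun k => eLpNorm (f - g k) r (volume.restrict Ω)) atTop (𝓝 0) →
      Tendsto (fun k => eLpNorm (f - g k) 1 (volume.restrict Ω)) atTop (𝓝 0) := by
    intro F _ f g hf hg hl
    set K := volume.restrict Ω univ ^ (1 / (1 : ℝ≥0∞).toReal - 1 / r.toReal) with hK
    have hKt : K ≠ ⊤ := by
      refine ENNReal.rpow_ne_top_of_nonneg ?_ (measure_ne_top _ _)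
      simp only [ENNReal.toReal_one, div_one, sub_nonneg]
      rcases eq_or_ne r ⊤ with h | h
      · simp [h]
      · have : 1 ≤ r.toReal := by
          rw [← ENNReal.toReal_one]; exact ENNReal.toReal_mono h hr
        exact (div_le_one (by linarith)).2 this
    have := ENNReal.Tendsto.mul_const (b := K) hl (Or.inr hKt)
    rw [zero_mul] at this
    exact tendsto_of_tendsto_of_tendsto_of_le_of_le tendsto_const_nhds this (fun _ => zero_le)
      fun k => eLpNorm_le_eLpNorm_mul_rpow_measure_univ hr (hf.sub (hg k)).1
  have hd := continuous_gradient (hφ.1.of_le (by simp))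
  have hd' := bounded_of_compactSupport hd (hasCompactSupport_gradient hφ.2.1)
  have hc := bounded_of_compactSupport hφ.continuous hφ.2.1
  have l1 : Tendsto (fun k => ∫ x in Ω, w k x • ∇ φ x) atTop (𝓝 (∫ x in Ω, u x • ∇ φ x)) := by
    refine tendsto_integral_of_L1' _ (integrableOn_smul_of_bounded' (hu.integrable hr) hd hd').1
      (Eventually.of_forall fun k =>
        integrableOn_smul_of_bounded' ((h k).integrable hb hr) hd hd') ?_
    obtain ⟨C, hC⟩ := hd'
    have hb1 := ENNReal.Tendsto.const_mul (a := ENNReal.ofReal C) (toL1 hu (fun k => (h k).memLp) h1)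
      (Or.inr ENNReal.ofReal_ne_top)
    rw [mul_zero] at hb1
    refine tendsto_of_tendsto_of_tendsto_of_le_of_le tendsto_const_nhds hb1 (fun _ => zero_le)
      fun k => ?_
    refine eLpNorm_le_mul_eLpNorm_of_ae_le_mul (Eventually.of_forall fun x => ?_) 1
    simp only [Pi.sub_apply]
    rw [← sub_smul, norm_smul, mul_comm, norm_sub_rev]
    exact mul_le_mul_of_nonneg_right (hC x) (norm_nonneg _)
  have l2 : Tendsto (fun k => ∫ x in Ω, φ x • H k x) atTop (𝓝 (∫ x in Ω, φ x • G x)) := by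
    refine tendsto_integral_of_L1' _
      (integrableOn_smul_of_bounded (hG.integrable hr) hφ.continuous hc).1
      (Eventually.of_forall fun k =>
        integrableOn_smul_of_bounded ((h k).integrable_grad hb hr) hφ.continuous hc) ?_
    obtain ⟨C, hC⟩ := hc
    have hb1 := ENNReal.Tendsto.const_mul (a := ENNReal.ofReal C)
      (toL1 hG (fun k => (h k).memLp_grad) h2) (Or.inr ENNReal.ofReal_ne_top)
    rw [mul_zero] at hb1
    refine tendsto_of_tendsto_of_tendsto_of_le_of_le tendsto_const_nhds hb1 (fun _ => zero_le)
      fun k => ?_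
    refine eLpNorm_le_mul_eLpNorm_of_ae_le_mul (Eventually.of_forall fun x => ?_) 1
    simp only [Pi.sub_apply]
    rw [← smul_sub, norm_smul, norm_sub_rev]
    exact mul_le_mul_of_nonneg_right (hC x) (norm_nonneg _)
  exact tendsto_nhds_unique (l1.congr fun k => (h k).ibp φ hφ) l2.neg

/-- Lower semicontinuity of the energy. -/
lemma sobolevPair_limit {r : ℝ} (hr : 2 ≤ r) (hb : Bornology.IsBounded Ω)
    {u : Euc N → ℝ} (hu : MemLp u (ENNReal.ofReal r) (volume.restrict Ω))
    {w : ℕ → Euc N → ℝ} {G : ℕ → Euc N → Euc N}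
    (h : ∀ k, SobolevPair Ω (ENNReal.ofReal r) (w k) (G k))
    (hlim : Tendsto (fun k => eLpNorm (u - w k) (ENNReal.ofReal r) (volume.restrict Ω)) atTop (𝓝 0))
    {M : ℝ} (hM : ∀ k, ∫ x in Ω, ‖G k x‖ ^ r ≤ M) :
    ∃ H, SobolevPair Ω (ENNReal.ofReal r) u H ∧ ∫ x in Ω, ‖H x‖ ^ r ≤ M := by
  have hr1 : 1 ≤ ENNReal.ofReal r := by rw [ENNReal.one_le_ofReal]; linarith
  obtain ⟨H, hH, hHM, w', G', hP, l1, l2⟩ := exists_strong_limit hr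
    (SobolevPair Ω (ENNReal.ofReal r)) (fun w G h => ⟨h.memLp, h.memLp_grad⟩)
    (fun w G w' G' h h' => (h.add h' hb hr1).const_smul _) hu h hlim hM
  exact ⟨H, sobolevPair_of_tendsto hb hr1 hu hH hP l1 l2, hHM⟩

end

section

variable {N : ℕ} {Ω : Set (Euc N)}

/-! ### Convergence of mollifications in `L¹` and the chain rule -/

lemma integrable_moll_integrand {F : Type*} [NormedAddCommGroup F] [NormedSpace ℝ F] (k : ℕ)
    {g : Euc N → F} (hg : LocallyIntegrable g) (x : Euc N) :
    Integrable fun y => (mollBump N k).normed volume (x - y) • g y := by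
  have h := (mollBump N k).hasCompactSupport_normed (μ := volume) |>.convolutionExists_left
    (ContinuousLinearMap.lsmul ℝ ℝ) ((mollBump N k).contDiff_normed (n := 0)).continuous hg x
  exact h.integrable_swap

lemma moll_sub {F : Type*} [NormedAddCommGroup F] [NormedSpace ℝ F] (k : ℕ)
    {g h : Euc N → F} (hg : LocallyIntegrable g) (hh : LocallyIntegrable h) (x : Euc N) :
    moll k (g - h) x = moll k g x - moll k h x := by
  simp only [moll_apply, Pi.sub_apply, smul_sub]
  exact integral_sub (integrable_moll_integrand k hg x) (integrable_moll_integrand k hh x)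

lemma lintegral_enorm_moll_sub_le_of_continuous {F : Type*} [NormedAddCommGroup F]
    [NormedSpace ℝ F] [CompleteSpace F] {W : Euc N → F} (hW : Continuous W)
    (hc : HasCompactSupport W) {ε : ℝ≥0∞} (hε : 0 < ε) :
    ∀ᶠ k in atTop, ∫⁻ x, ‖moll k W x - W x‖ₑ ≤ ε := by
  -- No mollification radius exceeds `1`, so `W` and all its mollifications vanish off this compact
  -- set.
  set K := Metric.cthickening 1 (tsupport W) with hK
  have hKc : IsCompact K := IsCompact.cthickening hc
  obtain ⟨δ, hδ, hδε⟩ : ∃ δ : ℝ, 0 < δ ∧ ENNReal.ofReal δ * volume K ≤ ε := by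
    rcases eq_or_ne ε ⊤ with h | h
    · exact ⟨1, one_pos, by simp [h]⟩
    · obtain ⟨v, hv0, hv⟩ : ∃ v : ℝ, 0 ≤ v ∧ volume K = ENNReal.ofReal v :=
        ⟨_, ENNReal.toReal_nonneg, (ENNReal.ofReal_toReal hKc.measure_lt_top.ne).symm⟩
      obtain ⟨d, hd0, hd⟩ : ∃ d : ℝ, 0 < d ∧ ε = ENNReal.ofReal d :=
        ⟨_, ENNReal.toReal_pos hε.ne' h, (ENNReal.ofReal_toReal h).symm⟩
      refine ⟨d / (v + 1), by positivity, ?_⟩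
      rw [hv, hd, ← ENNReal.ofReal_mul (by positivity)]
      refine ENNReal.ofReal_le_ofReal ?_
      rw [div_mul_eq_mul_div, div_le_iff₀ (by positivity)]
      gcongr
      linarith
  filter_upwards [moll_uniform (hc.uniformContinuous_of_continuous hW) hδ] with k hk
  calc ∫⁻ x, ‖moll k W x - W x‖ₑ ≤ ∫⁻ x, K.indicator (fun _ => ENNReal.ofReal δ) x := by
        refine lintegral_mono fun x => ?_
        by_cases hx : x ∈ K
        · rw [indicator_of_mem hx, ← ofReal_norm]
          refine ENNReal.ofReal_le_ofReal ?_
          rw [← dist_eq_norm]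
          exact hk x
        · have h1 : W x = 0 := by
            by_contra h0
            exact hx (Metric.self_subset_cthickening _ (subset_tsupport _ h0))
          have h2 : moll k W x = 0 := by
            refine moll_eq_zero k fun y hy => ?_
            by_contra h0
            refine hx (Metric.mem_cthickening_of_dist_le x y _ _ (subset_tsupport _ h0) ?_)
            rw [dist_comm]
            refine hy.le.trans ?_
            rw [div_le_one (by positivity)]
            linarith [(Nat.cast_nonneg k : (0 : ℝ) ≤ k)]
          simp [h1, h2]
    _ = ENNReal.ofReal δ * volume K := by
        rw [lintegral_indicator hKc.measurableSet, lintegral_const, Measure.restrict_apply_univ]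
    _ ≤ ε := hδε

/-- Density of continuous compactly supported functions, combined with the fact that mollification
is a contraction in `L¹`. -/
lemma tendsto_lintegral_enorm_moll_sub {F : Type*} [NormedAddCommGroup F] [NormedSpace ℝ F]
    [MeasurableSpace F] [BorelSpace F] [SecondCountableTopology F] [CompleteSpace F]
    {g : Euc N → F} (hg : Integrable g) :
    Tendsto (fun k => ∫⁻ x, ‖moll k g x - g x‖ₑ) atTop (𝓝 0) := by
  rw [ENNReal.tendsto_nhds_zero]
  intro ε hε
  have hε3 : ε / 3 ≠ 0 := (ENNReal.div_pos hε.ne' (by simp)).ne'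
  obtain ⟨W, hWc, hWle, hWcont, hWint⟩ := hg.exists_hasCompactSupport_lintegral_sub_le hε3
  filter_upwards [lintegral_enorm_moll_sub_le_of_continuous hWcont hWc
    (pos_iff_ne_zero.2 hε3)] with k hk
  have hsub : Integrable (g - W) := hg.sub hWint
  have h1 : ∫⁻ x, ‖moll k (g - W) x‖ₑ ≤ ε / 3 := by
    have := lintegral_enorm_moll_rpow_le k hsub.aestronglyMeasurable le_rfl
    simp only [ENNReal.rpow_one, Pi.sub_apply] at this
    exact this.trans hWle
  have hm1 : Measurable fun x => ‖moll k (g - W) x‖ₑ :=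
    (contDiff_moll k hsub.locallyIntegrable).continuous.measurable.enorm
  have hm2 : Measurable fun x => ‖moll k W x - W x‖ₑ :=
    ((contDiff_moll k hWint.locallyIntegrable).continuous.sub hWcont).measurable.enorm
  calc ∫⁻ x, ‖moll k g x - g x‖ₑ
      ≤ ∫⁻ x, (‖moll k (g - W) x‖ₑ + (‖moll k W x - W x‖ₑ + ‖g x - W x‖ₑ)) := by
        refine lintegral_mono fun x => ?_
        have e1 : moll k g x - g x = moll k (g - W) x + ((moll k W x - W x) + -(g x - W x)) := by
          rw [moll_sub k hg.locallyIntegrable hWint.locallyIntegrable]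
          abel
        rw [e1]
        refine (enorm_add_le _ _).trans (add_le_add le_rfl ((enorm_add_le _ _).trans ?_))
        rw [enorm_neg]
    _ = (∫⁻ x, ‖moll k (g - W) x‖ₑ) + ((∫⁻ x, ‖moll k W x - W x‖ₑ) + ∫⁻ x, ‖g x - W x‖ₑ) := by
        rw [lintegral_add_left hm1, lintegral_add_left hm2]
    _ ≤ ε / 3 + (ε / 3 + ε / 3) := by gcongr
    _ = ε := by rw [← add_assoc, ENNReal.add_thirds]

lemma tendsto_eLpNorm_one_moll_sub {F : Type*} [NormedAddCommGroup F] [NormedSpace ℝ F]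
    [MeasurableSpace F] [BorelSpace F] [SecondCountableTopology F] [CompleteSpace F]
    (ho : IsOpen Ω) {g : Euc N → F} (hg : IntegrableOn g Ω) :
    Tendsto (fun k => ∫⁻ x in Ω, ‖moll k (Ω.indicator g) x - g x‖ₑ) atTop (𝓝 0) := by
  refine tendsto_of_tendsto_of_tendsto_of_le_of_le tendsto_const_nhds
    (tendsto_lintegral_enorm_moll_sub (integrable_indicator_of_integrableOn ho hg))
    (fun _ => zero_le) fun k => ?_
  calc ∫⁻ x in Ω, ‖moll k (Ω.indicator g) x - g x‖ₑ
      = ∫⁻ x in Ω, ‖moll k (Ω.indicator g) x - Ω.indicator g x‖ₑ :=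
        setLIntegral_congr_fun ho.measurableSet fun x hx => by simp [hx]
    _ ≤ _ := setLIntegral_le_lintegral _ _

/-- Chain rule for `C¹` functions with bounded derivative. -/
lemma SobolevPair.comp {r : ℝ≥0∞} {u G} (h : SobolevPair Ω r u G) (ho : IsOpen Ω)
    (hb : Bornology.IsBounded Ω) (hr : 1 ≤ r) {f : ℝ → ℝ} (hf : ContDiff ℝ 1 f) {L : ℝ}
    (hL : ∀ t, |deriv f t| ≤ L) :
    SobolevPair Ω r (fun x => f (u x)) (fun x => deriv f (u x) • G x) := by
  have hfin := isFiniteMeasure_restrict hb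
  have hL0 : 0 ≤ L := (abs_nonneg _).trans (hL 0)
  have hf' : Continuous (deriv f) := hf.continuous_deriv le_rfl
  have hfd : Differentiable ℝ f := hf.differentiable one_ne_zero
  have hlip : ∀ s t, |f s - f t| ≤ L * |s - t| := fun s t => by
    exact Convex.norm_image_sub_le_of_norm_deriv_le (f := f) (C := L) (s := univ) (x := t) (y := s)
      (fun x _ => hfd x) (fun x _ => hL x) convex_univ (mem_univ _) (mem_univ _)
  have hm1 : MemLp (fun x => f (u x)) r (volume.restrict Ω) := by
    have h0 : MemLp (fun x => L * |u x|) r (volume.restrict Ω) := h.memLp.norm.const_mul L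
    have h1 : MemLp (fun x => |f 0| + L * |u x|) r (volume.restrict Ω) :=
      (memLp_const |f 0|).add h0
    refine h1.of_le (hf.continuous.comp_aestronglyMeasurable h.memLp.1)
      (Eventually.of_forall fun x => ?_)
    have := hlip (u x) 0
    rw [sub_zero] at this
    rw [Real.norm_eq_abs, Real.norm_of_nonneg (by positivity)]
    calc |f (u x)| = |f 0 + (f (u x) - f 0)| := by ring_nf
      _ ≤ |f 0| + |f (u x) - f 0| := abs_add_le _ _
      _ ≤ _ := by linarith
  have hdm : AEStronglyMeasurable (fun x => deriv f (u x)) (volume.restrict Ω) :=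
    hf'.comp_aestronglyMeasurable h.memLp.1
  have hm2 : MemLp (fun x => deriv f (u x) • G x) r (volume.restrict Ω) := by
    refine (h.memLp_grad.const_smul L).of_le (hdm.smul h.memLp_grad.1)
      (Eventually.of_forall fun x => ?_)
    simp only [Pi.smul_apply]
    rw [norm_smul, norm_smul, Real.norm_eq_abs, Real.norm_of_nonneg hL0]
    exact mul_le_mul_of_nonneg_right (hL _) (norm_nonneg _)
  refine ⟨hm1, hm2, fun φ hφ => ?_⟩
  have hφ1 : ContDiff ℝ 1 φ := hφ.1.of_le (by simp)
  have hu := h.integrable hb hr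
  have hG := h.integrable_grad hb hr
  have hU := integrable_indicator_of_integrableOn ho hu
  rw [ibp_iff_forall_direction (hm1.integrable hr) (hm2.integrable hr) hφ1 hφ.2.1]
  intro e
  set U : ℕ → Euc N → ℝ := fun k => moll k (Ω.indicator u) with hUdef
  set V : ℕ → Euc N → Euc N := fun k => moll k (Ω.indicator G) with hVdef
  have hUs : ∀ k, ContDiff ℝ 1 (U k) := fun k =>
    (contDiff_moll k hU.locallyIntegrable).of_le (by simp)
  have hVc : ∀ k, Continuous (V k) := fun k => (contDiff_moll k
    (integrable_indicator_of_integrableOn ho hG).locallyIntegrable).continuous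
  have c1 : Continuous fun x => fderiv ℝ φ x e :=
    (hφ1.continuous_fderiv one_ne_zero).clm_apply continuous_const
  have s1 : HasCompactSupport fun x => fderiv ℝ φ x e :=
    (hφ.2.1.fderiv (𝕜 := ℝ)).comp_left (g := fun L : Euc N →L[ℝ] ℝ => L e) rfl
  obtain ⟨C1, hC1⟩ := bounded_of_compactSupport c1 s1
  obtain ⟨C2, hC2⟩ := bounded_of_compactSupport hφ.continuous hφ.2.1
  -- the identity for the mollified functions
  have key : ∀ᶠ k in atTop, ∫ x in Ω, f (U k x) * fderiv ℝ φ x e =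
      - ∫ x in Ω, φ x * (deriv f (U k x) * inner ℝ (V k x) e) := by
    obtain ⟨δ, hδ, hsub⟩ := IsCompact.exists_cthickening_subset_open hφ.2.1 ho hφ.2.2
    filter_upwards [(tendsto_mollBump_rOut (N := N)).eventually (gt_mem_nhds hδ)] with k hk
    have hcomp : ContDiff ℝ 1 (fun x => f (U k x)) := hf.comp (hUs k)
    have hp := sobolevPair_of_contDiff ho hb hcomp r
    rw [(ibp_iff_forall_direction (hp.integrable hb hr) (hp.integrable_grad hb hr) hφ1
      hφ.2.1).1 (hp.ibp φ hφ) e]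
    congr 1
    refine integral_congr_ae (Eventually.of_forall fun x => ?_)
    by_cases hx : x ∈ tsupport φ
    · have e1 : ∇ (U k) x = V k x := h.gradient_moll ho hb hr k
        (((Metric.closedBall_subset_closedBall hk.le).trans
          (Metric.closedBall_subset_cthickening hx δ)).trans hsub)
      have e2 : fderiv ℝ (fun x => f (U k x)) x = deriv f (U k x) • fderiv ℝ (U k) x :=
        ((hfd (U k x)).hasDerivAt.comp_hasFDerivAt x
          ((hUs k).differentiable one_ne_zero x).hasFDerivAt).fderiv
      simp only [inner_gradient_left]
      rw [e2, ← e1, inner_gradient_left]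
      simp
    · simp [image_eq_zero_of_notMem_tsupport hx]
  have lim1 : Tendsto (fun k => ∫ x in Ω, f (U k x) * fderiv ℝ φ x e) atTop
      (𝓝 (∫ x in Ω, f (u x) * fderiv ℝ φ x e)) := by
    refine tendsto_integral_of_L1 _
      (integrableOn_mul_of_bounded (hm1.integrable hr) c1 ⟨C1, hC1⟩).1
      (Eventually.of_forall fun k => ?_) ?_
    · exact integrableOn_of_continuousOn ho hb
        ((hf.continuous.comp (hUs k).continuous).mul c1).continuousOn
    · have hl := ENNReal.Tendsto.const_mul (a := ENNReal.ofReal (C1 * L))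
        (tendsto_eLpNorm_one_moll_sub ho hu) (Or.inr ENNReal.ofReal_ne_top)
      rw [mul_zero] at hl
      refine tendsto_of_tendsto_of_tendsto_of_le_of_le tendsto_const_nhds hl (fun _ => zero_le)
        fun k => ?_
      simp only []
      rw [← lintegral_const_mul' _ _ ENNReal.ofReal_ne_top]
      refine lintegral_mono fun x => ?_
      have hC10 : 0 ≤ C1 := (norm_nonneg _).trans (hC1 x)
      rw [← ofReal_norm, ← ofReal_norm, ← ENNReal.ofReal_mul (by positivity)]
      refine ENNReal.ofReal_le_ofReal ?_
      rw [← sub_mul, norm_mul, mul_comm, mul_assoc]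
      exact mul_le_mul (hC1 x) (hlip _ _) (norm_nonneg _) hC10
  have hGe : IntegrableOn (fun x => inner ℝ (G x) e) Ω := hG.inner_const e
  have lim2 : Tendsto (fun k => ∫ x in Ω, φ x * (deriv f (U k x) * inner ℝ (V k x) e)) atTop
      (𝓝 (∫ x in Ω, φ x * inner ℝ (deriv f (u x) • G x) e)) := by
    have hC20 : 0 ≤ C2 := (norm_nonneg _).trans (hC2 0)
    -- The nonlinear factor converges only almost everywhere, so it is first paired with the fixed
    -- gradient `G`; the remainder `V k - G` tends to zero in `L¹` and `deriv f` is bounded.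
    have la : Tendsto (fun k => ∫ x in Ω, φ x * (deriv f (U k x) * inner ℝ (G x) e)) atTop
        (𝓝 (∫ x in Ω, φ x * inner ℝ (deriv f (u x) • G x) e)) := by
      refine tendsto_integral_of_dominated_convergence (fun x => C2 * (L * ‖inner ℝ (G x) e‖))
        (fun k => ?_) ((hGe.norm.const_mul L).const_mul C2) (fun k => ?_) ?_
      · exact hφ.continuous.aestronglyMeasurable.mul
          ((hf'.comp (hUs k).continuous).aestronglyMeasurable.mul hGe.1)
      · refine Eventually.of_forall fun x => ?_
        rw [norm_mul, norm_mul]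
        exact mul_le_mul (hC2 x) (mul_le_mul_of_nonneg_right (hL _) (norm_nonneg _))
          (by positivity) hC20
      · filter_upwards [ae_restrict_mem ho.measurableSet,
          ae_restrict_of_ae (ae_tendsto_moll hU.locallyIntegrable)] with x hx hx'
        rw [indicator_of_mem hx] at hx'
        simp only [inner_smul_left, conj_trivial]
        exact (((hf'.tendsto _).comp hx').mul_const _).const_mul _
    have lb : Tendsto (fun k => ∫ x in Ω, φ x * (deriv f (U k x) * inner ℝ (V k x - G x) e))
        atTop (𝓝 0) := by
      have hl := ENNReal.Tendsto.const_mul (a := ENNReal.ofReal (C2 * (L * ‖e‖)))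
        (tendsto_eLpNorm_one_moll_sub ho hG) (Or.inr ENNReal.ofReal_ne_top)
      rw [mul_zero] at hl
      have hl' := (ENNReal.tendsto_toReal ENNReal.zero_ne_top).comp hl
      refine squeeze_zero_norm' ?_ hl'
      filter_upwards [hl.eventually (gt_mem_nhds (zero_lt_one (α := ℝ≥0∞)))] with k hk
      simp only [Function.comp_apply]
      rw [← ENNReal.ofReal_le_iff_le_toReal (hk.trans ENNReal.one_lt_top).ne, ofReal_norm]
      refine (enorm_integral_le_lintegral_enorm _).trans ?_
      rw [← lintegral_const_mul' _ _ ENNReal.ofReal_ne_top]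
      refine lintegral_mono fun x => ?_
      rw [← ofReal_norm, ← ofReal_norm, ← ENNReal.ofReal_mul (by positivity)]
      refine ENNReal.ofReal_le_ofReal ?_
      rw [norm_mul, norm_mul, mul_assoc, mul_assoc]
      refine mul_le_mul (hC2 x) (mul_le_mul (hL _) ?_ (norm_nonneg _) hL0) (by positivity) hC20
      rw [mul_comm]
      exact abs_real_inner_le_norm _ _
    have := la.add lb
    rw [add_zero] at this
    refine this.congr fun k => ?_
    rw [← integral_add]
    · congr 1; ext x
      rw [inner_sub_left]
      ring
    · have hcd : Continuous fun x => φ x * deriv f (U k x) :=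
        hφ.continuous.mul (hf'.comp (hUs k).continuous)
      refine (integrableOn_mul_of_bounded hGe hcd (bounded_of_compactSupport hcd
        hφ.2.1.mul_right)).congr (Eventually.of_forall fun x => ?_)
      simp only []
      ring
    · have hcd : Continuous fun x => φ x * deriv f (U k x) :=
        hφ.continuous.mul (hf'.comp (hUs k).continuous)
      have hVe : IntegrableOn (fun x => inner ℝ (V k x - G x) e) Ω :=
        ((integrableOn_of_continuousOn ho hb (hVc k).continuousOn).sub hG).inner_const e
      refine (integrableOn_mul_of_bounded hVe hcd (bounded_of_compactSupport hcd
        hφ.2.1.mul_right)).congr (Eventually.of_forall fun x => ?_)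
      simp only []
      ring
  refine tendsto_nhds_unique (lim1.congr' ?_) lim2.neg
  filter_upwards [key] with k hk
  exact hk

end

section

variable {N : ℕ} {Ω : Set (Euc N)}

/-! ### Functions that vanish on the boundary -/

/-- Smooth truncations near the origin with uniformly bounded slope. -/
lemma exists_smooth_truncation : ∃ L : ℝ, ∀ δ > 0, ∃ f : ℝ → ℝ, ContDiff ℝ ∞ f ∧
    (∀ t, |deriv f t| ≤ L) ∧ (∀ t, |t| ≤ δ → f t = 0) ∧ ∀ t, |f t - t| ≤ 2 * δ := by
  -- This profile vanishes for `|s| ≤ 1` and is the identity for `|s| ≥ 2`; rescaling by `δ` moves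
  -- the thresholds but keeps the slope bound.
  set g : ℝ → ℝ := fun s => s * Real.smoothTransition (s ^ 2 - 1) with hg
  have hgs : ContDiff ℝ ∞ g :=
    contDiff_id.mul (Real.smoothTransition.contDiff.comp ((contDiff_id.pow 2).sub contDiff_const))
  have hid : ∀ s, 2 ≤ |s| → g s = s := fun s hs => by
    have : 1 ≤ s ^ 2 - 1 := by
      have := sq_le_sq' (by linarith) hs
      rw [sq_abs] at this
      linarith
    simp [hg, Real.smoothTransition.one_of_one_le this]
  have hzero : ∀ s, |s| ≤ 1 → g s = 0 := fun s hs => by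
    have : s ^ 2 - 1 ≤ 0 := by
      have := sq_le_sq' (by linarith [abs_nonneg s]) hs
      rw [sq_abs] at this
      linarith
    simp [hg, Real.smoothTransition.zero_of_nonpos this]
  have hnear : ∀ s, |g s - s| ≤ 2 := fun s => by
    rcases le_total 2 |s| with h | h
    · simp [hid s h]
    · have h1 := Real.smoothTransition.nonneg (s ^ 2 - 1)
      have h2 := Real.smoothTransition.le_one (s ^ 2 - 1)
      have : g s - s = -(s * (1 - Real.smoothTransition (s ^ 2 - 1))) := by simp only [hg]; ring
      rw [this, abs_neg, abs_mul, abs_of_nonneg (sub_nonneg.2 h2)]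
      nlinarith [abs_nonneg s]
  have hgc : Continuous (deriv g) := hgs.continuous_deriv (by simp)
  obtain ⟨L, hL⟩ := (isCompact_Icc (a := (-2 : ℝ)) (b := 2)).exists_bound_of_continuousOn
    hgc.continuousOn
  have hgb : ∀ s, |deriv g s| ≤ max L 1 := fun s => by
    rcases le_or_gt |s| 2 with h | h
    · exact (hL s (abs_le.1 h)).trans (le_max_left _ _)
    · have : g =ᶠ[𝓝 s] id := by
        filter_upwards [(continuous_abs.tendsto s).eventually (lt_mem_nhds h)] with t ht
        exact hid t ht.le
      rw [this.deriv_eq, deriv_id, abs_one]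
      exact le_max_right _ _
  refine ⟨max L 1, fun δ hδ => ⟨fun t => δ * g (δ⁻¹ * t), ?_, fun t => ?_, fun t ht => ?_,
    fun t => ?_⟩⟩
  · exact contDiff_const.mul (hgs.comp (contDiff_const.mul contDiff_id))
  · have : HasDerivAt (fun t => δ * g (δ⁻¹ * t)) (δ * (deriv g (δ⁻¹ * t) * δ⁻¹)) t := by
      refine HasDerivAt.const_mul δ ?_
      have h1 : HasDerivAt (fun t => δ⁻¹ * t) δ⁻¹ t := by
        simpa using (hasDerivAt_id t).const_mul δ⁻¹
      exact (hgs.differentiable (by simp) (δ⁻¹ * t)).hasDerivAt.comp t h1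
    rw [this.deriv]
    have e : δ * (deriv g (δ⁻¹ * t) * δ⁻¹) = deriv g (δ⁻¹ * t) := by field_simp
    rw [e]
    exact hgb _
  · have : |δ⁻¹ * t| ≤ 1 := by
      rw [abs_mul, abs_of_pos (inv_pos.2 hδ), inv_mul_le_one₀ hδ]
      exact ht
    simp [hzero _ this]
  · have e : δ * g (δ⁻¹ * t) - t = δ * (g (δ⁻¹ * t) - δ⁻¹ * t) := by field_simp
    simp only []
    rw [e, abs_mul, abs_of_pos hδ]
    nlinarith [hnear (δ⁻¹ * t)]

lemma eLpNorm_le_of_bound (ho : IsOpen Ω) {r : ℝ≥0∞} {f : Euc N → ℝ} {ε : ℝ}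
    (h : ∀ x ∈ Ω, |f x| ≤ ε) :
    eLpNorm f r (volume.restrict Ω) ≤ volume Ω ^ (r.toReal⁻¹) * ENNReal.ofReal ε := by
  have := eLpNorm_le_of_ae_bound (p := r) (μ := volume.restrict Ω) (f := f) (C := ε) (by
    filter_upwards [ae_restrict_mem ho.measurableSet] with x hx using h x hx)
  rwa [Measure.restrict_apply_univ] at this

lemma tendsto_eLpNorm_of_bound (ho : IsOpen Ω) (hb : Bornology.IsBounded Ω) {r : ℝ≥0∞}
    {u : Euc N → ℝ} {w : ℕ → Euc N → ℝ} {ε : ℕ → ℝ} (hε : Tendsto ε atTop (𝓝 0))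
    (h : ∀ k, ∀ x ∈ Ω, |u x - w k x| ≤ ε k) :
    Tendsto (fun k => eLpNorm (u - w k) r (volume.restrict Ω)) atTop (𝓝 0) := by
  have h1 := ENNReal.Tendsto.const_mul (a := volume Ω ^ (r.toReal⁻¹)) (ENNReal.tendsto_ofReal hε)
    (Or.inr (ENNReal.rpow_ne_top_of_nonneg (by positivity) hb.measure_lt_top.ne))
  rw [ENNReal.ofReal_zero, mul_zero] at h1
  exact tendsto_of_tendsto_of_tendsto_of_le_of_le tendsto_const_nhds h1 (fun _ => zero_le)
    fun k => eLpNorm_le_of_bound ho (h k)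

lemma integral_norm_rpow_le_of_lintegral_le {X Y F F' : Type*} [MeasurableSpace X]
    [MeasurableSpace Y] [NormedAddCommGroup F] [NormedAddCommGroup F'] {μ : Measure X}
    {ν : Measure Y} {f : X → F} {g : Y → F'} {r : ℝ} (hr : 0 < r) (hf : AEStronglyMeasurable f μ)
    (hg : MemLp g (ENNReal.ofReal r) ν)
    (h : ∫⁻ x, ‖f x‖ₑ ^ r ∂μ ≤ ∫⁻ y, ‖g y‖ₑ ^ r ∂ν) :
    ∫ x, ‖f x‖ ^ r ∂μ ≤ ∫ y, ‖g y‖ ^ r ∂ν := by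
  have e1 : ∀ x, ENNReal.ofReal (‖f x‖ ^ r) = ‖f x‖ₑ ^ r := fun x => by
    rw [← ENNReal.ofReal_rpow_of_nonneg (norm_nonneg _) hr.le, ofReal_norm]
  have e2 : ∀ y, ENNReal.ofReal (‖g y‖ ^ r) = ‖g y‖ₑ ^ r := fun y => by
    rw [← ENNReal.ofReal_rpow_of_nonneg (norm_nonneg _) hr.le, ofReal_norm]
  have hg' := integrable_norm_rpow_of_memLp hr hg
  rw [integral_eq_lintegral_of_nonneg_ae (Eventually.of_forall fun x => by positivity)
      (hf.norm.aemeasurable.pow_const r).aestronglyMeasurable,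
    integral_eq_lintegral_of_nonneg_ae (Eventually.of_forall fun x => by positivity) hg'.1]
  have hfin : ∫⁻ y, ENNReal.ofReal (‖g y‖ ^ r) ∂ν ≠ ⊤ := by
    have h2 := hg'.2
    rw [hasFiniteIntegral_iff_norm] at h2
    refine ne_of_lt (lt_of_le_of_lt (lintegral_mono fun y => ?_) h2)
    exact ENNReal.ofReal_le_ofReal (Real.le_norm_self _)
  refine ENNReal.toReal_mono hfin ?_
  simp_rw [e1, e2]
  exact h

/-- A Sobolev function that is continuous up to the boundary and vanishes there is a limit of
test functions. -/
lemma SobolevPair.memW10 (ho : IsOpen Ω) (hb : Bornology.IsBounded Ω) {r : ℝ} (hr : 2 ≤ r)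
    {w G} (h : SobolevPair Ω (ENNReal.ofReal r) w G) (hc : ContinuousOn w (closure Ω))
    (h0 : ∀ x ∈ frontier Ω, w x = 0) : MemW10 Ω (ENNReal.ofReal r) w := by
  have hr0 : 0 < r := by linarith
  have hr1 : 1 ≤ ENNReal.ofReal r := by rw [ENNReal.one_le_ofReal]; linarith
  obtain ⟨L, hL⟩ := exists_smooth_truncation
  have hL0 : 0 ≤ L := by
    obtain ⟨f, -, hf, -⟩ := hL 1 one_pos
    exact (abs_nonneg _).trans (hf 0)
  set M := L ^ r * ∫ x in Ω, ‖G x‖ ^ r with hMdef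
  -- Truncating small values leaves a function with compact support in `Ω`, because `w` is small
  -- near the boundary; a fine mollification is then a test function. The slope bound `L` does not
  -- depend on `δ`, so the energies stay bounded.
  have step : ∀ δ > 0, ∃ φ, IsTestFunction Ω φ ∧ (∀ x ∈ Ω, |w x - φ x| ≤ 3 * δ) ∧
      ∫ x in Ω, ‖∇ φ x‖ ^ r ≤ M := by
    intro δ hδ
    obtain ⟨f, hf, hfL, hf0, hfδ⟩ := hL δ hδ
    set g : Euc N → ℝ := Ω.indicator fun x => f (w x) with hg
    set K : Set (Euc N) := {x ∈ closure Ω | δ ≤ |w x|} with hK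
    have hKcl : IsClosed K := by
      have : K = closure Ω ∩ (fun x => |w x|) ⁻¹' Ici δ := rfl
      rw [this]
      exact hc.abs.preimage_isClosed_of_isClosed isClosed_closure isClosed_Ici
    have hKc : IsCompact K := hb.isCompact_closure.of_isClosed_subset hKcl fun x hx => hx.1
    have hKΩ : K ⊆ Ω := by
      intro x hx
      by_contra hxΩ
      have : w x = 0 := h0 x ⟨hx.1, by rwa [ho.interior_eq]⟩
      have h2 := hx.2
      rw [this, abs_zero] at h2
      linarith
    have hgK : ∀ x ∉ K, g x = 0 := by
      intro x hx
      by_cases hxΩ : x ∈ Ω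
      · have : |w x| ≤ δ := by
          by_contra hcon
          exact hx ⟨subset_closure hxΩ, (not_le.1 hcon).le⟩
        simp [hg, hxΩ, hf0 _ this]
      · simp [hg, hxΩ]
    have hgc : Continuous g := by
      rw [continuous_iff_continuousAt]
      intro x
      by_cases hxΩ : x ∈ Ω
      · have h1 : g =ᶠ[𝓝 x] fun x => f (w x) := by
          filter_upwards [ho.mem_nhds hxΩ] with y hy
          simp [hg, hy]
        refine ContinuousAt.congr ?_ h1.symm
        exact hf.continuous.continuousAt.comp
          ((hc.mono subset_closure).continuousAt (ho.mem_nhds hxΩ))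
      · have h1 : g =ᶠ[𝓝 x] fun _ => 0 := by
          filter_upwards [hKcl.isOpen_compl.mem_nhds (fun hxK => hxΩ (hKΩ hxK))] with y hy
          exact hgK y hy
        exact continuousAt_const.congr h1.symm
    have hgs : tsupport g ⊆ K := closure_minimal (fun x hx => by
      by_contra hxK; exact hx (hgK x hxK)) hKcl
    have hgcs : HasCompactSupport g := hKc.of_isClosed_subset (isClosed_tsupport _) hgs
    have hpair0 := h.comp ho hb hr1 (hf.of_le (by simp)) hfL
    have hpair : SobolevPair Ω (ENNReal.ofReal r) g (fun x => deriv f (w x) • G x) :=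
      hpair0.congr (by
        filter_upwards [ae_restrict_mem ho.measurableSet] with x hx
        simp [hg, hx]) EventuallyEq.rfl
    set H : Euc N → Euc N := fun x => deriv f (w x) • G x with hH
    have hind : Ω.indicator g = g := by
      ext x
      by_cases hx : x ∈ Ω <;> simp [hg, hx]
    obtain ⟨d, hd, hdsub⟩ := hKc.exists_cthickening_subset_open ho hKΩ
    obtain ⟨k, hk1, hk2, hk3⟩ := ((eventually_isTestFunction_moll ho hgc.locallyIntegrable hgcs
      (hgs.trans hKΩ)).and ((moll_uniform (hgcs.uniformContinuous_of_continuous hgc) hδ).and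
      ((tendsto_mollBump_rOut (N := N)).eventually (gt_mem_nhds (half_pos hd))))).exists
    refine ⟨moll k g, hk1, fun x hx => ?_, ?_⟩
    · have e1 := hk2 x
      rw [Real.dist_eq, abs_sub_comm] at e1
      have e2 : g x = f (w x) := by simp [hg, hx]
      have e3 := hfδ (w x)
      rw [abs_sub_comm] at e3
      rw [e2] at e1
      calc |w x - moll k g x| ≤ |w x - f (w x)| + |f (w x) - moll k g x| := _root_.abs_sub_le _ _ _
        _ ≤ 3 * δ := by linarith
    · have hgrad : ∀ x, ‖∇ (moll k g) x‖ₑ ≤ ‖moll k (Ω.indicator H) x‖ₑ := by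
        intro x
        by_cases hx : x ∈ Metric.cthickening (d / 2) K
        · have : Metric.closedBall x (1 / ((k : ℝ) + 1)) ⊆ Ω := by
            refine Subset.trans ?_ hdsub
            refine (Metric.closedBall_subset_closedBall hk3.le).trans ?_
            refine (Metric.closedBall_subset_cthickening hx (d / 2)).trans ?_
            refine (Metric.cthickening_cthickening_subset (half_pos hd).le (half_pos hd).le K).trans
              ?_
            rw [add_halves]
          have e := hpair.gradient_moll ho hb hr1 k this
          rw [hind] at e
          rw [e]
        · have hx' : x ∉ tsupport (moll k g) := fun hcon => hx
            ((Metric.cthickening_mono hk3.le K) ((Metric.cthickening_subset_of_subset _ hgs)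
              (tsupport_moll_subset k hcon)))
          have : ∇ (moll k g) x = 0 := by
            have hz : fderiv ℝ (moll k g) x = 0 :=
              image_eq_zero_of_notMem_tsupport fun hh => hx' (tsupport_fderiv_subset ℝ hh)
            rw [gradient, hz, map_zero]
          simp [this]
      have hHm : MemLp H (ENNReal.ofReal r) (volume.restrict Ω) := hpair.memLp_grad
      have hVi := integrable_indicator_of_integrableOn ho (hpair.integrable_grad hb hr1)
      have e1 : ∫ x in Ω, ‖∇ (moll k g) x‖ ^ r ≤ ∫ x in Ω, ‖H x‖ ^ r := by
        refine integral_norm_rpow_le_of_lintegral_le hr0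
          (continuous_gradient (hk1.1.of_le (by simp))).aestronglyMeasurable hHm ?_
        calc ∫⁻ x in Ω, ‖∇ (moll k g) x‖ₑ ^ r ≤ ∫⁻ x, ‖∇ (moll k g) x‖ₑ ^ r :=
              setLIntegral_le_lintegral _ _
          _ ≤ ∫⁻ x, ‖moll k (Ω.indicator H) x‖ₑ ^ r :=
              lintegral_mono fun x => ENNReal.rpow_le_rpow (hgrad x) hr0.le
          _ ≤ ∫⁻ x, ‖Ω.indicator H x‖ₑ ^ r :=
              lintegral_enorm_moll_rpow_le k hVi.aestronglyMeasurable (by linarith)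
          _ = ∫⁻ x in Ω, ‖H x‖ₑ ^ r := by
              rw [← lintegral_indicator ho.measurableSet]
              congr 1; ext z
              by_cases hz : z ∈ Ω
              · simp [hz]
              · simp [hz, hr0]
      refine e1.trans ?_
      rw [hMdef, ← integral_const_mul]
      refine integral_mono (integrable_norm_rpow_of_memLp hr0 hHm)
        ((integrable_norm_rpow_of_memLp hr0 h.memLp_grad).const_mul _) fun x => ?_
      simp only [hH]
      rw [norm_smul, Real.mul_rpow (norm_nonneg _) (norm_nonneg _)]
      gcongr
      exact hfL _
  choose φ hφ1 hφ2 hφ3 using fun j : ℕ => step (1 / ((j : ℝ) + 1)) (by positivity)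
  have hlim0 : Tendsto (fun j : ℕ => 3 * (1 / ((j : ℝ) + 1))) atTop (𝓝 0) := by
    simpa using (tendsto_one_div_add_atTop_nhds_zero_nat (𝕜 := ℝ)).const_mul 3
  -- So far the approximation is uniform with bounded energies only. Test functions with their
  -- gradients form a class closed under midpoints, so other members of it converge together with
  -- their gradients.
  obtain ⟨H, hH, -, w', G', hP, l1, l2⟩ := exists_strong_limit (μ := volume.restrict Ω) hr
    (fun φ H => IsTestFunction Ω φ ∧ H = ∇ φ)
    (fun φ H hφ => by
      have := sobolevPair_of_contDiff ho hb (hφ.1.1.of_le (by simp)) (ENNReal.ofReal r)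
      rw [hφ.2]
      exact ⟨this.memLp, this.memLp_grad⟩)
    (fun φ H φ' H' hφ hφ' => by
      refine ⟨⟨(hφ.1.1.add hφ'.1.1).const_smul (1 / 2 : ℝ), ?_, ?_⟩, ?_⟩
      · exact (hφ.1.2.1.add hφ'.1.2.1).smul_left (f := fun _ => (1 / 2 : ℝ))
      · refine (closure_mono (Function.support_const_smul_subset _ _)).trans ?_
        exact (tsupport_add φ φ').trans (union_subset hφ.1.2.2 hφ'.1.2.2)
      · ext1 x
        have d1 := (hφ.1.1.differentiable (by simp) x).hasGradientAt
        have d2 := (hφ'.1.1.differentiable (by simp) x).hasGradientAt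
        have d3 : HasGradientAt ((1 / 2 : ℝ) • (φ + φ')) ((1 / 2 : ℝ) • (∇ φ x + ∇ φ' x)) x := by
          rw [hasGradientAt_iff_hasFDerivAt] at *
          simpa [map_add, map_smul] using (d1.add d2).const_smul (1 / 2 : ℝ)
        rw [d3.gradient, hφ.2, hφ'.2]
        rfl)
    h.memLp (fun j => ⟨hφ1 j, rfl⟩) (tendsto_eLpNorm_of_bound ho hb hlim0 hφ2) hφ3
  have hpairs : ∀ k, SobolevPair Ω (ENNReal.ofReal r) (w' k) (G' k) := fun k => by
    rw [(hP k).2]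
    exact sobolevPair_of_contDiff ho hb ((hP k).1.1.of_le (by simp)) _
  have hlimpair := sobolevPair_of_tendsto hb hr1 h.memLp hH hpairs l1 l2
  refine ⟨hlimpair.memW1 ho hb hr1, w', fun k => (hP k).1, l1, l2.congr fun k => ?_⟩
  rw [(hP k).2]
  refine eLpNorm_congr_ae ?_
  filter_upwards [hlimpair.weakGrad_ae_eq ho hb hr1] with x hx
  simp [hx]

/-- The absolute value of a Sobolev function. -/
lemma SobolevPair.abs (ho : IsOpen Ω) (hb : Bornology.IsBounded Ω) {r : ℝ} (hr : 2 ≤ r)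
    {u G} (h : SobolevPair Ω (ENNReal.ofReal r) u G) :
    ∃ H, SobolevPair Ω (ENNReal.ofReal r) (fun x => |u x|) H ∧
      ∫ x in Ω, ‖H x‖ ^ r ≤ ∫ x in Ω, ‖G x‖ ^ r := by
  have hr0 : 0 < r := by linarith
  have hr1 : 1 ≤ ENNReal.ofReal r := by rw [ENNReal.one_le_ofReal]; linarith
  -- Smooth approximations of the absolute value with slope at most one; lower semicontinuity
  -- transfers the energy bound to the limit.
  set f : ℕ → ℝ → ℝ := fun k t => √(t ^ 2 + (1 / ((k : ℝ) + 1)) ^ 2) with hf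
  have hpos : ∀ (k : ℕ) (t : ℝ), 0 < t ^ 2 + (1 / ((k : ℝ) + 1)) ^ 2 := fun k t => by positivity
  have hfs : ∀ k, ContDiff ℝ 1 (f k) := fun k =>
    ((contDiff_id.pow 2).add contDiff_const).sqrt fun t => (hpos k t).ne'
  have hfd : ∀ k t, |deriv (f k) t| ≤ 1 := fun k t => by
    have h1 : HasDerivAt (fun t : ℝ => t ^ 2 + (1 / ((k : ℝ) + 1)) ^ 2) (2 * t) t := by
      simpa using (hasDerivAt_pow 2 t).add_const ((1 / ((k : ℝ) + 1)) ^ 2)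
    have h2 : deriv (f k) t = 2 * t / (2 * √(t ^ 2 + (1 / ((k : ℝ) + 1)) ^ 2)) :=
      (h1.sqrt (hpos k t).ne').deriv
    have h3 := Real.sqrt_pos.2 (hpos k t)
    rw [h2, mul_div_mul_left _ _ two_ne_zero, abs_div, abs_of_pos h3, div_le_one h3]
    exact Real.abs_le_sqrt (by nlinarith [sq_nonneg (1 / ((k : ℝ) + 1))])
  have hclose : ∀ (k : ℕ) (t : ℝ), |(|t|) - f k t| ≤ 1 / ((k : ℝ) + 1) := fun k t => by
    have hε : 0 ≤ 1 / ((k : ℝ) + 1) := by positivity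
    have h1 : |t| ≤ f k t := Real.abs_le_sqrt (by nlinarith [sq_nonneg (1 / ((k : ℝ) + 1))])
    have h2 : f k t ≤ |t| + 1 / ((k : ℝ) + 1) := by
      refine Real.sqrt_le_iff.2 ⟨by positivity, ?_⟩
      have := abs_nonneg t
      rw [add_sq, sq_abs]
      nlinarith [mul_nonneg this hε]
    rw [abs_sub_comm, abs_of_nonneg (by linarith)]
    linarith
  refine sobolevPair_limit hr hb h.memLp.norm (fun k => h.comp ho hb hr1 (hfs k) (hfd k))
    (tendsto_eLpNorm_of_bound ho hb (tendsto_one_div_add_atTop_nhds_zero_nat (𝕜 := ℝ))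
      fun k x _ => hclose k (u x)) fun k => ?_
  refine integral_mono (integrable_norm_rpow_of_memLp hr0
    (h.comp ho hb hr1 (hfs k) (hfd k)).memLp_grad)
    (integrable_norm_rpow_of_memLp hr0 h.memLp_grad) fun x => ?_
  simp only []
  rw [norm_smul]
  gcongr
  exact mul_le_of_le_one_left (norm_nonneg _) (hfd k _)

/-! ### Continuous representatives, boundary values and compactness. -/

lemma morreyExp_le {p : ℝ} (hp : 2 * N ≤ p) : morreyExp N ≤ ENNReal.ofReal p :=
  ENNReal.ofReal_le_ofReal hp

lemma MemW1.exists_rep (hN : 1 ≤ N) (hΩ : IsSmoothBoundedDomain Ω) {p : ℝ} (hp : 2 * N ≤ p)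
    {u : Euc N → ℝ} (h : MemW1 Ω (ENNReal.ofReal p) u) :
    ∃ u', ContinuousOn u' (closure Ω) ∧ u' =ᵐ[volume.restrict Ω] u ∧
      SobolevPair Ω (ENNReal.ofReal p) u' (weakGrad Ω u) := by
  obtain ⟨u', hc, hae⟩ := (h.sobolevPair.mono_exponent hΩ.isBounded
    (morreyExp_le hp)).exists_continuousOn hN hΩ
  exact ⟨u', hc, hae, h.sobolevPair.congr hae.symm EventuallyEq.rfl⟩

lemma IsTestFunction.eq_zero_of_mem_frontier (ho : IsOpen Ω) {φ : Euc N → ℝ}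
    (hφ : IsTestFunction Ω φ) {x : Euc N} (hx : x ∈ frontier Ω) : φ x = 0 :=
  image_eq_zero_of_notMem_tsupport fun h => by
    have := hx.2
    rw [ho.interior_eq] at this
    exact this (hφ.2.2 h)

/-- At a boundary point `x` the difference `u' - φ k` takes the value `u' x`. Averaging the
oscillation bound for this difference over `Ω` bounds `|u' x|` by its `L¹` norm and its gradient
norm, and both tend to zero. -/
lemma MemW10.exists_rep (hN : 1 ≤ N) (hΩ : IsSmoothBoundedDomain Ω) {p : ℝ} (hp : 2 * N ≤ p)
    {u : Euc N → ℝ} (h : MemW10 Ω (ENNReal.ofReal p) u) :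
    ∃ u', ContinuousOn u' (closure Ω) ∧ u' =ᵐ[volume.restrict Ω] u ∧
      SobolevPair Ω (ENNReal.ofReal p) u' (weakGrad Ω u) ∧ ∀ x ∈ frontier Ω, u' x = 0 := by
  have ho := hΩ.isOpen
  have hb := hΩ.isBounded
  have hfin := isFiniteMeasure_restrict hb
  have hN' : (1 : ℝ) ≤ N := by exact_mod_cast hN
  have hp1 : 1 ≤ ENNReal.ofReal p := by rw [ENNReal.one_le_ofReal]; linarith
  obtain ⟨u', hc, hae, hpair⟩ := h.1.exists_rep hN hΩ hp
  refine ⟨u', hc, hae, hpair, fun x hx => ?_⟩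
  obtain ⟨φ, hφ, l1, l2⟩ := h.2
  obtain ⟨C, hC0, hC⟩ := exists_oscillation_bound hN hΩ
  have hd : ∀ k, SobolevPair Ω (ENNReal.ofReal p) (u' - φ k) (weakGrad Ω u - ∇ (φ k)) := fun k =>
    hpair.sub (sobolevPair_of_contDiff ho hb ((hφ k).1.of_le (by simp)) _) hb hp1
  have hdc : ∀ k, ContinuousOn (u' - φ k) (closure Ω) := fun k =>
    hc.sub (hφ k).continuous.continuousOn
  set V := (volume Ω).toReal with hV
  have hV0 : 0 < V := ENNReal.toReal_pos (ho.measure_pos _ hΩ.isConnected.nonempty).ne'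
    hb.measure_lt_top.ne
  have lower : ∀ {F : Type} [NormedAddCommGroup F] {g : ℕ → Euc N → F} {s : ℝ≥0∞},
      s ≤ ENNReal.ofReal p → 1 ≤ s → (∀ k, MemLp (g k) (ENNReal.ofReal p) (volume.restrict Ω)) →
      Tendsto (fun k => eLpNorm (g k) (ENNReal.ofReal p) (volume.restrict Ω)) atTop (𝓝 0) →
      Tendsto (fun k => (eLpNorm (g k) s (volume.restrict Ω)).toReal) atTop (𝓝 0) := by
    intro F _ g s hs hs1 hg hl
    have hst : s ≠ ⊤ := (hs.trans_lt ENNReal.ofReal_lt_top).ne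
    have := ENNReal.Tendsto.mul_const (b := (volume.restrict Ω univ) ^
      (1 / s.toReal - 1 / (ENNReal.ofReal p).toReal)) hl (Or.inr (by
        refine ENNReal.rpow_ne_top_of_nonneg ?_ (measure_ne_top _ _)
        rw [sub_nonneg]
        exact one_div_le_one_div_of_le (ENNReal.toReal_pos (zero_lt_one.trans_le hs1).ne' hst)
          (ENNReal.toReal_mono ENNReal.ofReal_ne_top hs)))
    rw [zero_mul] at this
    have h2 := tendsto_of_tendsto_of_tendsto_of_le_of_le tendsto_const_nhds this
      (fun _ => zero_le) fun k => eLpNorm_le_eLpNorm_mul_rpow_measure_univ hs (hg k).1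
    exact (ENNReal.tendsto_toReal ENNReal.zero_ne_top).comp h2
  have l1' : Tendsto (fun k => (eLpNorm (u' - φ k) 1 (volume.restrict Ω)).toReal) atTop (𝓝 0) := by
    refine lower hp1 le_rfl (fun k => (hd k).memLp) (l1.congr fun k => eLpNorm_congr_ae ?_)
    filter_upwards [hae] with y hy
    simp [hy]
  have l2' : Tendsto (fun k => gradNorm Ω (weakGrad Ω u - ∇ (φ k))) atTop (𝓝 0) :=
    lower (morreyExp_le hp) (one_le_morreyExp hN) (fun k => (hd k).memLp_grad) l2
  have hbound : ∀ k, |u' x| * V ≤ (eLpNorm (u' - φ k) 1 (volume.restrict Ω)).toReal +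
      C * gradNorm Ω (weakGrad Ω u - ∇ (φ k)) * V := by
    intro k
    have hx0 : (u' - φ k) x = u' x := by
      simp [(hφ k).eq_zero_of_mem_frontier ho hx]
    have hosc : ∀ y ∈ Ω, |u' x| ≤ |(u' - φ k) y| + C * gradNorm Ω (weakGrad Ω u - ∇ (φ k)) := by
      intro y hy
      have := hC _ _ ((hd k).mono_exponent hb (morreyExp_le hp)) (hdc k) x
        (frontier_subset_closure hx) y (subset_closure hy)
      rw [hx0] at this
      calc |u' x| = |(u' x - (u' - φ k) y) + (u' - φ k) y| := by ring_nf
        _ ≤ |u' x - (u' - φ k) y| + |(u' - φ k) y| := abs_add_le _ _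
        _ ≤ _ := by linarith
    have hi : IntegrableOn (fun y => |(u' - φ k) y|) Ω := ((hd k).integrable hb hp1).norm
    have e1 : (eLpNorm (u' - φ k) 1 (volume.restrict Ω)).toReal = ∫ y in Ω, |(u' - φ k) y| := by
      rw [eLpNorm_one_eq_lintegral_enorm, ← integral_norm_eq_lintegral_enorm (hd k).memLp.1]
      rfl
    have e2 : ∀ c : ℝ, ∫ _ in Ω, c = c * V := fun c => by
      rw [setIntegral_const, smul_eq_mul, mul_comm]
      rfl
    rw [e1, ← e2, ← e2, ← integral_add hi (integrable_const _)]
    refine setIntegral_mono_on (integrable_const _) (hi.add (integrable_const _))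
      ho.measurableSet hosc
  have hlim : Tendsto (fun k => (eLpNorm (u' - φ k) 1 (volume.restrict Ω)).toReal +
      C * gradNorm Ω (weakGrad Ω u - ∇ (φ k)) * V) atTop (𝓝 0) := by
    simpa using l1'.add ((l2'.const_mul C).mul_const V)
  have := ge_of_tendsto' hlim hbound
  have h3 : |u' x| ≤ 0 := by
    by_contra hcon
    nlinarith [not_le.1 hcon]
  exact abs_eq_zero.1 (le_antisymm h3 (abs_nonneg _))

/-- Compactness of bounded sets of `W^{1,2N}` in the space of continuous functions. -/
lemma exists_subseq_tendstoUniformlyOn (hN : 1 ≤ N) (hΩ : IsSmoothBoundedDomain Ω)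
    {u : ℕ → Euc N → ℝ} {G : ℕ → Euc N → Euc N} {M B : ℝ}
    (h : ∀ k, SobolevPair Ω (morreyExp N) (u k) (G k))
    (hc : ∀ k, ContinuousOn (u k) (closure Ω)) (hG : ∀ k, gradNorm Ω (G k) ≤ M)
    (hB : ∀ k, ∀ x ∈ closure Ω, |u k x| ≤ B) :
    ∃ φ : ℕ → ℕ, StrictMono φ ∧ ∃ v, ContinuousOn v (closure Ω) ∧
      TendstoUniformlyOn (fun j => u (φ j)) v atTop (closure Ω) := by
  have hcomp : CompactSpace (closure Ω) := isCompact_iff_compactSpace.1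
    hΩ.isBounded.isCompact_closure
  set F : ℕ → BoundedContinuousFunction (closure Ω) ℝ := fun k =>
    BoundedContinuousFunction.mkOfCompact ⟨(closure Ω).domRestrict (u k), (hc k).domRestrict⟩ with hF
  have hcl : IsCompact (closure (range F)) := by
    refine BoundedContinuousFunction.arzela_ascoli (Icc (-B) B) isCompact_Icc (range F) ?_ ?_
    · rintro _ x ⟨k, rfl⟩
      exact abs_le.1 (hB k x x.2)
    · intro x₀
      rw [Metric.equicontinuousAt_iff]
      intro ε hε
      obtain ⟨δ, hδ, hd⟩ := exists_equicontinuity hN hΩ x₀.2 M hε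
      refine ⟨δ, hδ, ?_⟩
      rintro x hx ⟨_, k, rfl⟩
      rw [Real.dist_eq, abs_sub_comm]
      exact hd _ _ (h k) (hc k) (hG k) x x.2 hx
  obtain ⟨f, -, φ, hφ, hlim⟩ := hcl.tendsto_subseq fun k => subset_closure (mem_range_self k)
  have hunif := BoundedContinuousFunction.tendsto_iff_tendstoUniformly.1 hlim
  set v : Euc N → ℝ := Function.extend ((↑) : closure Ω → Euc N) f 0 with hv
  have hvf : ∀ x : closure Ω, v x = f x := fun x => Subtype.val_injective.extend_apply _ _ x
  refine ⟨φ, hφ, v, ?_, ?_⟩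
  · rw [continuousOn_iff_continuous_domRestrict]
    have : (closure Ω).domRestrict v = f := by ext x; exact hvf x
    rw [this]
    exact f.continuous
  · rw [tendstoUniformlyOn_iff_tendstoUniformly_comp_coe]
    have : v ∘ ((↑) : closure Ω → Euc N) = f := by ext x; exact hvf x
    rw [this]
    exact hunif

end

section

variable {N : ℕ} {Ω : Set (Euc N)}

/-! ### Convexity of powers -/

/-- The tangent inequality of the convex function `‖·‖ ^ q`, obtained from Cauchy–Schwarz and
Young's inequality for `‖b‖ * ‖a‖ ^ (q - 1)`. It is the source of all convexity and monotonicity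
estimates below. -/
lemma norm_rpow_convex {E : Type*} [NormedAddCommGroup E] [InnerProductSpace ℝ E] {q : ℝ}
    (hq : 1 < q) (a b : E) :
    ‖a‖ ^ q + q * (‖a‖ ^ (q - 2) * inner ℝ a (b - a)) ≤ ‖b‖ ^ q := by
  rcases eq_or_ne a 0 with rfl | ha
  · simp only [norm_zero, inner_zero_left, mul_zero, add_zero]
    rw [Real.zero_rpow (by linarith)]
    positivity
  have ha0 : 0 < ‖a‖ := norm_pos_iff.2 ha
  have hconj : q.HolderConjugate (q / (q - 1)) := Real.HolderConjugate.conjExponent hq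
  have hy := Real.young_inequality_of_nonneg (norm_nonneg b)
    (Real.rpow_nonneg (norm_nonneg a) (q - 1)) hconj
  have hq1 : q - 1 ≠ 0 := by linarith
  have e1 : (‖a‖ ^ (q - 1)) ^ (q / (q - 1)) = ‖a‖ ^ q := by
    rw [← Real.rpow_mul ha0.le, mul_div_cancel₀ _ hq1]
  have e2 : ‖a‖ ^ (q - 2) * (‖a‖ * ‖b‖) = ‖b‖ * ‖a‖ ^ (q - 1) := by
    have : ‖a‖ ^ (q - 1) = ‖a‖ ^ (q - 2) * ‖a‖ := by
      rw [← Real.rpow_add_one ha0.ne']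
      congr 1; ring
    rw [this]; ring
  have e3 : ‖a‖ ^ (q - 2) * ‖a‖ ^ 2 = ‖a‖ ^ q := by
    rw [← Real.rpow_natCast, ← Real.rpow_add ha0]
    congr 1; push_cast; ring
  have h1 : ‖a‖ ^ (q - 2) * inner ℝ a (b - a) ≤ ‖b‖ * ‖a‖ ^ (q - 1) - ‖a‖ ^ q := by
    rw [inner_sub_right, real_inner_self_eq_norm_sq, mul_sub, e3, ← e2]
    gcongr
    exact real_inner_le_norm a b
  rw [e1] at hy
  have h2 : q * (‖b‖ * ‖a‖ ^ (q - 1)) ≤ ‖b‖ ^ q + (q - 1) * ‖a‖ ^ q := by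
    have h3 := mul_le_mul_of_nonneg_left hy (show 0 ≤ q by linarith)
    have h4 : q * (‖b‖ ^ q / q + ‖a‖ ^ q / (q / (q - 1))) = ‖b‖ ^ q + (q - 1) * ‖a‖ ^ q := by
      field_simp
    linarith
  have h5 := mul_le_mul_of_nonneg_left h1 (show 0 ≤ q by linarith)
  nlinarith

lemma abs_rpow_convex {β : ℝ} (hβ : 1 < β) (a b : ℝ) :
    |a| ^ β + β * (|a| ^ (β - 2) * a) * (b - a) ≤ |b| ^ β := by
  have := norm_rpow_convex hβ a b
  have e : inner ℝ a (b - a) = a * (b - a) := by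
    rw [RCLike.inner_apply, conj_trivial]; ring
  rw [e, Real.norm_eq_abs, Real.norm_eq_abs] at this
  linarith

/-- The monotone function `t ↦ |t|^{β-2} t`. -/
noncomputable def signedPow (β t : ℝ) : ℝ := |t| ^ (β - 2) * t

lemma continuous_abs_rpow {β : ℝ} (hβ : 0 ≤ β) : Continuous fun t : ℝ => |t| ^ β :=
  continuous_abs.rpow_const fun _ => Or.inr hβ

lemma continuous_signedPow {β : ℝ} (hβ : 2 ≤ β) : Continuous (signedPow β) :=
  (continuous_abs_rpow (by linarith)).mul continuous_id

lemma signedPow_neg (β t : ℝ) : signedPow β (-t) = - signedPow β t := by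
  simp [signedPow]

lemma signedPow_of_nonneg {β t : ℝ} (hβ : 2 ≤ β) (ht : 0 ≤ t) : signedPow β t = t ^ (β - 1) := by
  rcases eq_or_lt_of_le ht with rfl | h
  · rw [signedPow, mul_zero, Real.zero_rpow (by linarith)]
  · rw [signedPow, abs_of_pos h, ← Real.rpow_add_one h.ne']
    congr 1; ring

lemma strictMono_signedPow {β : ℝ} (hβ : 2 ≤ β) : StrictMono (signedPow β) := by
  refine strictMono_of_odd_strictMonoOn_nonneg (signedPow_neg β) fun a ha b hb hab => ?_
  rw [signedPow_of_nonneg hβ ha, signedPow_of_nonneg hβ hb]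
  exact Real.rpow_lt_rpow ha hab (by linarith)

lemma signedPow_mul_self {β t : ℝ} (hβ : 2 ≤ β) : signedPow β t * t = |t| ^ β := by
  rcases eq_or_ne t 0 with rfl | h
  · simp [Real.zero_rpow (show β ≠ 0 by linarith)]
  · rw [signedPow, mul_assoc, ← sq, ← sq_abs, ← Real.rpow_natCast, ← Real.rpow_add (abs_pos.2 h)]
    congr 1; push_cast; ring

lemma signedPow_pos {β t : ℝ} (hβ : 2 ≤ β) (ht : 0 < t) : 0 < signedPow β t := by
  rw [signedPow_of_nonneg hβ ht.le]; positivity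

/-! ### Integrals of continuous functions -/

/-- Uniform convergence keeps all values in a fixed compact rectangle, where `Ψ` is bounded, so
dominated convergence applies. The filter is general because both sequences and real parameters
tending to a point occur. -/
lemma tendsto_integral_comp {ι : Type*} {l : Filter ι} [l.IsCountablyGenerated]
    (ho : IsOpen Ω) (hb : Bornology.IsBounded Ω) {Ψ : ℝ → ℝ → ℝ}
    (hΨ : Continuous (Function.uncurry Ψ)) {u v : ι → Euc N → ℝ} {u₀ v₀ : Euc N → ℝ}
    (hu : ∀ᶠ i in l, ContinuousOn (u i) (closure Ω)) (hv : ∀ᶠ i in l, ContinuousOn (v i) (closure Ω))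
    (hu₀ : ContinuousOn u₀ (closure Ω)) (hv₀ : ContinuousOn v₀ (closure Ω))
    (hul : TendstoUniformlyOn u u₀ l (closure Ω)) (hvl : TendstoUniformlyOn v v₀ l (closure Ω)) :
    Tendsto (fun i => ∫ x in Ω, Ψ (u i x) (v i x)) l (𝓝 (∫ x in Ω, Ψ (u₀ x) (v₀ x))) := by
  have hfin := isFiniteMeasure_restrict hb
  obtain ⟨B, hB⟩ := hb.isCompact_closure.exists_bound_of_continuousOn hu₀
  obtain ⟨B', hB'⟩ := hb.isCompact_closure.exists_bound_of_continuousOn hv₀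
  obtain ⟨C, hC⟩ := ((isCompact_closedBall (0 : ℝ) (B + 1)).prod
    (isCompact_closedBall (0 : ℝ) (B' + 1))).exists_bound_of_continuousOn hΨ.continuousOn
  have bd : ∀ {a b c : ℝ}, |b| ≤ c → dist b a < 1 → a ∈ Metric.closedBall (0 : ℝ) (c + 1) := by
    intro a b c h1 h2
    rw [Metric.mem_closedBall, dist_zero_right, Real.norm_eq_abs]
    rw [dist_comm, Real.dist_eq] at h2
    calc |a| = |b + (a - b)| := by ring_nf
      _ ≤ |b| + |a - b| := abs_add_le _ _
      _ ≤ c + 1 := by linarith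
  refine tendsto_integral_filter_of_dominated_convergence (fun _ => C) ?_ ?_ (integrable_const C) ?_
  · filter_upwards [hu, hv] with i h1 h2
    exact ContinuousOn.aestronglyMeasurable (hΨ.comp_continuousOn
      ((h1.mono subset_closure).prodMk (h2.mono subset_closure))) ho.measurableSet
  · filter_upwards [Metric.tendstoUniformlyOn_iff.1 hul 1 one_pos,
      Metric.tendstoUniformlyOn_iff.1 hvl 1 one_pos] with i h1 h2
    filter_upwards [ae_restrict_mem ho.measurableSet] with x hx
    have hx' := subset_closure hx
    exact hC (u i x, v i x) ⟨bd (hB x hx') (h1 x hx'), bd (hB' x hx') (h2 x hx')⟩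
  · filter_upwards [ae_restrict_mem ho.measurableSet] with x hx
    have hx' := subset_closure hx
    exact (hΨ.tendsto (u₀ x, v₀ x)).comp
      ((hul.tendsto_at hx').prodMk_nhds (hvl.tendsto_at hx'))

lemma integral_pos_of_exists_pos (ho : IsOpen Ω) (hb : Bornology.IsBounded Ω) {f : Euc N → ℝ}
    (hf : ContinuousOn f (closure Ω)) (h0 : ∀ x ∈ Ω, 0 ≤ f x) {x : Euc N} (hx : x ∈ Ω)
    (hpos : 0 < f x) : 0 < ∫ x in Ω, f x := by
  have hi := integrableOn_of_continuousOn ho hb hf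
  rw [setIntegral_pos_iff_support_of_nonneg_ae (by
    filter_upwards [ae_restrict_mem ho.measurableSet] with y hy using h0 y hy) hi]
  have hc := (hf.mono subset_closure).continuousAt (ho.mem_nhds hx)
  obtain ⟨W, hW, hWo, hxW⟩ := mem_nhds_iff.1
    (Filter.inter_mem (hc.eventually (lt_mem_nhds hpos)) (ho.mem_nhds hx))
  refine (hWo.measure_pos volume ⟨x, hxW⟩).trans_le (measure_mono fun y hy => ?_)
  exact ⟨(show 0 < f y from (hW hy).1).ne', (hW hy).2⟩

lemma exists_ne_zero_of_integral_ne_zero {f : Euc N → ℝ}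
    (h : ∫ x in Ω, f x ≠ 0) : ∃ x ∈ Ω, f x ≠ 0 := by
  by_contra hcon
  push Not at hcon
  exact h (setIntegral_eq_zero_of_forall_eq_zero hcon)

/-! ### First variation of the energy -/

lemma integrable_rpow_inner {X F : Type*} [MeasurableSpace X] {μ : Measure X}
    [NormedAddCommGroup F] [InnerProductSpace ℝ F] {q : ℝ} (hq : 2 ≤ q) {V Z : X → F}
    (hV : MemLp V (ENNReal.ofReal q) μ) (hZ : MemLp Z (ENNReal.ofReal q) μ) :
    Integrable (fun x => ‖V x‖ ^ (q - 2) * inner ℝ (V x) (Z x)) μ := by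
  have hq0 : 0 < q := by linarith
  have hb := integrable_norm_rpow_of_memLp hq0 (hV.norm.add hZ.norm)
  refine hb.mono ((hV.1.norm.aemeasurable.pow_const _).aestronglyMeasurable.mul
    (hV.1.inner hZ.1)) (Eventually.of_forall fun x => ?_)
  simp only [Pi.add_apply]
  rw [Real.norm_of_nonneg (by positivity : (0 : ℝ) ≤ ‖‖V x‖ + ‖Z x‖‖ ^ q),
    Real.norm_of_nonneg (by positivity : (0 : ℝ) ≤ ‖V x‖ + ‖Z x‖), norm_mul,
    Real.norm_of_nonneg (by positivity : (0 : ℝ) ≤ ‖V x‖ ^ (q - 2))]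
  have h0 : 0 ≤ ‖V x‖ + ‖Z x‖ := by positivity
  calc ‖V x‖ ^ (q - 2) * ‖inner ℝ (V x) (Z x)‖
      ≤ (‖V x‖ + ‖Z x‖) ^ (q - 2) * ((‖V x‖ + ‖Z x‖) * (‖V x‖ + ‖Z x‖)) := by
        refine mul_le_mul ?_ ?_ (norm_nonneg _) (by positivity)
        · exact Real.rpow_le_rpow (norm_nonneg _) (by linarith [norm_nonneg (Z x)]) (by linarith)
        · refine (norm_inner_le_norm _ _).trans ?_
          gcongr <;> linarith [norm_nonneg (V x), norm_nonneg (Z x)]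
    _ = (‖V x‖ + ‖Z x‖) ^ q := by
        rw [← sq, ← Real.rpow_natCast, ← Real.rpow_add_of_nonneg h0 (by linarith) (by norm_num)]
        congr 1; push_cast; ring

/-- A lower bound for the increments of the energy is enough: convexity supplies the upper bound `t
* D t` with `D` continuous at zero. Dividing by `t` of either sign then identifies `D 0` with `A`.
-/
lemma first_variation {X F : Type*} [MeasurableSpace X] {μ : Measure X}
    [NormedAddCommGroup F] [InnerProductSpace ℝ F] {q : ℝ} (hq : 2 ≤ q) {V Z : X → F}
    (hV : MemLp V (ENNReal.ofReal q) μ) (hZ : MemLp Z (ENNReal.ofReal q) μ) {A : ℝ}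
    (h : ∀ ε > 0, ∃ δ > 0, ∀ t : ℝ, |t| < δ → t * A - ε * |t| ≤
      (∫ x, ‖V x + t • Z x‖ ^ q / q ∂μ) - ∫ x, ‖V x‖ ^ q / q ∂μ) :
    ∫ x, ‖V x‖ ^ (q - 2) * inner ℝ (V x) (Z x) ∂μ = A := by
  have hq0 : 0 < q := by linarith
  set D : ℝ → ℝ := fun t => ∫ x, ‖V x + t • Z x‖ ^ (q - 2) * inner ℝ (V x + t • Z x) (Z x) ∂μ
    with hD
  have hVt : ∀ t : ℝ, MemLp (fun x => V x + t • Z x) (ENNReal.ofReal q) μ := fun t =>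
    hV.add (hZ.const_smul t)
  have hupper : ∀ t : ℝ, (∫ x, ‖V x + t • Z x‖ ^ q / q ∂μ) - ∫ x, ‖V x‖ ^ q / q ∂μ ≤ t * D t := by
    intro t
    have i1 := (integrable_norm_rpow_of_memLp hq0 (hVt t)).div_const q
    have i2 := (integrable_norm_rpow_of_memLp hq0 hV).div_const q
    simp only [hD]
    rw [← integral_sub i1 i2, ← integral_const_mul]
    refine integral_mono (i1.sub i2) ((integrable_rpow_inner hq (hVt t) hZ).const_mul t)
      fun x => ?_
    have := norm_rpow_convex (show 1 < q by linarith) (V x + t • Z x) (V x)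
    have e1 : V x - (V x + t • Z x) = -(t • Z x) := by abel
    rw [e1, inner_neg_right, inner_smul_right] at this
    simp only []
    rw [← sub_div, div_le_iff₀ hq0]
    nlinarith
  have hlim : Tendsto D (𝓝 0) (𝓝 (∫ x, ‖V x‖ ^ (q - 2) * inner ℝ (V x) (Z x) ∂μ)) := by
    refine tendsto_integral_filter_of_dominated_convergence
      (fun x => (‖V x‖ + ‖Z x‖ + ‖Z x‖) ^ q) ?_ ?_ ?_ ?_
    · exact Eventually.of_forall fun t => (integrable_rpow_inner hq (hVt t) hZ).1
    · have : ∀ᶠ t : ℝ in 𝓝 0, |t| < 1 := by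
        have := (continuous_abs.tendsto (0 : ℝ)).eventually 
          (gt_mem_nhds (show |(0 : ℝ)| < 1 by simp))
        exact this
      filter_upwards [this] with t ht
      refine Eventually.of_forall fun x => ?_
      have h1 : ‖V x + t • Z x‖ ≤ ‖V x‖ + ‖Z x‖ + ‖Z x‖ := by
        refine (norm_add_le _ _).trans ?_
        rw [norm_smul, Real.norm_eq_abs]
        nlinarith [norm_nonneg (Z x)]
      have h0 : 0 ≤ ‖V x‖ + ‖Z x‖ + ‖Z x‖ := by positivity
      rw [norm_mul, Real.norm_of_nonneg (by positivity : (0 : ℝ) ≤ ‖V x + t • Z x‖ ^ (q - 2))]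
      calc ‖V x + t • Z x‖ ^ (q - 2) * ‖inner ℝ (V x + t • Z x) (Z x)‖
          ≤ (‖V x‖ + ‖Z x‖ + ‖Z x‖) ^ (q - 2) *
            ((‖V x‖ + ‖Z x‖ + ‖Z x‖) * (‖V x‖ + ‖Z x‖ + ‖Z x‖)) := by
            refine mul_le_mul ?_ ?_ (norm_nonneg _) (by positivity)
            · exact Real.rpow_le_rpow (norm_nonneg _) h1 (by linarith)
            · refine (norm_inner_le_norm _ _).trans ?_
              gcongr
              linarith [norm_nonneg (V x), norm_nonneg (Z x)]
        _ = (‖V x‖ + ‖Z x‖ + ‖Z x‖) ^ q := by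
            rw [← sq, ← Real.rpow_natCast, ← Real.rpow_add_of_nonneg h0 (by linarith) (by norm_num)]
            congr 1; push_cast; ring
    · have := integrable_norm_rpow_of_memLp hq0 ((hV.norm.add hZ.norm).add hZ.norm)
      refine this.congr (Eventually.of_forall fun x => ?_)
      simp only [Pi.add_apply]
      rw [Real.norm_of_nonneg (by positivity)]
    · refine Eventually.of_forall fun x => ?_
      have hc : Continuous fun t : ℝ => ‖V x + t • Z x‖ ^ (q - 2) * inner ℝ (V x + t • Z x) (Z x) := by
        refine Continuous.mul ?_ (by fun_prop)
        exact (by fun_prop : Continuous fun t : ℝ => ‖V x + t • Z x‖).rpow_const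
          fun _ => Or.inr (by linarith)
      have := hc.tendsto 0
      simpa using this
  refine le_antisymm ?_ ?_
  · refine le_of_forall_pos_le_add fun ε hε => ?_
    obtain ⟨δ, hδ, hd⟩ := h ε hε
    have hl : Tendsto D (𝓝[<] 0) _ := hlim.mono_left nhdsWithin_le_nhds
    refine le_of_tendsto hl ?_
    filter_upwards [Ioo_mem_nhdsLT (neg_lt_zero.2 hδ)] with t ht
    have h1 := (hd t (by rw [abs_of_neg ht.2]; linarith [ht.1])).trans (hupper t)
    rw [abs_of_neg ht.2] at h1
    nlinarith [ht.2]
  · refine le_of_forall_pos_le_add fun ε hε => ?_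
    obtain ⟨δ, hδ, hd⟩ := h ε hε
    have hl : Tendsto D (𝓝[>] 0) _ := hlim.mono_left nhdsWithin_le_nhds
    rw [← sub_le_iff_le_add]
    refine ge_of_tendsto hl ?_
    filter_upwards [Ioo_mem_nhdsGT hδ] with t ht
    have h1 := (hd t (by rw [abs_of_pos ht.1]; exact ht.2)).trans (hupper t)
    rw [abs_of_pos ht.1] at h1
    nlinarith [ht.1]

end

section

variable {N : ℕ} {Ω : Set (Euc N)}

/-! ### The variational problem for large finite exponents -/

/-- Exponents for which all functions involved are continuous and all powers are convex. -/
structure LargeExponents (N : ℕ) (p q α β : ℝ) : Prop where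
  hp : 2 * N ≤ p
  hq : 2 * N ≤ q
  hα : 2 ≤ α
  hβ : 2 ≤ β
  hsum : α / p + β / q = 1

/-- Pairs in `W^{1,p}_0 × W^{1,q}`, given by continuous representatives and their gradients. -/
structure RegularPair (Ω : Set (Euc N)) (p q : ℝ) (u v : Euc N → ℝ) (Gu Gv : Euc N → Euc N) :
    Prop where
  cont_u : ContinuousOn u (closure Ω)
  cont_v : ContinuousOn v (closure Ω)
  pair_u : SobolevPair Ω (ENNReal.ofReal p) u Gu
  pair_v : SobolevPair Ω (ENNReal.ofReal q) v Gv
  zero_u : ∀ x ∈ frontier Ω, u x = 0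

/-- `∫ |u|^α |v|^β`. -/
noncomputable def coupling (Ω : Set (Euc N)) (α β : ℝ) (u v : Euc N → ℝ) : ℝ :=
  ∫ x in Ω, |u x| ^ α * |v x| ^ β

/-- `∫ |u|^α |v|^{β-2} v`. -/
noncomputable def moment (Ω : Set (Euc N)) (α β : ℝ) (u v : Euc N → ℝ) : ℝ :=
  ∫ x in Ω, |u x| ^ α * signedPow β (v x)

/-- `∫ |∇u|^p / p + ∫ |∇v|^q / q`. -/
noncomputable def energy (Ω : Set (Euc N)) (p q : ℝ) (Gu Gv : Euc N → Euc N) : ℝ :=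
  (∫ x in Ω, ‖Gu x‖ ^ p / p) + ∫ x in Ω, ‖Gv x‖ ^ q / q

lemma energy_nonneg {p q : ℝ} (hp : 0 ≤ p) (hq : 0 ≤ q) (Gu Gv : Euc N → Euc N) :
    0 ≤ energy Ω p q Gu Gv :=
  add_nonneg (integral_nonneg fun x => by positivity) (integral_nonneg fun x => by positivity)

lemma LargeExponents.two_le_p {p q α β : ℝ} (h : LargeExponents N p q α β) (hN : 1 ≤ N) :
    2 ≤ p := by
  have hN' : (1 : ℝ) ≤ N := by exact_mod_cast hN
  linarith [h.hp]

lemma LargeExponents.two_le_q {p q α β : ℝ} (h : LargeExponents N p q α β) (hN : 1 ≤ N) :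
    2 ≤ q := by
  have hN' : (1 : ℝ) ≤ N := by exact_mod_cast hN
  linarith [h.hq]

lemma one_le_ofReal_of_two_le {p : ℝ} (hp : 2 ≤ p) : 1 ≤ ENNReal.ofReal p := by
  rw [ENNReal.one_le_ofReal]; linarith

lemma continuousOn_coupling {α β : ℝ} (hα : 0 ≤ α) (hβ : 0 ≤ β) {u v : Euc N → ℝ}
    (hu : ContinuousOn u (closure Ω)) (hv : ContinuousOn v (closure Ω)) :
    ContinuousOn (fun x => |u x| ^ α * |v x| ^ β) (closure Ω) :=
  ((continuous_abs_rpow hα).comp_continuousOn hu).mul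
    ((continuous_abs_rpow hβ).comp_continuousOn hv)

lemma continuousOn_moment {α β : ℝ} (hα : 0 ≤ α) (hβ : 2 ≤ β) {u v : Euc N → ℝ}
    (hu : ContinuousOn u (closure Ω)) (hv : ContinuousOn v (closure Ω)) :
    ContinuousOn (fun x => |u x| ^ α * signedPow β (v x)) (closure Ω) :=
  ((continuous_abs_rpow hα).comp_continuousOn hu).mul
    ((continuous_signedPow hβ).comp_continuousOn hv)

lemma firstEigenvalue_nonneg {p q α β : ℝ} (hp : 0 ≤ p) (hq : 0 ≤ q) :
    0 ≤ firstEigenvalue Ω p q α β := by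
  refine Real.sInf_nonneg ?_
  rintro _ ⟨u, v, -, rfl⟩
  exact div_nonneg (energy_nonneg hp hq _ _) (integral_nonneg fun x => by positivity)

lemma bddBelow_rayleigh {p q α β : ℝ} (hp : 0 ≤ p) (hq : 0 ≤ q) :
    BddBelow {r | ∃ u v, Admissible Ω p q α β u v ∧ r = rayleigh Ω p q α β u v} := by
  refine ⟨0, ?_⟩
  rintro _ ⟨u, v, -, rfl⟩
  exact div_nonneg (energy_nonneg hp hq _ _) (integral_nonneg fun x => by positivity)

lemma energy_congr {p q : ℝ} {Gu Gv Gu' Gv' : Euc N → Euc N}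
    (hu : Gu =ᵐ[volume.restrict Ω] Gu') (hv : Gv =ᵐ[volume.restrict Ω] Gv') :
    energy Ω p q Gu Gv = energy Ω p q Gu' Gv' := by
  unfold energy
  congr 1
  · exact integral_congr_ae (by filter_upwards [hu] with x hx; rw [hx])
  · exact integral_congr_ae (by filter_upwards [hv] with x hx; rw [hx])

lemma RegularPair.admissible (hN : 1 ≤ N) (hΩ : IsSmoothBoundedDomain Ω) {p q α β : ℝ}
    (hE : LargeExponents N p q α β) {u v Gu Gv} (h : RegularPair Ω p q u v Gu Gv)
    (hm : moment Ω α β u v = 0) (hJ : coupling Ω α β u v ≠ 0) : Admissible Ω p q α β u v := by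
  refine ⟨h.pair_u.memW10 hΩ.isOpen hΩ.isBounded (hE.two_le_p hN) h.cont_u h.zero_u,
    h.pair_v.memW1 hΩ.isOpen hΩ.isBounded (one_le_ofReal_of_two_le (hE.two_le_q hN)), ?_, hm⟩
  intro hae
  refine hJ (integral_eq_zero_of_ae ?_)
  filter_upwards [hae] with x hx
  have hα := hE.hα
  have hβ := hE.hβ
  rcases mul_eq_zero.1 hx with h0 | h0
  · simp [h0, Real.zero_rpow (show α ≠ 0 by linarith)]
  · simp [h0, Real.zero_rpow (show β ≠ 0 by linarith)]

/-- The variational characterization of the first eigenvalue as a lower bound for the energy. -/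
lemma RegularPair.le_energy (hN : 1 ≤ N) (hΩ : IsSmoothBoundedDomain Ω) {p q α β : ℝ}
    (hE : LargeExponents N p q α β) {u v Gu Gv} (h : RegularPair Ω p q u v Gu Gv)
    (hm : moment Ω α β u v = 0) :
    firstEigenvalue Ω p q α β * coupling Ω α β u v ≤ energy Ω p q Gu Gv := by
  have hp := hE.two_le_p hN
  have hq := hE.two_le_q hN
  by_cases hJ : coupling Ω α β u v = 0
  · rw [hJ, mul_zero]
    exact energy_nonneg (by linarith) (by linarith) _ _
  have hJ0 : 0 < coupling Ω α β u v :=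
    lt_of_le_of_ne (integral_nonneg fun x => by positivity) (Ne.symm hJ)
  have hle : firstEigenvalue Ω p q α β ≤ rayleigh Ω p q α β u v :=
    csInf_le (bddBelow_rayleigh (by linarith) (by linarith))
      ⟨u, v, h.admissible hN hΩ hE hm hJ, rfl⟩
  have e : rayleigh Ω p q α β u v = energy Ω p q Gu Gv / coupling Ω α β u v := by
    rw [← energy_congr (h.pair_u.weakGrad_ae_eq hΩ.isOpen hΩ.isBounded (one_le_ofReal_of_two_le hp))
      (h.pair_v.weakGrad_ae_eq hΩ.isOpen hΩ.isBounded (one_le_ofReal_of_two_le hq))]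
    rfl
  rw [e, le_div_iff₀ hJ0] at hle
  exact hle

lemma tendstoUniformlyOn_add_const (v : Euc N → ℝ) (K : Set (Euc N)) (c₀ : ℝ) :
    TendstoUniformlyOn (fun (c : ℝ) x => v x + c) (fun x => v x + c₀) (𝓝 c₀) K := by
  rw [Metric.tendstoUniformlyOn_iff]
  intro ε hε
  filter_upwards [Metric.ball_mem_nhds c₀ hε] with c hc x _
  rw [dist_add_left, dist_comm]
  exact hc

lemma continuous_moment_shift (ho : IsOpen Ω) (hb : Bornology.IsBounded Ω) {α β : ℝ}
    (hα : 0 ≤ α) (hβ : 2 ≤ β) {u v : Euc N → ℝ} (hu : ContinuousOn u (closure Ω))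
    (hv : ContinuousOn v (closure Ω)) :
    Continuous fun c : ℝ => moment Ω α β u (fun x => v x + c) := by
  rw [continuous_iff_continuousAt]
  intro c₀
  have hΨ : Continuous (Function.uncurry fun a b : ℝ => |a| ^ α * signedPow β b) :=
    ((continuous_abs_rpow hα).comp continuous_fst).mul
      ((continuous_signedPow hβ).comp continuous_snd)
  refine tendsto_integral_comp (l := 𝓝 c₀) ho hb hΨ (u := fun _ => u) (v := fun c x => v x + c)
    (Eventually.of_forall fun _ => hu) (Eventually.of_forall fun c => hv.add continuousOn_const) hu
    (hv.add continuousOn_const) ?_ (tendstoUniformlyOn_add_const v _ c₀)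
  rw [Metric.tendstoUniformlyOn_iff]
  intro ε hε
  exact Eventually.of_forall fun c x _ => by simpa using hε

/-- Adding a suitable constant makes the moment vanish. -/
lemma exists_shift (ho : IsOpen Ω) (hb : Bornology.IsBounded Ω) {α β : ℝ}
    (hα : 0 ≤ α) (hβ : 2 ≤ β) {u v : Euc N → ℝ} (hu : ContinuousOn u (closure Ω))
    (hv : ContinuousOn v (closure Ω)) :
    ∃ c : ℝ, moment Ω α β u (fun x => v x + c) = 0 := by
  obtain ⟨B, hB⟩ := hb.isCompact_closure.exists_bound_of_continuousOn hv
  have hcont := continuous_moment_shift ho hb hα hβ hu hv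
  have hmono := (strictMono_signedPow hβ).monotone
  have h0 : signedPow β 0 = 0 := by simp [signedPow]
  -- Shifting by plus or minus a bound of `v` gives `v` a constant sign, so the moment changes sign
  -- in between.
  have h1 : 0 ≤ moment Ω α β u (fun x => v x + |B|) := by
    refine setIntegral_nonneg ho.measurableSet fun x hx => mul_nonneg (by positivity) ?_
    rw [← h0]
    refine hmono ?_
    have := (abs_le.1 ((hB x (subset_closure hx)).trans (le_abs_self B))).1
    linarith
  have h2 : moment Ω α β u (fun x => v x + -|B|) ≤ 0 := by
    refine setIntegral_nonpos ho.measurableSet fun x hx =>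
      mul_nonpos_of_nonneg_of_nonpos (by positivity) ?_
    rw [← h0]
    refine hmono ?_
    have := (abs_le.1 ((hB x (subset_closure hx)).trans (le_abs_self B))).2
    linarith
  obtain ⟨c, -, hc⟩ := intermediate_value_Icc (a := -|B|) (b := |B|)
    (by linarith [abs_nonneg B]) hcont.continuousOn ⟨h2, h1⟩
  exact ⟨c, hc⟩

/-- Strictness makes it possible to confine the shift that restores the constraint to an arbitrarily
small interval. -/
lemma moment_lt_moment (ho : IsOpen Ω) (hb : Bornology.IsBounded Ω) {α β : ℝ}
    (hα : 0 < α) (hβ : 2 ≤ β) {u v v' : Euc N → ℝ} (hu : ContinuousOn u (closure Ω))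
    (hv : ContinuousOn v (closure Ω)) (hv' : ContinuousOn v' (closure Ω))
    (hlt : ∀ x ∈ Ω, v x < v' x) (hne : ∃ x ∈ Ω, u x ≠ 0) :
    moment Ω α β u v < moment Ω α β u v' := by
  have hc := continuousOn_moment hα.le hβ hu hv
  have hc' := continuousOn_moment hα.le hβ hu hv'
  obtain ⟨x, hx, hux⟩ := hne
  rw [← sub_pos, moment, moment, ← integral_sub (integrableOn_of_continuousOn ho hb hc')
    (integrableOn_of_continuousOn ho hb hc)]
  refine integral_pos_of_exists_pos ho hb (hc'.sub hc) (fun y hy => ?_) hx ?_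
  · rw [← mul_sub]
    exact mul_nonneg (by positivity) (sub_nonneg.2 ((strictMono_signedPow hβ) (hlt y hy)).le)
  · rw [← mul_sub]
    have := abs_pos.2 hux
    exact mul_pos (by positivity) (sub_pos.2 ((strictMono_signedPow hβ) (hlt x hx)))

lemma exists_ne_zero_of_coupling_ne_zero {α β : ℝ} (hα : 0 < α) (hβ : 0 < β)
    {u v : Euc N → ℝ} (hJ : coupling Ω α β u v ≠ 0) : ∃ x ∈ Ω, u x ≠ 0 ∧ v x ≠ 0 := by
  obtain ⟨x, hx, h⟩ := exists_ne_zero_of_integral_ne_zero hJ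
  refine ⟨x, hx, fun h0 => h ?_, fun h0 => h ?_⟩
  · simp [h0, Real.zero_rpow hα.ne']
  · simp [h0, Real.zero_rpow hβ.ne']

/-- The integrated tangent inequality for `|·| ^ β`. If the moment vanishes, the constant part of
`z` drops out of the first-order term. -/
lemma coupling_le_coupling_shift (ho : IsOpen Ω) (hb : Bornology.IsBounded Ω) {α β : ℝ}
    (hα : 0 ≤ α) (hβ : 2 ≤ β) {u v z : Euc N → ℝ} (hu : ContinuousOn u (closure Ω))
    (hv : ContinuousOn v (closure Ω)) (hz : ContinuousOn z (closure Ω)) :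
    coupling Ω α β u v + β * ∫ x in Ω, |u x| ^ α * signedPow β (v x) * z x ≤
      coupling Ω α β u (fun x => v x + z x) := by
  have i1 := integrableOn_of_continuousOn ho hb (continuousOn_coupling hα (by linarith) hu hv)
  have i2 : IntegrableOn (fun x => |u x| ^ α * signedPow β (v x) * z x) Ω :=
    integrableOn_of_continuousOn ho hb ((continuousOn_moment hα hβ hu hv).mul hz)
  have i3 : IntegrableOn (fun x => |u x| ^ α * |v x + z x| ^ β) Ω :=
    integrableOn_of_continuousOn ho hb
      (continuousOn_coupling hα (by linarith) hu (hv.add hz) (β := β))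
  rw [coupling, coupling, ← integral_const_mul, ← integral_add i1 (i2.const_mul β)]
  refine integral_mono (i1.add (i2.const_mul β)) i3 fun x => ?_
  have := abs_rpow_convex (show 1 < β by linarith) (v x) (v x + z x)
  rw [add_sub_cancel_left] at this
  have h2 := mul_le_mul_of_nonneg_left this (show 0 ≤ |u x| ^ α by positivity)
  simp only [signedPow]
  linarith

/-- The counterpart in the first variable, from the tangent inequality for `|·| ^ α`. -/
lemma moment_shift_le_coupling (ho : IsOpen Ω) (hb : Bornology.IsBounded Ω) {α β : ℝ}
    (hα : 2 ≤ α) (hβ : 0 ≤ β) {u v w : Euc N → ℝ} (hu : ContinuousOn u (closure Ω))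
    (hv : ContinuousOn v (closure Ω)) (hw : ContinuousOn w (closure Ω)) :
    coupling Ω α β u v + α * ∫ x in Ω, signedPow α (u x) * w x * |v x| ^ β ≤
      coupling Ω α β (fun x => u x + w x) v := by
  have i1 := integrableOn_of_continuousOn ho hb
    (continuousOn_coupling (show 0 ≤ α by linarith) hβ hu hv)
  have i2 : IntegrableOn (fun x => signedPow α (u x) * w x * |v x| ^ β) Ω :=
    integrableOn_of_continuousOn ho hb
      ((((continuous_signedPow hα).comp_continuousOn hu).mul hw).mul
        ((continuous_abs_rpow hβ).comp_continuousOn hv))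
  have i3 : IntegrableOn (fun x => |u x + w x| ^ α * |v x| ^ β) Ω :=
    integrableOn_of_continuousOn ho hb
      (continuousOn_coupling (show 0 ≤ α by linarith) hβ (hu.add hw) hv)
  rw [coupling, coupling, ← integral_const_mul, ← integral_add i1 (i2.const_mul α)]
  refine integral_mono (i1.add (i2.const_mul α)) i3 fun x => ?_
  have := abs_rpow_convex (show 1 < α by linarith) (u x) (u x + w x)
  rw [add_sub_cancel_left] at this
  have h2 := mul_le_mul_of_nonneg_right this (show 0 ≤ |v x| ^ β by positivity)
  simp only [signedPow]
  linarith

/-- Minimizers satisfy the Euler-Lagrange equation for the second component. -/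
lemma RegularPair.eq_v (hN : 1 ≤ N) (hΩ : IsSmoothBoundedDomain Ω) {p q α β : ℝ}
    (hE : LargeExponents N p q α β) {u v Gu Gv} (h : RegularPair Ω p q u v Gu Gv)
    (hm : moment Ω α β u v = 0) (hJ : coupling Ω α β u v = 1)
    (hmin : energy Ω p q Gu Gv = firstEigenvalue Ω p q α β) {z Z}
    (hz : SobolevPair Ω (ENNReal.ofReal q) z Z) (hzc : ContinuousOn z (closure Ω)) :
    ∫ x in Ω, ‖Gv x‖ ^ (q - 2) * inner ℝ (Gv x) (Z x) =
      firstEigenvalue Ω p q α β * β * ∫ x in Ω, |u x| ^ α * signedPow β (v x) * z x := by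
  have ho := hΩ.isOpen
  have hb := hΩ.isBounded
  have hq := hE.two_le_q hN
  have hq1 := one_le_ofReal_of_two_le hq
  have hα := hE.hα
  have hβ := hE.hβ
  have hlam : 0 ≤ firstEigenvalue Ω p q α β :=
    firstEigenvalue_nonneg (by linarith [hE.two_le_p hN]) (by linarith)
  refine first_variation hq h.pair_v.memLp_grad hz.memLp_grad fun ε hε => ⟨1, one_pos, fun t _ => ?_⟩
  have hvt : ContinuousOn (fun x => v x + t * z x) (closure Ω) :=
    h.cont_v.add (continuousOn_const.mul hzc)
  -- The shift leaves the gradient unchanged, and it disappears from the first-order term because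
  -- the moment of `(u, v)` is zero. No bound on `c` is needed.
  obtain ⟨c, hc⟩ := exists_shift ho hb (by linarith : 0 ≤ α) hβ h.cont_u hvt
  have hpair : RegularPair Ω p q u (fun x => v x + t * z x + c) Gu (Gv + t • Z) :=
    ⟨h.cont_u, hvt.add continuousOn_const, h.pair_u,
      (h.pair_v.add (hz.const_smul t) hb hq1).add_const ho hb hq1 c, h.zero_u⟩
  have h1 := hpair.le_energy hN hΩ hE hc
  have hzt : ContinuousOn (fun x => t * z x + c) (closure Ω) :=
    (continuousOn_const.mul hzc).add continuousOn_const
  have h2 := coupling_le_coupling_shift ho hb (by linarith : 0 ≤ α) hβ h.cont_u h.cont_v hzt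
  have i1 : IntegrableOn (fun x => |u x| ^ α * signedPow β (v x) * z x) Ω :=
    integrableOn_of_continuousOn ho hb
      ((continuousOn_moment (by linarith : 0 ≤ α) hβ h.cont_u h.cont_v).mul hzc)
  have i2 := integrableOn_of_continuousOn ho hb
    (continuousOn_moment (by linarith : 0 ≤ α) hβ h.cont_u h.cont_v)
  have e1 : ∫ x in Ω, |u x| ^ α * signedPow β (v x) * (t * z x + c) =
      t * ∫ x in Ω, |u x| ^ α * signedPow β (v x) * z x := by
    have e2 : ∫ x in Ω, |u x| ^ α * signedPow β (v x) * (t * z x + c) =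
        (∫ x in Ω, t * (|u x| ^ α * signedPow β (v x) * z x)) +
          ∫ x in Ω, c * (|u x| ^ α * signedPow β (v x)) := by
      rw [← integral_add (i1.const_mul t) (i2.const_mul c)]
      congr 1; ext x; ring
    have hm' : ∫ x in Ω, |u x| ^ α * signedPow β (v x) = 0 := hm
    rw [e2, integral_const_mul, integral_const_mul, hm', mul_zero, add_zero]
  have e3 : (fun x => v x + (t * z x + c)) = fun x => v x + t * z x + c := by ext x; ring
  rw [e1, hJ, e3] at h2
  have h3 := mul_le_mul_of_nonneg_left h2 hlam
  have h4 : energy Ω p q Gu (Gv + t • Z) - energy Ω p q Gu Gv =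
      (∫ x in Ω, ‖Gv x + t • Z x‖ ^ q / q) - ∫ x in Ω, ‖Gv x‖ ^ q / q := by
    simp only [energy, Pi.add_apply, Pi.smul_apply]
    ring
  rw [← h4, hmin]
  have h5 : 0 ≤ ε * |t| := by positivity
  linarith

/-- Minimizers satisfy the Euler-Lagrange equation for the first component. -/
lemma RegularPair.eq_u (hN : 1 ≤ N) (hΩ : IsSmoothBoundedDomain Ω) {p q α β : ℝ}
    (hE : LargeExponents N p q α β) {u v Gu Gv} (h : RegularPair Ω p q u v Gu Gv)
    (hm : moment Ω α β u v = 0) (hJ : coupling Ω α β u v = 1)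
    (hmin : energy Ω p q Gu Gv = firstEigenvalue Ω p q α β) {w W}
    (hw : SobolevPair Ω (ENNReal.ofReal p) w W) (hwc : ContinuousOn w (closure Ω))
    (hw0 : ∀ x ∈ frontier Ω, w x = 0) :
    ∫ x in Ω, ‖Gu x‖ ^ (p - 2) * inner ℝ (Gu x) (W x) =
      firstEigenvalue Ω p q α β * α * ∫ x in Ω, signedPow α (u x) * w x * |v x| ^ β := by
  have ho := hΩ.isOpen
  have hb := hΩ.isBounded
  have hp := hE.two_le_p hN
  have hp1 := one_le_ofReal_of_two_le hp
  have hq := hE.two_le_q hN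
  have hq1 := one_le_ofReal_of_two_le hq
  have hα := hE.hα
  have hβ := hE.hβ
  set lam := firstEigenvalue Ω p q α β with hlamdef
  have hlam : 0 ≤ lam := firstEigenvalue_nonneg (by linarith) (by linarith)
  have hne : ∃ x ∈ Ω, u x ≠ 0 := by
    obtain ⟨x, hx, h1, -⟩ := exists_ne_zero_of_coupling_ne_zero (by linarith : 0 < α)
      (by linarith : 0 < β) (hJ ▸ one_ne_zero : coupling Ω α β u v ≠ 0)
    exact ⟨x, hx, h1⟩
  set g : Euc N → ℝ := fun x => signedPow α (u x) * w x with hg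
  have hgc : ContinuousOn g (closure Ω) :=
    ((continuous_signedPow hα).comp_continuousOn h.cont_u).mul hwc
  refine first_variation hp h.pair_u.memLp_grad hw.memLp_grad fun ε hε => ?_
  -- continuity of the weight in the shift
  have hΨ : Continuous (Function.uncurry fun a b : ℝ => a * |b| ^ β) :=
    continuous_fst.mul ((continuous_abs_rpow (by linarith : 0 ≤ β)).comp continuous_snd)
  have hconst : ∀ {ι : Type} (l : Filter ι) (f : Euc N → ℝ),
      TendstoUniformlyOn (fun (_ : ι) => f) f l (closure Ω) := by
    intro ι l f
    rw [Metric.tendstoUniformlyOn_iff]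
    exact fun ε hε => Eventually.of_forall fun c x _ => by simpa using hε
  -- Here the shift `c` stays inside the first-order term through the weight `|v + c| ^ β`, so
  -- unlike in the second equation it must be small when `t` is small.
  have hcontI : Tendsto (fun c : ℝ => ∫ x in Ω, g x * |v x + c| ^ β) (𝓝 0)
      (𝓝 (∫ x in Ω, g x * |v x + 0| ^ β)) :=
    tendsto_integral_comp ho hb hΨ (u := fun _ => g) (v := fun c x => v x + c)
      (Eventually.of_forall fun _ => hgc)
      (Eventually.of_forall fun c => h.cont_v.add continuousOn_const) hgc
      (h.cont_v.add continuousOn_const) (hconst _ _) (tendstoUniformlyOn_add_const v _ 0)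
  simp only [add_zero] at hcontI
  set I₀ := ∫ x in Ω, g x * |v x| ^ β with hI₀
  -- Chosen so that `lam * α * ε' ≤ ε`; the summand `1` keeps the denominator positive if `lam = 0`.
  set ε' := ε / (lam * α + 1) with hε'
  have hden : 0 < lam * α + 1 := by positivity
  have hε'0 : 0 < ε' := by positivity
  obtain ⟨η, hη, hηI⟩ := Metric.eventually_nhds_iff.1
    (hcontI.eventually (Metric.ball_mem_nhds I₀ hε'0))
  -- the shift is small for small perturbations
  set η' := η / 2 with hη'
  have hη'0 : 0 < η' := half_pos hη
  -- At `t = 0` the shifts `η'` and `-η'` give moments of opposite strict signs. This persists for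
  -- small `t`, so a restoring shift exists between them.
  have hup : 0 < moment Ω α β u (fun x => v x + η') := by
    rw [← hm]
    exact moment_lt_moment ho hb (by linarith) hβ h.cont_u h.cont_v
      (h.cont_v.add continuousOn_const) (fun x _ => by linarith) hne
  have hdown : moment Ω α β u (fun x => v x + -η') < 0 := by
    rw [← hm]
    exact moment_lt_moment ho hb (by linarith) hβ h.cont_u
      (h.cont_v.add continuousOn_const) h.cont_v (fun x _ => by linarith) hne
  have hΨ2 : Continuous (Function.uncurry fun a b : ℝ => |a| ^ α * signedPow β b) :=
    ((continuous_abs_rpow (by linarith : 0 ≤ α)).comp continuous_fst).mul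
      ((continuous_signedPow hβ).comp continuous_snd)
  have hut : ∀ t : ℝ, ContinuousOn (fun x => u x + t * w x) (closure Ω) := fun t =>
    h.cont_u.add (continuousOn_const.mul hwc)
  have hul : TendstoUniformlyOn (fun (t : ℝ) x => u x + t * w x) u (𝓝 0) (closure Ω) := by
    obtain ⟨B, hB⟩ := hb.isCompact_closure.exists_bound_of_continuousOn hwc
    rw [Metric.tendstoUniformlyOn_iff]
    intro ε hε
    have hB1 : 0 < |B| + 1 := by positivity
    filter_upwards [Metric.ball_mem_nhds (0 : ℝ) (div_pos hε hB1)] with t ht x hx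
    rw [Metric.mem_ball, dist_zero_right, Real.norm_eq_abs, lt_div_iff₀ hB1] at ht
    rw [dist_comm, Real.dist_eq, add_sub_cancel_left, abs_mul]
    refine lt_of_le_of_lt ?_ ht
    gcongr
    exact ((hB x hx).trans (le_abs_self B)).trans (by linarith)
  have hmt : ∀ c : ℝ, Tendsto (fun t : ℝ => moment Ω α β (fun x => u x + t * w x)
      (fun x => v x + c)) (𝓝 0) (𝓝 (moment Ω α β u (fun x => v x + c))) := fun c =>
    tendsto_integral_comp ho hb hΨ2 (u := fun t x => u x + t * w x) (v := fun _ x => v x + c)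
      (Eventually.of_forall hut) (Eventually.of_forall fun _ => h.cont_v.add continuousOn_const)
      h.cont_u (h.cont_v.add continuousOn_const) hul (hconst _ _)
  obtain ⟨δ, hδ, hδm⟩ := Metric.eventually_nhds_iff.1
    (((hmt η').eventually (lt_mem_nhds hup)).and ((hmt (-η')).eventually (gt_mem_nhds hdown)))
  refine ⟨δ, hδ, fun t ht => ?_⟩
  obtain ⟨m1, m2⟩ := hδm (y := t) (by rwa [dist_zero_right, Real.norm_eq_abs])
  obtain ⟨c, hc, hc0⟩ := intermediate_value_Icc (a := -η') (b := η') (by linarith)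
    (continuous_moment_shift ho hb (by linarith : 0 ≤ α) hβ (hut t) h.cont_v).continuousOn
    ⟨m2.le, m1.le⟩
  have hcη : dist c 0 < η := by
    rw [dist_zero_right, Real.norm_eq_abs]
    exact (abs_le.2 hc).trans_lt (half_lt_self hη)
  have hpair : RegularPair Ω p q (fun x => u x + t * w x) (fun x => v x + c) (Gu + t • W) Gv :=
    ⟨hut t, h.cont_v.add continuousOn_const, h.pair_u.add (hw.const_smul t) hb hp1,
      h.pair_v.add_const ho hb hq1 c, fun x hx => by rw [h.zero_u x hx, hw0 x hx]; simp⟩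
  have h1 := hpair.le_energy hN hΩ hE hc0
  have h2 := moment_shift_le_coupling ho hb hα (by linarith : 0 ≤ β) h.cont_u
    (v := fun x => v x + c) (w := fun x => t * w x)
    (h.cont_v.add (continuousOn_const (c := c))) (continuousOn_const (c := t) |>.mul hwc)
  -- With zero moment the shift alone cannot bring the coupling below one.
  have h3 := coupling_le_coupling_shift ho hb (by linarith : 0 ≤ α) hβ h.cont_u h.cont_v
    (continuousOn_const (c := c))
  rw [integral_mul_const] at h3
  have hm' : ∫ x in Ω, |u x| ^ α * signedPow β (v x) = 0 := hm
  rw [hm', zero_mul, mul_zero, add_zero, hJ] at h3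
  have e1 : ∫ x in Ω, signedPow α (u x) * (t * w x) * |v x + c| ^ β =
      t * ∫ x in Ω, g x * |v x + c| ^ β := by
    rw [← integral_const_mul]
    congr 1; ext x; simp only [hg]; ring
  have h2' : 1 + α * (t * ∫ x in Ω, g x * |v x + c| ^ β) ≤
      coupling Ω α β (fun x => u x + t * w x) (fun x => v x + c) := by
    rw [← e1]
    exact (add_le_add h3 le_rfl).trans h2
  have h4 := hηI hcη
  rw [Real.dist_eq] at h4
  have h5 : t * I₀ - |t| * ε' ≤ t * ∫ x in Ω, g x * |v x + c| ^ β := by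
    have : |t * ((∫ x in Ω, g x * |v x + c| ^ β) - I₀)| ≤ |t| * ε' := by
      rw [abs_mul]
      gcongr
    have := (abs_le.1 this).1
    linarith
  have h6 : lam * (1 + α * (t * I₀ - |t| * ε')) ≤ energy Ω p q (Gu + t • W) Gv := by
    refine le_trans (mul_le_mul_of_nonneg_left ?_ hlam) h1
    refine le_trans ?_ h2'
    gcongr
  have h7 : energy Ω p q (Gu + t • W) Gv - energy Ω p q Gu Gv =
      (∫ x in Ω, ‖Gu x + t • W x‖ ^ p / p) - ∫ x in Ω, ‖Gu x‖ ^ p / p := by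
    simp only [energy, Pi.add_apply, Pi.smul_apply]
    ring
  rw [← h7, hmin]
  have h8 : lam * α * ε' ≤ ε := by
    rw [hε', mul_div_assoc', div_le_iff₀ hden]
    nlinarith
  have h9 : lam * α * ε' * |t| ≤ ε * |t| := by gcongr
  linarith

end

section

variable {N : ℕ} {Ω : Set (Euc N)}

/-! ### Compactness and existence of minimizers -/

lemma eLpNorm_toReal_le (hb : Bornology.IsBounded Ω) {r p : ℝ} (hr : 0 < r) (hrp : r ≤ p)
    {G : Euc N → Euc N} (hG : MemLp G (ENNReal.ofReal p) (volume.restrict Ω)) :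
    (eLpNorm G (ENNReal.ofReal r) (volume.restrict Ω)).toReal ≤
      (∫ x in Ω, ‖G x‖ ^ p) ^ (1 / p) * volume.real Ω ^ (1 / r - 1 / p) := by
  have hfin := isFiniteMeasure_restrict hb
  have hp : 0 < p := hr.trans_le hrp
  have h := eLpNorm_le_eLpNorm_mul_rpow_measure_univ (ENNReal.ofReal_le_ofReal hrp)
    hG.aestronglyMeasurable
  rw [eLpNorm_eq_ofReal_integral hp hG, ENNReal.toReal_ofReal hr.le,
    ENNReal.toReal_ofReal hp.le, Measure.restrict_apply_univ] at h
  have hV : volume Ω ≠ ⊤ := hb.measure_lt_top.ne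
  have h0 : 0 ≤ 1 / r - 1 / p := sub_nonneg.2 (one_div_le_one_div_of_le hr hrp)
  have h2 := ENNReal.toReal_mono
    (ENNReal.mul_ne_top ENNReal.ofReal_ne_top (ENNReal.rpow_ne_top_of_nonneg h0 hV)) h
  rwa [ENNReal.toReal_mul, ENNReal.toReal_ofReal
    (Real.rpow_nonneg (integral_nonneg fun x => by positivity) _), ← ENNReal.toReal_rpow] at h2

/-- The volume enters with the exponent `1 / (2N) - 1 / p`, which lies in `[0, 1]`, so the constant
is uniform in `p`. -/
lemma gradNorm_le (hN : 1 ≤ N) (hb : Bornology.IsBounded Ω) {p : ℝ} (hp : 2 * N ≤ p)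
    {G : Euc N → Euc N} (hG : MemLp G (ENNReal.ofReal p) (volume.restrict Ω)) :
    gradNorm Ω G ≤ (∫ x in Ω, ‖G x‖ ^ p) ^ (1 / p) * max 1 (volume.real Ω) := by
  have hN' : (1 : ℝ) ≤ N := by exact_mod_cast hN
  refine (eLpNorm_toReal_le hb (by linarith) hp hG).trans ?_
  refine mul_le_mul_of_nonneg_left ?_ (Real.rpow_nonneg (integral_nonneg fun x => by positivity) _)
  have h0 : 0 ≤ 1 / (2 * (N : ℝ)) - 1 / p :=
    sub_nonneg.2 (one_div_le_one_div_of_le (by linarith) hp)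
  have h1 : 1 / (2 * (N : ℝ)) - 1 / p ≤ 1 := by
    have : 1 / (2 * (N : ℝ)) ≤ 1 := by rw [div_le_one (by linarith)]; linarith
    have : 0 ≤ 1 / p := by apply one_div_nonneg.2; linarith
    linarith
  calc volume.real Ω ^ (1 / (2 * (N : ℝ)) - 1 / p)
      ≤ (max 1 (volume.real Ω)) ^ (1 / (2 * (N : ℝ)) - 1 / p) :=
        Real.rpow_le_rpow measureReal_nonneg (le_max_right _ _) h0
    _ ≤ (max 1 (volume.real Ω)) ^ (1 : ℝ) :=
        Real.rpow_le_rpow_of_exponent_le (le_max_left _ _) h1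
    _ = _ := Real.rpow_one _

lemma IsSmoothBoundedDomain.frontier_nonempty (hN : 1 ≤ N) (hΩ : IsSmoothBoundedDomain Ω) :
    (frontier Ω).Nonempty := by
  have : Nonempty (Fin N) := ⟨⟨0, hN⟩⟩
  refine nonempty_frontier_iff.2 ⟨hΩ.isConnected.nonempty, fun h => ?_⟩
  exact NormedSpace.unbounded_univ ℝ (Euc N) (h ▸ hΩ.isBounded)

/-- Without a zero, `v` would have one sign on the connected set `Ω` and the moment could not
vanish. The zero anchors `v`, so the oscillation bound becomes a bound on `v` itself; for `u` the
boundary values play this role. -/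
lemma exists_zero_of_moment_eq_zero (hΩ : IsSmoothBoundedDomain Ω) {α β : ℝ} (hα : 0 < α)
    (hβ : 2 ≤ β) {u v : Euc N → ℝ} (hu : ContinuousOn u (closure Ω))
    (hv : ContinuousOn v (closure Ω)) (hne : ∃ x ∈ Ω, u x ≠ 0) (hm : moment Ω α β u v = 0) :
    ∃ x ∈ Ω, v x = 0 := by
  by_contra! hcon
  obtain ⟨x₀, hx₀, hux₀⟩ := hne
  have hpos : ∀ v : Euc N → ℝ, ContinuousOn v (closure Ω) → moment Ω α β u v = 0 →
      (∀ x ∈ Ω, v x ≠ 0) → 0 < v x₀ → False := by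
    intro v hv hm hcon h0
    have hall : ∀ x ∈ Ω, 0 < v x := by
      intro x hx
      by_contra! hle
      obtain ⟨y, hy, hy0⟩ := hΩ.isConnected.isPreconnected.intermediate_value hx hx₀
        (hv.mono subset_closure) ⟨hle, h0.le⟩
      exact hcon y hy hy0
    refine (integral_pos_of_exists_pos hΩ.isOpen hΩ.isBounded (continuousOn_moment hα.le hβ hu hv)
      (fun x hx => mul_nonneg (by positivity) (signedPow_pos hβ (hall x hx)).le) hx₀ ?_).ne' hm
    have := abs_pos.2 hux₀
    exact mul_pos (by positivity) (signedPow_pos hβ h0)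
  rcases lt_or_gt_of_ne (hcon x₀ hx₀) with h | h
  · refine hpos (fun x => -v x) hv.neg ?_ (fun x hx => neg_ne_zero.2 (hcon x hx)) (by linarith)
    simp only [moment, signedPow_neg, mul_neg, integral_neg]
    exact neg_eq_zero.2 hm
  · exact hpos v hv hm hcon h

/-- Bounded sequences of pairs have uniformly convergent subsequences. -/
lemma exists_subseq_regularPair (hN : 1 ≤ N) (hΩ : IsSmoothBoundedDomain Ω) {p q : ℕ → ℝ}
    (hp : ∀ k, 2 * N ≤ p k) (hq : ∀ k, 2 * N ≤ q k) {u v : ℕ → Euc N → ℝ}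
    {Gu Gv : ℕ → Euc N → Euc N} (h : ∀ k, RegularPair Ω (p k) (q k) (u k) (v k) (Gu k) (Gv k))
    {M : ℝ} (hMu : ∀ k, gradNorm Ω (Gu k) ≤ M) (hMv : ∀ k, gradNorm Ω (Gv k) ≤ M)
    (hz : ∀ k, ∃ x ∈ Ω, v k x = 0) :
    ∃ φ : ℕ → ℕ, StrictMono φ ∧ ∃ u₀ v₀, ContinuousOn u₀ (closure Ω) ∧
      ContinuousOn v₀ (closure Ω) ∧ TendstoUniformlyOn (fun j => u (φ j)) u₀ atTop (closure Ω) ∧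
      TendstoUniformlyOn (fun j => v (φ j)) v₀ atTop (closure Ω) ∧
      ∀ x ∈ frontier Ω, u₀ x = 0 := by
  have hb := hΩ.isBounded
  obtain ⟨C, hC0, hC⟩ := exists_oscillation_bound hN hΩ
  obtain ⟨y, hy⟩ := hΩ.frontier_nonempty hN
  have hu : ∀ k, SobolevPair Ω (morreyExp N) (u k) (Gu k) := fun k =>
    (h k).pair_u.mono_exponent hb (morreyExp_le (hp k))
  have hv : ∀ k, SobolevPair Ω (morreyExp N) (v k) (Gv k) := fun k =>
    (h k).pair_v.mono_exponent hb (morreyExp_le (hq k))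
  have hBu : ∀ k, ∀ x ∈ closure Ω, |u k x| ≤ C * M := by
    intro k x hx
    have := hC _ _ (hu k) (h k).cont_u x hx y (frontier_subset_closure hy)
    rw [(h k).zero_u y hy, sub_zero] at this
    exact this.trans (by gcongr; exact hMu k)
  have hBv : ∀ k, ∀ x ∈ closure Ω, |v k x| ≤ C * M := by
    intro k x hx
    obtain ⟨z, hz, hz0⟩ := hz k
    have := hC _ _ (hv k) (h k).cont_v x hx z (subset_closure hz)
    rw [hz0, sub_zero] at this
    exact this.trans (by gcongr; exact hMv k)
  obtain ⟨φ, hφ, u₀, hu₀, hul⟩ := exists_subseq_tendstoUniformlyOn hN hΩ hu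
    (fun k => (h k).cont_u) hMu hBu
  obtain ⟨ψ, hψ, v₀, hv₀, hvl⟩ := exists_subseq_tendstoUniformlyOn hN hΩ (fun k => hv (φ k))
    (fun k => (h (φ k)).cont_v) (fun k => hMv (φ k)) (fun k => hBv (φ k))
  have hul' : TendstoUniformlyOn (fun j => u (φ (ψ j))) u₀ atTop (closure Ω) :=
    fun s hs => hψ.tendsto_atTop.eventually (hul s hs)
  refine ⟨φ ∘ ψ, hφ.comp hψ, u₀, v₀, hu₀, hv₀, hul', hvl, fun x hx => ?_⟩
  have h1 := hul'.tendsto_at (frontier_subset_closure hx)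
  refine tendsto_nhds_unique h1 ?_
  simp only [(h _).zero_u x hx]
  exact tendsto_const_nhds

/-- Lower semicontinuity of the Dirichlet integral under uniform convergence. -/
lemma sobolevPair_of_tendstoUniformlyOn (ho : IsOpen Ω) (hb : Bornology.IsBounded Ω) {r : ℝ}
    (hr : 2 ≤ r) {u₀ : Euc N → ℝ} {w : ℕ → Euc N → ℝ} {G : ℕ → Euc N → Euc N}
    (hc : ContinuousOn u₀ (closure Ω))
    (h : ∀ᶠ k in atTop, SobolevPair Ω (ENNReal.ofReal r) (w k) (G k))
    (hlim : TendstoUniformlyOn w u₀ atTop (closure Ω)) {a : ℝ}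
    (ha : ∀ ε > 0, ∀ᶠ k in atTop, ∫ x in Ω, ‖G k x‖ ^ r ≤ a + ε) :
    SobolevPair Ω (ENNReal.ofReal r) u₀ (weakGrad Ω u₀) ∧
      ∫ x in Ω, ‖weakGrad Ω u₀ x‖ ^ r ≤ a := by
  have hr1 : 1 ≤ ENNReal.ofReal r := one_le_ofReal_of_two_le hr
  -- The gradient `weakGrad Ω u₀` is the same for every `ε`, so the slack can be removed at the end.
  have key : ∀ ε > 0, SobolevPair Ω (ENNReal.ofReal r) u₀ (weakGrad Ω u₀) ∧
      ∫ x in Ω, ‖weakGrad Ω u₀ x‖ ^ r ≤ a + ε := by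
    intro ε hε
    have hsel : ∀ j : ℕ, ∃ k, SobolevPair Ω (ENNReal.ofReal r) (w k) (G k) ∧
        (∫ x in Ω, ‖G k x‖ ^ r ≤ a + ε) ∧ ∀ x ∈ closure Ω, dist (u₀ x) (w k x) < 1 / (j + 1) :=
      fun j => (h.and ((ha ε hε).and
        (Metric.tendstoUniformlyOn_iff.1 hlim _ Nat.one_div_pos_of_nat))).exists
    choose k hk1 hk2 hk3 using hsel
    obtain ⟨H, hH, hHM⟩ := sobolevPair_limit hr hb (memLp_of_continuousOn ho hb hc _) hk1
      (tendsto_eLpNorm_of_bound ho hb tendsto_one_div_add_atTop_nhds_zero_nat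
        fun j x hx => (Real.dist_eq _ _ ▸ hk3 j x (subset_closure hx)).le) hk2
    have hae := hH.weakGrad_ae_eq ho hb hr1
    refine ⟨hH.congr (Filter.EventuallyEq.refl _ _) hae.symm, le_trans (le_of_eq ?_) hHM⟩
    exact integral_congr_ae (by filter_upwards [hae] with x hx; rw [hx])
  exact ⟨(key 1 one_pos).1, le_of_forall_pos_le_add fun ε hε => (key ε hε).2⟩

/-! ### Reduction to normalized pairs and the direct method. -/

lemma coupling_congr {α β : ℝ} {u v u' v' : Euc N → ℝ} (hu : u =ᵐ[volume.restrict Ω] u')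
    (hv : v =ᵐ[volume.restrict Ω] v') : coupling Ω α β u v = coupling Ω α β u' v' :=
  integral_congr_ae (by filter_upwards [hu, hv] with x h1 h2; rw [h1, h2])

lemma moment_congr {α β : ℝ} {u v u' v' : Euc N → ℝ} (hu : u =ᵐ[volume.restrict Ω] u')
    (hv : v =ᵐ[volume.restrict Ω] v') : moment Ω α β u v = moment Ω α β u' v' :=
  integral_congr_ae (by filter_upwards [hu, hv] with x h1 h2; rw [h1, h2])

lemma coupling_pos (ho : IsOpen Ω) (hb : Bornology.IsBounded Ω) {α β : ℝ} (hα : 0 ≤ α)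
    (hβ : 0 ≤ β) {u v : Euc N → ℝ} (hu : ContinuousOn u (closure Ω))
    (hv : ContinuousOn v (closure Ω)) (hne : ∃ x ∈ Ω, u x * v x ≠ 0) :
    0 < coupling Ω α β u v := by
  obtain ⟨x, hx, hxne⟩ := hne
  refine integral_pos_of_exists_pos ho hb (continuousOn_coupling hα hβ hu hv)
    (fun x _ => by positivity) hx ?_
  have h1 := abs_pos.2 (left_ne_zero_of_mul hxne)
  have h2 := abs_pos.2 (right_ne_zero_of_mul hxne)
  positivity

lemma signedPow_mul {β s t : ℝ} (hs : 0 < s) :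
    signedPow β (s * t) = s ^ (β - 1) * signedPow β t := by
  rw [signedPow, signedPow, abs_mul, abs_of_pos hs, Real.mul_rpow hs.le (abs_nonneg t),
    show β - 1 = (β - 2) + 1 by ring, Real.rpow_add hs, Real.rpow_one]
  ring

/-- Scaling to coupling one. -/
lemma RegularPair.normalize {p q α β : ℝ} (hp : 0 < p) (hq : 0 < q) (hsum : α / p + β / q = 1)
    {u v Gu Gv} (h : RegularPair Ω p q u v Gu Gv) (hJ : 0 < coupling Ω α β u v)
    (hm : moment Ω α β u v = 0) :
    ∃ s t : ℝ, 0 < s ∧ 0 < t ∧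
      RegularPair Ω p q (fun x => s * u x) (fun x => t * v x) (s • Gu) (t • Gv) ∧
      coupling Ω α β (fun x => s * u x) (fun x => t * v x) = 1 ∧
      moment Ω α β (fun x => s * u x) (fun x => t * v x) = 0 ∧
      energy Ω p q (s • Gu) (t • Gv) = energy Ω p q Gu Gv / coupling Ω α β u v := by
  set J := coupling Ω α β u v with hJdef
  have hJi : 0 < J⁻¹ := inv_pos.2 hJ
  -- With the factors `J ^ (-1/p)` and `J ^ (-1/q)` both energies are multiplied by `J⁻¹`, and so is
  -- the coupling because `α / p + β / q = 1`. Thus the quotient is invariant.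
  have hs : 0 < J⁻¹ ^ (1 / p) := by positivity
  have ht : 0 < J⁻¹ ^ (1 / q) := by positivity
  have hsp : (J⁻¹ ^ (1 / p)) ^ p = J⁻¹ := by
    rw [← Real.rpow_mul hJi.le, one_div_mul_cancel hp.ne', Real.rpow_one]
  have htq : (J⁻¹ ^ (1 / q)) ^ q = J⁻¹ := by
    rw [← Real.rpow_mul hJi.le, one_div_mul_cancel hq.ne', Real.rpow_one]
  have hst : (J⁻¹ ^ (1 / p)) ^ α * (J⁻¹ ^ (1 / q)) ^ β = J⁻¹ := by
    rw [← Real.rpow_mul hJi.le, ← Real.rpow_mul hJi.le, ← Real.rpow_add hJi,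
      show 1 / p * α + 1 / q * β = α / p + β / q by ring, hsum, Real.rpow_one]
  refine ⟨J⁻¹ ^ (1 / p), J⁻¹ ^ (1 / q), hs, ht,
    ⟨continuousOn_const.mul h.cont_u, continuousOn_const.mul h.cont_v, h.pair_u.const_smul _,
      h.pair_v.const_smul _, fun x hx => by rw [h.zero_u x hx, mul_zero]⟩, ?_, ?_, ?_⟩
  · have e : ∀ x, |J⁻¹ ^ (1 / p) * u x| ^ α * |J⁻¹ ^ (1 / q) * v x| ^ β =
        J⁻¹ * (|u x| ^ α * |v x| ^ β) := by
      intro x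
      rw [abs_mul, abs_mul, abs_of_pos hs, abs_of_pos ht, Real.mul_rpow hs.le (abs_nonneg _),
        Real.mul_rpow ht.le (abs_nonneg _), mul_mul_mul_comm, hst]
    rw [coupling]
    simp only [e]
    rw [integral_const_mul]
    exact inv_mul_cancel₀ hJ.ne'
  · have e : ∀ x, |J⁻¹ ^ (1 / p) * u x| ^ α * signedPow β (J⁻¹ ^ (1 / q) * v x) =
        ((J⁻¹ ^ (1 / p)) ^ α * (J⁻¹ ^ (1 / q)) ^ (β - 1)) * (|u x| ^ α * signedPow β (v x)) := by
      intro x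
      rw [abs_mul, abs_of_pos hs, Real.mul_rpow hs.le (abs_nonneg _), signedPow_mul ht]
      ring
    rw [moment]
    simp only [e]
    rw [integral_const_mul]
    exact mul_eq_zero_of_right _ hm
  · have e1 : ∀ x, ‖(J⁻¹ ^ (1 / p) • Gu) x‖ ^ p / p = J⁻¹ * (‖Gu x‖ ^ p / p) := by
      intro x
      rw [Pi.smul_apply, norm_smul, Real.norm_eq_abs, abs_of_pos hs,
        Real.mul_rpow hs.le (norm_nonneg _), hsp]
      ring
    have e2 : ∀ x, ‖(J⁻¹ ^ (1 / q) • Gv) x‖ ^ q / q = J⁻¹ * (‖Gv x‖ ^ q / q) := by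
      intro x
      rw [Pi.smul_apply, norm_smul, Real.norm_eq_abs, abs_of_pos ht,
        Real.mul_rpow ht.le (norm_nonneg _), htq]
      ring
    rw [energy]
    simp only [e1, e2]
    rw [integral_const_mul, integral_const_mul, ← mul_add, mul_comm, ← div_eq_mul_inv]
    rfl

/-- Admissible pairs may be replaced by normalized ones with nonnegative first component. -/
lemma Admissible.exists_normalized (hN : 1 ≤ N) (hΩ : IsSmoothBoundedDomain Ω) {p q α β : ℝ}
    (hE : LargeExponents N p q α β) {u v : Euc N → ℝ} (h : Admissible Ω p q α β u v) :
    ∃ u' v' Gu Gv, RegularPair Ω p q u' v' Gu Gv ∧ coupling Ω α β u' v' = 1 ∧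
      moment Ω α β u' v' = 0 ∧ energy Ω p q Gu Gv ≤ rayleigh Ω p q α β u v ∧ ∀ x, 0 ≤ u' x := by
  have ho := hΩ.isOpen
  have hb := hΩ.isBounded
  have hp := hE.two_le_p hN
  have hq := hE.two_le_q hN
  have hα := hE.hα
  have hβ := hE.hβ
  obtain ⟨u₁, hu₁c, hu₁, hu₁p, hu₁0⟩ := h.1.exists_rep hN hΩ hE.hp
  obtain ⟨v₁, hv₁c, hv₁, hv₁p⟩ := h.2.1.exists_rep hN hΩ hE.hq
  -- Coupling and moment see only `|u|`, and the energy does not increase when `u` is replaced by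
  -- `|u|`.
  obtain ⟨H, hH, hHle⟩ := hu₁p.abs ho hb hp
  have hne : ∃ x ∈ Ω, |u₁ x| * v₁ x ≠ 0 := by
    by_contra! hcon
    refine h.2.2.1 ?_
    filter_upwards [hu₁, hv₁, ae_restrict_mem ho.measurableSet] with x h1 h2 hx
    rw [← h1, ← h2]
    have := hcon x hx
    rcases mul_eq_zero.1 this with h0 | h0
    · rw [abs_eq_zero.1 h0, zero_mul]
    · rw [h0, mul_zero]
  have hR : RegularPair Ω p q (fun x => |u₁ x|) v₁ H (weakGrad Ω v) :=
    ⟨hu₁c.abs, hv₁c, hH, hv₁p, fun x hx => by rw [hu₁0 x hx, abs_zero]⟩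
  have hJ := coupling_pos ho hb (by linarith : 0 ≤ α) (by linarith : 0 ≤ β) hu₁c.abs hv₁c hne
  have eJ : coupling Ω α β (fun x => |u₁ x|) v₁ = coupling Ω α β u v := by
    rw [← coupling_congr hu₁ hv₁]
    simp only [coupling, abs_abs]
  have hm : moment Ω α β (fun x => |u₁ x|) v₁ = 0 := by
    have : moment Ω α β (fun x => |u₁ x|) v₁ = moment Ω α β u v := by
      rw [← moment_congr hu₁ hv₁]
      simp only [moment, abs_abs]
    rw [this]
    exact h.2.2.2
  obtain ⟨s, t, hs, -, hreg, hc1, hm1, hen⟩ :=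
    hR.normalize (by linarith) (by linarith) hE.hsum hJ hm
  refine ⟨_, _, _, _, hreg, hc1, hm1, ?_, fun x => by positivity⟩
  rw [hen, eJ]
  rw [eJ] at hJ
  refine div_le_div_of_nonneg_right (add_le_add ?_ le_rfl) hJ.le
  rw [integral_div, integral_div]
  exact div_le_div_of_nonneg_right hHle (by linarith)

lemma integral_rpow_le_energy {p q : ℝ} (hp : 0 < p) (hq : 0 < q) (Gu Gv : Euc N → Euc N) :
    ∫ x in Ω, ‖Gu x‖ ^ p ≤ p * energy Ω p q Gu Gv ∧
      ∫ x in Ω, ‖Gv x‖ ^ q ≤ q * energy Ω p q Gu Gv := by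
  have h1 : 0 ≤ ∫ x in Ω, ‖Gu x‖ ^ p := integral_nonneg fun x => by positivity
  have h2 : 0 ≤ ∫ x in Ω, ‖Gv x‖ ^ q := integral_nonneg fun x => by positivity
  simp only [energy, integral_div]
  constructor
  · rw [mul_add, mul_div_cancel₀ _ hp.ne']
    exact le_add_of_nonneg_right (by positivity)
  · rw [mul_add, mul_div_cancel₀ _ hq.ne']
    exact le_add_of_nonneg_left (by positivity)

/-- The direct method. -/
lemma exists_minimizer (hN : 1 ≤ N) (hΩ : IsSmoothBoundedDomain Ω) {p q α β : ℝ}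
    (hE : LargeExponents N p q α β) (hne : ∃ u v, Admissible Ω p q α β u v) :
    ∃ u v Gu Gv, RegularPair Ω p q u v Gu Gv ∧ coupling Ω α β u v = 1 ∧
      moment Ω α β u v = 0 ∧ energy Ω p q Gu Gv = firstEigenvalue Ω p q α β ∧
      ∀ x ∈ Ω, 0 ≤ u x := by
  have ho := hΩ.isOpen
  have hb := hΩ.isBounded
  have hp := hE.two_le_p hN
  have hq := hE.two_le_q hN
  have hp0 : 0 < p := by linarith
  have hq0 : 0 < q := by linarith
  have hα := hE.hα
  have hβ := hE.hβ
  set lam := firstEigenvalue Ω p q α β with hlam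
  have hlam0 : 0 ≤ lam := firstEigenvalue_nonneg hp0.le hq0.le
  have hsel : ∀ k : ℕ, ∃ u v Gu Gv, RegularPair Ω p q u v Gu Gv ∧ coupling Ω α β u v = 1 ∧
      moment Ω α β u v = 0 ∧ energy Ω p q Gu Gv ≤ lam + 1 / (k + 1) ∧ ∀ x, 0 ≤ u x := by
    intro k
    obtain ⟨_, ⟨u, v, hadm, rfl⟩, hlt⟩ := exists_lt_of_csInf_lt
      (s := {r | ∃ u v, Admissible Ω p q α β u v ∧ r = rayleigh Ω p q α β u v})
      (by obtain ⟨u, v, h⟩ := hne; exact ⟨_, u, v, h, rfl⟩)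
      (show lam < lam + 1 / ((k : ℝ) + 1) from lt_add_of_pos_right _ Nat.one_div_pos_of_nat)
    obtain ⟨u', v', Gu, Gv, h1, h2, h3, h4, h5⟩ := hadm.exists_normalized hN hΩ hE
    exact ⟨u', v', Gu, Gv, h1, h2, h3, h4.trans hlt.le, h5⟩
  choose u v Gu Gv hR hJ hm hen hu0 using hsel
  have hen1 : ∀ k, energy Ω p q (Gu k) (Gv k) ≤ lam + 1 := fun k =>
    (hen k).trans (by gcongr; rw [div_le_one (by positivity)]; linarith [k.cast_nonneg (α := ℝ)])
  have hlow : ∀ k, lam ≤ energy Ω p q (Gu k) (Gv k) := fun k => by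
    have := (hR k).le_energy hN hΩ hE (hm k)
    rwa [hJ, mul_one] at this
  have hIu : ∀ k, ∫ x in Ω, ‖Gu k x‖ ^ p ≤ p * (lam + 1) := fun k =>
    (integral_rpow_le_energy hp0 hq0 _ _).1.trans (by gcongr; exact hen1 k)
  have hIv : ∀ k, ∫ x in Ω, ‖Gv k x‖ ^ q ≤ q * (lam + 1) := fun k =>
    (integral_rpow_le_energy hp0 hq0 _ _).2.trans (by gcongr; exact hen1 k)
  set V := max 1 (volume.real Ω) with hV
  have hV0 : 0 ≤ V := zero_le_one.trans (le_max_left _ _)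
  set M := max ((p * (lam + 1)) ^ (1 / p) * V) ((q * (lam + 1)) ^ (1 / q) * V) with hM
  have hMu : ∀ k, gradNorm Ω (Gu k) ≤ M := fun k => by
    refine (gradNorm_le hN hb hE.hp (hR k).pair_u.memLp_grad).trans
      (le_trans ?_ (le_max_left _ _))
    gcongr
    exact hIu k
  have hMv : ∀ k, gradNorm Ω (Gv k) ≤ M := fun k => by
    refine (gradNorm_le hN hb hE.hq (hR k).pair_v.memLp_grad).trans
      (le_trans ?_ (le_max_right _ _))
    gcongr
    exact hIv k
  have hz : ∀ k, ∃ x ∈ Ω, v k x = 0 := fun k => by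
    obtain ⟨x, hx, h1, -⟩ := exists_ne_zero_of_coupling_ne_zero (by linarith : 0 < α)
      (by linarith : 0 < β) (hJ k ▸ one_ne_zero : coupling Ω α β (u k) (v k) ≠ 0)
    exact exists_zero_of_moment_eq_zero hΩ (by linarith) hβ (hR k).cont_u (hR k).cont_v
      ⟨x, hx, h1⟩ (hm k)
  obtain ⟨φ, hφ, u₀, v₀, hu₀, hv₀, hul, hvl, hzero⟩ :=
    exists_subseq_regularPair hN hΩ (fun _ => hE.hp) (fun _ => hE.hq) hR hMu hMv hz
  -- Lower semicontinuity is applied to each Dirichlet integral separately, so a further subsequence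
  -- is taken along which the first converges to `a`; the second then converges because the total
  -- energy does.
  obtain ⟨a, -, ψ, hψ, ha⟩ := isCompact_Icc.tendsto_subseq
    (x := fun j => ∫ x in Ω, ‖Gu (φ j) x‖ ^ p) (s := Icc 0 (p * (lam + 1)))
    fun j => ⟨integral_nonneg fun x => by positivity, hIu _⟩
  have hent : Tendsto (fun k => energy Ω p q (Gu k) (Gv k)) atTop (𝓝 lam) := by
    refine tendsto_of_tendsto_of_tendsto_of_le_of_le tendsto_const_nhds ?_ hlow hen
    simpa using tendsto_one_div_add_atTop_nhds_zero_nat.const_add lam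
  have hφψ : Tendsto (fun j => φ (ψ j)) atTop atTop := hφ.tendsto_atTop.comp hψ.tendsto_atTop
  have hbt : Tendsto (fun j => ∫ x in Ω, ‖Gv (φ (ψ j)) x‖ ^ q) atTop (𝓝 (q * (lam - a / p))) := by
    refine (((hent.comp hφψ).sub (ha.div_const p)).const_mul q).congr fun j => ?_
    simp only [Function.comp_apply, energy, integral_div]
    field_simp
    ring
  have hlp : ∀ {f : ℕ → ℝ} {a : ℝ}, Tendsto f atTop (𝓝 a) → ∀ ε > 0, ∀ᶠ k in atTop, f k ≤ a + ε :=
    fun hf ε hε => (hf.eventually (gt_mem_nhds (lt_add_of_pos_right _ hε))).mono fun _ => le_of_lt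
  have hul' : TendstoUniformlyOn (fun j => u (φ (ψ j))) u₀ atTop (closure Ω) :=
    fun s hs => hψ.tendsto_atTop.eventually (hul s hs)
  have hvl' : TendstoUniformlyOn (fun j => v (φ (ψ j))) v₀ atTop (closure Ω) :=
    fun s hs => hψ.tendsto_atTop.eventually (hvl s hs)
  obtain ⟨hpu, hpu'⟩ := sobolevPair_of_tendstoUniformlyOn ho hb hp hu₀
    (Eventually.of_forall fun j => (hR (φ (ψ j))).pair_u) hul' (hlp ha)
  obtain ⟨hpv, hpv'⟩ := sobolevPair_of_tendstoUniformlyOn ho hb hq hv₀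
    (Eventually.of_forall fun j => (hR (φ (ψ j))).pair_v) hvl' (hlp hbt)
  have hreg : RegularPair Ω p q u₀ v₀ (weakGrad Ω u₀) (weakGrad Ω v₀) := ⟨hu₀, hv₀, hpu, hpv, hzero⟩
  have hJ₀ : coupling Ω α β u₀ v₀ = 1 := by
    have hΨ : Continuous (Function.uncurry fun a b : ℝ => |a| ^ α * |b| ^ β) :=
      ((continuous_abs_rpow (by linarith : 0 ≤ α)).comp continuous_fst).mul
        ((continuous_abs_rpow (by linarith : 0 ≤ β)).comp continuous_snd)
    refine tendsto_nhds_unique (tendsto_integral_comp ho hb hΨ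
      (Eventually.of_forall fun j => (hR (φ j)).cont_u)
      (Eventually.of_forall fun j => (hR (φ j)).cont_v) hu₀ hv₀ hul hvl) ?_
    exact tendsto_const_nhds.congr fun j => (hJ (φ j)).symm
  have hm₀ : moment Ω α β u₀ v₀ = 0 := by
    have hΨ : Continuous (Function.uncurry fun a b : ℝ => |a| ^ α * signedPow β b) :=
      ((continuous_abs_rpow (by linarith : 0 ≤ α)).comp continuous_fst).mul
        ((continuous_signedPow hβ).comp continuous_snd)
    refine tendsto_nhds_unique (tendsto_integral_comp ho hb hΨ
      (Eventually.of_forall fun j => (hR (φ j)).cont_u)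
      (Eventually.of_forall fun j => (hR (φ j)).cont_v) hu₀ hv₀ hul hvl) ?_
    exact tendsto_const_nhds.congr fun j => (hm (φ j)).symm
  refine ⟨u₀, v₀, _, _, hreg, hJ₀, hm₀, le_antisymm ?_ ?_, fun x hx => ?_⟩
  · simp only [energy, integral_div]
    have h1 := div_le_div_of_nonneg_right hpu' hp0.le
    have h2 := div_le_div_of_nonneg_right hpv' hq0.le
    rw [mul_div_cancel_left₀ _ hq0.ne'] at h2
    linarith
  · have := hreg.le_energy hN hΩ hE hm₀
    rwa [hJ₀, mul_one] at this
  · exact ge_of_tendsto' (hul.tendsto_at (subset_closure hx)) fun j => hu0 _ x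

end

section

variable {N : ℕ} {Ω : Set (Euc N)}

/-! ### Eigenfunctions for large finite exponents -/

/-- Minimizers are eigenfunctions. -/
lemma RegularPair.isNormalizedFirstEigenfunction (hN : 1 ≤ N) (hΩ : IsSmoothBoundedDomain Ω)
    {p q α β : ℝ} (hE : LargeExponents N p q α β) {u v Gu Gv}
    (h : RegularPair Ω p q u v Gu Gv) (hm : moment Ω α β u v = 0) (hJ : coupling Ω α β u v = 1)
    (hmin : energy Ω p q Gu Gv = firstEigenvalue Ω p q α β) :
    IsNormalizedFirstEigenfunction Ω p q α β u v := by
  have ho := hΩ.isOpen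
  have hb := hΩ.isBounded
  have hp := hE.two_le_p hN
  have hq := hE.two_le_q hN
  have hGu := h.pair_u.weakGrad_ae_eq ho hb (one_le_ofReal_of_two_le hp)
  have hGv := h.pair_v.weakGrad_ae_eq ho hb (one_le_ofReal_of_two_le hq)
  have hadm := h.admissible hN hΩ hE hm (hJ ▸ one_ne_zero)
  refine ⟨⟨hadm.1, hadm.2.1, fun h0 => hadm.2.2.1 ?_, fun w hw => ?_, fun z hz => ?_⟩, hJ⟩
  · filter_upwards [h0] with x hx
    rw [hx.1, zero_mul]
  · obtain ⟨w', hw'c, hw', hw'p, hw'0⟩ := hw.exists_rep hN hΩ hE.hp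
    have e := h.eq_u hN hΩ hE hm hJ hmin hw'p hw'c hw'0
    calc _ = ∫ x in Ω, ‖Gu x‖ ^ (p - 2) * inner ℝ (Gu x) (weakGrad Ω w x) :=
          integral_congr_ae (by filter_upwards [hGu] with x hx; rw [hx])
      _ = _ := e
      _ = _ := by
          congr 1
          refine integral_congr_ae ?_
          filter_upwards [hw'] with x hx
          simp only [signedPow, hx]
          ring
  · obtain ⟨z', hz'c, hz', hz'p⟩ := hz.exists_rep hN hΩ hE.hq
    have e := h.eq_v hN hΩ hE hm hJ hmin hz'p hz'c
    calc _ = ∫ x in Ω, ‖Gv x‖ ^ (q - 2) * inner ℝ (Gv x) (weakGrad Ω z x) :=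
          integral_congr_ae (by filter_upwards [hGv] with x hx; rw [hx])
      _ = _ := e
      _ = _ := by
          congr 1
          refine integral_congr_ae ?_
          filter_upwards [hz'] with x hx
          simp only [signedPow, hx]

/-- Normalized eigenfunctions, given by continuous representatives and their gradients. -/
structure RegularEigenpair (Ω : Set (Euc N)) (p q α β lam : ℝ) (u v : Euc N → ℝ)
    (Gu Gv : Euc N → Euc N) : Prop extends RegularPair Ω p q u v Gu Gv where
  eq_u : ∀ w W, SobolevPair Ω (ENNReal.ofReal p) w W → ContinuousOn w (closure Ω) →
    (∀ x ∈ frontier Ω, w x = 0) →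
    ∫ x in Ω, ‖Gu x‖ ^ (p - 2) * inner ℝ (Gu x) (W x) =
      lam * α * ∫ x in Ω, signedPow α (u x) * |v x| ^ β * w x
  eq_v : ∀ z Z, SobolevPair Ω (ENNReal.ofReal q) z Z → ContinuousOn z (closure Ω) →
    ∫ x in Ω, ‖Gv x‖ ^ (q - 2) * inner ℝ (Gv x) (Z x) =
      lam * β * ∫ x in Ω, |u x| ^ α * signedPow β (v x) * z x
  coupling_eq : coupling Ω α β u v = 1

lemma IsNormalizedFirstEigenfunction.exists_regularEigenpair (hN : 1 ≤ N)
    (hΩ : IsSmoothBoundedDomain Ω) {p q α β : ℝ} (hE : LargeExponents N p q α β)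
    {u v : Euc N → ℝ} (h : IsNormalizedFirstEigenfunction Ω p q α β u v) :
    ∃ u' v', u' =ᵐ[volume.restrict Ω] u ∧ v' =ᵐ[volume.restrict Ω] v ∧
      RegularEigenpair Ω p q α β (firstEigenvalue Ω p q α β) u' v' (weakGrad Ω u)
        (weakGrad Ω v) := by
  have ho := hΩ.isOpen
  have hb := hΩ.isBounded
  have hp := hE.two_le_p hN
  have hq := hE.two_le_q hN
  obtain ⟨u', hu'c, hu', hu'p, hu'0⟩ := h.1.mem_u.exists_rep hN hΩ hE.hp
  obtain ⟨v', hv'c, hv', hv'p⟩ := h.1.mem_v.exists_rep hN hΩ hE.hq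
  refine ⟨u', v', hu', hv', ⟨⟨hu'c, hv'c, hu'p, hv'p, hu'0⟩, fun w W hw hwc hw0 => ?_,
    fun z Z hz hzc => ?_, (coupling_congr hu' hv').trans h.2⟩⟩
  · have hW := hw.weakGrad_ae_eq ho hb (one_le_ofReal_of_two_le hp)
    calc _ = ∫ x in Ω, ‖weakGrad Ω u x‖ ^ (p - 2) * inner ℝ (weakGrad Ω u x) (weakGrad Ω w x) :=
          integral_congr_ae (by filter_upwards [hW] with x hx; rw [hx])
      _ = _ := h.1.eq_u w (hw.memW10 ho hb hp hwc hw0)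
      _ = _ := by
          congr 1
          refine integral_congr_ae ?_
          filter_upwards [hu', hv'] with x h1 h2
          simp only [signedPow, h1, h2]
  · have hZ := hz.weakGrad_ae_eq ho hb (one_le_ofReal_of_two_le hq)
    calc _ = ∫ x in Ω, ‖weakGrad Ω v x‖ ^ (q - 2) * inner ℝ (weakGrad Ω v x) (weakGrad Ω z x) :=
          integral_congr_ae (by filter_upwards [hZ] with x hx; rw [hx])
      _ = _ := h.1.eq_v z (hz.memW1 ho hb (one_le_ofReal_of_two_le hq))
      _ = _ := by
          congr 1
          refine integral_congr_ae ?_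
          filter_upwards [hu', hv'] with x h1 h2
          simp only [signedPow, h1, h2]

lemma rpow_sub_two_mul_inner_self {F : Type*} [NormedAddCommGroup F] [InnerProductSpace ℝ F]
    {p : ℝ} (hp : 2 ≤ p) (a : F) : ‖a‖ ^ (p - 2) * inner ℝ a a = ‖a‖ ^ p := by
  rw [real_inner_self_eq_norm_sq, ← Real.rpow_two]
  rcases (norm_nonneg a).eq_or_lt with h | h
  · rw [← h, Real.zero_rpow two_ne_zero, mul_zero, Real.zero_rpow (by linarith)]
  · rw [← Real.rpow_add h, sub_add_cancel]

section

variable {p q α β lam : ℝ} {u v : Euc N → ℝ} {Gu Gv : Euc N → Euc N}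

/-- The equation tested with its own solution. Together with the analogue for `v`, it ties the
gradient norms to the eigenvalue, which is the source of compactness as the exponents grow. -/
lemma RegularEigenpair.integral_u (hN : 1 ≤ N) (hE : LargeExponents N p q α β)
    (h : RegularEigenpair Ω p q α β lam u v Gu Gv) : ∫ x in Ω, ‖Gu x‖ ^ p = lam * α := by
  have e := h.eq_u u Gu h.pair_u h.cont_u h.zero_u
  simp only [rpow_sub_two_mul_inner_self (hE.two_le_p hN)] at e
  rw [e]
  have : ∫ x in Ω, signedPow α (u x) * |v x| ^ β * u x = coupling Ω α β u v :=
    integral_congr_ae (Eventually.of_forall fun x => by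
      simp only [← signedPow_mul_self hE.hα (t := u x)]; ring)
  rw [this, h.coupling_eq, mul_one]

lemma RegularEigenpair.integral_v (hN : 1 ≤ N) (hE : LargeExponents N p q α β)
    (h : RegularEigenpair Ω p q α β lam u v Gu Gv) : ∫ x in Ω, ‖Gv x‖ ^ q = lam * β := by
  have e := h.eq_v v Gv h.pair_v h.cont_v
  simp only [rpow_sub_two_mul_inner_self (hE.two_le_q hN)] at e
  rw [e]
  have : ∫ x in Ω, |u x| ^ α * signedPow β (v x) * v x = coupling Ω α β u v :=
    integral_congr_ae (Eventually.of_forall fun x => by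
      simp only [← signedPow_mul_self hE.hβ (t := v x)]; ring)
  rw [this, h.coupling_eq, mul_one]

lemma RegularEigenpair.exists_ne_zero (ho : IsOpen Ω) (hE : LargeExponents N p q α β)
    (h : RegularEigenpair Ω p q α β lam u v Gu Gv) : ∃ x ∈ Ω, u x ≠ 0 ∧ v x ≠ 0 :=
  exists_ne_zero_of_coupling_ne_zero (by linarith [hE.hα]) (by linarith [hE.hβ])
    (h.coupling_eq ▸ one_ne_zero)

/-- If `lam ≤ 0`, the tested equation makes the gradient of `u` vanish; with zero boundary values
`u` would vanish too, against the normalization. -/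
lemma RegularEigenpair.lam_pos (hN : 1 ≤ N) (hΩ : IsSmoothBoundedDomain Ω)
    (hE : LargeExponents N p q α β) (h : RegularEigenpair Ω p q α β lam u v Gu Gv) :
    0 < lam := by
  have hα := hE.hα
  have hp := hE.two_le_p hN
  have hI := h.integral_u hN hE
  by_contra! hle
  have h0 : ∫ x in Ω, ‖Gu x‖ ^ p = 0 := by
    refine le_antisymm ?_ (integral_nonneg fun x => by positivity)
    rw [hI]
    exact mul_nonpos_of_nonpos_of_nonneg hle (by linarith)
  obtain ⟨C, hC0, hC⟩ := exists_oscillation_bound hN hΩ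
  obtain ⟨y, hy⟩ := hΩ.frontier_nonempty hN
  obtain ⟨x, hx, hux, -⟩ := h.exists_ne_zero hΩ.isOpen hE
  have h1 := hC _ _ (h.pair_u.mono_exponent hΩ.isBounded (morreyExp_le hE.hp)) h.cont_u x
    (subset_closure hx) y (frontier_subset_closure hy)
  have h2 := gradNorm_le hN hΩ.isBounded hE.hp h.pair_u.memLp_grad
  rw [h0, Real.zero_rpow (by apply one_div_ne_zero; linarith), zero_mul] at h2
  rw [h.zero_u y hy, sub_zero] at h1
  exact (abs_pos.2 hux).not_ge (h1.trans (mul_nonpos_of_nonneg_of_nonpos hC0 h2))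

/-- The constraint is contained in the Neumann equation: constants are admissible test functions,
and positivity of `lam` allows division. -/
lemma RegularEigenpair.moment_eq (hN : 1 ≤ N) (hΩ : IsSmoothBoundedDomain Ω)
    (hE : LargeExponents N p q α β) (h : RegularEigenpair Ω p q α β lam u v Gu Gv) :
    moment Ω α β u v = 0 := by
  have hβ := hE.hβ
  have e := h.eq_v (fun _ => 1) 0 (sobolevPair_const hΩ.isOpen hΩ.isBounded 1 _)
    continuousOn_const
  simp only [Pi.zero_apply, inner_zero_right, mul_zero, integral_zero, mul_one] at e
  have hl := h.lam_pos hN hΩ hE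
  exact (mul_eq_zero.1 e.symm).resolve_left (by positivity)

/-- This odd symmetry, with the one for `u`, reduces subsolution statements to supersolution
arguments. -/
lemma RegularEigenpair.neg_v (h : RegularEigenpair Ω p q α β lam u v Gu Gv) :
    RegularEigenpair Ω p q α β lam u (-v) Gu (-Gv) where
  cont_u := h.cont_u
  cont_v := h.cont_v.neg
  pair_u := h.pair_u
  pair_v := h.pair_v.neg
  zero_u := h.zero_u
  eq_u w W hw hwc hw0 := by simpa using h.eq_u w W hw hwc hw0
  eq_v z Z hz hzc := by
    simpa [signedPow_neg, integral_neg] using h.eq_v z Z hz hzc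
  coupling_eq := by simpa [coupling] using h.coupling_eq

lemma RegularEigenpair.neg_u (h : RegularEigenpair Ω p q α β lam u v Gu Gv) :
    RegularEigenpair Ω p q α β lam (-u) v (-Gu) Gv where
  cont_u := h.cont_u.neg
  cont_v := h.cont_v
  pair_u := h.pair_u.neg
  pair_v := h.pair_v
  zero_u := fun x hx => by simp [h.zero_u x hx]
  eq_u w W hw hwc hw0 := by
    simpa [signedPow_neg, integral_neg] using h.eq_u w W hw hwc hw0
  eq_v z Z hz hzc := by simpa using h.eq_v z Z hz hzc
  coupling_eq := by simpa [coupling] using h.coupling_eq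

end

end

section

variable {N : ℕ} {Ω : Set (Euc N)}

/-! ### Power means with exponents tending to infinity -/

/-- Uniform convergence in joint form, simultaneously in the index and the point. In this form it
composes with products and variable powers, and it fits the neighbourhoods of a touching point. -/
lemma _root_.TendstoUniformlyOn.tendsto_prod {X : Type*} [TopologicalSpace X] {F : ℕ → X → ℝ}
    {f : X → ℝ} {K : Set X} (h : TendstoUniformlyOn F f atTop K) (hf : ContinuousOn f K)
    {x : X} (hx : x ∈ K) :
    Tendsto (fun y : ℕ × X => F y.1 y.2) (atTop ×ˢ 𝓝[K] x) (𝓝 (f x)) := by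
  have h' : TendstoUniformlyOn (fun i : ℕ × X => F i.1) f (atTop ×ˢ 𝓝[K] x) K :=
    fun s hs => tendsto_fst.eventually (h s hs)
  exact h'.tendsto_comp (hf x hx) tendsto_snd

lemma tendstoUniformlyOn_of_tendsto_prod {X : Type*} [TopologicalSpace X] {F : ℕ → X → ℝ}
    {f : X → ℝ} {K : Set X} (hK : IsCompact K) (hf : ContinuousOn f K)
    (h : ∀ x ∈ K, Tendsto (fun y : ℕ × X => F y.1 y.2) (atTop ×ˢ 𝓝[K] x) (𝓝 (f x))) :
    TendstoUniformlyOn F f atTop K := by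
  rw [← tendstoLocallyUniformlyOn_iff_tendstoUniformlyOn_of_compact hK,
    tendstoLocallyUniformlyOn_iff_forall_tendsto]
  intro x hx
  have h1 : Tendsto (fun y : ℕ × X => f y.2) (atTop ×ˢ 𝓝[K] x) (𝓝 (f x)) :=
    (hf x hx).tendsto.comp tendsto_snd
  exact ((h1.prodMk_nhds (h x hx))).mono_right (nhds_le_uniformity _)

/-- The exponents vary as well. Positivity of their limits makes the power jointly continuous even
where the base vanishes. -/
lemma tendstoUniformlyOn_rpow_mul_rpow {X : Type*} [TopologicalSpace X] {K : Set X}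
    (hK : IsCompact K) {a b : ℝ → ℝ} (ha : Continuous a) (hb : Continuous b)
    {f g : ℕ → X → ℝ} {f₀ g₀ : X → ℝ} (hf₀ : ContinuousOn f₀ K) (hg₀ : ContinuousOn g₀ K)
    (hf : TendstoUniformlyOn f f₀ atTop K) (hg : TendstoUniformlyOn g g₀ atTop K)
    {s t : ℕ → ℝ} {s₀ t₀ : ℝ} (hs₀ : 0 < s₀) (ht₀ : 0 < t₀) (hs : Tendsto s atTop (𝓝 s₀))
    (ht : Tendsto t atTop (𝓝 t₀)) :
    TendstoUniformlyOn (fun n x => a (f n x) ^ s n * b (g n x) ^ t n)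
      (fun x => a (f₀ x) ^ s₀ * b (g₀ x) ^ t₀) atTop K := by
  refine tendstoUniformlyOn_of_tendsto_prod hK ?_ fun x hx => ?_
  · exact ((ha.comp_continuousOn hf₀).rpow_const fun _ _ => Or.inr hs₀.le).mul
      ((hb.comp_continuousOn hg₀).rpow_const fun _ _ => Or.inr ht₀.le)
  · exact (((ha.tendsto _).comp (hf.tendsto_prod hf₀ hx)).rpow (hs.comp tendsto_fst)
      (Or.inr hs₀)).mul (((hb.tendsto _).comp (hg.tendsto_prod hg₀ hx)).rpow
        (ht.comp tendsto_fst) (Or.inr ht₀))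

lemma tendstoUniformlyOn_const {X : Type*} (f : X → ℝ) (K : Set X) :
    TendstoUniformlyOn (fun _ : ℕ => f) f atTop K := by
  rw [Metric.tendstoUniformlyOn_iff]
  exact fun ε hε => Eventually.of_forall fun n x _ => by simpa using hε

lemma tendsto_const_rpow_one_div {c : ℝ} (hc : 0 < c) {r : ℕ → ℝ} (hr : Tendsto r atTop atTop) :
    Tendsto (fun n => c ^ (1 / r n)) atTop (𝓝 1) := by
  have h : Tendsto (fun n => 1 / r n) atTop (𝓝 0) := by
    simp only [one_div]
    exact tendsto_inv_atTop_zero.comp hr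
  simpa using (tendsto_const_nhds (x := c)).rpow h (Or.inl hc.ne')

lemma measureReal_pos_of_isOpen {U : Set (Euc N)} (hU : IsOpen U) (hne : U.Nonempty)
    (hb : Bornology.IsBounded U) : 0 < volume.real U :=
  ENNReal.toReal_pos (hU.measure_pos volume hne).ne' hb.measure_lt_top.ne

/-- The root of the integral of high powers tends to the supremum. -/
lemma tendsto_root_integral (ho : IsOpen Ω) (hb : Bornology.IsBounded Ω) (hne : Ω.Nonempty)
    {g : ℕ → Euc N → ℝ} {g₀ : Euc N → ℝ} {r : ℕ → ℝ} (hr : Tendsto r atTop atTop)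
    (hg : ∀ᶠ n in atTop, ContinuousOn (g n) (closure Ω)) (h0 : ∀ n, ∀ x ∈ Ω, 0 ≤ g n x)
    (hg₀ : ContinuousOn g₀ (closure Ω)) (hl : TendstoUniformlyOn g g₀ atTop (closure Ω)) :
    Tendsto (fun n => (∫ x in Ω, g n x ^ r n) ^ (1 / r n)) atTop (𝓝 (sSup (g₀ '' Ω))) := by
  have hbdd : BddAbove (g₀ '' Ω) :=
    (hb.isCompact_closure.bddAbove_image hg₀).mono (image_mono subset_closure)
  have hV := measureReal_pos_of_isOpen ho hne hb
  have hint : ∀ᶠ n in atTop, IntegrableOn (fun x => g n x ^ r n) Ω := by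
    filter_upwards [hg, hr.eventually_ge_atTop 0] with n hn hrn
    exact integrableOn_of_continuousOn ho hb (hn.rpow_const fun _ _ => Or.inr hrn)
  have hdist := Metric.tendstoUniformlyOn_iff.1 hl
  have hroot : ∀ {c r : ℝ}, 0 ≤ c → 0 < r → ∀ {m : ℝ}, 0 ≤ m →
      (m * c ^ r) ^ (1 / r) = m ^ (1 / r) * c := by
    intro c r hc hr m hm
    rw [Real.mul_rpow hm (Real.rpow_nonneg hc _), ← Real.rpow_mul hc, mul_one_div_cancel hr.ne',
      Real.rpow_one]
  rw [tendsto_order]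
  refine ⟨fun a ha => ?_, fun a ha => ?_⟩
  · rcases lt_or_ge a 0 with ha0 | ha0
    · refine Eventually.of_forall fun n => ha0.trans_le (Real.rpow_nonneg ?_ _)
      exact setIntegral_nonneg ho.measurableSet fun x hx => Real.rpow_nonneg (h0 n x hx) _
    obtain ⟨_, ⟨x, hx, rfl⟩, hax⟩ := exists_lt_of_lt_csSup (hne.image g₀) ha
    obtain ⟨b, hab, hbx⟩ := exists_between hax
    obtain ⟨b', hbb', hb'x⟩ := exists_between hbx
    -- An open set of positive measure on which `g n ≥ b` for large `n`; the gap `b' - b` absorbs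
    -- the uniform error, and the root of the measure tends to one.
    set U := Ω ∩ g₀ ⁻¹' Ioi b' with hU
    have hUo : IsOpen U := (hg₀.mono subset_closure).isOpen_inter_preimage ho isOpen_Ioi
    have hm := measureReal_pos_of_isOpen hUo ⟨x, hx, hb'x⟩ (hb.subset inter_subset_left)
    have hlim : Tendsto (fun n => volume.real U ^ (1 / r n) * b) atTop (𝓝 (1 * b)) :=
      (tendsto_const_rpow_one_div hm hr).mul_const b
    rw [one_mul] at hlim
    filter_upwards [hlim.eventually (lt_mem_nhds hab), hint, hr.eventually_gt_atTop 0,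
      hdist (b' - b) (sub_pos.2 hbb')] with n h1 h2 h3 h4
    refine h1.trans_le ?_
    rw [← hroot (ha0.trans hab.le) h3 measureReal_nonneg]
    refine Real.rpow_le_rpow (by positivity [ha0.trans hab.le]) ?_ (by positivity)
    have e : volume.real U * b ^ r n = ∫ _ in U, b ^ r n := by
      rw [setIntegral_const, smul_eq_mul]
    rw [e]
    refine (setIntegral_mono_on ?_ (h2.mono_set inter_subset_left) hUo.measurableSet
      fun y hy => ?_).trans (setIntegral_mono_set h2 ?_ (ae_of_all _ inter_subset_left))
    · exact integrableOn_const (hb.subset inter_subset_left).measure_lt_top.ne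
    · refine Real.rpow_le_rpow (ha0.trans hab.le) ?_ h3.le
      have h5 := h4 y (subset_closure hy.1)
      have h6 : b' < g₀ y := hy.2
      rw [Real.dist_eq] at h5
      have := (abs_lt.1 h5).2
      linarith
    · filter_upwards [ae_restrict_mem ho.measurableSet] with y hy
      exact Real.rpow_nonneg (h0 n y hy) _
  · obtain ⟨b, hSb, hba⟩ := exists_between ha
    obtain ⟨b', hSb', hb'b⟩ := exists_between hSb
    have hle : ∀ x ∈ Ω, g₀ x ≤ b' := fun x hx => (le_csSup hbdd (mem_image_of_mem _ hx)).trans hSb'.le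
    have hlim : Tendsto (fun n => volume.real Ω ^ (1 / r n) * b) atTop (𝓝 (1 * b)) :=
      (tendsto_const_rpow_one_div hV hr).mul_const b
    rw [one_mul] at hlim
    filter_upwards [hlim.eventually (gt_mem_nhds hba), hint, hr.eventually_gt_atTop 0,
      hdist (b - b') (sub_pos.2 hb'b)] with n h1 h2 h3 h4
    have hgb : ∀ y ∈ Ω, g n y ≤ b := by
      intro y hy
      have h5 := h4 y (subset_closure hy)
      rw [Real.dist_eq] at h5
      have := (abs_lt.1 h5).1
      linarith [hle y hy]
    obtain ⟨x, hx⟩ := hne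
    have hb0 : 0 ≤ b := (h0 n x hx).trans (hgb x hx)
    refine lt_of_le_of_lt ?_ h1
    rw [← hroot hb0 h3 hV.le]
    refine Real.rpow_le_rpow
      (setIntegral_nonneg ho.measurableSet fun x hx => Real.rpow_nonneg (h0 n x hx) _) ?_
      (by positivity)
    have e : volume.real Ω * b ^ r n = ∫ _ in Ω, b ^ r n := by
      rw [setIntegral_const, smul_eq_mul]
    rw [e]
    refine setIntegral_mono_on h2 (integrableOn_const hb.measure_lt_top.ne) ho.measurableSet
      fun y hy => Real.rpow_le_rpow (h0 n y hy) (hgb y hy) h3.le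

/-! ### Essential suprema of functions and gradients. -/

lemma supNorm_eq_sSup (ho : IsOpen Ω) (hb : Bornology.IsBounded Ω) (hne : Ω.Nonempty)
    {g : Euc N → ℝ} (hg : ContinuousOn g (closure Ω)) (h0 : ∀ x ∈ Ω, 0 ≤ g x) :
    supNorm Ω g = sSup (g '' Ω) := by
  have hbdd : BddAbove (g '' Ω) :=
    (hb.isCompact_closure.bddAbove_image hg).mono (image_mono subset_closure)
  have hS0 : 0 ≤ sSup (g '' Ω) := by
    obtain ⟨x, hx⟩ := hne
    exact (h0 x hx).trans (le_csSup hbdd (mem_image_of_mem _ hx))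
  have hle : eLpNormEssSup g (volume.restrict Ω) ≤ ENNReal.ofReal (sSup (g '' Ω)) := by
    refine eLpNormEssSup_le_of_ae_bound ?_
    filter_upwards [ae_restrict_mem ho.measurableSet] with x hx
    rw [Real.norm_eq_abs, abs_of_nonneg (h0 x hx)]
    exact le_csSup hbdd (mem_image_of_mem _ hx)
  rw [supNorm, eLpNorm_exponent_top]
  refine le_antisymm (ENNReal.toReal_le_of_le_ofReal hS0 hle) ?_
  refine csSup_le (hne.image g) ?_
  rintro _ ⟨x, hx, rfl⟩
  by_contra! hlt
  set b := (eLpNormEssSup g (volume.restrict Ω)).toReal with hbdef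
  -- By continuity this superlevel set is open, so it cannot be a null set once it contains a point.
  set U := Ω ∩ g ⁻¹' Ioi b with hU
  have hUo : IsOpen U := (hg.mono subset_closure).isOpen_inter_preimage ho isOpen_Ioi
  have hpos := hUo.measure_pos volume ⟨x, hx, hlt⟩
  have hae := ae_le_eLpNormEssSup (f := g) (μ := volume.restrict Ω)
  rw [ae_restrict_iff' ho.measurableSet] at hae
  refine hpos.ne' (measure_mono_null (fun y hy => ?_) (ae_iff.1 hae))
  simp only [mem_ofPred_eq, Classical.not_imp, not_le]
  refine ⟨hy.1, ?_⟩
  have h1 : b < g y := hy.2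
  rw [← ENNReal.ofReal_toReal (ne_top_of_le_ne_top ENNReal.ofReal_ne_top hle), ← ofReal_norm,
    Real.norm_eq_abs, abs_of_nonneg (h0 y hy.1)]
  exact ENNReal.ofReal_lt_ofReal_iff_of_nonneg ENNReal.toReal_nonneg |>.2 h1

lemma supNorm_nonneg {F : Type*} [NormedAddCommGroup F] (f : Euc N → F) : 0 ≤ supNorm Ω f :=
  ENNReal.toReal_nonneg

lemma ae_norm_le_supNorm {F : Type*} [NormedAddCommGroup F] {f : Euc N → F}
    (hf : MemLp f ⊤ (volume.restrict Ω)) : ∀ᵐ x ∂volume.restrict Ω, ‖f x‖ ≤ supNorm Ω f := by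
  filter_upwards [ae_le_eLpNormEssSup (f := f) (μ := volume.restrict Ω)] with x hx
  have h := hf.eLpNorm_lt_top.ne
  rw [← toReal_enorm]
  rw [eLpNorm_exponent_top] at h
  rw [supNorm, eLpNorm_exponent_top]
  exact ENNReal.toReal_mono h hx

lemma integral_rpow_le_supNorm (hb : Bornology.IsBounded Ω)
    {G : Euc N → Euc N} (hG : MemLp G ⊤ (volume.restrict Ω)) {r : ℝ} (hr : 0 < r) :
    ∫ x in Ω, ‖G x‖ ^ r ≤ volume.real Ω * supNorm Ω G ^ r := by
  have hfin := isFiniteMeasure_restrict hb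
  have e : volume.real Ω * supNorm Ω G ^ r = ∫ _ in Ω, supNorm Ω G ^ r := by
    rw [setIntegral_const, smul_eq_mul]
  rw [e]
  refine integral_mono_ae (integrable_norm_rpow_of_memLp hr (hG.mono_exponent le_top))
    (integrable_const _) ?_
  filter_upwards [ae_norm_le_supNorm hG] with x hx
  exact Real.rpow_le_rpow (norm_nonneg _) hx hr.le

/-- Uniform control of all power means bounds the essential supremum. -/
lemma supNorm_le_of_integral_rpow_le (hb : Bornology.IsBounded Ω) {G : Euc N → Euc N} {l : ℝ}
    (hl : 0 ≤ l) (hG : ∀ r : ℝ, 2 ≤ r → MemLp G (ENNReal.ofReal r) (volume.restrict Ω))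
    (hI : ∀ r : ℝ, 2 ≤ r → ∫ x in Ω, ‖G x‖ ^ r ≤ volume.real Ω * l ^ r) :
    MemLp G ⊤ (volume.restrict Ω) ∧ supNorm Ω G ≤ l := by
  have hfin := isFiniteMeasure_restrict hb
  have key : ∀ t : ℝ, l < t → ∀ᵐ x ∂volume.restrict Ω, ‖G x‖ < t := by
    intro t ht
    have ht0 : 0 < t := hl.trans_lt ht
    have hq : 0 ≤ l / t := by positivity
    have hq1 : l / t < 1 := (div_lt_one ht0).2 ht
    -- Chebyshev's inequality with exponent `k + 2` bounds `m` by a geometric sequence of ratio `l /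
    -- t < 1`.
    set m := (volume.restrict Ω).real {x | t ≤ ‖G x‖} with hm
    have hbd : ∀ k : ℕ, m ≤ volume.real Ω * (l / t) ^ (k + 2) := by
      intro k
      have hk : (2 : ℝ) ≤ ((k + 2 : ℕ) : ℝ) := by push_cast; linarith [k.cast_nonneg (α := ℝ)]
      have h1 := mul_meas_ge_le_integral_of_nonneg (μ := volume.restrict Ω)
        (f := fun x => ‖G x‖ ^ ((k + 2 : ℕ) : ℝ)) (Eventually.of_forall fun x => by positivity)
        (integrable_norm_rpow_of_memLp (by linarith) (hG _ hk)) (t ^ ((k + 2 : ℕ) : ℝ))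
      have h2 := h1.trans (hI _ hk)
      have e : {x | t ^ ((k + 2 : ℕ) : ℝ) ≤ ‖G x‖ ^ ((k + 2 : ℕ) : ℝ)} = {x | t ≤ ‖G x‖} := by
        ext x
        exact Real.rpow_le_rpow_iff ht0.le (norm_nonneg _) (by linarith)
      rw [e, ← hm, Real.rpow_natCast, Real.rpow_natCast] at h2
      rw [div_pow, mul_div_assoc', le_div_iff₀ (by positivity)]
      linarith
    have hlim : Tendsto (fun k : ℕ => volume.real Ω * (l / t) ^ (k + 2)) atTop (𝓝 0) := by
      simpa using ((tendsto_pow_atTop_nhds_zero_of_lt_one hq hq1).comp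
        (tendsto_add_atTop_nat 2)).const_mul (volume.real Ω)
    have hm0 : m = 0 := le_antisymm (ge_of_tendsto' hlim hbd) measureReal_nonneg
    rw [hm, measureReal_eq_zero_iff] at hm0
    rw [ae_iff]
    simpa only [not_lt] using hm0
  have hae : ∀ᵐ x ∂volume.restrict Ω, ‖G x‖ ≤ l := by
    have h1 : ∀ᵐ x ∂volume.restrict Ω, ∀ k : ℕ, ‖G x‖ < l + 1 / ((k : ℝ) + 1) :=
      ae_all_iff.2 fun k => key _ (lt_add_of_pos_right _ Nat.one_div_pos_of_nat)
    filter_upwards [h1] with x hx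
    have hlim : Tendsto (fun k : ℕ => l + 1 / ((k : ℝ) + 1)) atTop (𝓝 (l + 0)) :=
      tendsto_one_div_add_atTop_nhds_zero_nat.const_add l
    rw [add_zero] at hlim
    exact ge_of_tendsto' hlim fun k => (hx k).le
  refine ⟨memLp_top_of_bound (hG 2 le_rfl).aestronglyMeasurable l hae, ?_⟩
  rw [supNorm, eLpNorm_exponent_top]
  exact ENNReal.toReal_le_of_le_ofReal hl (eLpNormEssSup_le_of_ae_bound hae)

end

section

variable {N : ℕ} {Ω : Set (Euc N)}

/-! ### Sequences of exponents -/

/-- The exponents of the limit process. -/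
structure ExponentLimit (Γ Q : ℝ) (p q α β : ℕ → ℝ) : Prop where
  hp : Tendsto p atTop atTop
  hq : Tendsto q atTop atTop
  hsum : ∀ n, α n / p n + β n / q n = 1
  hΓ : Tendsto (fun n => α n / p n) atTop (𝓝 Γ)
  hQ : Tendsto (fun n => q n / p n) atTop (𝓝 Q)
  Γ_pos : 0 < Γ
  Γ_lt : Γ < 1
  Q_pos : 0 < Q

namespace ExponentLimit

variable {Γ Q : ℝ} {p q α β : ℕ → ℝ}

lemma comp (h : ExponentLimit Γ Q p q α β) {k : ℕ → ℕ} (hk : Tendsto k atTop atTop) :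
    ExponentLimit Γ Q (p ∘ k) (q ∘ k) (α ∘ k) (β ∘ k) :=
  ⟨h.hp.comp hk, h.hq.comp hk, fun _ => h.hsum _, h.hΓ.comp hk, h.hQ.comp hk, h.Γ_pos, h.Γ_lt,
    h.Q_pos⟩

lemma one_sub_pos (h : ExponentLimit Γ Q p q α β) : 0 < 1 - Γ := sub_pos.2 h.Γ_lt

lemma tendsto_β_div_q (h : ExponentLimit Γ Q p q α β) :
    Tendsto (fun n => β n / q n) atTop (𝓝 (1 - Γ)) :=
  (h.hΓ.const_sub 1).congr fun n => by rw [← h.hsum n]; ring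

lemma p_pos (h : ExponentLimit Γ Q p q α β) : ∀ᶠ n in atTop, 0 < p n := h.hp.eventually_gt_atTop 0

lemma q_pos (h : ExponentLimit Γ Q p q α β) : ∀ᶠ n in atTop, 0 < q n := h.hq.eventually_gt_atTop 0

lemma tendsto_β_div_p (h : ExponentLimit Γ Q p q α β) :
    Tendsto (fun n => β n / p n) atTop (𝓝 ((1 - Γ) * Q)) := by
  refine (h.tendsto_β_div_q.mul h.hQ).congr' ?_
  filter_upwards [h.q_pos] with n hn
  exact div_mul_div_cancel₀ hn.ne'

lemma tendsto_p_div_q (h : ExponentLimit Γ Q p q α β) :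
    Tendsto (fun n => p n / q n) atTop (𝓝 (1 / Q)) := by
  rw [one_div]
  exact (h.hQ.inv₀ h.Q_pos.ne').congr fun n => inv_div _ _

lemma tendsto_α_div_q (h : ExponentLimit Γ Q p q α β) :
    Tendsto (fun n => α n / q n) atTop (𝓝 (Γ / Q)) := by
  rw [show Γ / Q = Γ * (1 / Q) by ring]
  refine (h.hΓ.mul h.tendsto_p_div_q).congr' ?_
  filter_upwards [h.p_pos] with n hn
  exact div_mul_div_cancel₀ hn.ne'

lemma tendsto_α (h : ExponentLimit Γ Q p q α β) : Tendsto α atTop atTop := by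
  refine (h.hΓ.pos_mul_atTop h.Γ_pos h.hp).congr' ?_
  filter_upwards [h.p_pos] with n hn
  exact div_mul_cancel₀ _ hn.ne'

lemma tendsto_β (h : ExponentLimit Γ Q p q α β) : Tendsto β atTop atTop := by
  refine (h.tendsto_β_div_q.pos_mul_atTop h.one_sub_pos h.hq).congr' ?_
  filter_upwards [h.q_pos] with n hn
  exact div_mul_cancel₀ _ hn.ne'

lemma eventually_large (h : ExponentLimit Γ Q p q α β) :
    ∀ᶠ n in atTop, LargeExponents N (p n) (q n) (α n) (β n) := by
  filter_upwards [h.hp.eventually_ge_atTop (2 * N), h.hq.eventually_ge_atTop (2 * N),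
    h.tendsto_α.eventually_ge_atTop 2, h.tendsto_β.eventually_ge_atTop 2] with n h1 h2 h3 h4
  exact ⟨h1, h2, h3, h4, h.hsum n⟩

lemma tendsto_one_div {r : ℕ → ℝ} (hr : Tendsto r atTop atTop) :
    Tendsto (fun n => 1 / r n) atTop (𝓝 0) := by
  simp only [one_div]
  exact tendsto_inv_atTop_zero.comp hr

/-- Write `a` as `(a / r) * r`: the first factor has a positive limit, and `r ^ (1 / r)` tends to
one. -/
lemma tendsto_rpow_self {a r : ℕ → ℝ} {c : ℝ} (hc : 0 < c)
    (hr : Tendsto r atTop atTop) (har : Tendsto (fun n => a n / r n) atTop (𝓝 c)) :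
    Tendsto (fun n => a n ^ (1 / r n)) atTop (𝓝 1) := by
  have h1 : Tendsto (fun n => r n ^ (1 / r n)) atTop (𝓝 1) := tendsto_rpow_div.comp hr
  have h2 : Tendsto (fun n => (a n / r n) ^ (1 / r n)) atTop (𝓝 (c ^ (0 : ℝ))) :=
    har.rpow (tendsto_one_div hr) (Or.inl hc.ne')
  have h3 := h2.mul h1
  rw [Real.rpow_zero, mul_one] at h3
  refine h3.congr' ?_
  filter_upwards [hr.eventually_gt_atTop 0, har.eventually (lt_mem_nhds hc)] with n hn hn2
  rw [← Real.mul_rpow hn2.le hn.le, div_mul_cancel₀ _ hn.ne']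

lemma tendsto_α_root (h : ExponentLimit Γ Q p q α β) :
    Tendsto (fun n => α n ^ (1 / p n)) atTop (𝓝 1) := tendsto_rpow_self h.Γ_pos h.hp h.hΓ

lemma tendsto_β_root (h : ExponentLimit Γ Q p q α β) :
    Tendsto (fun n => β n ^ (1 / q n)) atTop (𝓝 1) :=
  tendsto_rpow_self h.one_sub_pos h.hq h.tendsto_β_div_q

lemma mul_pos (h : ExponentLimit Γ Q p q α β) : 0 < (1 - Γ) * Q :=
  _root_.mul_pos h.one_sub_pos h.Q_pos

end ExponentLimit

/-! ### The limit problem -/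

lemma abs_rpow_eq_max {t s : ℝ} (hs : 0 < s) : |t| ^ s = max (t⁺ ^ s) (t⁻ ^ s) := by
  rcases le_total 0 t with h | h
  · rw [abs_of_nonneg h, posPart_of_nonneg h, negPart_of_nonneg h, Real.zero_rpow hs.ne',
      max_eq_left (by positivity)]
  · rw [abs_of_nonpos h, posPart_of_nonpos h, negPart_of_nonpos h, Real.zero_rpow hs.ne',
      max_eq_right (Real.rpow_nonneg (neg_nonneg.2 h) _)]

lemma continuousOn_limit_weight {a b : ℝ → ℝ} (ha : Continuous a) (hb : Continuous b) {s t : ℝ}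
    (hs : 0 ≤ s) (ht : 0 ≤ t) {w z : Euc N → ℝ} (hw : ContinuousOn w (closure Ω))
    (hz : ContinuousOn z (closure Ω)) :
    ContinuousOn (fun x => a (w x) ^ s * b (z x) ^ t) (closure Ω) :=
  ((ha.comp_continuousOn hw).rpow_const fun _ _ => Or.inr hs).mul
    ((hb.comp_continuousOn hz).rpow_const fun _ _ => Or.inr ht)

/-- For pairs in the limit class, both one-sided suprema equal the two-sided one. -/
lemma AdmissibleTop.sSup_eq (ho : IsOpen Ω) (hb : Bornology.IsBounded Ω) (hne : Ω.Nonempty)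
    {Γ Q : ℝ} (hΓ : 0 < Γ) (hτ : 0 < (1 - Γ) * Q) {w z : Euc N → ℝ}
    (h : AdmissibleTop Ω Γ Q w z) :
    0 < supNorm Ω (fun x => |w x| ^ Γ * |z x| ^ ((1 - Γ) * Q)) ∧
    sSup ((fun x => |w x| ^ Γ * ((z x)⁺) ^ ((1 - Γ) * Q)) '' Ω) =
      supNorm Ω (fun x => |w x| ^ Γ * |z x| ^ ((1 - Γ) * Q)) ∧
    sSup ((fun x => |w x| ^ Γ * ((z x)⁻) ^ ((1 - Γ) * Q)) '' Ω) =
      supNorm Ω (fun x => |w x| ^ Γ * |z x| ^ ((1 - Γ) * Q)) := by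
  have hwc := h.1.1.2
  have hzc := h.2.1.2
  have hbd : ∀ {f : Euc N → ℝ}, ContinuousOn f (closure Ω) → BddAbove (f '' Ω) := fun hf =>
    (hb.isCompact_closure.bddAbove_image hf).mono (image_mono subset_closure)
  have c1 : ContinuousOn (fun x => |w x| ^ Γ * |z x| ^ ((1 - Γ) * Q)) (closure Ω) :=
    continuousOn_limit_weight continuous_abs continuous_abs hΓ.le hτ.le hwc hzc
  have c2 : ContinuousOn (fun x => |w x| ^ Γ * ((z x)⁺) ^ ((1 - Γ) * Q)) (closure Ω) :=
    continuousOn_limit_weight continuous_abs continuous_posPart hΓ.le hτ.le hwc hzc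
  have c3 : ContinuousOn (fun x => |w x| ^ Γ * ((z x)⁻) ^ ((1 - Γ) * Q)) (closure Ω) :=
    continuousOn_limit_weight continuous_abs continuous_negPart hΓ.le hτ.le hwc hzc
  rw [supNorm_eq_sSup ho hb hne c1 fun x _ => by positivity]
  set S := sSup ((fun x => |w x| ^ Γ * |z x| ^ ((1 - Γ) * Q)) '' Ω) with hS
  set Sp := sSup ((fun x => |w x| ^ Γ * ((z x)⁺) ^ ((1 - Γ) * Q)) '' Ω) with hSp
  have heq := h.2.2.2
  rw [← hSp] at heq
  rw [← heq]
  have hpos : 0 < S := by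
    obtain ⟨x, hx, hx0⟩ := h.2.2.1
    refine lt_of_lt_of_le ?_ (le_csSup (hbd c1) (mem_image_of_mem _ hx))
    have h1 := abs_pos.2 (left_ne_zero_of_mul hx0)
    have h2 := abs_pos.2 (right_ne_zero_of_mul hx0)
    positivity
  have hle : Sp = S := by
    refine le_antisymm (csSup_le (hne.image _) ?_) (csSup_le (hne.image _) ?_)
    · rintro _ ⟨x, hx, rfl⟩
      refine le_trans ?_ (le_csSup (hbd c1) (mem_image_of_mem _ hx))
      simp only [abs_rpow_eq_max hτ (t := z x)]
      gcongr
      exact le_max_left _ _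
    · rintro _ ⟨x, hx, rfl⟩
      simp only [abs_rpow_eq_max hτ (t := z x)]
      rcases max_choice (((z x)⁺) ^ ((1 - Γ) * Q)) (((z x)⁻) ^ ((1 - Γ) * Q)) with e | e
      · rw [e]
        exact le_csSup (hbd c2) (mem_image_of_mem _ hx)
      · rw [e, heq]
        exact le_csSup (hbd c3) (mem_image_of_mem _ hx)
  exact ⟨hpos, hle, hle⟩

lemma memW1_top_of_contDiff (ho : IsOpen Ω) (hb : Bornology.IsBounded Ω) {g : Euc N → ℝ}
    (hg : ContDiff ℝ 1 g) : MemW1Top Ω g :=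
  ⟨(sobolevPair_of_contDiff ho hb hg _).memW1 ho hb le_top, hg.continuous.continuousOn⟩

/-- The limit class is nonempty. -/
lemma exists_admissibleTop (hN : 1 ≤ N) (hΩ : IsSmoothBoundedDomain Ω) {Γ Q : ℝ} (hΓ : 0 < Γ)
    (hτ : 0 < (1 - Γ) * Q) : ∃ w z, AdmissibleTop Ω Γ Q w z := by
  have ho := hΩ.isOpen
  have hb := hΩ.isBounded
  have : Nonempty (Fin N) := ⟨⟨0, hN⟩⟩
  obtain ⟨x₀, hx₀⟩ := hΩ.isConnected.nonempty
  obtain ⟨R, hR, hball⟩ := Metric.isOpen_iff.1 ho x₀ hx₀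
  obtain ⟨e, he⟩ := exists_norm_eq (Euc N) (show 0 ≤ R / 2 by positivity)
  -- Two disjoint bumps of height one: their sum serves as `w` and their difference as `z`, so both
  -- one-sided maxima equal one.
  let f₁ : ContDiffBump (x₀ + e) := ⟨R / 8, R / 4, by positivity, by linarith⟩
  let f₂ : ContDiffBump (x₀ - e) := ⟨R / 8, R / 4, by positivity, by linarith⟩
  have hdist : dist (x₀ + e) (x₀ - e) = R := by
    rw [dist_eq_norm, show x₀ + e - (x₀ - e) = (2 : ℝ) • e by rw [two_smul]; abel, norm_smul, he]
    norm_num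
    ring
  have hdisj : ∀ x, f₁ x = 0 ∨ f₂ x = 0 := by
    intro x
    by_contra! hcon
    have h1 : x ∈ Metric.ball (x₀ + e) (R / 4) := by
      rw [← show f₁.rOut = R / 4 from rfl, ← f₁.support_eq]; exact hcon.1
    have h2 : x ∈ Metric.ball (x₀ - e) (R / 4) := by
      rw [← show f₂.rOut = R / 4 from rfl, ← f₂.support_eq]; exact hcon.2
    rw [Metric.mem_ball] at h1 h2
    have h3 := dist_triangle_left (x₀ + e) (x₀ - e) x
    linarith
  have hsub : ∀ (c : Euc N), dist c x₀ = R / 2 → Metric.ball c (R / 4) ⊆ Ω := by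
    intro c hc x hx
    refine hball ?_
    rw [Metric.mem_ball] at hx ⊢
    have := dist_triangle x c x₀
    linarith
  have hd1 : dist (x₀ + e) x₀ = R / 2 := by rw [dist_eq_norm, add_sub_cancel_left, he]
  have hd2 : dist (x₀ - e) x₀ = R / 2 := by
    rw [dist_eq_norm, show x₀ - e - x₀ = -e by abel, norm_neg, he]
  have hs1 : Function.support f₁ ⊆ Ω := by rw [f₁.support_eq]; exact hsub _ hd1
  have hs2 : Function.support f₂ ⊆ Ω := by rw [f₂.support_eq]; exact hsub _ hd2
  have hc1 : x₀ + e ∈ Ω := hsub _ hd1 (Metric.mem_ball_self (by positivity))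
  have hc2 : x₀ - e ∈ Ω := hsub _ hd2 (Metric.mem_ball_self (by positivity))
  have v11 : f₁ (x₀ + e) = 1 := f₁.one_of_mem_closedBall (Metric.mem_closedBall_self f₁.rIn_pos.le)
  have v22 : f₂ (x₀ - e) = 1 := f₂.one_of_mem_closedBall (Metric.mem_closedBall_self f₂.rIn_pos.le)
  have v12 : f₂ (x₀ + e) = 0 := (hdisj _).resolve_left (by rw [v11]; exact one_ne_zero)
  have v21 : f₁ (x₀ - e) = 0 := (hdisj _).resolve_right (by rw [v22]; exact one_ne_zero)
  have hfr : ∀ x ∈ frontier Ω, x ∉ Ω := fun x hx h => by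
    rw [ho.frontier_eq] at hx
    exact hx.2 h
  have hbd : ∀ s : ℝ, 0 < s → ∀ a b : ℝ, 0 ≤ a → a ≤ 1 → 0 ≤ b → b ≤ 1 → a ^ Γ * b ^ s ≤ 1 :=
    fun s hs a b ha ha1 hb hb1 => mul_le_one₀ (Real.rpow_le_one ha ha1 hΓ.le)
      (Real.rpow_nonneg hb _) (Real.rpow_le_one hb hb1 hs.le)
  have hw1 : ∀ x, |f₁ x + f₂ x| ≤ 1 := by
    intro x
    rcases hdisj x with h | h
    · rw [h, zero_add, abs_of_nonneg f₂.nonneg]; exact f₂.le_one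
    · rw [h, add_zero, abs_of_nonneg f₁.nonneg]; exact f₁.le_one
  have hz1 : ∀ x, |f₁ x - f₂ x| ≤ 1 := by
    intro x
    rcases hdisj x with h | h
    · rw [h, zero_sub, abs_neg, abs_of_nonneg f₂.nonneg]; exact f₂.le_one
    · rw [h, sub_zero, abs_of_nonneg f₁.nonneg]; exact f₁.le_one
  have g1 : IsGreatest ((fun x => |f₁ x + f₂ x| ^ Γ * ((f₁ x - f₂ x)⁺) ^ ((1 - Γ) * Q)) '' Ω) 1 := by
    refine ⟨⟨x₀ + e, hc1, ?_⟩, ?_⟩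
    · simp only [v11, v12, add_zero, sub_zero, abs_one, Real.one_rpow]
      rw [posPart_of_nonneg zero_le_one, Real.one_rpow, one_mul]
    · rintro _ ⟨x, -, rfl⟩
      exact hbd _ hτ _ _ (abs_nonneg _) (hw1 x) (posPart_nonneg _)
        ((max_le (le_abs_self _) (abs_nonneg _)).trans (hz1 x))
  have g2 : IsGreatest ((fun x => |f₁ x + f₂ x| ^ Γ * ((f₁ x - f₂ x)⁻) ^ ((1 - Γ) * Q)) '' Ω) 1 := by
    refine ⟨⟨x₀ - e, hc2, ?_⟩, ?_⟩
    · simp only [v21, v22, zero_add, zero_sub, abs_one, Real.one_rpow]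
      rw [negPart_of_nonpos (by norm_num), neg_neg, Real.one_rpow, one_mul]
    · rintro _ ⟨x, -, rfl⟩
      exact hbd _ hτ _ _ (abs_nonneg _) (hw1 x) (negPart_nonneg _)
        ((max_le (neg_le_abs _) (abs_nonneg _)).trans (hz1 x))
  refine ⟨fun x => f₁ x + f₂ x, fun x => f₁ x - f₂ x,
    ⟨memW1_top_of_contDiff ho hb (f₁.contDiff.add f₂.contDiff), fun x hx => ?_⟩,
    memW1_top_of_contDiff ho hb (f₁.contDiff.sub f₂.contDiff), ⟨x₀ + e, hc1, ?_⟩,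
    g1.csSup_eq.trans g2.csSup_eq.symm⟩
  · have h1 : f₁ x = 0 := by by_contra h; exact hfr x hx (hs1 h)
    have h2 : f₂ x = 0 := by by_contra h; exact hfr x hx (hs2 h)
    simp only [h1, h2, add_zero]
  · simp [v11, v12]

end

section

variable {N : ℕ} {Ω : Set (Euc N)}

/-! ### Convergence of the eigenvalues -/

/-- The exponent `1 / p` is moved inside: the base `a (u) ^ (s / p) * b (v) ^ (t / p)` converges
uniformly. The functions `a`, `b` are left open to cover the absolute value and the positive and
negative parts. -/
lemma tendsto_root_integral_mul (hΩ : IsSmoothBoundedDomain Ω) {a b : ℝ → ℝ} (ha : Continuous a)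
    (hb : Continuous b) (ha0 : ∀ t, 0 ≤ a t) (hb0 : ∀ t, 0 ≤ b t) {u v : ℕ → Euc N → ℝ}
    {u₀ v₀ : Euc N → ℝ} (hu : ∀ᶠ n in atTop, ContinuousOn (u n) (closure Ω))
    (hv : ∀ᶠ n in atTop, ContinuousOn (v n) (closure Ω)) (hu₀ : ContinuousOn u₀ (closure Ω))
    (hv₀ : ContinuousOn v₀ (closure Ω)) (hul : TendstoUniformlyOn u u₀ atTop (closure Ω))
    (hvl : TendstoUniformlyOn v v₀ atTop (closure Ω)) {p s t : ℕ → ℝ} {s₀ t₀ : ℝ}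
    (hs₀ : 0 < s₀) (ht₀ : 0 < t₀) (hp : Tendsto p atTop atTop)
    (hs : Tendsto (fun n => s n / p n) atTop (𝓝 s₀))
    (ht : Tendsto (fun n => t n / p n) atTop (𝓝 t₀)) :
    Tendsto (fun n => (∫ x in Ω, a (u n x) ^ s n * b (v n x) ^ t n) ^ (1 / p n)) atTop
      (𝓝 (sSup ((fun x => a (u₀ x) ^ s₀ * b (v₀ x) ^ t₀) '' Ω))) := by
  have hunif := tendstoUniformlyOn_rpow_mul_rpow hΩ.isBounded.isCompact_closure ha hb hu₀ hv₀
    hul hvl hs₀ ht₀ hs ht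
  have hcont : ∀ᶠ n in atTop, ContinuousOn
      (fun x => a (u n x) ^ (s n / p n) * b (v n x) ^ (t n / p n)) (closure Ω) := by
    filter_upwards [hu, hv, hs.eventually (lt_mem_nhds hs₀), ht.eventually (lt_mem_nhds ht₀)]
      with n h1 h2 h3 h4
    exact continuousOn_limit_weight ha hb h3.le h4.le h1 h2
  have hmain := tendsto_root_integral hΩ.isOpen hΩ.isBounded hΩ.isConnected.nonempty hp hcont
    (fun n x _ => mul_nonneg (Real.rpow_nonneg (ha0 _) _) (Real.rpow_nonneg (hb0 _) _))
    (continuousOn_limit_weight ha hb hs₀.le ht₀.le hu₀ hv₀) hunif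
  refine hmain.congr' ?_
  filter_upwards [hp.eventually_gt_atTop 0] with n hn
  congr 2
  ext x
  rw [Real.mul_rpow (Real.rpow_nonneg (ha0 _) _) (Real.rpow_nonneg (hb0 _) _),
    ← Real.rpow_mul (ha0 _), ← Real.rpow_mul (hb0 _), div_mul_cancel₀ _ hn.ne',
    div_mul_cancel₀ _ hn.ne']

/-- `|z + c|` dominates the positive part of `z` if `c ≥ 0` and the negative part if `c ≤ 0`. The
bound is free of `c`, so the uncontrolled shift that restores the constraint does no harm. -/
lemma min_integral_le_coupling_add_const (ho : IsOpen Ω) (hb : Bornology.IsBounded Ω) {α β : ℝ}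
    (hα : 0 ≤ α) (hβ : 0 ≤ β) {w z : Euc N → ℝ} (hw : ContinuousOn w (closure Ω))
    (hz : ContinuousOn z (closure Ω)) (c : ℝ) :
    min (∫ x in Ω, |w x| ^ α * (z x)⁺ ^ β) (∫ x in Ω, |w x| ^ α * (z x)⁻ ^ β) ≤
      coupling Ω α β w (fun x => z x + c) := by
  have i1 := integrableOn_of_continuousOn ho hb
    (continuousOn_coupling hα hβ hw (hz.add (continuousOn_const (c := c))))
  rcases le_total 0 c with hc | hc
  · refine (min_le_left _ _).trans (setIntegral_mono_on ?_ i1 ho.measurableSet fun x _ => ?_)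
    · exact integrableOn_of_continuousOn ho hb
        (continuousOn_limit_weight continuous_abs continuous_posPart hα hβ hw hz)
    · refine mul_le_mul_of_nonneg_left (Real.rpow_le_rpow (posPart_nonneg _) ?_ hβ) (by positivity)
      exact max_le (le_abs.2 (Or.inl (by simpa using hc))) (abs_nonneg _)
  · refine (min_le_right _ _).trans (setIntegral_mono_on ?_ i1 ho.measurableSet fun x _ => ?_)
    · exact integrableOn_of_continuousOn ho hb
        (continuousOn_limit_weight continuous_abs continuous_negPart hα hβ hw hz)
    · refine mul_le_mul_of_nonneg_left (Real.rpow_le_rpow (negPart_nonneg _) ?_ hβ) (by positivity)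
      exact max_le (le_abs.2 (Or.inr (by simpa using hc))) (abs_nonneg _)

lemma MemW1Top.sobolevPair {w : Euc N → ℝ} (h : MemW1Top Ω w) (hb : Bornology.IsBounded Ω)
    (r : ℝ≥0∞) : SobolevPair Ω r w (weakGrad Ω w) :=
  h.1.sobolevPair.mono_exponent hb le_top

variable {Γ Q : ℝ} {p q α β : ℕ → ℝ}

/-- Every pair in the limit class bounds the eigenvalues asymptotically. -/
lemma AdmissibleTop.exists_bound (hN : 1 ≤ N) (hΩ : IsSmoothBoundedDomain Ω)
    (hL : ExponentLimit Γ Q p q α β) {w z : Euc N → ℝ} (h : AdmissibleTop Ω Γ Q w z) :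
    (∀ᶠ n in atTop, ∃ u v, Admissible Ω (p n) (q n) (α n) (β n) u v) ∧
    ∃ b : ℕ → ℝ, Tendsto b atTop (𝓝 (rayleighTop Ω Γ Q w z)) ∧
      ∀ᶠ n in atTop, firstEigenvalue Ω (p n) (q n) (α n) (β n) ^ (1 / p n) ≤ b n := by
  have ho := hΩ.isOpen
  have hb := hΩ.isBounded
  have hne := hΩ.isConnected.nonempty
  have hwc := h.1.1.2
  have hzc := h.2.1.2
  obtain ⟨hS, hSp, hSm⟩ := h.sSup_eq ho hb hne hL.Γ_pos hL.mul_pos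
  set S := supNorm Ω (fun x => |w x| ^ Γ * |z x| ^ ((1 - Γ) * Q)) with hSdef
  set A := supNorm Ω (weakGrad Ω w) with hA
  set B := supNorm Ω (weakGrad Ω z) with hB
  have hA0 : 0 ≤ A := supNorm_nonneg _
  have hB0 : 0 ≤ B := supNorm_nonneg _
  have hV := measureReal_pos_of_isOpen ho hne hb
  set V := volume.real Ω with hVdef
  set Ip : ℕ → ℝ := fun n => ∫ x in Ω, |w x| ^ α n * (z x)⁺ ^ β n with hIp
  set Im : ℕ → ℝ := fun n => ∫ x in Ω, |w x| ^ α n * (z x)⁻ ^ β n with hIm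
  have tp : Tendsto (fun n => Ip n ^ (1 / p n)) atTop (𝓝 S) := by
    rw [← hSp]
    exact tendsto_root_integral_mul hΩ continuous_abs continuous_posPart (fun _ => abs_nonneg _)
      (fun _ => posPart_nonneg _) (Eventually.of_forall fun _ => hwc)
      (Eventually.of_forall fun _ => hzc) hwc hzc (tendstoUniformlyOn_const w _)
      (tendstoUniformlyOn_const z _) hL.Γ_pos hL.mul_pos hL.hp hL.hΓ hL.tendsto_β_div_p
  have tm : Tendsto (fun n => Im n ^ (1 / p n)) atTop (𝓝 S) := by
    rw [← hSm]
    exact tendsto_root_integral_mul hΩ continuous_abs continuous_negPart (fun _ => abs_nonneg _)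
      (fun _ => negPart_nonneg _) (Eventually.of_forall fun _ => hwc)
      (Eventually.of_forall fun _ => hzc) hwc hzc (tendstoUniformlyOn_const w _)
      (tendstoUniformlyOn_const z _) hL.Γ_pos hL.mul_pos hL.hp hL.hΓ hL.tendsto_β_div_p
  have tmin : Tendsto (fun n => min (Ip n ^ (1 / p n)) (Im n ^ (1 / p n))) atTop (𝓝 S) := by
    simpa using tp.min tm
  -- `2 * V` accounts for the two energy integrals; the factors `1 / p` and `1 / q` are simply
  -- estimated by one.
  have tnum : Tendsto (fun n => (2 * V) ^ (1 / p n) * max A (B ^ (q n / p n))) atTop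
      (𝓝 (max A (B ^ Q))) := by
    have h1 := tendsto_const_rpow_one_div (show 0 < 2 * V by positivity) hL.hp
    have h2 : Tendsto (fun n => B ^ (q n / p n)) atTop (𝓝 (B ^ Q)) :=
      (tendsto_const_nhds (x := B)).rpow hL.hQ (Or.inr hL.Q_pos)
    simpa using h1.mul ((tendsto_const_nhds (x := A)).max h2)
  have key : ∀ᶠ n in atTop, (∃ u v, Admissible Ω (p n) (q n) (α n) (β n) u v) ∧
      firstEigenvalue Ω (p n) (q n) (α n) (β n) ^ (1 / p n) ≤
        (2 * V) ^ (1 / p n) * max A (B ^ (q n / p n)) /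
          min (Ip n ^ (1 / p n)) (Im n ^ (1 / p n)) := by
    filter_upwards [hL.eventually_large (N := N), tmin.eventually (lt_mem_nhds hS)] with n hE hmin
    have hp2 := hE.two_le_p hN
    have hq2 := hE.two_le_q hN
    have hp0 : 0 < p n := by linarith
    have hq0 : 0 < q n := by linarith
    have hα := hE.hα
    have hβ := hE.hβ
    have hIp0 : 0 ≤ Ip n := integral_nonneg fun x =>
      mul_nonneg (by positivity) (Real.rpow_nonneg (posPart_nonneg _) _)
    have hIm0 : 0 ≤ Im n := integral_nonneg fun x =>
      mul_nonneg (by positivity) (Real.rpow_nonneg (negPart_nonneg _) _)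
    -- The pair `(w, z)` itself need not satisfy the constraint at finite exponents; a constant
    -- added to `z` repairs this without changing its gradient.
    obtain ⟨c, hc⟩ := exists_shift ho hb (by linarith : 0 ≤ α n) hβ hwc hzc
    have hpair : RegularPair Ω (p n) (q n) w (fun x => z x + c) (weakGrad Ω w) (weakGrad Ω z) :=
      ⟨hwc, hzc.add continuousOn_const, h.1.1.sobolevPair hb _,
        (h.2.1.sobolevPair hb _).add_const ho hb (one_le_ofReal_of_two_le hq2) c, h.1.2⟩
    have hcoup := min_integral_le_coupling_add_const ho hb (by linarith : 0 ≤ α n)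
      (by linarith : 0 ≤ β n) hwc hzc c
    have hroot : min (Ip n ^ (1 / p n)) (Im n ^ (1 / p n)) = min (Ip n) (Im n) ^ (1 / p n) :=
      ((Real.monotoneOn_rpow_Ici_of_exponent_nonneg (by positivity)).map_min hIp0 hIm0).symm
    have hI0 : 0 ≤ min (Ip n) (Im n) := le_min hIp0 hIm0
    have hI : 0 < min (Ip n) (Im n) := by
      refine lt_of_le_of_ne hI0 fun h0 => ?_
      rw [hroot, ← h0, Real.zero_rpow (by positivity)] at hmin
      exact lt_irrefl _ hmin
    refine ⟨⟨w, _, hpair.admissible hN hΩ hE hc (hI.trans_le hcoup).ne'⟩, ?_⟩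
    have hlam : 0 ≤ firstEigenvalue Ω (p n) (q n) (α n) (β n) := firstEigenvalue_nonneg hp0.le hq0.le
    have h1 := hpair.le_energy hN hΩ hE hc
    have h2 : firstEigenvalue Ω (p n) (q n) (α n) (β n) * min (Ip n) (Im n) ≤
        2 * V * max A (B ^ (q n / p n)) ^ p n := by
      refine ((mul_le_mul_of_nonneg_left hcoup hlam).trans h1).trans ?_
      have e1 := integral_rpow_le_supNorm hb h.1.1.1.2.2 hp0
      have e2 := integral_rpow_le_supNorm hb h.2.1.1.2.2 hq0
      rw [← hA] at e1
      rw [← hB] at e2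
      have m1 : A ^ p n ≤ max A (B ^ (q n / p n)) ^ p n :=
        Real.rpow_le_rpow hA0 (le_max_left _ _) hp0.le
      have m2 : B ^ q n ≤ max A (B ^ (q n / p n)) ^ p n := by
        refine le_trans (le_of_eq ?_)
          (Real.rpow_le_rpow (Real.rpow_nonneg hB0 _) (le_max_right _ _) hp0.le)
        rw [← Real.rpow_mul hB0, div_mul_cancel₀ _ hp0.ne']
      have i1 : 0 ≤ ∫ x in Ω, ‖weakGrad Ω w x‖ ^ p n := integral_nonneg fun x => by positivity
      have i2 : 0 ≤ ∫ x in Ω, ‖weakGrad Ω z x‖ ^ q n := integral_nonneg fun x => by positivity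
      rw [energy, integral_div, integral_div]
      have d1 := div_le_self i1 (show 1 ≤ p n by linarith)
      have d2 := div_le_self i2 (show 1 ≤ q n by linarith)
      have f1 := mul_le_mul_of_nonneg_left m1 hV.le
      have f2 := mul_le_mul_of_nonneg_left m2 hV.le
      linarith
    have hM0 : 0 ≤ max A (B ^ (q n / p n)) := hA0.trans (le_max_left _ _)
    have h3 := Real.rpow_le_rpow (mul_nonneg hlam hI0) h2 (show 0 ≤ 1 / p n by positivity)
    rw [Real.mul_rpow hlam hI0, Real.mul_rpow (by positivity) (Real.rpow_nonneg hM0 _),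
      ← Real.rpow_mul hM0, mul_one_div_cancel hp0.ne', Real.rpow_one, ← hroot] at h3
    rwa [le_div_iff₀ hmin]
  refine ⟨key.mono fun n hn => hn.1, _, ?_, key.mono fun n hn => hn.2⟩
  exact tnum.div tmin hS.ne'

/-- Gradient bounds pass to uniform limits as the exponents tend to infinity. -/
lemma memW1Top_of_tendstoUniformlyOn (hΩ : IsSmoothBoundedDomain Ω) {r : ℕ → ℝ}
    (hr : Tendsto r atTop atTop) {w : ℕ → Euc N → ℝ} {G : ℕ → Euc N → Euc N} {w₀ : Euc N → ℝ}
    (h : ∀ n, SobolevPair Ω (ENNReal.ofReal (r n)) (w n) (G n))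
    (hc : ContinuousOn w₀ (closure Ω)) (hl : TendstoUniformlyOn w w₀ atTop (closure Ω)) {l : ℝ}
    (hI : Tendsto (fun n => (∫ x in Ω, ‖G n x‖ ^ r n) ^ (1 / r n)) atTop (𝓝 l)) :
    MemW1Top Ω w₀ ∧ supNorm Ω (weakGrad Ω w₀) ≤ l := by
  have ho := hΩ.isOpen
  have hb := hΩ.isBounded
  have hV := measureReal_pos_of_isOpen ho hΩ.isConnected.nonempty hb
  have hl0 : 0 ≤ l := ge_of_tendsto' hI fun n =>
    Real.rpow_nonneg (integral_nonneg fun x => by positivity) _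
  -- At a fixed exponent `s`, Hölder and lower semicontinuity give a bound with constant `l`; the
  -- bounds for all `s` together control the essential supremum.
  have key : ∀ s : ℝ, 2 ≤ s → SobolevPair Ω (ENNReal.ofReal s) w₀ (weakGrad Ω w₀) ∧
      ∫ x in Ω, ‖weakGrad Ω w₀ x‖ ^ s ≤ volume.real Ω * l ^ s := by
    intro s hs
    have hs0 : 0 < s := by linarith
    refine sobolevPair_of_tendstoUniformlyOn (G := G) ho hb hs hc ?_ hl fun ε hε => ?_
    · filter_upwards [hr.eventually_ge_atTop s] with n hn
      exact (h n).mono_exponent hb (ENNReal.ofReal_le_ofReal hn)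
    · have hlim : Tendsto (fun n => ((∫ x in Ω, ‖G n x‖ ^ r n) ^ (1 / r n) *
          volume.real Ω ^ (1 / s - 1 / r n)) ^ s) atTop (𝓝 ((l * volume.real Ω ^ (1 / s - 0)) ^ s)) :=
        (hI.mul ((tendsto_const_nhds (x := volume.real Ω)).rpow
          ((ExponentLimit.tendsto_one_div hr).const_sub (1 / s)) (Or.inl hV.ne'))).rpow_const
          (Or.inr hs0.le)
      rw [sub_zero, Real.mul_rpow hl0 (by positivity), ← Real.rpow_mul hV.le,
        one_div_mul_cancel hs0.ne', Real.rpow_one, mul_comm] at hlim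
      filter_upwards [hlim.eventually (gt_mem_nhds (lt_add_of_pos_right _ hε)),
        hr.eventually_ge_atTop s] with n h1 hn
      refine le_trans ?_ h1.le
      rw [integral_norm_rpow_eq hs0
        ((h n).mono_exponent hb (ENNReal.ofReal_le_ofReal hn)).memLp_grad]
      exact Real.rpow_le_rpow ENNReal.toReal_nonneg
        (eLpNorm_toReal_le hb hs0 hn (h n).memLp_grad) hs0.le
  obtain ⟨h1, h2⟩ := supNorm_le_of_integral_rpow_le hb hl0 (fun s hs => (key s hs).1.memLp_grad)
    fun s hs => (key s hs).2
  have hpair : SobolevPair Ω ⊤ w₀ (weakGrad Ω w₀) :=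
    ⟨memLp_of_continuousOn ho hb hc _, h1, (key 2 le_rfl).1.ibp⟩
  exact ⟨⟨hpair.memW1 ho hb le_top, hc⟩, h2⟩

lemma signedPow_eq_sub {β : ℝ} (hβ : 2 ≤ β) (t : ℝ) :
    signedPow β t = t⁺ ^ (β - 1) - t⁻ ^ (β - 1) := by
  have hne : β - 1 ≠ 0 := by linarith
  have key : ∀ t : ℝ, 0 ≤ t → signedPow β t = t⁺ ^ (β - 1) - t⁻ ^ (β - 1) := by
    intro t ht
    rw [posPart_of_nonneg ht, negPart_of_nonneg ht, Real.zero_rpow hne, sub_zero, signedPow,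
      abs_of_nonneg ht]
    rcases ht.eq_or_lt with h | h
    · rw [← h, mul_zero, Real.zero_rpow hne]
    · rw [show β - 1 = (β - 2) + 1 by ring, Real.rpow_add h, Real.rpow_one]
  rcases le_total 0 t with ht | ht
  · exact key t ht
  · have := key (-t) (by linarith)
    rw [signedPow_neg, posPart_neg, negPart_neg] at this
    linarith

lemma bddBelow_rayleighTop :
    BddBelow {r | ∃ w z, AdmissibleTop Ω Γ Q w z ∧ r = rayleighTop Ω Γ Q w z} := by
  refine ⟨0, ?_⟩
  rintro _ ⟨w, z, -, rfl⟩
  exact div_nonneg ((supNorm_nonneg _).trans (le_max_left _ _)) (supNorm_nonneg _)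

/-- Normalized eigenfunctions converge along a subsequence to a minimizer of the limit problem. -/
lemma exists_subseq_minimizer (hN : 1 ≤ N) (hΩ : IsSmoothBoundedDomain Ω)
    (hL : ExponentLimit Γ Q p q α β) (hE : ∀ n, LargeExponents N (p n) (q n) (α n) (β n))
    {u v : ℕ → Euc N → ℝ} {Gu Gv : ℕ → Euc N → Euc N}
    (h : ∀ n, RegularEigenpair Ω (p n) (q n) (α n) (β n)
      (firstEigenvalue Ω (p n) (q n) (α n) (β n)) (u n) (v n) (Gu n) (Gv n)) :
    ∃ φ : ℕ → ℕ, StrictMono φ ∧ ∃ u₀ v₀, ContinuousOn u₀ (closure Ω) ∧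
      ContinuousOn v₀ (closure Ω) ∧ TendstoUniformlyOn (fun j => u (φ j)) u₀ atTop (closure Ω) ∧
      TendstoUniformlyOn (fun j => v (φ j)) v₀ atTop (closure Ω) ∧
      IsMinimizerTop Ω Γ Q u₀ v₀ ∧
      Tendsto (fun j => firstEigenvalue Ω (p (φ j)) (q (φ j)) (α (φ j)) (β (φ j)) ^ (1 / p (φ j)))
        atTop (𝓝 (lambdaTop Ω Γ Q)) := by
  have ho := hΩ.isOpen
  have hb := hΩ.isBounded
  have hne := hΩ.isConnected.nonempty
  have hp0 : ∀ n, 0 < p n := fun n => by linarith [(hE n).two_le_p hN]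
  have hq0 : ∀ n, 0 < q n := fun n => by linarith [(hE n).two_le_q hN]
  set lam : ℕ → ℝ := fun n => firstEigenvalue Ω (p n) (q n) (α n) (β n) with hlam
  have hlam0 : ∀ n, 0 ≤ lam n := fun n => firstEigenvalue_nonneg (hp0 n).le (hq0 n).le
  obtain ⟨wA, zA, hadm⟩ := exists_admissibleTop hN hΩ hL.Γ_pos hL.mul_pos
  -- A single pair of the limit class already bounds the roots of the eigenvalues.
  obtain ⟨C, hC⟩ : ∃ C, ∀ n, lam n ^ (1 / p n) ≤ C := by
    obtain ⟨-, b, hbl, hbd⟩ := hadm.exists_bound hN hΩ hL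
    have h1 : IsBoundedUnder (· ≤ ·) atTop fun n => lam n ^ (1 / p n) :=
      hbl.isBoundedUnder_le.mono_le hbd
    obtain ⟨C, hC⟩ := h1.bddAbove_range
    exact ⟨C, fun n => hC (mem_range_self n)⟩
  have hrootu : ∀ n, (∫ x in Ω, ‖Gu n x‖ ^ p n) ^ (1 / p n) =
      lam n ^ (1 / p n) * α n ^ (1 / p n) := fun n => by
    rw [(h n).integral_u hN (hE n), Real.mul_rpow (hlam0 n) (by linarith [(hE n).hα])]
  -- The `q`-th root of `lam` is the `p`-th root raised to `p / q`, which tends to `1 / Q`.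
  have hrootv : ∀ n, (∫ x in Ω, ‖Gv n x‖ ^ q n) ^ (1 / q n) =
      (lam n ^ (1 / p n)) ^ (p n / q n) * β n ^ (1 / q n) := fun n => by
    rw [(h n).integral_v hN (hE n), Real.mul_rpow (hlam0 n) (by linarith [(hE n).hβ]),
      ← Real.rpow_mul (hlam0 n), one_div_mul_eq_div, div_div_cancel_left' (hp0 n).ne', one_div]
  have hx : ∀ n, lam n ^ (1 / p n) ∈ Icc 0 C := fun n => ⟨Real.rpow_nonneg (hlam0 n) _, hC n⟩
  obtain ⟨l, -, φ₁, hφ₁, hl₁⟩ := isCompact_Icc.tendsto_subseq hx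
  have hl0 : 0 ≤ l := ge_of_tendsto' hl₁ fun n => (hx _).1
  have hL₁ := hL.comp hφ₁.tendsto_atTop
  have hru : Tendsto (fun j => (∫ x in Ω, ‖Gu (φ₁ j) x‖ ^ p (φ₁ j)) ^ (1 / p (φ₁ j))) atTop
      (𝓝 l) := by
    simp only [hrootu]
    simpa using hl₁.mul hL₁.tendsto_α_root
  have hrv : Tendsto (fun j => (∫ x in Ω, ‖Gv (φ₁ j) x‖ ^ q (φ₁ j)) ^ (1 / q (φ₁ j))) atTop
      (𝓝 (l ^ (1 / Q))) := by
    simp only [hrootv]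
    simpa using (hl₁.rpow hL₁.tendsto_p_div_q (Or.inr (one_div_pos.2 hL.Q_pos))).mul
      hL₁.tendsto_β_root
  obtain ⟨C₁, hC₁⟩ := hru.isBoundedUnder_le.bddAbove_range
  obtain ⟨C₂, hC₂⟩ := hrv.isBoundedUnder_le.bddAbove_range
  set V := max 1 (volume.real Ω) with hV
  have hV0 : 0 ≤ V := zero_le_one.trans (le_max_left _ _)
  have hMu : ∀ j, gradNorm Ω (Gu (φ₁ j)) ≤ max (C₁ * V) (C₂ * V) := fun j => by
    refine (gradNorm_le hN hb (hE _).hp (h _).pair_u.memLp_grad).trans (le_trans ?_ (le_max_left _ _))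
    exact mul_le_mul_of_nonneg_right (hC₁ (mem_range_self j)) hV0
  have hMv : ∀ j, gradNorm Ω (Gv (φ₁ j)) ≤ max (C₁ * V) (C₂ * V) := fun j => by
    refine (gradNorm_le hN hb (hE _).hq (h _).pair_v.memLp_grad).trans (le_trans ?_ (le_max_right _ _))
    exact mul_le_mul_of_nonneg_right (hC₂ (mem_range_self j)) hV0
  have hz : ∀ j, ∃ x ∈ Ω, v (φ₁ j) x = 0 := fun j => by
    obtain ⟨x, hx, h1, -⟩ := (h (φ₁ j)).exists_ne_zero ho (hE _)
    exact exists_zero_of_moment_eq_zero hΩ (by linarith [(hE (φ₁ j)).hα]) (hE _).hβ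
      (h _).cont_u (h _).cont_v ⟨x, hx, h1⟩ ((h _).moment_eq hN hΩ (hE _))
  obtain ⟨φ₂, hφ₂, u₀, v₀, hu₀, hv₀, hul, hvl, hzero⟩ :=
    exists_subseq_regularPair hN hΩ (fun j => (hE (φ₁ j)).hp) (fun j => (hE (φ₁ j)).hq)
      (fun j => (h (φ₁ j)).toRegularPair) hMu hMv hz
  set φ := φ₁ ∘ φ₂ with hφ
  have hφm : StrictMono φ := hφ₁.comp hφ₂
  have hL₂ := hL.comp hφm.tendsto_atTop
  have hl₂ : Tendsto (fun j => lam (φ j) ^ (1 / p (φ j))) atTop (𝓝 l) := hl₁.comp hφ₂.tendsto_atTop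
  obtain ⟨huW, huG⟩ := memW1Top_of_tendstoUniformlyOn hΩ hL₂.hp (fun j => (h (φ j)).pair_u) hu₀ hul
    (hru.comp hφ₂.tendsto_atTop)
  obtain ⟨hvW, hvG⟩ := memW1Top_of_tendstoUniformlyOn hΩ hL₂.hq (fun j => (h (φ j)).pair_v) hv₀ hvl
    (hrv.comp hφ₂.tendsto_atTop)
  have hcu : ∀ᶠ j in atTop, ContinuousOn (u (φ j)) (closure Ω) :=
    Eventually.of_forall fun j => (h _).cont_u
  have hcv : ∀ᶠ j in atTop, ContinuousOn (v (φ j)) (closure Ω) :=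
    Eventually.of_forall fun j => (h _).cont_v
  have hsup : sSup ((fun x => |u₀ x| ^ Γ * |v₀ x| ^ ((1 - Γ) * Q)) '' Ω) = 1 := by
    refine tendsto_nhds_unique (tendsto_root_integral_mul hΩ continuous_abs continuous_abs
      (fun _ => abs_nonneg _) (fun _ => abs_nonneg _) hcu hcv hu₀ hv₀ hul hvl hL.Γ_pos hL.mul_pos
      hL₂.hp hL₂.hΓ hL₂.tendsto_β_div_p) ?_
    refine tendsto_const_nhds.congr fun j => ?_
    have e := (h (φ j)).coupling_eq
    rw [coupling] at e
    simp only [Function.comp_apply, hφ] at e ⊢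
    rw [e, Real.one_rpow]
  have hnorm : supNorm Ω (fun x => |u₀ x| ^ Γ * |v₀ x| ^ ((1 - Γ) * Q)) = 1 := by
    rw [supNorm_eq_sSup ho hb hne (continuousOn_limit_weight continuous_abs continuous_abs
      hL.Γ_pos.le hL.mul_pos.le hu₀ hv₀) fun x _ => by positivity, hsup]
  -- The moment carries the exponent `β - 1`; the missing `1 / p` vanishes in the limit, so the
  -- balance condition appears with the exponent of the limit class.
  have hβ' : Tendsto (fun j => (β (φ j) - 1) / p (φ j)) atTop (𝓝 ((1 - Γ) * Q)) := by
    have := hL₂.tendsto_β_div_p.sub (ExponentLimit.tendsto_one_div hL₂.hp)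
    rw [sub_zero] at this
    exact this.congr fun j => (sub_div _ _ _).symm
  have hmom : ∀ j, ∫ x in Ω, |u (φ j) x| ^ α (φ j) * (v (φ j) x)⁺ ^ (β (φ j) - 1) =
      ∫ x in Ω, |u (φ j) x| ^ α (φ j) * (v (φ j) x)⁻ ^ (β (φ j) - 1) := by
    intro j
    have hβ := (hE (φ j)).hβ
    have hα := (hE (φ j)).hα
    have e := (h (φ j)).moment_eq hN hΩ (hE _)
    simp only [moment, signedPow_eq_sub hβ, mul_sub] at e
    rw [integral_sub] at e
    · exact sub_eq_zero.1 e
    · exact integrableOn_of_continuousOn ho hb (continuousOn_limit_weight continuous_abs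
        continuous_posPart (by linarith) (by linarith) (h _).cont_u (h _).cont_v)
    · exact integrableOn_of_continuousOn ho hb (continuousOn_limit_weight continuous_abs
        continuous_negPart (by linarith) (by linarith) (h _).cont_u (h _).cont_v)
  have hcon : sSup ((fun x => |u₀ x| ^ Γ * ((v₀ x)⁺) ^ ((1 - Γ) * Q)) '' Ω) =
      sSup ((fun x => |u₀ x| ^ Γ * ((v₀ x)⁻) ^ ((1 - Γ) * Q)) '' Ω) := by
    have t1 := tendsto_root_integral_mul hΩ continuous_abs continuous_posPart
      (fun _ => abs_nonneg _) (fun _ => posPart_nonneg _) hcu hcv hu₀ hv₀ hul hvl hL.Γ_pos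
      hL.mul_pos hL₂.hp hL₂.hΓ hβ'
    have t2 := tendsto_root_integral_mul hΩ continuous_abs continuous_negPart
      (fun _ => abs_nonneg _) (fun _ => negPart_nonneg _) hcu hcv hu₀ hv₀ hul hvl hL.Γ_pos
      hL.mul_pos hL₂.hp hL₂.hΓ hβ'
    refine tendsto_nhds_unique t1 (t2.congr fun j => ?_)
    have := hmom j
    simp only [Function.comp_apply, hφ] at this ⊢
    rw [this]
  have hex : ∃ x ∈ Ω, u₀ x * v₀ x ≠ 0 := by
    obtain ⟨_, ⟨x, hx, rfl⟩, hpos⟩ := exists_lt_of_lt_csSup (hne.image _)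
      (by rw [hsup]; exact zero_lt_one : (0 : ℝ) < sSup ((fun x => |u₀ x| ^ Γ * |v₀ x| ^ ((1 - Γ) * Q)) '' Ω))
    refine ⟨x, hx, fun h0 => ?_⟩
    rcases mul_eq_zero.1 h0 with h0 | h0
    · simp [h0, Real.zero_rpow hL.Γ_pos.ne'] at hpos
    · simp only [h0, abs_zero, Real.zero_rpow hL.mul_pos.ne', mul_zero, lt_irrefl] at hpos
  have hadm₀ : AdmissibleTop Ω Γ Q u₀ v₀ := ⟨⟨huW, hzero⟩, hvW, hex, hcon⟩
  have hle : rayleighTop Ω Γ Q u₀ v₀ ≤ l := by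
    rw [rayleighTop, hnorm, div_one]
    refine max_le huG ((Real.rpow_le_rpow (supNorm_nonneg _) hvG hL.Q_pos.le).trans (le_of_eq ?_))
    rw [← Real.rpow_mul hl0, one_div_mul_cancel hL.Q_pos.ne', Real.rpow_one]
  -- The upper bound applies to every competitor, hence to the infimum; together with `hle` all
  -- inequalities become equalities.
  have hge : l ≤ lambdaTop Ω Γ Q := by
    refine le_csInf ⟨_, u₀, v₀, hadm₀, rfl⟩ ?_
    rintro _ ⟨w, z, hwz, rfl⟩
    obtain ⟨-, b, hbl, hbd⟩ := hwz.exists_bound hN hΩ hL₂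
    exact le_of_tendsto_of_tendsto hl₂ hbl hbd
  have hlt : lambdaTop Ω Γ Q ≤ rayleighTop Ω Γ Q u₀ v₀ :=
    csInf_le bddBelow_rayleighTop ⟨u₀, v₀, hadm₀, rfl⟩
  have hll : l = lambdaTop Ω Γ Q := le_antisymm hge (hlt.trans hle)
  refine ⟨φ, hφm, u₀, v₀, hu₀, hv₀, hul, hvl, ⟨hadm₀, le_antisymm (hle.trans hge) hlt⟩, ?_⟩
  rw [← hll]
  exact hl₂

end

section

variable {N : ℕ} {Ω : Set (Euc N)}

/-! ### Integration by parts against vector fields -/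

/-- The divergence of a vector field. -/
noncomputable def divergence (X : Euc N → Euc N) (x : Euc N) : ℝ :=
  ∑ i, inner ℝ (fderiv ℝ X x (EuclideanSpace.basisFun (Fin N) ℝ i))
    (EuclideanSpace.basisFun (Fin N) ℝ i)

lemma continuous_divergence {X : Euc N → Euc N} (hX : ContDiff ℝ 1 X) :
    Continuous (divergence X) :=
  continuous_finsetSum _ fun _ _ =>
    ((hX.continuous_fderiv one_ne_zero).clm_apply continuous_const).inner continuous_const

lemma integrableOn_inner_of_bounded {Y Z : Euc N → Euc N} (hZ : IntegrableOn Z Ω)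
    (hY : Continuous Y) (hb : ∃ C, ∀ x, ‖Y x‖ ≤ C) :
    IntegrableOn (fun x => inner ℝ (Y x) (Z x)) Ω := by
  obtain ⟨C, hC⟩ := hb
  refine (hZ.norm.const_mul C).mono' (hY.aestronglyMeasurable.inner hZ.aestronglyMeasurable)
    (Eventually.of_forall fun x => ?_)
  exact (norm_inner_le_norm _ _).trans (mul_le_mul_of_nonneg_right (hC x) (norm_nonneg _))

lemma SobolevPair.integrableOn_smul_field {r : ℝ≥0∞} {z Z} (h : SobolevPair Ω r z Z)
    (hb : Bornology.IsBounded Ω) (hr : 1 ≤ r) {X : Euc N → Euc N} (hX : ContDiff ℝ 1 X)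
    {χ : Euc N → ℝ} (hχ : Continuous χ) (hc : HasCompactSupport χ) :
    IntegrableOn (fun x => χ x * (inner ℝ (X x) (Z x) + z x * divergence X x)) Ω := by
  have i1 : IntegrableOn (fun x => inner ℝ (χ x • X x) (Z x)) Ω :=
    integrableOn_inner_of_bounded (h.integrable_grad hb hr) (hχ.smul hX.continuous)
      ((hc.smul_right (f' := X)).exists_bound_of_continuous (hχ.smul hX.continuous))
  have i2 : IntegrableOn (fun x => z x * (χ x * divergence X x)) Ω :=
    integrableOn_mul_of_bounded (h.integrable hb hr) (hχ.mul (continuous_divergence hX))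
      ((hc.mul_right (f' := divergence X)).exists_bound_of_continuous
        (hχ.mul (continuous_divergence hX)))
  refine (i1.add i2).congr (Eventually.of_forall fun x => ?_)
  simp only [Pi.add_apply, real_inner_smul_left]
  ring

/-- The scalar identity tested with `ζ` times each coordinate of `X` and summed; the divergence of
`ζ X` is `ζ div X` plus the derivative of `ζ` along `X`. -/
lemma SobolevPair.ibp_field {r : ℝ≥0∞} {z Z} (h : SobolevPair Ω r z Z) (ho : IsOpen Ω)
    (hb : Bornology.IsBounded Ω) (hr : 1 ≤ r) {X : Euc N → Euc N} (hX : ContDiff ℝ 1 X)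
    {ζ : Euc N → ℝ} (hζ : ContDiff ℝ 1 ζ) (hc : HasCompactSupport ζ) (hs : tsupport ζ ⊆ Ω) :
    ∫ x in Ω, ζ x * (inner ℝ (X x) (Z x) + z x * divergence X x) =
      - ∫ x in Ω, z x * fderiv ℝ ζ x (X x) := by
  set b := EuclideanSpace.basisFun (Fin N) ℝ with hbdef
  have hXi : ∀ i, ContDiff ℝ 1 fun x => inner ℝ (X x) (b i) := fun i => hX.inner ℝ contDiff_const
  have hder : ∀ i x, fderiv ℝ (fun y => ζ y * inner ℝ (X y) (b i)) x (b i) =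
      ζ x * inner ℝ (fderiv ℝ X x (b i)) (b i) + inner ℝ (X x) (b i) * fderiv ℝ ζ x (b i) := by
    intro i x
    have d1 := (hX.differentiable one_ne_zero x).hasFDerivAt
    have d2 := (hζ.differentiable one_ne_zero x).hasFDerivAt
    have d3 := d2.mul (d1.inner ℝ (hasFDerivAt_const (b i) x))
    rw [show (fun y => ζ y * inner ℝ (X y) (b i)) = ζ * fun y => inner ℝ (X y) (b i) from rfl,
      d3.fderiv]
    simp [fderivInnerCLM_apply]
  have hcs : ∀ i, HasCompactSupport fun y => ζ y * inner ℝ (X y) (b i) := fun i => hc.mul_right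
  have hψ : ∀ i, ContDiff ℝ 1 fun y => ζ y * inner ℝ (X y) (b i) := fun i => hζ.mul (hXi i)
  have heq : ∀ i, ∫ x in Ω, z x * fderiv ℝ (fun y => ζ y * inner ℝ (X y) (b i)) x (b i) =
      - ∫ x in Ω, ζ x * inner ℝ (X x) (b i) * inner ℝ (Z x) (b i) := fun i =>
    h.ibp_contDiff ho hb hr (hψ i) (hcs i)
      ((closure_mono (Function.support_mul_subset_left _ _)).trans hs) (b i)
  have hsum := Finset.sum_congr rfl fun i (_ : i ∈ Finset.univ) => heq i
  rw [Finset.sum_neg_distrib, ← integral_finsetSum, ← integral_finsetSum] at hsum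
  rotate_left
  · intro i _
    have hcont : Continuous fun x => ζ x * inner ℝ (X x) (b i) := (hψ i).continuous
    refine (integrableOn_inner_of_bounded (h.integrable_grad hb hr)
      (Y := fun x => (ζ x * inner ℝ (X x) (b i)) • b i) (hcont.smul continuous_const)
      (((hcs i).smul_right (f' := fun _ => b i)).exists_bound_of_continuous
        (hcont.smul continuous_const))).congr (Eventually.of_forall fun x => ?_)
    simp only [real_inner_smul_left]
    rw [real_inner_comm (b i) (Z x)]
  · intro i _
    have hcont : Continuous fun x => fderiv ℝ (fun y => ζ y * inner ℝ (X y) (b i)) x (b i) :=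
      ((hψ i).continuous_fderiv one_ne_zero).clm_apply continuous_const
    exact integrableOn_mul_of_bounded (h.integrable hb hr) hcont
      (((hcs i).fderiv_apply (𝕜 := ℝ) (b i)).exists_bound_of_continuous hcont)
  have e1 : ∀ x, ∑ i, z x * fderiv ℝ (fun y => ζ y * inner ℝ (X y) (b i)) x (b i) =
      z x * (ζ x * divergence X x) + z x * fderiv ℝ ζ x (X x) := by
    intro x
    simp only [hder]
    rw [← Finset.mul_sum, Finset.sum_add_distrib, ← Finset.mul_sum, mul_add]
    congr 2
    conv_rhs => rw [← b.sum_repr' (X x), map_sum]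
    refine Finset.sum_congr rfl fun i _ => ?_
    rw [map_smul, smul_eq_mul, real_inner_comm]
  have e2 : ∀ x, ∑ i, ζ x * inner ℝ (X x) (b i) * inner ℝ (Z x) (b i) =
      ζ x * inner ℝ (X x) (Z x) := by
    intro x
    rw [← b.sum_inner_mul_inner (X x) (Z x), Finset.mul_sum]
    refine Finset.sum_congr rfl fun i _ => ?_
    rw [real_inner_comm (Z x) (b i)]
    ring
  simp only [e1, e2] at hsum
  have i1 : IntegrableOn (fun x => z x * (ζ x * divergence X x)) Ω :=
    integrableOn_mul_of_bounded (h.integrable hb hr) (hζ.continuous.mul (continuous_divergence hX))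
      ((hc.mul_right (f' := divergence X)).exists_bound_of_continuous
        (hζ.continuous.mul (continuous_divergence hX)))
  have i2 : IntegrableOn (fun x => z x * fderiv ℝ ζ x (X x)) Ω := by
    have hcont : Continuous fun x => fderiv ℝ ζ x (X x) :=
      (hζ.continuous_fderiv one_ne_zero).clm_apply hX.continuous
    refine integrableOn_mul_of_bounded (h.integrable hb hr) hcont
      (HasCompactSupport.exists_bound_of_continuous ?_ hcont)
    refine (hc.fderiv (𝕜 := ℝ)).mono fun x hx h0 => hx ?_
    simp only [h0, zero_apply]
  have i3 : IntegrableOn (fun x => ζ x * inner ℝ (X x) (Z x)) Ω := by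
    refine (integrableOn_inner_of_bounded (h.integrable_grad hb hr)
      (Y := fun x => ζ x • X x) (hζ.continuous.smul hX.continuous)
      ((hc.smul_right (f' := X)).exists_bound_of_continuous
        (hζ.continuous.smul hX.continuous))).congr (Eventually.of_forall fun x => ?_)
    simp only [real_inner_smul_left]
  rw [integral_add i1 i2] at hsum
  have e3 : ∫ x in Ω, ζ x * (inner ℝ (X x) (Z x) + z x * divergence X x) =
      (∫ x in Ω, ζ x * inner ℝ (X x) (Z x)) + ∫ x in Ω, z x * (ζ x * divergence X x) := by
    rw [← integral_add i3 i1]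
    congr 1; ext x; ring
  rw [e3]
  linarith

/-- For `k > 0` the second factor is an inner cutoff: zero where `ρ ≥ -1 / k`, one where `ρ ≤ -2 /
k`. Since `ρ` is regular only in `U`, it is used under the localization `χ`. -/
lemma contDiff_cutoff_mul {U : Set (Euc N)} (hU : IsOpen U) {ρ χ : Euc N → ℝ}
    (hρ : ContDiffOn ℝ 1 ρ U) (hχ : ContDiff ℝ 1 χ) (hχU : tsupport χ ⊆ U) (k : ℝ) :
    ContDiff ℝ 1 fun x => χ x * Real.smoothTransition (-(k * ρ x) - 1) := by
  rw [contDiff_iff_contDiffAt]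
  intro x
  by_cases hx : x ∈ tsupport χ
  · have h1 : ContDiffAt ℝ 1 ρ x := (hρ x (hχU hx)).contDiffAt (hU.mem_nhds (hχU hx))
    have h2 : ContDiffAt ℝ 1 (fun x => -(k * ρ x) - 1) x :=
      ((contDiffAt_const.mul h1).neg).sub contDiffAt_const
    exact hχ.contDiffAt.mul
      ((Real.smoothTransition.contDiff (n := 1)).contDiffAt.comp x h2)
  · have h1 := notMem_tsupport_iff_eventuallyEq.1 hx
    refine (contDiffAt_const (c := (0 : ℝ))).congr_of_eventuallyEq ?_
    filter_upwards [h1] with y hy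
    rw [hy, Pi.zero_apply, zero_mul]

lemma deriv_smoothTransition_nonneg (t : ℝ) : 0 ≤ deriv Real.smoothTransition t :=
  Real.smoothTransition.monotone.deriv_nonneg

/-- The divergence inequality for nonnegative functions and fields pointing inwards where the
cutoff meets the boundary. -/
lemma SobolevPair.integral_field_nonpos {r : ℝ≥0∞} {z Z} (h : SobolevPair Ω r z Z) (ho : IsOpen Ω)
    (hb : Bornology.IsBounded Ω) (hr : 1 ≤ r) {X : Euc N → Euc N} (hX : ContDiff ℝ 1 X)
    {U : Set (Euc N)} (hU : IsOpen U) {ρ χ : Euc N → ℝ} (hρ : ContDiffOn ℝ 1 ρ U)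
    (hρΩ : ∀ y ∈ U, (y ∈ Ω ↔ ρ y < 0)) (hχ : ContDiff ℝ 1 χ) (hc : HasCompactSupport χ)
    (hχU : tsupport χ ⊆ U) (hχ0 : ∀ x, 0 ≤ χ x) (hz0 : ∀ x ∈ Ω, 0 ≤ z x)
    (hzχ : ∀ x ∈ Ω, z x = 0 ∨ fderiv ℝ χ x = 0)
    (hang : ∀ x ∈ tsupport χ, fderiv ℝ ρ x (X x) ≤ 0) :
    ∫ x in Ω, χ x * (inner ℝ (X x) (Z x) + z x * divergence X x) ≤ 0 := by
  set ζ : ℕ → Euc N → ℝ := fun k x => χ x * Real.smoothTransition (-(k * ρ x) - 1) with hζ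
  have hζ1 : ∀ k, ContDiff ℝ 1 (ζ k) := fun k => contDiff_cutoff_mul hU hρ hχ hχU k
  have hζc : ∀ k, HasCompactSupport (ζ k) := fun k => hc.mul_right
  have hρat : ∀ x ∈ tsupport χ, DifferentiableAt ℝ ρ x := fun x hx =>
    ((hρ x (hχU hx)).contDiffAt (hU.mem_nhds (hχU hx))).differentiableAt one_ne_zero
  have hζs : ∀ k, tsupport (ζ k) ⊆ Ω := by
    intro k x hx
    have hxχ : x ∈ tsupport χ := closure_mono (Function.support_mul_subset_left _ _) hx
    rw [hρΩ x (hχU hxχ)]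
    by_contra! hcon
    have hlt : -(k * ρ x) - 1 < 0 := by
      have : 0 ≤ (k : ℝ) * ρ x := by positivity
      linarith
    have hev : ∀ᶠ y in 𝓝 x, -(k * ρ y) - 1 < 0 :=
      (((continuousAt_const.mul (hρat x hxχ).continuousAt).neg).sub
        continuousAt_const).eventually (gt_mem_nhds hlt)
    refine (notMem_tsupport_iff_eventuallyEq.2 ?_) hx
    filter_upwards [hev] with y hy
    simp only [hζ, Real.smoothTransition.zero_of_nonpos hy.le, mul_zero, Pi.zero_apply]
  -- This is the boundary-layer term. Its part with the derivative of `χ` vanishes by `hzχ`, and the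
  -- rest is a product of nonnegative factors with `-fderiv ℝ ρ x (X x) ≥ 0`. Only this sign
  -- survives as `k → ∞`, so no boundary integral or trace is needed.
  have hpos : ∀ k, ∀ x ∈ Ω, 0 ≤ z x * fderiv ℝ (ζ k) x (X x) := by
    intro k x hx
    by_cases hxχ : x ∈ tsupport χ
    · have d1 := (hχ.differentiable one_ne_zero x).hasFDerivAt
      have d2 : HasFDerivAt (fun y => -((k : ℝ) * ρ y) - 1) (-((k : ℝ) • fderiv ℝ ρ x)) x :=
        (((hρat x hxχ).hasFDerivAt.const_mul (k : ℝ)).neg).sub_const 1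
      have d3 : HasDerivAt Real.smoothTransition (deriv Real.smoothTransition (-(k * ρ x) - 1))
          (-(k * ρ x) - 1) :=
        ((Real.smoothTransition.contDiff (n := 1)).differentiable one_ne_zero _).hasDerivAt
      have d4 := d1.mul (d3.comp_hasFDerivAt x d2)
      have e : fderiv ℝ (ζ k) x = _ := d4.fderiv
      rw [e]
      simp only [add_apply, smul_apply, smul_eq_mul,
        neg_apply, Function.comp_apply]
      have t1 : z x * fderiv ℝ χ x (X x) = 0 := by
        rcases hzχ x hx with h0 | h0
        · rw [h0, zero_mul]
        · rw [h0, zero_apply, mul_zero]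
      have t2 : 0 ≤ z x * χ x * deriv Real.smoothTransition (-(k * ρ x) - 1) *
          (k * -fderiv ℝ ρ x (X x)) :=
        mul_nonneg (mul_nonneg (mul_nonneg (hz0 x hx) (hχ0 x)) (deriv_smoothTransition_nonneg _))
          (mul_nonneg k.cast_nonneg (neg_nonneg.2 (hang x hxχ)))
      linear_combination t2 - Real.smoothTransition (-(k * ρ x) - 1) * t1
    · have h0 : ζ k =ᶠ[𝓝 x] fun _ => 0 := by
        filter_upwards [notMem_tsupport_iff_eventuallyEq.1 hxχ] with y hy
        simp only [hζ, hy, Pi.zero_apply, zero_mul]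
      rw [h0.fderiv_eq]
      simp
  have hle : ∀ k, ∫ x in Ω, ζ k x * (inner ℝ (X x) (Z x) + z x * divergence X x) ≤ 0 := by
    intro k
    rw [h.ibp_field ho hb hr hX (hζ1 k) (hζc k) (hζs k), neg_nonpos]
    exact setIntegral_nonneg ho.measurableSet (hpos k)
  refine le_of_tendsto' (tendsto_integral_of_dominated_convergence
    (fun x => ‖χ x * (inner ℝ (X x) (Z x) + z x * divergence X x)‖)
    (fun k => (h.integrableOn_smul_field hb hr hX (hζ1 k).continuous (hζc k)).aestronglyMeasurable)
    (h.integrableOn_smul_field hb hr hX hχ.continuous hc).norm (fun k => ?_) ?_) hle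
  · refine Eventually.of_forall fun x => ?_
    simp only [hζ, norm_mul, Real.norm_eq_abs, abs_of_nonneg (Real.smoothTransition.nonneg _)]
    refine mul_le_mul_of_nonneg_right ?_ (abs_nonneg _)
    exact mul_le_of_le_one_right (abs_nonneg _) (Real.smoothTransition.le_one _)
  · filter_upwards [ae_restrict_mem ho.measurableSet] with x hx
    refine Tendsto.mul_const _ ?_
    by_cases hxχ : x ∈ tsupport χ
    · have hneg : ρ x < 0 := (hρΩ x (hχU hxχ)).1 hx
      refine tendsto_const_nhds.congr' ?_
      have hlim : Tendsto (fun k : ℕ => (k : ℝ) * -ρ x) atTop atTop :=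
        tendsto_natCast_atTop_atTop.atTop_mul_const (neg_pos.2 hneg)
      filter_upwards [hlim.eventually_ge_atTop 2] with k hk
      simp only [hζ]
      rw [Real.smoothTransition.one_of_one_le (by linarith), mul_one]
    · simp only [hζ, image_eq_zero_of_notMem_tsupport hxχ, zero_mul]
      exact tendsto_const_nhds

/-! ### The `r`-Laplacian of test functions -/

/-- The Laplacian of `φ`. -/
noncomputable def hessianTrace (φ : Euc N → ℝ) (x : Euc N) : ℝ :=
  ∑ i, fderiv ℝ (fderiv ℝ φ) x (EuclideanSpace.basisFun (Fin N) ℝ i)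
    (EuclideanSpace.basisFun (Fin N) ℝ i)

/-- The infinity Laplacian `⟨D²φ ∇φ, ∇φ⟩`. -/
noncomputable def inftyLaplacian (φ : Euc N → ℝ) (x : Euc N) : ℝ :=
  fderiv ℝ (fderiv ℝ φ) x (∇ φ x) (∇ φ x)

/-- The field `‖∇φ‖^s ∇φ`. -/
noncomputable def gradField (s : ℝ) (φ : Euc N → ℝ) (x : Euc N) : Euc N := ‖∇ φ x‖ ^ s • ∇ φ x

lemma contDiff_gradient {φ : Euc N → ℝ} (hφ : ContDiff ℝ 2 φ) : ContDiff ℝ 1 (∇ φ) :=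
  (InnerProductSpace.toDual ℝ (Euc N)).symm.contDiff.comp
    (hφ.fderiv_right (m := 1) (by norm_num))

lemma continuous_fderiv_fderiv {φ : Euc N → ℝ} (hφ : ContDiff ℝ 2 φ) :
    Continuous (fderiv ℝ (fderiv ℝ φ)) :=
  (hφ.fderiv_right (m := 1) (by norm_num)).continuous_fderiv one_ne_zero

lemma inner_fderiv_gradient {φ : Euc N → ℝ} (hφ : ContDiff ℝ 2 φ) (x a b : Euc N) :
    inner ℝ (fderiv ℝ (∇ φ) x a) b = fderiv ℝ (fderiv ℝ φ) x a b := by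
  have h1 : HasFDerivAt (fderiv ℝ φ) (fderiv ℝ (fderiv ℝ φ) x) x :=
    ((hφ.fderiv_right (m := 1) (by norm_num)).differentiable one_ne_zero x).hasFDerivAt
  have h2 := ((InnerProductSpace.toDual ℝ (Euc N)).symm.toContinuousLinearEquiv
    |>.toContinuousLinearMap.hasFDerivAt (x := fderiv ℝ φ x)).comp x h1
  have e : fderiv ℝ (∇ φ) x = _ := h2.fderiv
  rw [e]
  exact InnerProductSpace.toDual_symm_apply

lemma contDiff_gradField {φ : Euc N → ℝ} (hφ : ContDiff ℝ 2 φ) {s : ℝ} (hs : 1 < s) :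
    ContDiff ℝ 1 (gradField s φ) :=
  ((contDiff_norm_rpow hs).comp (contDiff_gradient hφ)).smul (contDiff_gradient hφ)

/-- With `s = r - 2` this is the expanded `r`-Laplacian. The condition `s > 1` keeps the field `C¹`
at critical points of `φ`. -/
lemma divergence_gradField {φ : Euc N → ℝ} (hφ : ContDiff ℝ 2 φ) {s : ℝ} (hs : 1 < s)
    (x : Euc N) :
    divergence (gradField s φ) x =
      ‖∇ φ x‖ ^ s * hessianTrace φ x + s * ‖∇ φ x‖ ^ (s - 2) * inftyLaplacian φ x := by
  set b := EuclideanSpace.basisFun (Fin N) ℝ with hbdef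
  have h1 : HasFDerivAt (∇ φ) (fderiv ℝ (∇ φ) x) x :=
    ((contDiff_gradient hφ).differentiable one_ne_zero x).hasFDerivAt
  have h2 := ((hasFDerivAt_norm_rpow (∇ φ x) hs).comp x h1).smul h1
  have e : fderiv ℝ (gradField s φ) x = _ := h2.fderiv
  have hterm : ∀ i, inner ℝ (fderiv ℝ (gradField s φ) x (b i)) (b i) =
      ‖∇ φ x‖ ^ s * fderiv ℝ (fderiv ℝ φ) x (b i) (b i) +
        s * ‖∇ φ x‖ ^ (s - 2) *
          (inner ℝ (b i) (∇ φ x) * fderiv ℝ (fderiv ℝ φ) x (b i) (∇ φ x)) := by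
    intro i
    rw [e]
    simp only [add_apply, smul_apply,
      ContinuousLinearMap.smulRight_apply, ContinuousLinearMap.comp_apply, Function.comp_apply,
      innerSL_apply_apply, inner_add_left, real_inner_smul_left, inner_fderiv_gradient hφ,
      smul_eq_mul]
    rw [real_inner_comm (fderiv ℝ (∇ φ) x (b i)) (∇ φ x), inner_fderiv_gradient hφ,
      real_inner_comm (b i) (∇ φ x)]
    ring
  rw [divergence, Finset.sum_congr rfl fun i _ => hterm i, Finset.sum_add_distrib,
    ← Finset.mul_sum, ← Finset.mul_sum]
  congr 2
  have e1 := congrArg (fun y => fderiv ℝ (fderiv ℝ φ) x y (∇ φ x)) (b.sum_repr' (∇ φ x))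
  simp only [map_sum, map_smul, sum_apply, smul_apply, smul_eq_mul] at e1
  exact e1

end

section

variable {N : ℕ} {Ω : Set (Euc N)}

/-! ### Test functions touching the limit from below -/

/-- Continuous weak solutions of `-Δ_{r n} (v n) = f n` in `Ω`, tested with functions vanishing
outside `U`, that converge uniformly to `v₀` while `r n → ∞`. -/
structure WeakLimit (Ω U : Set (Euc N)) (r : ℕ → ℝ) (f v : ℕ → Euc N → ℝ)
    (G : ℕ → Euc N → Euc N) (v₀ : Euc N → ℝ) : Prop where
  hr : Tendsto r atTop atTop
  cont : ∀ n, ContinuousOn (v n) (closure Ω)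
  cont_f : ∀ n, ContinuousOn (f n) (closure Ω)
  pair : ∀ n, SobolevPair Ω (ENNReal.ofReal (r n)) (v n) (G n)
  weak_eq : ∀ n z Z, SobolevPair Ω (ENNReal.ofReal (r n)) z Z → ContinuousOn z (closure Ω) →
    (∀ x ∉ U, z x = 0) →
    ∫ x in Ω, ‖G n x‖ ^ (r n - 2) * inner ℝ (G n x) (Z x) = ∫ x in Ω, f n x * z x
  lim : TendstoUniformlyOn v v₀ atTop (closure Ω)
  cont_lim : ContinuousOn v₀ (closure Ω)

/-- The sum of the two tangent inequalities for `‖·‖ ^ q`, at `a` and at `b`. -/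
lemma inner_rpow_monotone {E : Type*} [NormedAddCommGroup E] [InnerProductSpace ℝ E] {q : ℝ}
    (hq : 1 < q) (a b : E) :
    ‖a‖ ^ (q - 2) * inner ℝ a (b - a) ≤ ‖b‖ ^ (q - 2) * inner ℝ b (b - a) := by
  have h1 := norm_rpow_convex hq a b
  have h2 := norm_rpow_convex hq b a
  rw [← neg_sub b a, inner_neg_right] at h2
  have h3 : q * (‖a‖ ^ (q - 2) * inner ℝ a (b - a)) ≤
      q * (‖b‖ ^ (q - 2) * inner ℝ b (b - a)) := by linarith
  exact le_of_mul_le_mul_left h3 (by linarith)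

lemma exists_deriv_smoothTransition_bound : ∃ L, ∀ t, |deriv Real.smoothTransition t| ≤ L := by
  have hc : Continuous (deriv Real.smoothTransition) :=
    (Real.smoothTransition.contDiff (n := 1)).continuous_deriv le_rfl
  obtain ⟨L, hL⟩ := (isCompact_Icc (a := (0 : ℝ)) (b := 1)).exists_bound_of_continuousOn
    hc.continuousOn
  refine ⟨L, fun t => ?_⟩
  have hL0 : 0 ≤ L := (norm_nonneg _).trans (hL 0 ⟨le_rfl, zero_le_one⟩)
  by_cases ht : t ∈ Icc (0 : ℝ) 1
  · exact hL t ht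
  · have h0 : deriv Real.smoothTransition t = 0 := by
      rw [mem_Icc, not_and_or, not_le, not_le] at ht
      rcases ht with ht | ht
      · have : Real.smoothTransition =ᶠ[𝓝 t] fun _ => 0 := by
          filter_upwards [gt_mem_nhds ht] with y hy
          exact Real.smoothTransition.zero_of_nonpos hy.le
        rw [this.deriv_eq, deriv_const]
      · have : Real.smoothTransition =ᶠ[𝓝 t] fun _ => 1 := by
          filter_upwards [lt_mem_nhds ht] with y hy
          exact Real.smoothTransition.one_of_one_le hy.le
        rw [this.deriv_eq, deriv_const]
    rw [h0, abs_zero]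
    exact hL0

/-- At a touching point, the limit equation cannot be strictly violated in a neighbourhood. -/
lemma WeakLimit.not_eventually_pos (ho : IsOpen Ω) (hb : Bornology.IsBounded Ω)
    {U : Set (Euc N)} {r : ℕ → ℝ} {f v : ℕ → Euc N → ℝ} {G : ℕ → Euc N → Euc N}
    {v₀ ρ φ : Euc N → ℝ} (h : WeakLimit Ω U r f v G v₀) (hU : IsOpen U) {x₀ : Euc N}
    (hxU : x₀ ∈ U) (hxc : x₀ ∈ closure Ω) (hρ : ContDiffOn ℝ 1 ρ U)
    (hρΩ : ∀ y ∈ U, (y ∈ Ω ↔ ρ y < 0)) (hφ : ContDiff ℝ 2 φ)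
    (hang : ∀ᶠ y in 𝓝 x₀, fderiv ℝ ρ y (∇ φ y) ≤ 0) (ht : TouchesBelow (closure Ω) v₀ φ x₀)
    {P : Set (Euc N)} (hP : P ∈ 𝓝 x₀)
    (hpos : ∀ᶠ n in atTop, ∀ x ∈ Ω ∩ P, 0 < f n x + divergence (gradField (r n - 2) φ) x) :
    False := by
  have hφ1 : ContDiff ℝ 1 φ := hφ.of_le (by norm_num)
  have htouch := eventually_nhdsWithin_iff.1 ht.2
  obtain ⟨ε, hε, hball⟩ := Metric.eventually_nhds_iff_ball.1
    ((Filter.Eventually.and (hU.mem_nhds hxU) hang).and (htouch.and hP))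
  set R := ε / 2 with hRdef
  have hR : 0 < R := half_pos hε
  have hRε : R < ε := half_lt_self hε
  have hin : ∀ y, dist y x₀ ≤ R → (y ∈ U ∧ fderiv ℝ ρ y (∇ φ y) ≤ 0) ∧
      (y ∈ closure Ω \ {x₀} → φ y < v₀ y) ∧ y ∈ P := fun y hy =>
    hball y (Metric.mem_ball.2 (hy.trans_lt hRε))
  -- the gap on an annulus
  set K := closure Ω ∩ {y | R / 2 ≤ dist y x₀ ∧ dist y x₀ ≤ R} with hK
  have hKc : IsCompact K := hb.isCompact_closure.inter_right
    ((isClosed_le continuous_const (continuous_id.dist continuous_const)).inter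
      (isClosed_le (continuous_id.dist continuous_const) continuous_const))
  obtain ⟨m, hm, hmK⟩ := hKc.exists_forall_le' (f := fun y => v₀ y - φ y) (a := 0)
    ((h.cont_lim.sub hφ.continuous.continuousOn).mono inter_subset_left) (fun y hy => by
      have hne : y ≠ x₀ := by
        rintro rfl
        have := hy.2.1
        rw [dist_self] at this
        linarith
      exact sub_pos.2 ((hin y hy.2.2).2.1 ⟨hy.1, hne⟩))
  obtain ⟨n, hn4, hdist, hposn⟩ := ((h.hr.eventually_ge_atTop 4).and
    ((Metric.tendstoUniformlyOn_iff.1 h.lim (m / 4) (by positivity)).and hpos)).exists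
  have hr1 : 1 ≤ ENNReal.ofReal (r n) := by rw [ENNReal.one_le_ofReal]; linarith
  have hs1 : 1 < r n - 2 := by linarith
  -- On the annulus `v₀ - φ ≥ m` and `v n` is within `m / 4` of `v₀`, so `w` is negative there,
  -- while `w` is positive at `x₀`. Thus the step function of `w` vanishes in `Ω` wherever the
  -- cutoff `χ` is not locally constant.
  set δ := m / 2 with hδ
  set w : Euc N → ℝ := fun x => φ x - v n x + δ with hwdef
  have hwc : ContinuousOn w (closure Ω) :=
    (hφ.continuous.continuousOn.sub (h.cont n)).add continuousOn_const
  have hwp : SobolevPair Ω (ENNReal.ofReal (r n)) w (∇ φ - G n) :=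
    ((sobolevPair_of_contDiff ho hb hφ1 _).sub (h.pair n) hb hr1).add_const ho hb hr1 δ
  obtain ⟨L, hL⟩ := exists_deriv_smoothTransition_bound
  have hzp := hwp.comp ho hb hr1 (Real.smoothTransition.contDiff (n := 1)) hL
  set z : Euc N → ℝ := fun x => Real.smoothTransition (w x) with hz
  set Z : Euc N → Euc N := fun x => deriv Real.smoothTransition (w x) • (∇ φ - G n) x with hZ
  have hzc : ContinuousOn z (closure Ω) := Real.smoothTransition.continuous.comp_continuousOn hwc
  have hz0 : ∀ x, 0 ≤ z x := fun x => Real.smoothTransition.nonneg _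
  let χ : ContDiffBump x₀ := ⟨R / 2, R, by positivity, by linarith⟩
  have hχ1 : ContDiff ℝ 1 χ := χ.contDiff
  have hχs : tsupport χ = Metric.closedBall x₀ R := χ.tsupport_eq
  have hχR : ∀ y ∈ tsupport χ, dist y x₀ ≤ R := fun y hy => Metric.mem_closedBall.1 (hχs ▸ hy)
  have hzχ : ∀ x ∈ Ω, z x = 0 ∨ fderiv ℝ χ x = 0 := by
    intro x hx
    rcases lt_or_ge (dist x x₀) (R / 2) with h1 | h1
    · right
      have : (χ : Euc N → ℝ) =ᶠ[𝓝 x] fun _ => 1 :=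
        χ.eventuallyEq_one_of_mem_ball (Metric.mem_ball.2 h1)
      rw [this.fderiv_eq]
      simp
    rcases le_or_gt (dist x x₀) R with h2 | h2
    · left
      refine Real.smoothTransition.zero_of_nonpos ?_
      have h3 := hmK x ⟨subset_closure hx, h1, h2⟩
      have h4 := hdist x (subset_closure hx)
      rw [Real.dist_eq] at h4
      have h5 := (abs_lt.1 h4).2
      simp only [hwdef, hδ]
      linarith
    · right
      have hx' : x ∉ tsupport χ := by
        rw [hχs, Metric.mem_closedBall, not_le]
        exact h2
      have : (χ : Euc N → ℝ) =ᶠ[𝓝 x] fun _ => 0 := notMem_tsupport_iff_eventuallyEq.1 hx'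
      rw [this.fderiv_eq]
      simp
  set X := gradField (r n - 2) φ with hX
  have hX1 : ContDiff ℝ 1 X := contDiff_gradField hφ hs1
  have hfield := hzp.integral_field_nonpos ho hb hr1 hX1 hU hρ hρΩ hχ1 χ.hasCompactSupport
    (fun y hy => (hin y (hχR y hy)).1.1) (fun x => χ.nonneg) (fun x _ => hz0 x) hzχ
    (fun y hy => by
      rw [hX, gradField, map_smul, smul_eq_mul]
      exact mul_nonpos_of_nonneg_of_nonpos (by positivity) (hin y (hχR y hy)).1.2)
  have hχz := hzp.mul_contDiff ho hb hr1 hχ1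
  have hχzc : ContinuousOn (fun x => χ x * z x) (closure Ω) := hχ1.continuous.continuousOn.mul hzc
  have hweak := h.weak_eq n _ _ hχz hχzc (fun x hx => by
    have : x ∉ tsupport χ := fun hx' => hx (hin x (hχR x hx')).1.1
    rw [image_eq_zero_of_notMem_tsupport this, zero_mul])
  have hgrad : ∀ x ∈ Ω, χ x • Z x + z x • ∇ χ x = χ x • Z x := by
    intro x hx
    rcases hzχ x hx with h0 | h0
    · rw [h0, zero_smul, add_zero]
    · rw [gradient, h0, map_zero, smul_zero, add_zero]
  have iA := integrable_rpow_inner (by linarith : 2 ≤ r n) (h.pair n).memLp_grad hχz.memLp_grad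
  have hfc : ContinuousOn (fun x => f n x * (χ x * z x)) (closure Ω) := (h.cont_f n).mul hχzc
  have hdc : ContinuousOn (fun x => χ x * z x * divergence X x) (closure Ω) :=
    hχzc.mul (continuous_divergence hX1).continuousOn
  have iF := integrableOn_of_continuousOn ho hb hfc
  have iD := integrableOn_of_continuousOn ho hb hdc
  -- The weak equation replaces the source by the flux of `G n`; since `Z` is a nonnegative multiple
  -- of `∇ φ - G n`, monotonicity exchanges this flux for that of `∇ φ`, and the divergence
  -- inequality applies.
  have hle : ∫ x in Ω, (f n x * (χ x * z x) + χ x * z x * divergence X x) ≤ 0 := by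
    refine le_trans ?_ hfield
    rw [integral_add iF iD, ← hweak, ← integral_add iA iD]
    refine setIntegral_mono_on (iA.add iD)
      (hzp.integrableOn_smul_field hb hr1 hX1 hχ1.continuous χ.hasCompactSupport)
      ho.measurableSet fun x hx => ?_
    rw [hgrad x hx, mul_add, mul_assoc (χ x) (z x)]
    refine add_le_add ?_ le_rfl
    simp only [hZ, real_inner_smul_right, Pi.sub_apply, hX, gradField, real_inner_smul_left]
    have h1 := inner_rpow_monotone (by linarith : 1 < r n) (G n x) (∇ φ x)
    have h2 := mul_le_mul_of_nonneg_left h1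
      (mul_nonneg χ.nonneg (deriv_smoothTransition_nonneg (w x)) :
        0 ≤ χ x * deriv Real.smoothTransition (w x))
    linarith
  -- the integrand is nonnegative and somewhere positive
  have hw0 : 0 < w x₀ := by
    have h4 := hdist x₀ hxc
    rw [Real.dist_eq] at h4
    have h5 := (abs_lt.1 h4).1
    simp only [hwdef, hδ]
    linarith [ht.1]
  have hne : (𝓝[Ω] x₀).NeBot := mem_closure_iff_nhdsWithin_neBot.1 hxc
  have hev : ∀ᶠ y in 𝓝[Ω] x₀, 0 < w y :=
    ((hwc x₀ hxc).mono subset_closure).eventually (lt_mem_nhds hw0)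
  obtain ⟨y, hyw, hyb, hyΩ⟩ := (hev.and (Filter.Eventually.and
    (nhdsWithin_le_nhds (Metric.ball_mem_nhds x₀ hR)) self_mem_nhdsWithin)).exists
  refine (integral_pos_of_exists_pos ho hb (hfc.add hdc) (fun x hx => ?_) hyΩ ?_).not_ge hle
  · simp only [Pi.add_apply]
    by_cases hxR : dist x x₀ ≤ R
    · have h1 := hposn x ⟨hx, (hin x hxR).2.2⟩
      have h2 : 0 ≤ χ x * z x * (f n x + divergence X x) :=
        mul_nonneg (mul_nonneg χ.nonneg (hz0 x)) h1.le
      linarith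
    · have h0 : χ x = 0 := image_eq_zero_of_notMem_tsupport (by
        rw [hχs, Metric.mem_closedBall]; exact hxR)
      simp [h0]
  · simp only [Pi.add_apply]
    have h1 := hposn y ⟨hyΩ, (hin y (Metric.mem_ball.1 hyb).le).2.2⟩
    have h2 : 0 < χ y * z y * (f n y + divergence X y) :=
      mul_pos (mul_pos (χ.pos_of_mem_ball hyb) (Real.smoothTransition.pos_of_pos hyw)) h1
    linarith

end

section

variable {N : ℕ} {Ω : Set (Euc N)}

/-! ### Consequences at touching points -/

section Pointwise

variable {r : ℕ → ℝ} {f : ℕ → Euc N → ℝ} {φ : Euc N → ℝ} {x₀ : Euc N}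

lemma tendsto_snd_nhdsWithin {Y : Type*} [TopologicalSpace Y] {g : Euc N → Y} (hg : Continuous g) :
    Tendsto (fun y : ℕ × Euc N => g y.2) (atTop ×ˢ 𝓝[Ω] x₀) (𝓝 (g x₀)) :=
  ((hg.tendsto x₀).mono_left nhdsWithin_le_nhds).comp tendsto_snd

lemma continuous_hessianTrace (hφ : ContDiff ℝ 2 φ) : Continuous (hessianTrace φ) :=
  continuous_finsetSum _ fun _ _ =>
    ((continuous_fderiv_fderiv hφ).clm_apply continuous_const).clm_apply continuous_const

lemma continuous_inftyLaplacian (hφ : ContDiff ℝ 2 φ) : Continuous (inftyLaplacian φ) :=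
  ((continuous_fderiv_fderiv hφ).clm_apply (contDiff_gradient hφ).continuous).clm_apply
    (contDiff_gradient hφ).continuous

/-- If the infinity Laplacian is positive and the gradient dominates the source term, then the
equation is strictly violated near the point. -/
lemma eventually_pos_of_inftyLaplacian_pos (hφ : ContDiff ℝ 2 φ) (hr : Tendsto r atTop atTop)
    (hD : 0 < inftyLaplacian φ x₀) {c : ℝ} (hc : 0 < c) (hcV : c < ‖∇ φ x₀‖)
    (hf : ∀ᶠ y in atTop ×ˢ 𝓝[Ω] x₀, -(c ^ r y.1) < f y.1 y.2) :
    ∀ᶠ y in atTop ×ˢ 𝓝[Ω] x₀, 0 < f y.1 y.2 + divergence (gradField (r y.1 - 2) φ) y.2 := by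
  have hV := (contDiff_gradient hφ).continuous.norm
  set d := inftyLaplacian φ x₀ / 2 with hd
  have hd0 : 0 < d := half_pos hD
  set C := ‖∇ φ x₀‖ ^ 2 * |hessianTrace φ x₀| + 1 with hC
  have e1 := (tendsto_snd_nhdsWithin (Ω := Ω) (x₀ := x₀) hV).eventually (lt_mem_nhds hcV)
  have e2 := (tendsto_snd_nhdsWithin (Ω := Ω) (x₀ := x₀) (continuous_inftyLaplacian hφ)).eventually
    (lt_mem_nhds (half_lt_self hD))
  have e3 : ∀ᶠ y in atTop ×ˢ 𝓝[Ω] x₀, ‖∇ φ y.2‖ ^ 2 * |hessianTrace φ y.2| < C :=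
    (tendsto_snd_nhdsWithin (g := fun x => ‖∇ φ x‖ ^ 2 * |hessianTrace φ x|) ((hV.pow 2).mul
      (continuous_hessianTrace hφ).abs)).eventually (gt_mem_nhds (lt_add_one _))
  -- After the power `r - 4` of the gradient norm is factored out, the bracket is at least `-C + (r
  -- - 2) * d`. This threshold makes it at least `c ^ 4`: the growing coefficient of the infinity
  -- Laplacian absorbs the Laplacian and a source of size `c ^ r`.
  have e4 : ∀ᶠ y in atTop ×ˢ 𝓝[Ω] x₀, 4 + (C + c ^ 4) / d ≤ r y.1 :=
    tendsto_fst.eventually (hr.eventually_ge_atTop _)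
  filter_upwards [hf, e1, e2, e3, e4] with y h0 h1 h2 h3 h4
  have hC0 : 0 < C := by positivity
  have hr4 : 4 ≤ r y.1 := le_trans (le_add_of_nonneg_right (by positivity)) h4
  have hv0 : 0 < ‖∇ φ y.2‖ := hc.trans h1
  rw [divergence_gradField hφ (by linarith)]
  have es : ‖∇ φ y.2‖ ^ (r y.1 - 2) = ‖∇ φ y.2‖ ^ (r y.1 - 2 - 2) * ‖∇ φ y.2‖ ^ 2 := by
    rw [← Real.rpow_two, ← Real.rpow_add hv0]
    ring_nf
  have ec : c ^ r y.1 = c ^ (r y.1 - 2 - 2) * c ^ 4 := by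
    rw [← Real.rpow_natCast c 4, ← Real.rpow_add hc]
    congr 1
    push_cast
    ring
  have h5 : C + c ^ 4 ≤ (r y.1 - 2) * inftyLaplacian φ y.2 := by
    have h6 : (C + c ^ 4) / d ≤ r y.1 - 2 := by linarith
    rw [div_le_iff₀ hd0] at h6
    exact h6.trans (mul_le_mul_of_nonneg_left h2.le (by linarith))
  have h7 : -C ≤ ‖∇ φ y.2‖ ^ 2 * hessianTrace φ y.2 := by
    have := neg_abs_le (hessianTrace φ y.2)
    nlinarith [sq_nonneg ‖∇ φ y.2‖]
  have h8 : c ^ r y.1 ≤ ‖∇ φ y.2‖ ^ (r y.1 - 2 - 2) *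
      (‖∇ φ y.2‖ ^ 2 * hessianTrace φ y.2 + (r y.1 - 2) * inftyLaplacian φ y.2) := by
    rw [ec]
    refine mul_le_mul (Real.rpow_le_rpow hc.le h1.le (by linarith)) (by linarith) (by positivity)
      (by positivity)
  rw [es]
  linarith

/-- If the source term dominates the gradient, then the equation is strictly violated near the
point. -/
lemma eventually_pos_of_norm_gradient_lt (hφ : ContDiff ℝ 2 φ) (hr : Tendsto r atTop atTop)
    {c : ℝ} (hcV : ‖∇ φ x₀‖ < c) (hf : ∀ᶠ y in atTop ×ˢ 𝓝[Ω] x₀, c ^ r y.1 < f y.1 y.2) :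
    ∀ᶠ y in atTop ×ˢ 𝓝[Ω] x₀, 0 < f y.1 y.2 + divergence (gradField (r y.1 - 2) φ) y.2 := by
  have hV := (contDiff_gradient hφ).continuous.norm
  -- The divergence is of order `r * c₁ ^ r`, and the exponential factor `(c / c₁) ^ r` of the
  -- source beats the linear growth in `r`.
  obtain ⟨c₁, hVc₁, hc₁⟩ := exists_between hcV
  have hc₁0 : 0 < c₁ := (norm_nonneg _).trans_lt hVc₁
  have hc0 : 0 < c := hc₁0.trans hc₁
  set A := |hessianTrace φ x₀| + 1 with hA
  set B := |inftyLaplacian φ x₀| + 1 with hB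
  have hA0 : 0 < A := by positivity
  have hB0 : 0 < B := by positivity
  have e1 := (tendsto_snd_nhdsWithin (Ω := Ω) (x₀ := x₀) hV).eventually (gt_mem_nhds hVc₁)
  have e2 := (tendsto_snd_nhdsWithin (Ω := Ω) (x₀ := x₀)
    (continuous_inftyLaplacian hφ).abs).eventually (gt_mem_nhds (lt_add_one _))
  have e3 := (tendsto_snd_nhdsWithin (Ω := Ω) (x₀ := x₀)
    (continuous_hessianTrace hφ).abs).eventually (gt_mem_nhds (lt_add_one _))
  have hlog : 0 < Real.log (c / c₁) := Real.log_pos ((one_lt_div hc₁0).2 hc₁)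
  have hexp : Tendsto (fun t : ℝ => Real.exp (Real.log (c / c₁) * t) / t ^ (1 : ℝ)) atTop atTop :=
    tendsto_exp_mul_div_rpow_atTop 1 _ hlog
  have e4 : ∀ᶠ y in atTop ×ˢ 𝓝[Ω] x₀, 4 ≤ r y.1 ∧
      (c₁ ^ 2 * A + B) / c₁ ^ 4 ≤ Real.exp (Real.log (c / c₁) * r y.1) / r y.1 ^ (1 : ℝ) :=
    tendsto_fst.eventually ((hr.eventually_ge_atTop 4).and
      ((hexp.comp hr).eventually_ge_atTop _))
  filter_upwards [hf, e1, e2, e3, e4] with y h0 h1 h2 h3 h4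
  obtain ⟨hr4, h5⟩ := h4
  have hr0 : 0 < r y.1 := by linarith
  rw [divergence_gradField hφ (by linarith)]
  have ec : c ^ r y.1 = Real.exp (Real.log (c / c₁) * r y.1) * c₁ ^ r y.1 := by
    rw [← Real.rpow_def_of_pos (by positivity), ← Real.mul_rpow (by positivity) hc₁0.le,
      div_mul_cancel₀ _ hc₁0.ne']
  have ec₁ : c₁ ^ r y.1 = c₁ ^ (r y.1 - 2 - 2) * c₁ ^ 4 := by
    rw [← Real.rpow_natCast c₁ 4, ← Real.rpow_add hc₁0]
    congr 1
    push_cast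
    ring
  have es : c₁ ^ (r y.1 - 2) = c₁ ^ (r y.1 - 2 - 2) * c₁ ^ 2 := by
    rw [← Real.rpow_two, ← Real.rpow_add hc₁0]
    ring_nf
  have t1 : |‖∇ φ y.2‖ ^ (r y.1 - 2) * hessianTrace φ y.2| ≤ c₁ ^ (r y.1 - 2) * A := by
    rw [abs_mul, abs_of_nonneg (by positivity)]
    exact mul_le_mul (Real.rpow_le_rpow (norm_nonneg _) h1.le (by linarith)) h3.le (abs_nonneg _)
      (by positivity)
  have t2 : |(r y.1 - 2) * ‖∇ φ y.2‖ ^ (r y.1 - 2 - 2) * inftyLaplacian φ y.2| ≤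
      r y.1 * c₁ ^ (r y.1 - 2 - 2) * B := by
    have hr2 : 0 ≤ r y.1 - 2 := by linarith
    rw [abs_mul, abs_of_nonneg (by positivity)]
    refine mul_le_mul (mul_le_mul (by linarith) (Real.rpow_le_rpow (norm_nonneg _) h1.le
      (by linarith)) (by positivity) hr0.le) h2.le (abs_nonneg _) (by positivity)
  rw [Real.rpow_one, div_le_div_iff₀ (by positivity) hr0] at h5
  have h6 : c₁ ^ (r y.1 - 2) * A + r y.1 * c₁ ^ (r y.1 - 2 - 2) * B ≤ c ^ r y.1 := by
    rw [ec, ec₁, es]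
    have h7 : c₁ ^ 2 * A + r y.1 * B ≤ (c₁ ^ 2 * A + B) * r y.1 := by
      have : 0 ≤ c₁ ^ 2 * A * (r y.1 - 1) := mul_nonneg (by positivity) (by linarith)
      linarith
    have h8 := mul_le_mul_of_nonneg_left (h7.trans h5)
      (show 0 ≤ c₁ ^ (r y.1 - 2 - 2) by positivity)
    linarith
  have t1' := (abs_le.1 t1).1
  have t2' := (abs_le.1 t2).1
  linarith

variable {c₀ : ℝ}

/-- A positive infinity Laplacian forces a nonzero gradient, and a nonnegative source lies above
`-(c ^ r)` for any positive `c`, so half the gradient norm can serve as `c`. -/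
lemma inftyLaplacian_nonpos_of_source_nonneg (hφ : ContDiff ℝ 2 φ) (hr : Tendsto r atTop atTop)
    (hf : ∀ᶠ y in atTop ×ˢ 𝓝[Ω] x₀, 0 ≤ f y.1 y.2)
    (hcore : ¬ ∀ᶠ y in atTop ×ˢ 𝓝[Ω] x₀,
      0 < f y.1 y.2 + divergence (gradField (r y.1 - 2) φ) y.2) :
    inftyLaplacian φ x₀ ≤ 0 := by
  by_contra! hD
  have hV : 0 < ‖∇ φ x₀‖ := by
    refine norm_pos_iff.2 fun h0 => hD.ne' ?_
    rw [inftyLaplacian, h0, map_zero]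
  refine hcore (eventually_pos_of_inftyLaplacian_pos hφ hr hD (half_pos hV) (half_lt_self hV) ?_)
  filter_upwards [hf] with y hy
  exact (neg_neg_of_pos (by positivity)).trans_le hy

/-- No sign of the source is assumed, only its size on the scale of `r`-th roots. This serves the
regions where the source is nonpositive or its sign is unknown. -/
lemma not_inftyLaplacian_pos_and_lt (hφ : ContDiff ℝ 2 φ) (hr : Tendsto r atTop atTop)
    (hroot : Tendsto (fun y : ℕ × Euc N => |f y.1 y.2| ^ (1 / r y.1)) (atTop ×ˢ 𝓝[Ω] x₀) (𝓝 c₀))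
    (hcore : ¬ ∀ᶠ y in atTop ×ˢ 𝓝[Ω] x₀,
      0 < f y.1 y.2 + divergence (gradField (r y.1 - 2) φ) y.2) :
    ¬ (0 < inftyLaplacian φ x₀ ∧ c₀ < ‖∇ φ x₀‖) := by
  rintro ⟨hD, hV⟩
  have hV0 : 0 < ‖∇ φ x₀‖ := by
    refine norm_pos_iff.2 fun h0 => hD.ne' ?_
    rw [inftyLaplacian, h0, map_zero]
  obtain ⟨c, hc, hcV⟩ := exists_between (max_lt hV hV0)
  have hc0 : 0 < c := (le_max_right _ _).trans_lt hc
  refine hcore (eventually_pos_of_inftyLaplacian_pos hφ hr hD hc0 hcV ?_)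
  have e1 : ∀ᶠ y in atTop ×ˢ 𝓝[Ω] x₀, 0 < r y.1 :=
    tendsto_fst.eventually (hr.eventually_gt_atTop 0)
  filter_upwards [hroot.eventually (gt_mem_nhds ((le_max_left _ _).trans_lt hc)), e1] with y h1 h2
  have h3 := Real.rpow_lt_rpow (by positivity) h1 h2
  rw [← Real.rpow_mul (abs_nonneg _), one_div_mul_cancel h2.ne', Real.rpow_one] at h3
  exact (abs_lt.1 h3).1

lemma le_norm_gradient_of_source_nonneg (hφ : ContDiff ℝ 2 φ) (hr : Tendsto r atTop atTop)
    (hf : ∀ᶠ y in atTop ×ˢ 𝓝[Ω] x₀, 0 ≤ f y.1 y.2)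
    (hroot : Tendsto (fun y : ℕ × Euc N => |f y.1 y.2| ^ (1 / r y.1)) (atTop ×ˢ 𝓝[Ω] x₀) (𝓝 c₀))
    (hcore : ¬ ∀ᶠ y in atTop ×ˢ 𝓝[Ω] x₀,
      0 < f y.1 y.2 + divergence (gradField (r y.1 - 2) φ) y.2) :
    c₀ ≤ ‖∇ φ x₀‖ := by
  by_contra! hlt
  obtain ⟨c, hVc, hc⟩ := exists_between hlt
  have hc0 : 0 ≤ c := (norm_nonneg _).trans hVc.le
  refine hcore (eventually_pos_of_norm_gradient_lt hφ hr hVc ?_)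
  have e1 : ∀ᶠ y in atTop ×ˢ 𝓝[Ω] x₀, 0 < r y.1 :=
    tendsto_fst.eventually (hr.eventually_gt_atTop 0)
  filter_upwards [hroot.eventually (lt_mem_nhds hc), e1, hf] with y h1 h2 h0
  have h3 := Real.rpow_lt_rpow hc0 h1 h2
  rwa [← Real.rpow_mul (abs_nonneg _), one_div_mul_cancel h2.ne', Real.rpow_one,
    abs_of_nonneg h0] at h3

end Pointwise

section Touching

variable {U : Set (Euc N)} {r : ℕ → ℝ} {f v : ℕ → Euc N → ℝ} {G : ℕ → Euc N → Euc N}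
  {v₀ ρ φ : Euc N → ℝ} {x₀ : Euc N}

lemma WeakLimit.not_eventually_pos_prod (ho : IsOpen Ω) (hb : Bornology.IsBounded Ω)
    (h : WeakLimit Ω U r f v G v₀) (hU : IsOpen U) (hxU : x₀ ∈ U) (hxc : x₀ ∈ closure Ω)
    (hρ : ContDiffOn ℝ 1 ρ U) (hρΩ : ∀ y ∈ U, (y ∈ Ω ↔ ρ y < 0)) (hφ : ContDiff ℝ 2 φ)
    (hang : ∀ᶠ y in 𝓝 x₀, fderiv ℝ ρ y (∇ φ y) ≤ 0) (ht : TouchesBelow (closure Ω) v₀ φ x₀) :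
    ¬ ∀ᶠ y in atTop ×ˢ 𝓝[Ω] x₀,
      0 < f y.1 y.2 + divergence (gradField (r y.1 - 2) φ) y.2 := by
  intro hev
  obtain ⟨pa, ha, pb, hpb, hab⟩ := eventually_prod_iff.1 hev
  refine h.not_eventually_pos ho hb hU hxU hxc hρ hρΩ hφ hang ht
    (P := {y | y ∈ Ω → pb y}) (eventually_nhdsWithin_iff.1 hpb) ?_
  filter_upwards [ha] with n hn x hx
  exact hab hn (hx.2 hx.1)

/-- In the interior the constant `-1` is a defining function, and the flux condition is void. -/
lemma WeakLimit.not_eventually_pos_interior (ho : IsOpen Ω) (hb : Bornology.IsBounded Ω)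
    (h : WeakLimit Ω Ω r f v G v₀) (hx : x₀ ∈ Ω) (hφ : ContDiff ℝ 2 φ)
    (ht : TouchesBelow (closure Ω) v₀ φ x₀) :
    ¬ ∀ᶠ y in atTop ×ˢ 𝓝[Ω] x₀,
      0 < f y.1 y.2 + divergence (gradField (r y.1 - 2) φ) y.2 :=
  h.not_eventually_pos_prod ho hb (ρ := fun _ => -1) ho hx (subset_closure hx) contDiffOn_const
    (fun y hy => ⟨fun _ => by norm_num, fun _ => hy⟩) hφ (Eventually.of_forall fun y => by simp) ht

/-- The strict sign of the normal derivative persists nearby and supplies the flux condition. The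
test functions do not vanish on the boundary, so the equation is needed with `U = univ`, its natural
Neumann form. -/
lemma WeakLimit.not_eventually_pos_frontier (ho : IsOpen Ω) (hb : Bornology.IsBounded Ω)
    (h : WeakLimit Ω univ r f v G v₀) (hx : x₀ ∈ frontier Ω) {ν : Euc N}
    (hν : IsOuterUnitNormal Ω x₀ ν) (hφ : ContDiff ℝ 2 φ) (hneg : inner ℝ (∇ φ x₀) ν < 0)
    (ht : TouchesBelow (closure Ω) v₀ φ x₀) :
    ¬ ∀ᶠ y in atTop ×ˢ 𝓝[Ω] x₀,
      0 < f y.1 y.2 + divergence (gradField (r y.1 - 2) φ) y.2 := by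
  obtain ⟨ρ, ⟨hρ0, U, hU, hxU, hρ, hρΩ⟩, rfl⟩ := hν
  have hρ1 : ContDiffOn ℝ 1 ρ U := hρ.of_le (by norm_cast)
  have h' : WeakLimit Ω U r f v G v₀ :=
    ⟨h.hr, h.cont, h.cont_f, h.pair, fun n z Z hz hzc _ =>
      h.weak_eq n z Z hz hzc fun x hx => absurd (mem_univ x) hx, h.lim, h.cont_lim⟩
  refine h'.not_eventually_pos_prod ho hb hU hxU (frontier_subset_closure hx) hρ1 hρΩ hφ ?_ ht
  have hlt : fderiv ℝ ρ x₀ (∇ φ x₀) < 0 := by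
    rw [real_inner_smul_right] at hneg
    have h1 : inner ℝ (∇ φ x₀) (∇ ρ x₀) < 0 := by
      by_contra! hge
      exact hneg.not_ge (mul_nonneg (by positivity) hge)
    rwa [real_inner_comm, inner_gradient_left] at h1
  have hcont : ContinuousAt (fun y => fderiv ℝ ρ y (∇ φ y)) x₀ :=
    (((hρ1.continuousOn_fderiv_of_isOpen hU le_rfl) x₀ hxU).continuousAt
      (hU.mem_nhds hxU)).clm_apply (contDiff_gradient hφ).continuous.continuousAt
  exact (hcont.eventually (gt_mem_nhds hlt)).mono fun y hy => le_of_lt hy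

end Touching

end

section

variable {N : ℕ} {Ω : Set (Euc N)}

/-! ### The limit equations -/

lemma tendsto_root_source {lam b r s t : ℕ → ℝ} {a s₀ t₀ : ℝ} {u v : ℕ → Euc N → ℝ}
    {u₀ v₀ : Euc N → ℝ} {x₀ : Euc N} (hx : x₀ ∈ closure Ω)
    (hlam : ∀ n, 0 ≤ lam n) (hb : ∀ n, 0 ≤ b n)
    (hlr : Tendsto (fun n => lam n ^ (1 / r n)) atTop (𝓝 a))
    (hbr : Tendsto (fun n => b n ^ (1 / r n)) atTop (𝓝 1))
    (hs : Tendsto (fun n => s n / r n) atTop (𝓝 s₀)) (hs₀ : 0 < s₀)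
    (ht : Tendsto (fun n => t n / r n) atTop (𝓝 t₀)) (ht₀ : 0 < t₀)
    (hul : TendstoUniformlyOn u u₀ atTop (closure Ω))
    (hvl : TendstoUniformlyOn v v₀ atTop (closure Ω)) (hu₀ : ContinuousOn u₀ (closure Ω))
    (hv₀ : ContinuousOn v₀ (closure Ω)) :
    Tendsto (fun y : ℕ × Euc N =>
        (lam y.1 * b y.1 * (|u y.1 y.2| ^ s y.1 * |v y.1 y.2| ^ t y.1)) ^ (1 / r y.1))
      (atTop ×ˢ 𝓝[Ω] x₀) (𝓝 (a * |u₀ x₀| ^ s₀ * |v₀ x₀| ^ t₀)) := by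
  have hle : atTop ×ˢ 𝓝[Ω] x₀ ≤ (atTop : Filter ℕ) ×ˢ 𝓝[closure Ω] x₀ :=
    prod_mono_right _ (nhdsWithin_mono _ subset_closure)
  have h1 := ((hul.tendsto_prod hu₀ hx).mono_left hle).abs.rpow (hs.comp tendsto_fst) (Or.inr hs₀)
  have h2 := ((hvl.tendsto_prod hv₀ hx).mono_left hle).abs.rpow (ht.comp tendsto_fst) (Or.inr ht₀)
  have h3 : Tendsto (fun y : ℕ × Euc N => lam y.1 ^ (1 / r y.1) * b y.1 ^ (1 / r y.1))
      (atTop ×ˢ 𝓝[Ω] x₀) (𝓝 (a * 1)) := (hlr.mul hbr).comp tendsto_fst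
  rw [mul_one] at h3
  refine ((h3.mul h1).mul h2).congr fun y => ?_
  simp only [Function.comp_apply]
  rw [Real.mul_rpow (mul_nonneg (hlam _) (hb _)) (by positivity), Real.mul_rpow (hlam _) (hb _),
    Real.mul_rpow (by positivity) (by positivity), ← Real.rpow_mul (abs_nonneg _),
    ← Real.rpow_mul (abs_nonneg _), mul_one_div, mul_one_div]
  ring

lemma abs_signedPow {β : ℝ} (hβ : 2 ≤ β) (t : ℝ) : |signedPow β t| = |t| ^ (β - 1) := by
  rw [signedPow, abs_mul, abs_of_nonneg (by positivity : 0 ≤ |t| ^ (β - 2))]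
  rcases (abs_nonneg t).eq_or_lt with h | h
  · rw [← h, mul_zero, Real.zero_rpow (by linarith)]
  · rw [show β - 1 = (β - 2) + 1 by ring, Real.rpow_add h, Real.rpow_one]

/-- Eigenpairs along exponents tending to infinity that converge uniformly. -/
structure EigenLimit (Ω : Set (Euc N)) (Γ Q Λ : ℝ) (p q α β lam : ℕ → ℝ) (u v : ℕ → Euc N → ℝ)
    (Gu Gv : ℕ → Euc N → Euc N) (u₀ v₀ : Euc N → ℝ) : Prop where
  exponents : ExponentLimit Γ Q p q α β
  large : ∀ n, LargeExponents N (p n) (q n) (α n) (β n)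
  eigenpair : ∀ n, RegularEigenpair Ω (p n) (q n) (α n) (β n) (lam n) (u n) (v n) (Gu n) (Gv n)
  lam_lim : Tendsto (fun n => lam n ^ (1 / p n)) atTop (𝓝 Λ)
  lim_u : TendstoUniformlyOn u u₀ atTop (closure Ω)
  lim_v : TendstoUniformlyOn v v₀ atTop (closure Ω)
  cont_u : ContinuousOn u₀ (closure Ω)
  cont_v : ContinuousOn v₀ (closure Ω)

namespace EigenLimit

variable {Γ Q Λ : ℝ} {p q α β lam : ℕ → ℝ} {u v : ℕ → Euc N → ℝ} {Gu Gv : ℕ → Euc N → Euc N}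
  {u₀ v₀ : Euc N → ℝ}

lemma neg_u (h : EigenLimit Ω Γ Q Λ p q α β lam u v Gu Gv u₀ v₀) :
    EigenLimit Ω Γ Q Λ p q α β lam (fun n => -u n) v (fun n => -Gu n) Gv (-u₀) v₀ :=
  ⟨h.exponents, h.large, fun n => (h.eigenpair n).neg_u, h.lam_lim, h.lim_u.neg, h.lim_v,
    h.cont_u.neg, h.cont_v⟩

lemma neg_v (h : EigenLimit Ω Γ Q Λ p q α β lam u v Gu Gv u₀ v₀) :
    EigenLimit Ω Γ Q Λ p q α β lam u (fun n => -v n) Gu (fun n => -Gv n) u₀ (-v₀) :=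
  ⟨h.exponents, h.large, fun n => (h.eigenpair n).neg_v, h.lam_lim, h.lim_u, h.lim_v.neg,
    h.cont_u, h.cont_v.neg⟩

/-- `U` is arbitrary because the second equation admits test functions without boundary condition;
the first one below requires `U = Ω`. -/
lemma weakLimit_v (h : EigenLimit Ω Γ Q Λ p q α β lam u v Gu Gv u₀ v₀) (U : Set (Euc N)) :
    WeakLimit Ω U q (fun n x => lam n * β n * (|u n x| ^ α n * signedPow (β n) (v n x))) v Gv v₀ where
  hr := h.exponents.hq
  cont n := (h.eigenpair n).cont_v
  cont_f n := continuousOn_const.mul (continuousOn_moment (by linarith [(h.large n).hα])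
    (h.large n).hβ (h.eigenpair n).cont_u (h.eigenpair n).cont_v)
  pair n := (h.eigenpair n).pair_v
  weak_eq n z Z hz hzc _ := by
    rw [(h.eigenpair n).eq_v z Z hz hzc, ← integral_const_mul]
    congr 1; ext x; ring
  lim := h.lim_v
  cont_lim := h.cont_v

lemma weakLimit_u (h : EigenLimit Ω Γ Q Λ p q α β lam u v Gu Gv u₀ v₀) (ho : IsOpen Ω) :
    WeakLimit Ω Ω p (fun n x => lam n * α n * (signedPow (α n) (u n x) * |v n x| ^ β n)) u Gu u₀ where
  hr := h.exponents.hp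
  cont n := (h.eigenpair n).cont_u
  cont_f n := continuousOn_const.mul
    (((continuous_signedPow (h.large n).hα).comp_continuousOn (h.eigenpair n).cont_u).mul
      ((continuous_abs_rpow (by linarith [(h.large n).hβ])).comp_continuousOn
        (h.eigenpair n).cont_v))
  pair n := (h.eigenpair n).pair_u
  weak_eq n z Z hz hzc hz0 := by
    rw [(h.eigenpair n).eq_u z Z hz hzc fun x hx => hz0 x (ho.frontier_eq ▸ hx).2,
      ← integral_const_mul]
    congr 1; ext x; ring
  lim := h.lim_u
  cont_lim := h.cont_u

lemma lam_nonneg (hN : 1 ≤ N) (hΩ : IsSmoothBoundedDomain Ω)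
    (h : EigenLimit Ω Γ Q Λ p q α β lam u v Gu Gv u₀ v₀) (n : ℕ) : 0 ≤ lam n :=
  ((h.eigenpair n).lam_pos hN hΩ (h.large n)).le

lemma tendsto_root_v (hN : 1 ≤ N) (hΩ : IsSmoothBoundedDomain Ω)
    (h : EigenLimit Ω Γ Q Λ p q α β lam u v Gu Gv u₀ v₀) {x₀ : Euc N} (hx : x₀ ∈ closure Ω) :
    Tendsto (fun y : ℕ × Euc N => |lam y.1 * β y.1 *
        (|u y.1 y.2| ^ α y.1 * signedPow (β y.1) (v y.1 y.2))| ^ (1 / q y.1))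
      (atTop ×ˢ 𝓝[Ω] x₀) (𝓝 (Λ ^ (1 / Q) * |u₀ x₀| ^ (Γ / Q) * |v₀ x₀| ^ (1 - Γ))) := by
  have hE := h.exponents
  have hβ0 : ∀ n, 0 ≤ β n := fun n => by linarith [(h.large n).hβ]
  have hlr : Tendsto (fun n => lam n ^ (1 / q n)) atTop (𝓝 (Λ ^ (1 / Q))) := by
    refine (h.lam_lim.rpow hE.tendsto_p_div_q (Or.inr (one_div_pos.2 hE.Q_pos))).congr fun n => ?_
    have hp0 : p n ≠ 0 := by linarith [(h.large n).two_le_p hN]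
    rw [← Real.rpow_mul (h.lam_nonneg hN hΩ n), one_div_mul_eq_div, div_div_cancel_left' hp0,
      one_div]
  have ht : Tendsto (fun n => (β n - 1) / q n) atTop (𝓝 (1 - Γ)) := by
    have := hE.tendsto_β_div_q.sub (ExponentLimit.tendsto_one_div hE.hq)
    rw [sub_zero] at this
    exact this.congr fun j => (sub_div _ _ _).symm
  refine (tendsto_root_source hx (h.lam_nonneg hN hΩ) hβ0 hlr hE.tendsto_β_root
    hE.tendsto_α_div_q (div_pos hE.Γ_pos hE.Q_pos) ht hE.one_sub_pos h.lim_u h.lim_v h.cont_u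
    h.cont_v).congr fun y => ?_
  rw [abs_mul, abs_of_nonneg (mul_nonneg (h.lam_nonneg hN hΩ _) (hβ0 _)), abs_mul,
    abs_signedPow (h.large y.1).hβ, abs_of_nonneg (by positivity : 0 ≤ |u y.1 y.2| ^ α y.1)]

lemma tendsto_root_u (hN : 1 ≤ N) (hΩ : IsSmoothBoundedDomain Ω)
    (h : EigenLimit Ω Γ Q Λ p q α β lam u v Gu Gv u₀ v₀) {x₀ : Euc N} (hx : x₀ ∈ closure Ω) :
    Tendsto (fun y : ℕ × Euc N => |lam y.1 * α y.1 *
        (signedPow (α y.1) (u y.1 y.2) * |v y.1 y.2| ^ β y.1)| ^ (1 / p y.1))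
      (atTop ×ˢ 𝓝[Ω] x₀) (𝓝 (Λ * |u₀ x₀| ^ Γ * |v₀ x₀| ^ ((1 - Γ) * Q))) := by
  have hE := h.exponents
  have hα0 : ∀ n, 0 ≤ α n := fun n => by linarith [(h.large n).hα]
  have hs : Tendsto (fun n => (α n - 1) / p n) atTop (𝓝 Γ) := by
    have := hE.hΓ.sub (ExponentLimit.tendsto_one_div hE.hp)
    rw [sub_zero] at this
    exact this.congr fun j => (sub_div _ _ _).symm
  refine (tendsto_root_source hx (h.lam_nonneg hN hΩ) hα0 h.lam_lim hE.tendsto_α_root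
    hs hE.Γ_pos hE.tendsto_β_div_p hE.mul_pos h.lim_u h.lim_v h.cont_u h.cont_v).congr fun y => ?_
  rw [abs_mul, abs_of_nonneg (mul_nonneg (h.lam_nonneg hN hΩ _) (hα0 _)), abs_mul,
    abs_signedPow (h.large y.1).hα, abs_of_nonneg (by positivity : 0 ≤ |v y.1 y.2| ^ β y.1)]

/-- The pointwise inequality for test functions touching the second component from below. -/
lemma limitOperatorV_nonneg (hN : 1 ≤ N) (hΩ : IsSmoothBoundedDomain Ω)
    (h : EigenLimit Ω Γ Q Λ p q α β lam u v Gu Gv u₀ v₀) {x₀ : Euc N} (hx : x₀ ∈ closure Ω)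
    {φ : Euc N → ℝ} (hφ : ContDiff ℝ 2 φ) (hval : v₀ x₀ = φ x₀)
    (hcore : ¬ ∀ᶠ y in atTop ×ˢ 𝓝[Ω] x₀,
      0 < lam y.1 * β y.1 * (|u y.1 y.2| ^ α y.1 * signedPow (β y.1) (v y.1 y.2)) +
        divergence (gradField (q y.1 - 2) φ) y.2) :
    0 ≤ (limitOperatorV Γ Q Λ u₀).at φ x₀ := by
  have hE := h.exponents
  have hroot := h.tendsto_root_v hN hΩ hx
  have hnot := not_inftyLaplacian_pos_and_lt
    (f := fun n x => lam n * β n * (|u n x| ^ α n * signedPow (β n) (v n x))) hφ hE.hq hroot hcore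
  simp only [Operator.at, limitOperatorV, ← hval]
  change 0 ≤ if 0 < v₀ x₀ then
      min (-inftyLaplacian φ x₀) (‖∇ φ x₀‖ - Λ ^ (1 / Q) * |u₀ x₀| ^ (Γ / Q) * |v₀ x₀| ^ (1 - Γ))
    else if v₀ x₀ < 0 then
      max (-inftyLaplacian φ x₀) (-‖∇ φ x₀‖ + Λ ^ (1 / Q) * |u₀ x₀| ^ (Γ / Q) * |v₀ x₀| ^ (1 - Γ))
    else -inftyLaplacian φ x₀
  -- Where `v₀ > 0` the source is eventually nonnegative and both inequalities hold. Where `v₀ < 0`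
  -- only their alternative is available. Where `v₀ = 0` the limiting root is zero, since `1 - Γ >
  -- 0`, so a nonzero gradient already exceeds it.
  split_ifs with h1 h2
  · have hle : atTop ×ˢ 𝓝[Ω] x₀ ≤ (atTop : Filter ℕ) ×ˢ 𝓝[closure Ω] x₀ :=
      prod_mono_right _ (nhdsWithin_mono _ subset_closure)
    have hf : ∀ᶠ y in atTop ×ˢ 𝓝[Ω] x₀,
        0 ≤ lam y.1 * β y.1 * (|u y.1 y.2| ^ α y.1 * signedPow (β y.1) (v y.1 y.2)) := by
      filter_upwards [((h.lim_v.tendsto_prod h.cont_v hx).mono_left hle).eventually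
        (lt_mem_nhds h1)] with y hy
      have hβ := (h.large y.1).hβ
      exact mul_nonneg (mul_nonneg (h.lam_nonneg hN hΩ _) (by linarith))
        (mul_nonneg (by positivity) (signedPow_pos hβ hy).le)
    refine le_min ?_ ?_
    · exact neg_nonneg.2 (inftyLaplacian_nonpos_of_source_nonneg
        (f := fun n x => lam n * β n * (|u n x| ^ α n * signedPow (β n) (v n x))) hφ hE.hq hf hcore)
    · exact sub_nonneg.2 (le_norm_gradient_of_source_nonneg
        (f := fun n x => lam n * β n * (|u n x| ^ α n * signedPow (β n) (v n x))) hφ hE.hq hf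
        hroot hcore)
  · by_contra! hlt
    rw [max_lt_iff] at hlt
    exact hnot ⟨by linarith, by linarith⟩
  · by_contra! hlt
    have h0 : v₀ x₀ = 0 := le_antisymm (not_lt.1 h1) (not_lt.1 h2)
    have hD : 0 < inftyLaplacian φ x₀ := by linarith
    refine hnot ⟨hD, ?_⟩
    rw [h0, abs_zero, Real.zero_rpow hE.one_sub_pos.ne', mul_zero]
    refine norm_pos_iff.2 fun hg => hD.ne' ?_
    rw [inftyLaplacian, hg, map_zero]

lemma isNeumannSupersolution (hN : 1 ≤ N) (hΩ : IsSmoothBoundedDomain Ω)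
    (h : EigenLimit Ω Γ Q Λ p q α β lam u v Gu Gv u₀ v₀) :
    IsNeumannSupersolution Ω (limitOperatorV Γ Q Λ u₀) v₀ := by
  refine ⟨h.cont_v.lowerSemicontinuousOn, fun x₀ hx φ hφ ht => ⟨fun hxΩ => ?_, fun hxf ν hν => ?_⟩⟩
  · exact h.limitOperatorV_nonneg hN hΩ hx hφ ht.1
      ((h.weakLimit_v Ω).not_eventually_pos_interior hΩ.isOpen hΩ.isBounded hxΩ hφ ht)
  · by_contra! hlt
    rw [max_lt_iff] at hlt
    exact hlt.1.not_ge (h.limitOperatorV_nonneg hN hΩ hx hφ ht.1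
      ((h.weakLimit_v univ).not_eventually_pos_frontier hΩ.isOpen hΩ.isBounded hxf hν hφ hlt.2 ht))

end EigenLimit

lemma gradient_neg' (φ : Euc N → ℝ) (x : Euc N) : ∇ (-φ) x = -∇ φ x := by
  rw [gradient, gradient, fderiv_neg, map_neg]

lemma fderiv_fderiv_neg (φ : Euc N → ℝ) (x : Euc N) :
    fderiv ℝ (fderiv ℝ (-φ)) x = -fderiv ℝ (fderiv ℝ φ) x := by
  have : fderiv ℝ (-φ) = -fderiv ℝ φ := funext fun y => fderiv_neg
  rw [this, fderiv_neg]

/-- The operator is odd: negation exchanges the regions `v > 0` and `v < 0`, and minimum with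
maximum. Hence the subsolution property of `v₀` is the supersolution property of `-v₀`. -/
lemma limitOperatorV_at_neg {Γ Q Λ : ℝ} {u φ : Euc N → ℝ} {x : Euc N} :
    (limitOperatorV Γ Q Λ u).at (-φ) x = -(limitOperatorV Γ Q Λ u).at φ x := by
  simp only [Operator.at, limitOperatorV, gradient_neg', fderiv_fderiv_neg, Pi.neg_apply, norm_neg,
    abs_neg, map_neg, neg_apply, neg_neg, Left.neg_pos_iff, Left.neg_neg_iff]
  rcases lt_trichotomy (φ x) 0 with h | h | h
  · rw [if_pos h, if_neg h.not_gt, if_pos h, ← min_neg_neg, neg_neg]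
    congr 1
    ring
  · simp [h]
  · rw [if_neg h.not_gt, if_pos h, if_pos h, ← max_neg_neg, neg_neg]
    congr 1
    ring

lemma TouchesAbove.neg {K : Set (Euc N)} {u φ : Euc N → ℝ} {x₀ : Euc N}
    (h : TouchesAbove K u φ x₀) : TouchesBelow K (-u) (-φ) x₀ :=
  ⟨by simp [h.1], h.2.mono fun x hx => neg_lt_neg hx⟩

/-- A `C²` function on an open set agrees near each point with a global `C²` function. -/
lemma exists_contDiff_eventuallyEq (ho : IsOpen Ω) {φ : Euc N → ℝ} (hφ : ContDiffOn ℝ 2 φ Ω)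
    {x₀ : Euc N} (hx : x₀ ∈ Ω) : ∃ ψ : Euc N → ℝ, ContDiff ℝ 2 ψ ∧ ψ =ᶠ[𝓝 x₀] φ := by
  obtain ⟨R, hR, hball⟩ := Metric.isOpen_iff.1 ho x₀ hx
  let χ : ContDiffBump x₀ := ⟨R / 4, R / 2, by positivity, by linarith⟩
  have hχs : tsupport χ ⊆ Ω := by
    rw [χ.tsupport_eq]
    exact (Metric.closedBall_subset_ball (half_lt_self hR)).trans hball
  refine ⟨fun x => χ x * φ x, contDiff_iff_contDiffAt.2 fun x => ?_, ?_⟩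
  · by_cases hxs : x ∈ tsupport χ
    · exact χ.contDiff.contDiffAt.mul ((hφ x (hχs hxs)).contDiffAt (ho.mem_nhds (hχs hxs)))
    · refine (contDiffAt_const (c := (0 : ℝ))).congr_of_eventuallyEq ?_
      filter_upwards [notMem_tsupport_iff_eventuallyEq.1 hxs] with y hy
      rw [hy, Pi.zero_apply, zero_mul]
  · filter_upwards [χ.eventuallyEq_one] with y hy
    rw [hy, Pi.one_apply, one_mul]

lemma Operator.at_congr (F : Operator N) {φ ψ : Euc N → ℝ} {x : Euc N} (h : ψ =ᶠ[𝓝 x] φ) :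
    F.at ψ x = F.at φ x := by
  rw [Operator.at, Operator.at, h.eq_of_nhds, h.gradient_eq, h.fderiv.fderiv_eq]

lemma nhdsWithin_diff_closure (ho : IsOpen Ω) {x₀ : Euc N} (hx : x₀ ∈ Ω) :
    𝓝[closure Ω \ {x₀}] x₀ = 𝓝[Ω \ {x₀}] x₀ := by
  refine nhdsWithin_eq_nhdsWithin hx ho ?_
  ext y
  constructor
  · rintro ⟨⟨-, h2⟩, h3⟩
    exact ⟨⟨h3, h2⟩, h3⟩
  · rintro ⟨⟨h1, h2⟩, h3⟩
    exact ⟨⟨subset_closure h1, h2⟩, h3⟩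

namespace EigenLimit

variable {Γ Q Λ : ℝ} {p q α β lam : ℕ → ℝ} {u v : ℕ → Euc N → ℝ} {Gu Gv : ℕ → Euc N → Euc N}
  {u₀ v₀ : Euc N → ℝ}

/-- The second component of the limit solves the limit equation with the Neumann condition. -/
lemma isNeumannViscositySolution (hN : 1 ≤ N) (hΩ : IsSmoothBoundedDomain Ω)
    (h : EigenLimit Ω Γ Q Λ p q α β lam u v Gu Gv u₀ v₀) :
    IsNeumannViscositySolution Ω (limitOperatorV Γ Q Λ u₀) v₀ := by
  refine ⟨⟨h.cont_v.upperSemicontinuousOn, fun x₀ hx φ hφ ht => ?_⟩,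
    h.isNeumannSupersolution hN hΩ⟩
  obtain ⟨h1, h2⟩ := (h.neg_v.isNeumannSupersolution hN hΩ).2 x₀ hx (-φ) hφ.neg ht.neg
  refine ⟨fun hxΩ => ?_, fun hxf ν hν => ?_⟩
  · have := h1 hxΩ
    rw [limitOperatorV_at_neg] at this
    linarith
  · have := h2 hxf ν hν
    rw [limitOperatorV_at_neg, gradient_neg', inner_neg_left, max_neg_neg] at this
    linarith

/-- The nonnegative first component of the limit solves the limit equation with the Dirichlet
condition. -/
lemma isDirichletViscositySolution (hN : 1 ≤ N) (hΩ : IsSmoothBoundedDomain Ω)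
    (h : EigenLimit Ω Γ Q Λ p q α β lam u v Gu Gv u₀ v₀) (h0 : ∀ n, ∀ x ∈ Ω, 0 ≤ u n x)
    (hzero : ∀ x ∈ frontier Ω, u₀ x = 0) :
    IsDirichletViscositySolution Ω (limitOperatorU Γ Q Λ v₀) u₀ := by
  have ho := hΩ.isOpen
  have hE := h.exponents
  refine ⟨⟨h.cont_u.upperSemicontinuousOn, fun x hx => (hzero x hx).le, fun x₀ hx φ hφ ht => ?_⟩,
    ⟨h.cont_u.lowerSemicontinuousOn, fun x hx => (hzero x hx).ge, fun x₀ hx φ hφ ht => ?_⟩⟩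
  · obtain ⟨ψ, hψ, hψφ⟩ := exists_contDiff_eventuallyEq ho hφ hx
    have hval : u₀ x₀ = ψ x₀ := ht.1.trans hψφ.eq_of_nhds.symm
    have ht' : TouchesAbove (closure Ω) u₀ ψ x₀ := by
      refine ⟨hval, ?_⟩
      rw [nhdsWithin_diff_closure ho hx]
      filter_upwards [ht.2, nhdsWithin_le_nhds hψφ] with y h1 h2
      rw [h2]
      exact h1
    rw [← Operator.at_congr _ hψφ]
    -- For `-u` the source is nonpositive, so only the alternative that compares sizes is available;
    -- it is exactly the negation of a positive minimum.
    have hψn : ContDiff ℝ 2 (-ψ) := hψ.neg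
    have hcore := (h.neg_u.weakLimit_u ho).not_eventually_pos_interior ho hΩ.isBounded hx hψn
      ht'.neg
    have hroot := h.neg_u.tendsto_root_u hN hΩ (subset_closure hx)
    have hnot := not_inftyLaplacian_pos_and_lt
      (f := fun n x => lam n * α n * (signedPow (α n) ((-u n) x) * |v n x| ^ β n))
      hψn hE.hp hroot hcore
    by_contra! hlt
    simp only [Operator.at, limitOperatorU, lt_min_iff] at hlt
    refine hnot ⟨?_, ?_⟩
    · rw [inftyLaplacian, gradient_neg', fderiv_fderiv_neg]
      simpa using hlt.1
    · rw [gradient_neg', norm_neg, Pi.neg_apply, abs_neg, hval]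
      linarith [hlt.2]
  · obtain ⟨ψ, hψ, hψφ⟩ := exists_contDiff_eventuallyEq ho hφ hx
    have hval : u₀ x₀ = ψ x₀ := ht.1.trans hψφ.eq_of_nhds.symm
    have ht' : TouchesBelow (closure Ω) u₀ ψ x₀ := by
      refine ⟨hval, ?_⟩
      rw [nhdsWithin_diff_closure ho hx]
      filter_upwards [ht.2, nhdsWithin_le_nhds hψφ] with y h1 h2
      rw [h2]
      exact h1
    rw [← Operator.at_congr _ hψφ]
    have hcore := (h.weakLimit_u ho).not_eventually_pos_interior ho hΩ.isBounded hx hψ ht'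
    have hroot := h.tendsto_root_u hN hΩ (subset_closure hx)
    have hf : ∀ᶠ y in atTop ×ˢ 𝓝[Ω] x₀,
        0 ≤ lam y.1 * α y.1 * (signedPow (α y.1) (u y.1 y.2) * |v y.1 y.2| ^ β y.1) := by
      have hmem : ∀ᶠ y in (atTop : Filter ℕ) ×ˢ 𝓝[Ω] x₀, y.2 ∈ Ω :=
        tendsto_snd.eventually self_mem_nhdsWithin
      filter_upwards [hmem] with y hy
      have hα := (h.large y.1).hα
      have hs : 0 ≤ signedPow (α y.1) (u y.1 y.2) :=
        mul_nonneg (by positivity) (h0 _ _ hy)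
      exact mul_nonneg (mul_nonneg (h.lam_nonneg hN hΩ _) (by linarith))
        (mul_nonneg hs (by positivity))
    have c1 := inftyLaplacian_nonpos_of_source_nonneg
      (f := fun n x => lam n * α n * (signedPow (α n) (u n x) * |v n x| ^ β n)) hψ hE.hp hf hcore
    have c2 := le_norm_gradient_of_source_nonneg
      (f := fun n x => lam n * α n * (signedPow (α n) (u n x) * |v n x| ^ β n)) hψ hE.hp hf hroot
      hcore
    simp only [Operator.at, limitOperatorU, ← hval]
    exact le_min (neg_nonneg.2 c1) (sub_nonneg.2 c2)

end EigenLimit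

end

section

variable {N : ℕ} {Ω : Set (Euc N)}

/-! ### Convergence of eigenvalues and eigenfunctions -/

variable {Γ Q : ℝ} {p q α β : ℕ → ℝ}

lemma ExponentLimit.eventually_exists_eigenfunction (hN : 1 ≤ N) (hΩ : IsSmoothBoundedDomain Ω)
    (hL : ExponentLimit Γ Q p q α β) :
    ∀ᶠ n in atTop, ∃ u v : Euc N → ℝ,
      IsNormalizedFirstEigenfunction Ω (p n) (q n) (α n) (β n) u v ∧
        ∀ᵐ x ∂volume.restrict Ω, 0 ≤ u x := by
  obtain ⟨w, z, hwz⟩ := exists_admissibleTop hN hΩ hL.Γ_pos hL.mul_pos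
  filter_upwards [hL.eventually_large (N := N), (hwz.exists_bound hN hΩ hL).1] with n hE hne
  obtain ⟨u, v, Gu, Gv, h, hJ, hm, hmin, h0⟩ := exists_minimizer hN hΩ hE hne
  exact ⟨u, v, h.isNormalizedFirstEigenfunction hN hΩ hE hm hJ hmin,
    (ae_restrict_mem hΩ.isOpen.measurableSet).mono h0⟩

lemma ExponentLimit.tendsto_firstEigenvalue (hN : 1 ≤ N) (hΩ : IsSmoothBoundedDomain Ω)
    (hL : ExponentLimit Γ Q p q α β) :
    Tendsto (fun n => firstEigenvalue Ω (p n) (q n) (α n) (β n) ^ (1 / p n)) atTop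
      (𝓝 (lambdaTop Ω Γ Q)) := by
  -- Every subsequence has a further one along which eigenfunctions exist and the compactness
  -- theorem gives the same limit.
  refine tendsto_of_subseq_tendsto fun ns hns => ?_
  obtain ⟨J, hJ⟩ := eventually_atTop.1 (hns.eventually
    (((hL.eventually_large (N := N)).and (hL.eventually_exists_eigenfunction hN hΩ))))
  have hE : ∀ j, LargeExponents N (p (ns (j + J))) (q (ns (j + J))) (α (ns (j + J)))
    (β (ns (j + J))) := fun j => (hJ (j + J) (Nat.le_add_left _ _)).1
  choose u v huv using fun j => (hJ (j + J) (Nat.le_add_left _ _)).2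
  choose u' v' _ _ hreg using fun j => (huv j).1.exists_regularEigenpair hN hΩ (hE j)
  obtain ⟨φ, -, -, -, -, -, -, -, -, hlim⟩ := exists_subseq_minimizer hN hΩ
    (hL.comp (hns.comp (tendsto_add_atTop_nat J))) hE hreg
  exact ⟨fun j => φ j + J, hlim⟩

/-- A continuous function that is nonnegative almost everywhere in an open set is nonnegative
there. -/
lemma nonneg_of_ae_nonneg (ho : IsOpen Ω) {u : Euc N → ℝ} (hu : ContinuousOn u Ω)
    (h : ∀ᵐ x ∂volume.restrict Ω, 0 ≤ u x) : ∀ x ∈ Ω, 0 ≤ u x := by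
  have he : (fun x => max (u x) 0) =ᵐ[volume.restrict Ω] u := h.mono fun x hx => max_eq_left hx
  intro x hx
  rw [← Measure.eqOn_open_of_ae_eq he ho (hu.sup continuousOn_const) hu hx]
  exact le_max_right _ _

lemma EigenLimit.comp {Λ : ℝ} {lam : ℕ → ℝ} {u v : ℕ → Euc N → ℝ} {Gu Gv : ℕ → Euc N → Euc N}
    {u₀ v₀ : Euc N → ℝ} (h : EigenLimit Ω Γ Q Λ p q α β lam u v Gu Gv u₀ v₀) {k : ℕ → ℕ}
    (hk : Tendsto k atTop atTop) :
    EigenLimit Ω Γ Q Λ (p ∘ k) (q ∘ k) (α ∘ k) (β ∘ k) (lam ∘ k) (u ∘ k) (v ∘ k) (Gu ∘ k) (Gv ∘ k)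
      u₀ v₀ where
  exponents := h.exponents.comp hk
  large n := h.large (k n)
  eigenpair n := h.eigenpair (k n)
  lam_lim := h.lam_lim.comp hk
  lim_u s hs := hk.eventually (h.lim_u s hs)
  lim_v s hs := hk.eventually (h.lim_v s hs)
  cont_u := h.cont_u
  cont_v := h.cont_v

lemma EigenLimit.nonneg {Λ : ℝ} {lam : ℕ → ℝ} {u v : ℕ → Euc N → ℝ} {Gu Gv : ℕ → Euc N → Euc N}
    {u₀ v₀ : Euc N → ℝ} (h : EigenLimit Ω Γ Q Λ p q α β lam u v Gu Gv u₀ v₀)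
    (h0 : ∀ n, ∀ x ∈ Ω, 0 ≤ u n x) : ∀ x ∈ closure Ω, 0 ≤ u₀ x := by
  have h1 : ∀ x ∈ Ω, 0 ≤ u₀ x := fun x hx =>
    ge_of_tendsto' (h.lim_u.tendsto_at (subset_closure hx)) fun n => h0 n x hx
  intro x hx
  have := mem_closure_iff_nhdsWithin_neBot.1 hx
  exact ge_of_tendsto ((h.cont_u x hx).mono subset_closure)
    (eventually_mem_nhdsWithin.mono h1)

end

end PQSystem

open PQSystem in
theorem theorem1p2 {N : ℕ} (hN : 1 ≤ N) (Ω : Set (EuclideanSpace ℝ (Fin N)))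
    (hΩ : IsSmoothBoundedDomain Ω)
    (Γ Q : ℝ) (hΓ0 : 0 < Γ) (hΓ1 : Γ < 1) (hQ : 0 < Q)
    (p q α β : ℕ → ℝ) (hp : ∀ n, 1 < p n) (hq : ∀ n, 1 < q n)
    (hα : ∀ n, 0 < α n) (hβ : ∀ n, 0 < β n) (hαβ : ∀ n, α n / p n + β n / q n = 1)
    (hp_lim : Tendsto p atTop atTop) (hq_lim : Tendsto q atTop atTop)
    (hΓ_lim : Tendsto (fun n => α n / p n) atTop (𝓝 Γ))
    (hQ_lim : Tendsto (fun n => q n / p n) atTop (𝓝 Q)) :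
    -- convergence of the eigenvalues
    Tendsto (fun n => firstEigenvalue Ω (p n) (q n) (α n) (β n) ^ (1 / p n)) atTop
      (𝓝 (lambdaTop Ω Γ Q)) ∧
    -- normalized first eigenfunctions exist for large `n`, even with `u ≥ 0`
    (∀ᶠ n in atTop, ∃ u v : EuclideanSpace ℝ (Fin N) → ℝ,
      IsNormalizedFirstEigenfunction Ω (p n) (q n) (α n) (β n) u v ∧
        ∀ᵐ x ∂volume.restrict Ω, 0 ≤ u x) ∧
    -- every family of normalized first eigenfunctions converges along a subsequence
    ∀ u v : ℕ → EuclideanSpace ℝ (Fin N) → ℝ,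
      (∀ᶠ n in atTop,
        IsNormalizedFirstEigenfunction Ω (p n) (q n) (α n) (β n) (u n) (v n)) →
      ∃ (k : ℕ → ℕ) (u' v' : ℕ → EuclideanSpace ℝ (Fin N) → ℝ)
        (uLim vLim : EuclideanSpace ℝ (Fin N) → ℝ),
        StrictMono k ∧
        -- `u' j`, `v' j` are the continuous representatives of `u (k j)`, `v (k j)`
        (∀ j, ContinuousOn (u' j) (closure Ω) ∧ u' j =ᵐ[volume.restrict Ω] u (k j)) ∧
        (∀ j, ContinuousOn (v' j) (closure Ω) ∧ v' j =ᵐ[volume.restrict Ω] v (k j)) ∧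
        TendstoUniformlyOn u' uLim atTop (closure Ω) ∧
        TendstoUniformlyOn v' vLim atTop (closure Ω) ∧
        IsMinimizerTop Ω Γ Q uLim vLim ∧
        IsNeumannViscositySolution Ω (limitOperatorV Γ Q (lambdaTop Ω Γ Q) uLim) vLim ∧
        -- the equation for the first component, under the sign normalization `u ≥ 0`
        ((∀ᶠ n in atTop, ∀ᵐ x ∂volume.restrict Ω, 0 ≤ u n x) →
          (∀ x ∈ closure Ω, 0 ≤ uLim x) ∧
          IsDirichletViscositySolution Ω (limitOperatorU Γ Q (lambdaTop Ω Γ Q) vLim) uLim) := by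
  have hL : ExponentLimit Γ Q p q α β := ⟨hp_lim, hq_lim, hαβ, hΓ_lim, hQ_lim, hΓ0, hΓ1, hQ⟩
  refine ⟨hL.tendsto_firstEigenvalue hN hΩ, hL.eventually_exists_eigenfunction hN hΩ,
    fun u v huv => ?_⟩
  -- The shift by `J` makes the eventual properties hold for every index; the one by `K` below does
  -- the same for the sign of `u`.
  obtain ⟨J, hJ⟩ := eventually_atTop.1 ((hL.eventually_large (N := N)).and huv)
  have hE : ∀ j, LargeExponents N (p (j + J)) (q (j + J)) (α (j + J)) (β (j + J)) :=
    fun j => (hJ (j + J) (Nat.le_add_left _ _)).1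
  choose u' v' hu' hv' hreg using fun j =>
    (hJ (j + J) (Nat.le_add_left _ _)).2.exists_regularEigenpair hN hΩ (hE j)
  obtain ⟨φ, hφ, u₀, v₀, hu₀, hv₀, hlu, hlv, hmin, hlim⟩ := exists_subseq_minimizer hN hΩ
    (hL.comp (tendsto_add_atTop_nat J)) hE hreg
  have hlimit := EigenLimit.mk
    ((hL.comp (tendsto_add_atTop_nat J)).comp hφ.tendsto_atTop) (fun j => hE (φ j))
    (fun j => hreg (φ j)) hlim hlu hlv hu₀ hv₀
  refine ⟨fun j => φ j + J, fun j => u' (φ j), fun j => v' (φ j), u₀, v₀,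
    fun i j hij => Nat.add_lt_add_right (hφ hij) J, fun j => ⟨(hreg (φ j)).cont_u, hu' (φ j)⟩,
    fun j => ⟨(hreg (φ j)).cont_v, hv' (φ j)⟩, hlu, hlv, hmin,
    hlimit.isNeumannViscositySolution hN hΩ, fun hpos => ?_⟩
  obtain ⟨K, hK⟩ := eventually_atTop.1
    (((tendsto_add_atTop_nat J).comp hφ.tendsto_atTop).eventually hpos)
  have hshift := hlimit.comp (tendsto_add_atTop_nat K)
  have h0 : ∀ j, ∀ x ∈ Ω, 0 ≤ u' (φ (j + K)) x := fun j =>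
    nonneg_of_ae_nonneg hΩ.isOpen ((hreg _).cont_u.mono subset_closure) (by
      filter_upwards [hu' (φ (j + K)), hK (j + K) (Nat.le_add_left _ _)] with x hx hx0
      rw [hx]
      exact hx0)
  exact ⟨hshift.nonneg h0, hshift.isDirichletViscositySolution hN hΩ h0 hmin.1.1.2⟩
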